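/- **Setting.** Fix integers $M,K\ge 0$ (numbers of characteristics and of factors) and a constant $\kappa$. For each $n$ in a sequence (all quantities may depend on $n$, which is suppressed) let $N,T,J$ be sample sizes and sieve size, and let $$y_{it}=\alpha(z_{it})+\beta(z_{it})'f_t+\varepsilon_{it},\qquad i\le N,\ t\le T,$$ with $z_{it}$ an $M$-vector of random characteristics with entries in a set $\mathcal Z\subset\mathbb R$, $f_t\in\mathbb R^K$ nonrandom, $\varepsilon_{it}$ random with finite fourth moments, $\alpha(z)=\sum_m\alpha_m(z_m)$, $\beta_k(z)=\sum_m\beta_{km}(z_m)$. Given measurable basis functions $\phi_1,\dots,\phi_J$ on $\mathcal Z$ with $\xi_J=\sup_{x\in\mathcal Z}\|(\phi_1(x),\dots,\phi_J(x))\|<\infty$, write $\alpha_m=\sum_{j\le J}a_{m,j}\phi_j+r_{m,J}$ and $\beta_{km}=\sum_{j\le J}b_{km,j}\phi_j+\delta_{km,J}$; let $a\in\mathbb R^{JM}$ and the $JM\times K$ matrix $B$ collect the coefficients, let $\phi(z)\in\mathbb R^{JM}$ collect all $\phi_j(z_m)$, $\Phi(Z_t)=(\phi(z_{1t}),\dots,\phi(z_{Nt}))'$,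 $F=(f_1,\dots,f_T)'$, $\bar f=\sum_tf_t/T$, $M_T=I_T-1_T1_T'/T$, $\hat Q_t=\Phi(Z_t)'\Phi(Z_t)/N$, $Q_{it}=E[\phi(z_{it})\phi(z_{it})']$, $Q_t=\sum_iQ_{it}/N$, $\varepsilon_t=(\varepsilon_{1t},\dots,\varepsilon_{Nt})'$, $Z_t=(z_{1t},\dots,z_{Nt})'$, $Y_t=(y_{1t},\dots,y_{Nt})'$. Write $\|\cdot\|$ for the Euclidean and $\|\cdot\|_F$ for the Frobenius norm. **Estimators.** $\tilde Y$ is the $JM\times T$ matrix with columns $\tilde Y_t=(\Phi(Z_t)'\Phi(Z_t))^{-1}\Phi(Z_t)'Y_t$; the columns of $\hat B$ are orthonormal eigenvectors of $\tilde YM_T\tilde Y'/T$ for its $K$ largest eigenvalues in descending order; $\hat a=(I-\hat B\hat B')\sum_t\tilde Y_t/T$; $\hat F=\tilde Y'\hat B$; $H=(F'M_T\hat F)(\hat F'M_T\hat F)^{-1}$. **Assumptions.** All constants below are positive, finite and independent of $n$; the deterministic conditions are required for all large $n$. 1. With probability approaching one, all eigenvalues of all $\hat Q_t$, $t\le T$,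 lie in $(c_{\min},c_{\max})$; $\max_{m,j,i,t}E[\phi_j^2(z_{it,m})]$ is bounded. 2. The eigenvalues of $B'B$ lie in $(d_{\min},d_{\max})$; $\max_t\|f_t\|<d_{\max}$; $\lambda_{\min}(F'M_TF/T)>d_{\min}$; $\max_{k,m}\sup_{\mathcal Z}|\delta_{km,J}|=O(J^{-\kappa})$ and $\max_m\sup_{\mathcal Z}|r_{m,J}|=O(J^{-\kappa})$ with $\kappa>1/2$. 3. $\{\varepsilon_t\}_{t\le T}$ is independent of $\{Z_t\}_{t\le T}$; $E[\varepsilon_{it}]=0$; $\max_{i,t}\sum_j|E[\varepsilon_{it}\varepsilon_{jt}]|<C_1$ and $\frac1{NT}\sum_{i,j,t,s}|E[\varepsilon_{it}\varepsilon_{js}]|<C_1$. 4. $a'B=0$ and $\|a\|<C_0$. 5. $\max_{m,j,i,t}E[\phi_j^4(z_{it,m})]$ is bounded; the eigenvalues of all $Q_{it}$ are bounded and bounded away from $0$, uniformly in $i,t,n$; $\{z_{it}\}$ are independent across $i$; $\max_t\frac1{N^2}\sum_{i,j,k,\ell}|E[\varepsilon_{it}\varepsilon_{jt}\varepsilon_{kt}\varepsilon_{\ell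 t}]|<C_2$ and $\frac1{N^2T}\sum_t\big(\sum_{s,i,j}|E[\varepsilon_{it}\varepsilon_{js}]|\big)^2<C_2$. 6. $(F'M_TF/T)B'B$ has $K$ distinct eigenvalues, with pairwise gaps bounded below by a constant $c>0$; $\{\varepsilon_{it}\}$ are independent across $i$; $\max_i\frac1{T^2}\sum_{t,s,u,v}|E[\varepsilon_{it}\varepsilon_{is}\varepsilon_{iu}\varepsilon_{iv}]|<C_3$. The asymptotics are: $N\to\infty$; $T\to\infty$, or $T\ge K+1$ is fixed; $J\to\infty$ with $J^2\xi_J^2\log J=o(N)$. **Population quantities.** Let $\Upsilon$ be an orthogonal (nonrandom) matrix and $\mathcal V$ a diagonal matrix with descending entries such that $(F'M_TF/T)^{1/2}B'B(F'M_TF/T)^{1/2}\,\Upsilon=\Upsilon\mathcal V$, and put $\mathcal H=(F'M_TF/T)^{1/2}\Upsilon\mathcal V^{-1/2}$, $\mathcal M=\mathcal H\mathcal V^{-1}$. Eigenvectors being determined only up to sign, the columns of $\hat B$ and of $B\mathcal H$ are assumed to be signed consistently: with probability approaching one, the $k$-th columns of $\hat B$ and $B\mathcal H$ have nonnegative inner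 product for every $k\le K$. With $f_t^\dagger=(1,(f_t-\bar f)')'$ let $$\Omega=\frac1{NT}\sum_{i=1}^N\sum_{t=1}^T\sum_{s=1}^T\big(f_t^\dagger f_s^{\dagger\prime}\big)\otimes\big(Q_t^{-1}E[\phi(z_{it})\phi(z_{is})']Q_s^{-1}\big)\,E[\varepsilon_{it}\varepsilon_{is}].$$ **Theorem.** Under these assumptions, on a suitable extension of the underlying probability space (for each $n$) there is a $JM\times(K+1)$ random matrix $\mathbb N$, with first column $\mathbb N_1$ and last $K$ columns $\mathbb N_2$, such that $\Omega$ is positive semidefinite and $\mathrm{vec}(\mathbb N)\sim N(0,\Omega)$ for all large $n$, and, with $$\mathbb G_B=\mathbb N_2B'B\mathcal M,\qquad \mathbb G_a=(I_{JM}-B\mathcal H\mathcal H'B')(\mathbb N_1-\mathbb G_B\mathcal H^{-1}\bar f)-B\mathcal H\mathbb G_B'a,$$ both $$\|\sqrt{NT}(\hat a-a)-\mathbb G_a\|\quad\text{and}\quad\|\sqrt{NT}(\hat B-BH)-\mathbb G_B\|_F$$ are $$O_p\!\left(\frac{\sqrt{NT}}{J^{\kappa}}+\frac{\sqrt{TJ}}{\sqrt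 N}+\frac{J^{5/6}}{N^{1/6}}+\frac{\sqrt{J\xi_J}\,\log^{1/4}J}{N^{1/4}}\right).$$ -/

import Mathlib

open MeasureTheory ProbabilityTheory Filter Topology
open scoped Matrix Kronecker MatrixOrder

universe u

noncomputable section

/-! ### Norms, stochastic order symbols, eigenvectors -/

/-- Euclidean norm of a finite real vector. -/
def euclNorm {ι : Type*} [Fintype ι] (x : ι → ℝ) : ℝ := ‖WithLp.toLp 2 x‖

/-- Frobenius norm of a real matrix. -/
def frobNorm {ι κ : Type*} [Fintype ι] [Fintype κ] (A : Matrix ι κ ℝ) : ℝ :=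
  Real.sqrt (∑ i, ∑ j, A i j ^ 2)

/-- `X n = O_p(r n)` as `n → ∞`, where `X n` is defined on the space with law `P n`. -/
def IsBigOInProb {Ω : ℕ → Type*} [∀ n, MeasurableSpace (Ω n)] (P : ∀ n, Measure (Ω n))
    (X : ∀ n, Ω n → ℝ) (r : ℕ → ℝ) : Prop :=
  ∀ η : ℝ, 0 < η → ∃ C : ℝ, 0 < C ∧
    ∀ᶠ n in atTop, P n {ω | C * r n < |X n ω|} ≤ ENNReal.ofReal η

/-- The property `p n` holds with probability approaching one. -/
def WithProbToOne {Ω : ℕ → Type*} [∀ n, MeasurableSpace (Ω n)] (P : ∀ n, Measure (Ω n))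
    (p : ∀ n, Ω n → Prop) : Prop :=
  Tendsto (fun n => P n {ω | ¬ p n ω}) atTop (𝓝 0)

/-- The columns of `V` are orthonormal eigenvectors of the symmetric matrix `W` that belong to its
`K` largest eigenvalues (with multiplicity), in descending order. -/
def IsLeadingEigenvectors {ι : Type*} [Fintype ι] [DecidableEq ι] {K : ℕ}
    (W : Matrix ι ι ℝ) (V : Matrix ι (Fin K) ℝ) : Prop :=
  Vᵀ * V = 1 ∧ ∃ ℓ : Fin K → ℝ, Antitone ℓ ∧ W * V = V * Matrix.diagonal ℓ ∧
    ∀ (x : ι → ℝ) (μ : ℝ), x ≠ 0 → W *ᵥ x = μ • x → Vᵀ *ᵥ x = 0 → ∀ k, μ ≤ ℓ k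

/-- `S = Υ diag(v) Υᵀ` with `Υ` orthogonal and the eigenvalues `v` in descending order. -/
def IsSpectralDecomposition {K : ℕ} (S Υ : Matrix (Fin K) (Fin K) ℝ) (v : Fin K → ℝ) : Prop :=
  Υᵀ * Υ = 1 ∧ Antitone v ∧ S * Υ = Υ * Matrix.diagonal v

/-- The matrix `M_T = I_T - 1_T 1_Tᵀ / T`. -/
def centering (T : ℕ) : Matrix (Fin T) (Fin T) ℝ :=
  1 - (1 / (T : ℝ)) • Matrix.of (fun _ _ => (1 : ℝ))

/-! ### The semiparametric factor model at one stage of the asymptotics -/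

/-- The objects of the model with `M` characteristics and `K` factors: the sample sizes `N`, `T`,
the sieve size `J`, the domain of the characteristics, the sieve basis, the additive components of
the intercept and loading functions, their sieve coefficients `a` and `B` (rows indexed by
`(m, j)`), the (nonrandom) factors, the characteristics and the idiosyncratic errors. -/
structure FactorModel (M K : ℕ) (Ω : Type u) where
  N : ℕ
  T : ℕ
  J : ℕ
  dom : Set ℝ
  φ : Fin J → ℝ → ℝ
  α : Fin M → ℝ → ℝ
  β : Fin K → Fin M → ℝ → ℝ
  a : Fin M × Fin J → ℝ
  B : Matrix (Fin M × Fin J) (Fin K) ℝ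
  f : Fin T → Fin K → ℝ
  z : Fin N → Fin T → Ω → Fin M → ℝ
  ε : Fin N → Fin T → Ω → ℝ

namespace FactorModel

variable {M K : ℕ} {Ω : Type u} (D : FactorModel M K Ω)

/-- `y_it = α(z_it) + β(z_it)ᵀ f_t + ε_it`, with additively separable `α` and `β_k`. -/
def y (i : Fin D.N) (t : Fin D.T) (ω : Ω) : ℝ :=
  (∑ m, D.α m (D.z i t ω m)) + (∑ k, (∑ m, D.β k m (D.z i t ω m)) * D.f t k) + D.ε i t ω

/-- Sieve remainder of the `m`-th component of the intercept function. -/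
def r (m : Fin M) (x : ℝ) : ℝ := D.α m x - ∑ j, D.a (m, j) * D.φ j x

/-- Sieve remainder of the `m`-th component of the `k`-th loading function. -/
def δ (k : Fin K) (m : Fin M) (x : ℝ) : ℝ := D.β k m x - ∑ j, D.B (m, j) k * D.φ j x

/-- `ξ_J`, the supremum over the domain of the Euclidean norm of `(φ_1(x), …, φ_J(x))`. -/
def ξ : ℝ := sSup ((fun x => euclNorm (fun j => D.φ j x)) '' D.dom)

/-- The `JM`-vector `φ(x)` of all basis functions at all coordinates of `x`. -/
def phi (x : Fin M → ℝ) : Fin M × Fin D.J → ℝ := fun p => D.φ p.2 (x p.1)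

/-- The `N × JM` matrix `Φ(Z_t)`. -/
def Phi (t : Fin D.T) (ω : Ω) : Matrix (Fin D.N) (Fin M × Fin D.J) ℝ :=
  Matrix.of fun i => D.phi (D.z i t ω)

/-- `Q̂_t = Φ(Z_t)ᵀ Φ(Z_t) / N`. -/
def Qhat (t : Fin D.T) (ω : Ω) : Matrix (Fin M × Fin D.J) (Fin M × Fin D.J) ℝ :=
  (1 / (D.N : ℝ)) • ((D.Phi t ω)ᵀ * D.Phi t ω)

/-- The `T × K` matrix of factors. -/
def F : Matrix (Fin D.T) (Fin K) ℝ := Matrix.of D.f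

/-- The time average of the factors. -/
def fbar : Fin K → ℝ := (1 / (D.T : ℝ)) • ∑ t, D.f t

/-- `Fᵀ M_T F / T`. -/
def SigmaF : Matrix (Fin K) (Fin K) ℝ :=
  (1 / (D.T : ℝ)) • (D.Fᵀ * centering D.T * D.F)

/-! #### The regressed-PCA estimators -/

/-- The `JM × T` matrix whose columns are the period-by-period least squares coefficients. -/
def Ytilde (ω : Ω) : Matrix (Fin M × Fin D.J) (Fin D.T) ℝ :=
  Matrix.of fun p t =>
    (((D.Phi t ω)ᵀ * D.Phi t ω)⁻¹ *ᵥ ((D.Phi t ω)ᵀ *ᵥ fun i => D.y i t ω)) p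

/-- The time average of the least squares coefficients. -/
def Ybar (ω : Ω) : Fin M × Fin D.J → ℝ := fun p => (1 / (D.T : ℝ)) * ∑ t, D.Ytilde ω p t

/-- `Ỹ M_T Ỹᵀ / T`; the columns of `B̂` are its `K` leading eigenvectors. -/
def pcaMatrix (ω : Ω) : Matrix (Fin M × Fin D.J) (Fin M × Fin D.J) ℝ :=
  (1 / (D.T : ℝ)) • (D.Ytilde ω * centering D.T * (D.Ytilde ω)ᵀ)

/-- `â`, given the value `Bh` of `B̂` at `ω`. -/
def ahat (Bh : Matrix (Fin M × Fin D.J) (Fin K) ℝ) (ω : Ω) : Fin M × Fin D.J → ℝ :=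
  (1 - Bh * Bhᵀ) *ᵥ D.Ybar ω

/-- `F̂ = Ỹᵀ B̂`, given the value `Bh` of `B̂` at `ω`. -/
def Fhat (Bh : Matrix (Fin M × Fin D.J) (Fin K) ℝ) (ω : Ω) : Matrix (Fin D.T) (Fin K) ℝ :=
  (D.Ytilde ω)ᵀ * Bh

/-- The rotation `H = (Fᵀ M_T F̂)(F̂ᵀ M_T F̂)⁻¹`, given the value `Bh` of `B̂` at `ω`. -/
def H (Bh : Matrix (Fin M × Fin D.J) (Fin K) ℝ) (ω : Ω) : Matrix (Fin K) (Fin K) ℝ :=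
  (D.Fᵀ * centering D.T * D.Fhat Bh ω) *
    ((D.Fhat Bh ω)ᵀ * centering D.T * D.Fhat Bh ω)⁻¹

/-! #### Population objects -/

/-- `(Fᵀ M_T F / T)^{1/2} Bᵀ B (Fᵀ M_T F / T)^{1/2}`. -/
def spectralMatrix : Matrix (Fin K) (Fin K) ℝ :=
  CFC.sqrt D.SigmaF * (D.Bᵀ * D.B) * CFC.sqrt D.SigmaF

/-- `𝓗 = (Fᵀ M_T F / T)^{1/2} Υ 𝓥^{-1/2}`, `𝓥 = diag(v)`. -/
def limH (Υ : Matrix (Fin K) (Fin K) ℝ) (v : Fin K → ℝ) : Matrix (Fin K) (Fin K) ℝ :=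
  CFC.sqrt D.SigmaF * Υ * Matrix.diagonal (fun k => (Real.sqrt (v k))⁻¹)

/-- `𝓜 = 𝓗 𝓥⁻¹`, `𝓥 = diag(v)`. -/
def limM (Υ : Matrix (Fin K) (Fin K) ℝ) (v : Fin K → ℝ) : Matrix (Fin K) (Fin K) ℝ :=
  D.limH Υ v * Matrix.diagonal (fun k => (v k)⁻¹)

/-- `𝔾_B = ℕ₂ Bᵀ B 𝓜`, where `ℕ₂` consists of the last `K` columns of `NN`. -/
def GB (Υ : Matrix (Fin K) (Fin K) ℝ) (v : Fin K → ℝ)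
    (NN : Matrix (Fin M × Fin D.J) (Fin (K + 1)) ℝ) : Matrix (Fin M × Fin D.J) (Fin K) ℝ :=
  NN.submatrix id Fin.succ * (D.Bᵀ * D.B) * D.limM Υ v

/-- `𝔾_a = (I - B𝓗𝓗ᵀBᵀ)(ℕ₁ - 𝔾_B 𝓗⁻¹ f̄) - B𝓗 𝔾_Bᵀ a`, where `ℕ₁` is the first column of `NN`. -/
def Ga (Υ : Matrix (Fin K) (Fin K) ℝ) (v : Fin K → ℝ)
    (NN : Matrix (Fin M × Fin D.J) (Fin (K + 1)) ℝ) : Fin M × Fin D.J → ℝ :=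
  (1 - D.B * D.limH Υ v * (D.limH Υ v)ᵀ * D.Bᵀ) *ᵥ
      ((fun p => NN p 0) - (D.GB Υ v NN * (D.limH Υ v)⁻¹) *ᵥ D.fbar)
    - (D.B * D.limH Υ v * (D.GB Υ v NN)ᵀ) *ᵥ D.a

/-- `f†_t = (1, (f_t - f̄)ᵀ)ᵀ`. -/
def fdag (t : Fin D.T) : Fin (K + 1) → ℝ := Fin.cons 1 (D.f t - D.fbar)

/-- The rate in the strong approximation. -/
def rate (κ : ℝ) : ℝ :=
  Real.sqrt (D.N * D.T) / (D.J : ℝ) ^ κ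
    + Real.sqrt (D.T * D.J) / Real.sqrt D.N
    + (D.J : ℝ) ^ (5 / 6 : ℝ) / (D.N : ℝ) ^ (1 / 6 : ℝ)
    + Real.sqrt (D.J * D.ξ) * Real.log D.J ^ (1 / 4 : ℝ) / (D.N : ℝ) ^ (1 / 4 : ℝ)

variable [MeasurableSpace Ω] (P : Measure Ω)

/-- `E[φ(z_it) φ(z_is)ᵀ]`. -/
def crossMoment (i : Fin D.N) (t s : Fin D.T) :
    Matrix (Fin M × Fin D.J) (Fin M × Fin D.J) ℝ :=
  Matrix.of fun p q => ∫ ω, D.phi (D.z i t ω) p * D.phi (D.z i s ω) q ∂P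

/-- `Q_t = ∑_i E[φ(z_it) φ(z_it)ᵀ] / N`. -/
def Q (t : Fin D.T) : Matrix (Fin M × Fin D.J) (Fin M × Fin D.J) ℝ :=
  (1 / (D.N : ℝ)) • ∑ i, D.crossMoment P i t t

/-- The covariance matrix
`Ω = ∑_i ∑_t ∑_s (f†_t f†_sᵀ) ⊗ (Q_t⁻¹ E[φ(z_it) φ(z_is)ᵀ] Q_s⁻¹) E[ε_it ε_is] / (NT)`. -/
def Omega : Matrix (Fin (K + 1) × (Fin M × Fin D.J)) (Fin (K + 1) × (Fin M × Fin D.J)) ℝ :=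
  (1 / ((D.N : ℝ) * D.T)) • ∑ i, ∑ t, ∑ s, (∫ ω, D.ε i t ω * D.ε i s ω ∂P) •
    (Matrix.vecMulVec (D.fdag t) (D.fdag s) ⊗ₖ
      ((D.Q P t)⁻¹ * D.crossMoment P i t s * (D.Q P s)⁻¹))

/-- What is implicit in the setup: measurability, characteristics with values in the domain,
finite `ξ_J`, and errors with the moments that the assumptions below speak about. -/
def Regular : Prop :=
  (∀ j, Measurable (D.φ j)) ∧ (∀ i t, Measurable (D.z i t)) ∧ (∀ i t, Measurable (D.ε i t)) ∧
  (∀ i t ω m, D.z i t ω m ∈ D.dom) ∧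
  BddAbove ((fun x => euclNorm (fun j => D.φ j x)) '' D.dom) ∧
  (∀ i t, MemLp (D.ε i t) 4 P)

end FactorModel

/-! ### The assumptions, along a sequence of models -/

section Assumptions

variable {M K : ℕ} {Ω : ℕ → Type u} [∀ n, MeasurableSpace (Ω n)]
  (P : ∀ n, Measure (Ω n)) (D : ∀ n, FactorModel M K (Ω n))

/-- Basis functions. -/
def AssumptionBasis : Prop :=
  (∃ cmin cmax : ℝ, 0 < cmin ∧ 0 < cmax ∧
    WithProbToOne P fun n ω => ∀ t, spectrum ℝ ((D n).Qhat t ω) ⊆ Set.Ioo cmin cmax) ∧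
  (∃ C : ℝ, ∀ᶠ n in atTop, ∀ m j i t, ∫ ω, (D n).φ j ((D n).z i t ω m) ^ 2 ∂(P n) ≤ C)

/-- Factor loading functions and factors. -/
def AssumptionLoadingsFactors (κ : ℝ) : Prop :=
  (∃ dmin dmax : ℝ, 0 < dmin ∧ 0 < dmax ∧ ∀ᶠ n in atTop,
    spectrum ℝ ((D n).Bᵀ * (D n).B) ⊆ Set.Ioo dmin dmax ∧
    (∀ t, euclNorm ((D n).f t) < dmax) ∧
    spectrum ℝ (D n).SigmaF ⊆ Set.Ioi dmin) ∧
  (1 / 2 < κ ∧ ∃ C : ℝ, ∀ᶠ n in atTop, ∀ m, ∀ x ∈ (D n).dom,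
    (∀ k, |(D n).δ k m x| ≤ C * ((D n).J : ℝ) ^ (-κ)) ∧
    |(D n).r m x| ≤ C * ((D n).J : ℝ) ^ (-κ))

/-- Data generating process. -/
def AssumptionDGP : Prop :=
  (∀ᶠ n in atTop, IndepFun (fun ω i t => (D n).ε i t ω) (fun ω i t => (D n).z i t ω) (P n)) ∧
  (∀ᶠ n in atTop, ∀ i t, ∫ ω, (D n).ε i t ω ∂(P n) = 0) ∧
  (∃ C₁ : ℝ, 0 < C₁ ∧ ∀ᶠ n in atTop,
    (∀ i t, ∑ j, |∫ ω, (D n).ε i t ω * (D n).ε j t ω ∂(P n)| < C₁) ∧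
    1 / (((D n).N : ℝ) * (D n).T) *
      ∑ i, ∑ j, ∑ t, ∑ s, |∫ ω, (D n).ε i t ω * (D n).ε j s ω ∂(P n)| < C₁)

/-- Intercept function. -/
def AssumptionIntercept : Prop :=
  ∃ C₀ : ℝ, 0 < C₀ ∧ ∀ᶠ n in atTop, (D n).a ᵥ* (D n).B = 0 ∧ euclNorm (D n).a < C₀

/-- Rate of convergence. -/
def AssumptionRates : Prop :=
  (∃ C : ℝ, ∀ᶠ n in atTop, ∀ m j i t, ∫ ω, (D n).φ j ((D n).z i t ω m) ^ 4 ∂(P n) ≤ C) ∧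
  (∃ c C : ℝ, 0 < c ∧ ∀ᶠ n in atTop, ∀ i t,
    spectrum ℝ ((D n).crossMoment (P n) i t t) ⊆ Set.Icc c C) ∧
  (∀ᶠ n in atTop, iIndepFun (fun i ω t => (D n).z i t ω) (P n)) ∧
  (∃ C₂ : ℝ, 0 < C₂ ∧ ∀ᶠ n in atTop,
    (∀ t, 1 / ((D n).N : ℝ) ^ 2 * ∑ i, ∑ j, ∑ k, ∑ l,
      |∫ ω, (D n).ε i t ω * (D n).ε j t ω * (D n).ε k t ω * (D n).ε l t ω ∂(P n)| < C₂) ∧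
    1 / (((D n).N : ℝ) ^ 2 * (D n).T) *
      ∑ t, (∑ s, ∑ i, ∑ j, |∫ ω, (D n).ε i t ω * (D n).ε j s ω ∂(P n)|) ^ 2 < C₂)

/-- Asymptotic distribution. The eigenvalues are distinct uniformly along the sequence. -/
def AssumptionAsym : Prop :=
  (∃ c : ℝ, 0 < c ∧ ∀ᶠ n in atTop,
    (spectrum ℝ ((D n).SigmaF * ((D n).Bᵀ * (D n).B))).ncard = K ∧
    (spectrum ℝ ((D n).SigmaF * ((D n).Bᵀ * (D n).B))).Pairwise fun x y => c ≤ |x - y|) ∧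
  (∀ᶠ n in atTop, iIndepFun (fun i ω t => (D n).ε i t ω) (P n)) ∧
  (∃ C₃ : ℝ, 0 < C₃ ∧ ∀ᶠ n in atTop, ∀ i,
    1 / ((D n).T : ℝ) ^ 2 * ∑ t, ∑ s, ∑ w, ∑ x,
      |∫ ω, (D n).ε i t ω * (D n).ε i s ω * (D n).ε i w ω * (D n).ε i x ω ∂(P n)| < C₃)

/-- The joint asymptotics: `N → ∞`; `T → ∞` or `T ≥ K + 1` fixed; `J → ∞` with
`J² ξ_J² log J = o(N)`. -/
def AsymptoticRegime : Prop :=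
  Tendsto (fun n => (D n).N) atTop atTop ∧
  (Tendsto (fun n => (D n).T) atTop atTop ∨
    ∃ T₀, K + 1 ≤ T₀ ∧ ∀ᶠ n in atTop, (D n).T = T₀) ∧
  Tendsto (fun n => (D n).J) atTop atTop ∧
  (fun n => ((D n).J : ℝ) ^ 2 * (D n).ξ ^ 2 * Real.log (D n).J) =o[atTop]
    fun n => ((D n).N : ℝ)

end Assumptions

end

noncomputable section

/-! ### Kantorovich–Rubinstein duality and couplings -/

open scoped Pointwise in
/-- Finite Kantorovich–Rubinstein duality. -/
theorem exists_transport_plan {ι κ E : Type*} [Fintype ι] [Fintype κ] [PseudoMetricSpace E]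
    (x : ι → E) (y : κ → E) (p : ι → ℝ) (q : κ → ℝ) (hp : ∀ i, 0 ≤ p i) (hq : ∀ j, 0 ≤ q j)
    (hp1 : ∑ i, p i = 1) (hq1 : ∑ j, q j = 1) (W : ℝ)
    (h : ∀ f : E → ℝ, LipschitzWith 1 f → ∑ i, p i * f (x i) - ∑ j, q j * f (y j) ≤ W) :
    ∃ π : ι → κ → ℝ, (∀ i j, 0 ≤ π i j) ∧ (∀ i, ∑ j, π i j = p i) ∧ (∀ j, ∑ i, π i j = q j) ∧
      ∑ i, ∑ j, π i j * dist (x i) (y j) ≤ W := by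
  classical
  let Lm : (ι × κ → ℝ) →ₗ[ℝ] (ι → ℝ) × (κ → ℝ) × ℝ :=
    { toFun := fun π => (fun i => ∑ j, π (i, j), fun j => ∑ i, π (i, j),
        ∑ i, ∑ j, π (i, j) * dist (x i) (y j))
      map_add' := by
        intro a b
        simp only [Pi.add_apply, Finset.sum_add_distrib, add_mul]
        rfl
      map_smul' := by
        intro c a
        refine Prod.ext ?_ (Prod.ext ?_ ?_)
        · ext i; simp [Finset.mul_sum]
        · ext j; simp [Finset.mul_sum]
        · simp [Finset.mul_sum, mul_assoc] }
  let A : Set ((ι → ℝ) × (κ → ℝ) × ℝ) := Lm '' stdSimplex ℝ (ι × κ)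
  let R : Set ((ι → ℝ) × (κ → ℝ) × ℝ) := {w | w.1 = 0 ∧ w.2.1 = 0 ∧ 0 ≤ w.2.2}
  have hA : IsCompact A := (isCompact_stdSimplex ℝ _).image Lm.continuous_of_finiteDimensional
  have hAc : Convex ℝ A := (convex_stdSimplex ℝ _).linear_image Lm
  have hR : IsClosed R := by
    exact (isClosed_eq continuous_fst continuous_const).inter
      ((isClosed_eq (continuous_fst.comp continuous_snd) continuous_const).inter
        (isClosed_le continuous_const (continuous_snd.comp continuous_snd)))
  have hRc : Convex ℝ R := by
    rintro ⟨a1, a2, a3⟩ ⟨h1, h2, h3⟩ ⟨b1, b2, b3⟩ ⟨h1', h2', h3'⟩ s t hs ht _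
    simp only at h1 h2 h3 h1' h2' h3'
    subst h1 h2 h1' h2'
    refine ⟨by simp, by simp, ?_⟩
    simp only [Prod.smul_mk, Prod.mk_add_mk, smul_eq_mul]
    positivity
  by_cases hmem : ((p, q, W) : (ι → ℝ) × (κ → ℝ) × ℝ) ∈ A + R
  · obtain ⟨_, ⟨π, hπ, rfl⟩, ⟨r1, r2, r3⟩, ⟨h1, h2, h3⟩, hsum⟩ := hmem
    simp only at h1 h2 h3
    subst h1 h2
    have e1 := congrArg Prod.fst hsum
    have e2 := congrArg (fun w : (ι → ℝ) × (κ → ℝ) × ℝ => w.2.1) hsum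
    have e3 := congrArg (fun w : (ι → ℝ) × (κ → ℝ) × ℝ => w.2.2) hsum
    simp only [Lm, LinearMap.coe_mk, AddHom.coe_mk, Prod.mk_add_mk, add_zero] at e1 e2 e3
    refine ⟨fun i j => π (i, j), fun i j => hπ.1 _, fun i => congrFun e1 i,
      fun j => congrFun e2 j, by linarith⟩
  exfalso
  obtain ⟨f, s, hs1, hs2⟩ := geometric_hahn_banach_point_closed (hAc.add hRc)
    (hR.add_left_of_isCompact hA) hmem
  set a : ι → ℝ := fun i => f (Pi.single i 1, 0, 0) with ha
  set b : κ → ℝ := fun j => f (0, Pi.single j 1, 0) with hb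
  set l : ℝ := f (0, 0, 1) with hl
  have hf : ∀ (u : ι → ℝ) (v : κ → ℝ) (w : ℝ),
      f (u, v, w) = ∑ i, u i * a i + ∑ j, v j * b j + w * l := by
    intro u v w
    have : ((u, v, w) : (ι → ℝ) × (κ → ℝ) × ℝ) = ∑ i, u i • ((Pi.single i 1, 0, 0) : (ι → ℝ) × (κ → ℝ) × ℝ)
        + ∑ j, v j • ((0, Pi.single j 1, 0) : (ι → ℝ) × (κ → ℝ) × ℝ) + w • ((0, 0, 1) : (ι → ℝ) × (κ → ℝ) × ℝ) := by
      refine Prod.ext ?_ (Prod.ext ?_ ?_)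
      · ext i; simp [Prod.fst_sum, Finset.sum_apply, Pi.single_apply]
      · ext j; simp [Prod.snd_sum, Prod.fst_sum, Finset.sum_apply, Pi.single_apply]
      · simp [Prod.snd_sum]
    rw [this]
    simp only [map_add, map_sum, map_smul, smul_eq_mul, ha, hb, hl]
  have key : ∀ i j (t : ℝ), 0 ≤ t → s < a i + b j + (dist (x i) (y j) + t) * l := by
    intro i j t ht
    have := hs2 (Lm (Pi.single (i, j) 1) + (0, 0, t))
      (Set.add_mem_add ⟨_, single_mem_stdSimplex ℝ _, rfl⟩ ⟨rfl, rfl, ht⟩)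
    have e : (Lm (Pi.single (i, j) 1) + (0, 0, t) : (ι → ℝ) × (κ → ℝ) × ℝ)
        = (Pi.single i 1, Pi.single j 1, dist (x i) (y j) + t) := by
      have hs : ∀ i' j', (Pi.single (i, j) (1 : ℝ) : ι × κ → ℝ) (i', j')
          = (if i' = i then 1 else 0) * (if j' = j then 1 else 0) := fun i' j' => by
        by_cases h1 : i' = i <;> by_cases h2 : j' = j <;> simp [h1, h2]
      refine Prod.ext ?_ (Prod.ext ?_ ?_)
      · ext i'
        simp [Lm, hs, Pi.single_apply]
      · ext j'
        simp [Lm, hs, Pi.single_apply]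
      · simp [Lm, hs]
    rw [e, hf] at this
    simpa [Pi.single_apply] using this
  rw [hf] at hs1
  have hne : Nonempty ι := by
    by_contra hc
    rw [not_nonempty_iff] at hc
    simp at hp1
  have hne' : Nonempty κ := by
    by_contra hc
    rw [not_nonempty_iff] at hc
    simp at hq1
  have hl0 : 0 ≤ l := by
    by_contra hc
    push Not at hc
    obtain ⟨i⟩ := hne
    obtain ⟨j⟩ := hne'
    have h1 := key i j (|(s - a i - b j - dist (x i) (y j) * l) / l|) (abs_nonneg _)
    have h2 : |(s - a i - b j - dist (x i) (y j) * l) / l| * l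
        ≤ (s - a i - b j - dist (x i) (y j) * l) / l * l :=
      mul_le_mul_of_nonpos_right (le_abs_self _) hc.le
    rw [div_mul_cancel₀ _ hc.ne] at h2
    nlinarith
  have hsumk : ∀ g : ι → κ → ℝ, (∀ i j, s ≤ g i j) → s ≤ ∑ i, ∑ j, p i * q j * g i j := by
    intro g hg
    calc s = ∑ i, ∑ j, p i * q j * s := by
          simp_rw [← Finset.sum_mul, ← Finset.mul_sum, hq1, mul_one, hp1, one_mul]
      _ ≤ _ := Finset.sum_le_sum fun i _ => Finset.sum_le_sum fun j _ =>
          mul_le_mul_of_nonneg_left (hg i j) (mul_nonneg (hp i) (hq j))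
  rcases hl0.eq_or_lt with hl0 | hlpos
  · have := hsumk (fun i j => a i + b j) fun i j => by
      have := key i j 0 le_rfl
      rw [← hl0] at this
      linarith
    have e : ∑ i, ∑ j, p i * q j * (a i + b j) = ∑ i, p i * a i + ∑ j, q j * b j := by
      simp_rw [mul_add, Finset.sum_add_distrib]
      congr 1
      · refine Finset.sum_congr rfl fun i _ => ?_
        rw [← Finset.sum_mul, ← Finset.mul_sum, hq1, mul_one]
      · rw [Finset.sum_comm]
        refine Finset.sum_congr rfl fun j _ => ?_
        simp_rw [mul_assoc]
        rw [← Finset.sum_mul, hp1, one_mul]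
    rw [e] at this
    rw [← hl0] at hs1
    linarith
  -- the potential
  let φ : E → ℝ := fun z => Finset.univ.inf' Finset.univ_nonempty (fun j => b j / l + dist z (y j))
  have hφ : LipschitzWith 1 φ := by
    refine LipschitzWith.of_le_add fun z w => ?_
    obtain ⟨j, _, hj⟩ := Finset.exists_mem_eq_inf' (Finset.univ_nonempty (α := κ))
      (fun j => b j / l + dist w (y j))
    calc φ z ≤ b j / l + dist z (y j) := Finset.inf'_le _ (Finset.mem_univ j)
      _ ≤ (b j / l + dist w (y j)) + dist z w := by linarith [dist_triangle z w (y j)]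
      _ = φ w + dist z w := by rw [← hj]
  have hφy : ∀ j, φ (y j) ≤ b j / l := fun j => by
    have := Finset.inf'_le (fun k => b k / l + dist (y j) (y k)) (Finset.mem_univ j)
    simpa using this
  have hφx : ∀ i, (s - a i) / l ≤ φ (x i) := fun i => by
    refine Finset.le_inf' _ _ fun j _ => ?_
    rw [div_add' _ _ _ hlpos.ne', div_le_div_iff_of_pos_right hlpos]
    linarith [key i j 0 le_rfl]
  have h1 : ∑ i, p i * ((s - a i) / l) ≤ ∑ i, p i * φ (x i) :=
    Finset.sum_le_sum fun i _ => mul_le_mul_of_nonneg_left (hφx i) (hp i)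
  have h2 : ∑ j, q j * φ (y j) ≤ ∑ j, q j * (b j / l) :=
    Finset.sum_le_sum fun j _ => mul_le_mul_of_nonneg_left (hφy j) (hq j)
  have h3 := h φ hφ
  have e1 : ∑ i, p i * ((s - a i) / l) = (s - ∑ i, p i * a i) / l := by
    simp_rw [mul_div_assoc', mul_sub]
    rw [← Finset.sum_div, Finset.sum_sub_distrib, ← Finset.sum_mul, hp1, one_mul]
  have e2 : ∑ j, q j * (b j / l) = (∑ j, q j * b j) / l := by
    simp_rw [mul_div_assoc']
    rw [← Finset.sum_div]
  have h4 : (s - ∑ i, p i * a i) / l - (∑ j, q j * b j) / l ≤ W := by linarith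
  rw [← sub_div, div_le_iff₀ hlpos] at h4
  linarith

/-- A Lipschitz function of an integrable random vector is integrable. -/
theorem integrable_comp_of_lipschitz {S E : Type*} [MeasurableSpace S] [NormedAddCommGroup E]
    {f : E → ℝ} {K : NNReal} (hf : LipschitzWith K f) {μ : Measure S} [IsFiniteMeasure μ]
    {Z : S → E} (hZ : Integrable Z μ) : Integrable (fun s => f (Z s)) μ := by
  have hfm : AEStronglyMeasurable (fun s => f (Z s)) μ :=
    hf.continuous.comp_aestronglyMeasurable hZ.1
  refine ((integrable_const ‖f 0‖).add (hZ.norm.const_mul K)).mono' hfm (ae_of_all _ fun s => ?_)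
  have := hf.dist_le_mul (Z s) 0
  simp only [Real.dist_eq, dist_zero_right] at this
  simp only [Pi.add_apply, Real.norm_eq_abs]
  have h2 := abs_sub_abs_le_abs_sub (f (Z s)) (f 0)
  linarith

/-- A random vector `X` can be coupled, on an extension of its probability space, with any law `γ`
at an `L¹` cost arbitrarily close to the Kantorovich–Rubinstein dual bound. -/
theorem exists_coupling_of_lipschitz {Ω : Type*} {E : Type*} [MeasurableSpace Ω]
    [NormedAddCommGroup E] [MeasurableSpace E] [BorelSpace E] [SecondCountableTopology E]
    (P : Measure Ω) [IsProbabilityMeasure P] (γ : Measure E) [IsProbabilityMeasure γ]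
    (X : Ω → E) (hX : Measurable X) (hXi : Integrable X P) (hγ : Integrable id γ) (W : ℝ)
    (h : ∀ f : E → ℝ, LipschitzWith 1 f → ∫ ω, f (X ω) ∂P - ∫ e, f e ∂γ ≤ W)
    (η : ℝ) (hη : 0 < η) :
    ∃ P' : Measure (Ω × E), P'.map Prod.fst = P ∧ P'.map Prod.snd = γ ∧
      Integrable (fun z => ‖X z.1 - z.2‖) P' ∧ ∫ z, ‖X z.1 - z.2‖ ∂P' ≤ W + η := by
  classical
  obtain ⟨X₀, hX₀, hX₀L⟩ : ∃ X₀ : SimpleFunc Ω E, ∫ ω, ‖X ω - X₀ ω‖ ∂P ≤ η / 4 ∧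
      Integrable X₀ P := by
    obtain ⟨g, hg, hgL⟩ := (memLp_one_iff_integrable.2 hXi).exists_simpleFunc_eLpNorm_sub_lt
      ENNReal.one_ne_top (ε := ENNReal.ofReal (η / 4)) (by simpa using by positivity)
    have hgi := memLp_one_iff_integrable.1 hgL
    refine ⟨g, ?_, hgi⟩
    have := (hXi.sub hgi)
    rw [eLpNorm_one_eq_lintegral_enorm, ← ofReal_integral_norm_eq_lintegral_enorm this] at hg
    exact ((ENNReal.ofReal_lt_ofReal_iff (by positivity)).1 hg).le
  obtain ⟨Y₀, hY₀, hY₀L⟩ : ∃ Y₀ : SimpleFunc E E, ∫ e, ‖e - Y₀ e‖ ∂γ ≤ η / 4 ∧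
      Integrable Y₀ γ := by
    obtain ⟨g, hg, hgL⟩ := (memLp_one_iff_integrable.2 hγ).exists_simpleFunc_eLpNorm_sub_lt
      ENNReal.one_ne_top (ε := ENNReal.ofReal (η / 4)) (by simpa using by positivity)
    have hgi := memLp_one_iff_integrable.1 hgL
    refine ⟨g, ?_, hgi⟩
    have := (hγ.sub hgi)
    rw [eLpNorm_one_eq_lintegral_enorm, ← ofReal_integral_norm_eq_lintegral_enorm this] at hg
    exact ((ENNReal.ofReal_lt_ofReal_iff (by positivity)).1 hg).le
  set A : X₀.range → Set Ω := fun i => X₀ ⁻¹' {i.1} with hAdef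
  set B : Y₀.range → Set E := fun j => Y₀ ⁻¹' {j.1} with hBdef
  have hAm : ∀ i, MeasurableSet (A i) := fun i => X₀.measurableSet_fiber _
  have hBm : ∀ j, MeasurableSet (B j) := fun j => Y₀.measurableSet_fiber _
  set p : X₀.range → ℝ := fun i => P.real (A i) with hpdef
  set q : Y₀.range → ℝ := fun j => γ.real (B j) with hqdef
  have hPsum : ∑ i, P.restrict (A i) = P := by
    ext S hS
    have : ∀ i, (P.restrict (A i)) S = P (A i ∩ S) := fun i => by
      rw [Measure.restrict_apply hS, Set.inter_comm]
    rw [Measure.finsetSum_apply, Finset.sum_congr rfl fun i _ => this i,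
      ← measure_biUnion_finset]
    · congr 1
      ext ω
      simp [A]
    · intro i _ j _ hij
      refine Set.disjoint_left.2 fun ω h1 h2 => hij (Subtype.ext ?_)
      exact h1.1.symm.trans h2.1
    · exact fun i _ => (hAm i).inter hS
  have hγsum : ∑ j, γ.restrict (B j) = γ := by
    ext S hS
    have : ∀ i, (γ.restrict (B i)) S = γ (B i ∩ S) := fun i => by
      rw [Measure.restrict_apply hS, Set.inter_comm]
    rw [Measure.finsetSum_apply, Finset.sum_congr rfl fun i _ => this i,
      ← measure_biUnion_finset]
    · congr 1
      ext ω
      simp [B]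
    · intro i _ j _ hij
      refine Set.disjoint_left.2 fun ω h1 h2 => hij (Subtype.ext ?_)
      exact h1.1.symm.trans h2.1
    · exact fun i _ => (hBm i).inter hS
  have hp1 : ∑ i, p i = 1 := by
    have := congrArg (fun m : Measure Ω => (m Set.univ).toReal) hPsum
    simp only [Measure.finsetSum_apply, Measure.restrict_apply_univ, measure_univ,
      ENNReal.toReal_one] at this
    rwa [ENNReal.toReal_sum fun i _ => measure_ne_top _ _] at this
  have hq1 : ∑ j, q j = 1 := by
    have := congrArg (fun m : Measure E => (m Set.univ).toReal) hγsum
    simp only [Measure.finsetSum_apply, Measure.restrict_apply_univ, measure_univ,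
      ENNReal.toReal_one] at this
    rwa [ENNReal.toReal_sum fun i _ => measure_ne_top _ _] at this
  have hdual : ∀ f : E → ℝ, LipschitzWith 1 f →
      ∑ i : X₀.range, p i * f i.1 - ∑ j : Y₀.range, q j * f j.1 ≤ W + η / 2 := by
    intro f hf
    have e1 : ∑ i : X₀.range, p i * f i.1 = ∫ ω, f (X₀ ω) ∂P := by
      conv_rhs => rw [← hPsum]
      rw [integral_finsetSum_measure fun i _ =>
        (integrable_comp_of_lipschitz hf hX₀L).mono_measure Measure.restrict_le_self]
      refine Finset.sum_congr rfl fun i _ => ?_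
      rw [setIntegral_congr_fun (g := fun _ => f i.1) (hAm i)
        (fun ω hω => by simp only; rw [show X₀ ω = i.1 from hω])]
      simp [p]
    have e2 : ∑ j : Y₀.range, q j * f j.1 = ∫ e, f (Y₀ e) ∂γ := by
      conv_rhs => rw [← hγsum]
      rw [integral_finsetSum_measure fun i _ =>
        (integrable_comp_of_lipschitz hf hY₀L).mono_measure Measure.restrict_le_self]
      refine Finset.sum_congr rfl fun i _ => ?_
      rw [setIntegral_congr_fun (g := fun _ => f i.1) (hBm i)
        (fun ω hω => by simp only; rw [show Y₀ ω = i.1 from hω])]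
      simp [q]
    have h1 : ∫ ω, f (X₀ ω) ∂P - ∫ ω, f (X ω) ∂P ≤ η / 4 := by
      rw [← integral_sub (integrable_comp_of_lipschitz hf hX₀L) (integrable_comp_of_lipschitz hf hXi)]
      refine (integral_mono ((integrable_comp_of_lipschitz hf hX₀L).sub (integrable_comp_of_lipschitz hf hXi))
        (hXi.sub hX₀L).norm fun ω => ?_).trans hX₀
      have := hf.dist_le_mul (X₀ ω) (X ω)
      simp only [NNReal.coe_one, one_mul, dist_eq_norm] at this
      simp only [Pi.sub_apply]
      rw [norm_sub_rev]
      exact (le_abs_self _).trans this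
    have h2 : ∫ e, f e ∂γ - ∫ e, f (Y₀ e) ∂γ ≤ η / 4 := by
      have hi : Integrable (fun e => f e) γ := integrable_comp_of_lipschitz hf hγ
      rw [← integral_sub hi (integrable_comp_of_lipschitz hf hY₀L)]
      refine (integral_mono (hi.sub (integrable_comp_of_lipschitz hf hY₀L))
        (hγ.sub hY₀L).norm fun e => ?_).trans hY₀
      have := hf.dist_le_mul e (Y₀ e)
      simp only [NNReal.coe_one, one_mul, dist_eq_norm] at this
      exact (le_abs_self _).trans this
    rw [e1, e2]
    linarith [h f hf]
  have hPA : ∀ i, P (A i) = ENNReal.ofReal (p i) := fun i => by simp [p]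
  have hγB : ∀ j, γ (B j) = ENNReal.ofReal (q j) := fun j => by simp [q]
  have hp0 : ∀ i, 0 ≤ p i := fun i => measureReal_nonneg
  have hq0 : ∀ j, 0 ≤ q j := fun j => measureReal_nonneg
  clear_value p q
  obtain ⟨π, hπ0, hπp, hπq, hcost⟩ := exists_transport_plan (fun i : X₀.range => i.1)
    (fun j : Y₀.range => j.1) p q hp0 hq0
    hp1 hq1 _ hdual
  have hπp0 : ∀ i j, p i = 0 → π i j = 0 := fun i j h0 =>
    (Finset.sum_eq_zero_iff_of_nonneg fun j _ => hπ0 i j).1 ((hπp i).trans h0) j (Finset.mem_univ j)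
  have hπq0 : ∀ i j, q j = 0 → π i j = 0 := fun i j h0 =>
    (Finset.sum_eq_zero_iff_of_nonneg fun i _ => hπ0 i j).1 ((hπq j).trans h0) i (Finset.mem_univ i)
  set c : X₀.range → Y₀.range → ENNReal := fun i j => ENNReal.ofReal (π i j / (p i * q j)) with hc
  set P' : Measure (Ω × E) :=
    ∑ i, ∑ j, c i j • (P.restrict (A i)).prod (γ.restrict (B j)) with hP'
  have hfst : P'.map Prod.fst = P := by
    conv_rhs => rw [← hPsum]
    rw [hP', Measure.map_finset_sum measurable_fst.aemeasurable]
    refine Finset.sum_congr rfl fun i _ => ?_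
    rw [Measure.map_finset_sum measurable_fst.aemeasurable]
    simp_rw [Measure.map_smul, Measure.map_fst_prod, Measure.restrict_apply_univ, smul_smul]
    rw [← Finset.sum_smul]
    by_cases h0 : p i = 0
    · have : P (A i) = 0 := by
        rw [hPA, h0, ENNReal.ofReal_zero]
      rw [Measure.restrict_eq_zero.2 this, smul_zero]
    · have : ∑ j, c i j * γ (B j) = 1 := by
        have e : ∀ j, c i j * γ (B j) = ENNReal.ofReal (π i j / p i) := fun j => by
          rw [hγB, hc, ← ENNReal.ofReal_mul
            (div_nonneg (hπ0 i j) (mul_nonneg (hp0 i) (hq0 j)))]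
          congr 1
          by_cases hqz : q j = 0
          · rw [hπq0 i j hqz]; simp
          · field_simp
        simp_rw [e]
        rw [← ENNReal.ofReal_sum_of_nonneg fun j _ => div_nonneg (hπ0 i j) (hp0 i),
          ← Finset.sum_div, hπp, div_self h0, ENNReal.ofReal_one]
      rw [this, one_smul]
  have hsnd : P'.map Prod.snd = γ := by
    conv_rhs => rw [← hγsum]
    rw [hP', Finset.sum_comm, Measure.map_finset_sum measurable_snd.aemeasurable]
    refine Finset.sum_congr rfl fun j _ => ?_
    rw [Measure.map_finset_sum measurable_snd.aemeasurable]
    simp_rw [Measure.map_smul, Measure.map_snd_prod, Measure.restrict_apply_univ, smul_smul]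
    rw [← Finset.sum_smul]
    by_cases h0 : q j = 0
    · have : γ (B j) = 0 := by
        rw [hγB, h0, ENNReal.ofReal_zero]
      rw [Measure.restrict_eq_zero.2 this, smul_zero]
    · have : ∑ i, c i j * P (A i) = 1 := by
        have e : ∀ i, c i j * P (A i) = ENNReal.ofReal (π i j / q j) := fun i => by
          rw [hPA, hc, ← ENNReal.ofReal_mul
            (div_nonneg (hπ0 i j) (mul_nonneg (hp0 i) (hq0 j)))]
          congr 1
          by_cases hpz : p i = 0
          · rw [hπp0 i j hpz]; simp
          · field_simp
        simp_rw [e]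
        rw [← ENNReal.ofReal_sum_of_nonneg fun i _ => div_nonneg (hπ0 i j) (hq0 j),
          ← Finset.sum_div, hπq, div_self h0, ENNReal.ofReal_one]
      rw [this, one_smul]
  have hi1 : Integrable (fun z : Ω × E => ‖X z.1 - X₀ z.1‖) P' := by
    have : Integrable (fun ω => ‖X ω - X₀ ω‖) (P'.map Prod.fst) := by
      rw [hfst]; exact (hXi.sub hX₀L).norm
    exact this.comp_measurable measurable_fst
  have hi3 : Integrable (fun z : Ω × E => ‖z.2 - Y₀ z.2‖) P' := by
    have : Integrable (fun e => ‖e - Y₀ e‖) (P'.map Prod.snd) := by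
      rw [hsnd]; exact (hγ.sub hY₀L).norm
    exact this.comp_measurable measurable_snd
  have hi2 : Integrable (fun z : Ω × E => ‖X₀ z.1 - Y₀ z.2‖) P' := by
    have h1 : Integrable (fun z : Ω × E => X₀ z.1) P' := by
      have : Integrable X₀ (P'.map Prod.fst) := by rw [hfst]; exact hX₀L
      exact this.comp_measurable measurable_fst
    have h2 : Integrable (fun z : Ω × E => Y₀ z.2) P' := by
      have : Integrable Y₀ (P'.map Prod.snd) := by rw [hsnd]; exact hY₀L
      exact this.comp_measurable measurable_snd
    exact (h1.sub h2).norm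
  have hpt : ∀ z : Ω × E, ‖X z.1 - z.2‖
      ≤ ‖X z.1 - X₀ z.1‖ + ‖X₀ z.1 - Y₀ z.2‖ + ‖z.2 - Y₀ z.2‖ := fun z => by
    have : X z.1 - z.2 = (X z.1 - X₀ z.1) + (X₀ z.1 - Y₀ z.2) + (Y₀ z.2 - z.2) := by abel
    rw [this, norm_sub_rev z.2]
    exact norm_add₃_le
  have hisum := (hi1.add hi2).add hi3
  have hint : Integrable (fun z : Ω × E => ‖X z.1 - z.2‖) P' := by
    refine hisum.mono' ?_ (ae_of_all _ fun z => ?_)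
    · exact ((hX.comp measurable_fst).sub measurable_snd).norm.aestronglyMeasurable
    · rw [norm_norm]; exact hpt z
  refine ⟨P', hfst, hsnd, hint, ?_⟩
  have e1 : ∫ z, ‖X z.1 - X₀ z.1‖ ∂P' = ∫ ω, ‖X ω - X₀ ω‖ ∂P := by
    conv_rhs => rw [← hfst]
    rw [integral_map measurable_fst.aemeasurable]
    rw [hfst]; exact (hXi.sub hX₀L).norm.1
  have e3 : ∫ z, ‖z.2 - Y₀ z.2‖ ∂P' = ∫ e, ‖e - Y₀ e‖ ∂γ := by
    conv_rhs => rw [← hsnd]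
    rw [integral_map measurable_snd.aemeasurable]
    rw [hsnd]; exact (hγ.sub hY₀L).norm.1
  have e2 : ∫ z, ‖X₀ z.1 - Y₀ z.2‖ ∂P' = ∑ i, ∑ j, π i j * dist i.1 j.1 := by
    have hle : ∀ i j, c i j • (P.restrict (A i)).prod (γ.restrict (B j)) ≤ P' := fun i j =>
      (Finset.single_le_sum (f := fun j => c i j • (P.restrict (A i)).prod (γ.restrict (B j)))
        (fun _ _ => Measure.zero_le _) (Finset.mem_univ j)).trans
      (Finset.single_le_sum
        (f := fun i => ∑ j, c i j • (P.restrict (A i)).prod (γ.restrict (B j)))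
        (fun _ _ => Measure.zero_le _) (Finset.mem_univ i))
    rw [hP', integral_finsetSum_measure]
    · refine Finset.sum_congr rfl fun i _ => ?_
      rw [integral_finsetSum_measure fun j _ => hi2.mono_measure (hle i j)]
      refine Finset.sum_congr rfl fun j _ => ?_
      rw [integral_smul_measure, Measure.prod_restrict,
        setIntegral_congr_fun (g := fun _ => dist i.1 j.1) ((hAm i).prod (hBm j))]
      · rw [setIntegral_const, measureReal_def, Measure.prod_prod, ENNReal.toReal_mul, hPA,
          hγB, ENNReal.toReal_ofReal (hp0 i), ENNReal.toReal_ofReal (hq0 j), hc,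
          ENNReal.toReal_ofReal
            (div_nonneg (hπ0 i j) (mul_nonneg (hp0 i) (hq0 j)))]
        rw [smul_smul, smul_eq_mul]
        by_cases hpz : p i = 0
        · rw [hπp0 i j hpz]; simp
        by_cases hqz : q j = 0
        · rw [hπq0 i j hqz]; simp
        field_simp
      · rintro ⟨ω, e⟩ ⟨h1, h2⟩
        simp only
        rw [show X₀ ω = i.1 from h1, show Y₀ e = j.1 from h2, dist_eq_norm]
    · intro i _
      refine hi2.mono_measure ?_
      exact Finset.single_le_sum
        (f := fun i => ∑ j, c i j • (P.restrict (A i)).prod (γ.restrict (B j)))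
        (fun _ _ => Measure.zero_le _) (Finset.mem_univ i)
  calc ∫ z, ‖X z.1 - z.2‖ ∂P'
      ≤ ∫ z, (‖X z.1 - X₀ z.1‖ + ‖X₀ z.1 - Y₀ z.2‖ + ‖z.2 - Y₀ z.2‖) ∂P' :=
        integral_mono hint hisum hpt
    _ = ∫ ω, ‖X ω - X₀ ω‖ ∂P + ∑ i, ∑ j, π i j * dist i.1 j.1 + ∫ e, ‖e - Y₀ e‖ ∂γ := by
        rw [integral_add (f := fun z : Ω × E => ‖X z.1 - X₀ z.1‖ + ‖X₀ z.1 - Y₀ z.2‖) (hi1.add hi2) hi3,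
          integral_add hi1 hi2, e1, e2, e3]
    _ ≤ W + η := by linarith

/-! ### Gaussian smoothing of Lipschitz functions -/

theorem Real.abs_exp_sub_one_sub_id_sub_sq_le (x : ℝ) :
    |Real.exp x - 1 - x - x ^ 2 / 2| ≤ |x| ^ 3 * Real.exp |x| := by
  have h := Complex.norm_exp_sub_sum_le_norm_mul_exp (x : ℂ) 3
  have e : Complex.exp (x : ℂ) - ∑ m ∈ Finset.range 3, (x : ℂ) ^ m / (m.factorial : ℂ)
      = ((Real.exp x - 1 - x - x ^ 2 / 2 : ℝ) : ℂ) := by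
    simp [Finset.sum_range_succ, Nat.factorial]
    ring
  rw [e, Complex.norm_real, Complex.norm_real] at h
  exact h

/-- The third-order remainder in the expansion of the Gaussian likelihood ratio. -/
theorem abs_gaussian_ratio_remainder_le {a z : ℝ} (ha : |a| ≤ 1) :
    |Real.exp (a * z - a ^ 2 / 2) - 1 - a * z - a ^ 2 / 2 * (z ^ 2 - 1)|
      ≤ |a| ^ 3 * (|z| + 1 + (|z| + 1) ^ 3 * Real.exp (|z| + 1)) := by
  set x := a * z - a ^ 2 / 2 with hx
  have ha0 := abs_nonneg a
  have hz0 := abs_nonneg z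
  have hxle : |x| ≤ |a| * (|z| + 1) := by
    calc |x| ≤ |a * z| + |a ^ 2 / 2| := abs_sub _ _
      _ = |a| * |z| + |a| * |a| / 2 := by
        rw [abs_mul, abs_div, abs_pow, sq]; norm_num
      _ ≤ _ := by nlinarith
  have hxle' : |x| ≤ |z| + 1 := hxle.trans (by nlinarith)
  have h1 := Real.abs_exp_sub_one_sub_id_sub_sq_le x
  have h2 : |x| ^ 3 * Real.exp |x| ≤ |a| ^ 3 * ((|z| + 1) ^ 3 * Real.exp (|z| + 1)) := by
    rw [← mul_assoc, ← mul_pow]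
    gcongr
  have h3 : Real.exp x - 1 - a * z - a ^ 2 / 2 * (z ^ 2 - 1)
      = (Real.exp x - 1 - x - x ^ 2 / 2) + a ^ 3 * (- z / 2 + a / 8) := by
    rw [hx]; ring
  have h4 : |a ^ 3 * (- z / 2 + a / 8)| ≤ |a| ^ 3 * (|z| + 1) := by
    rw [abs_mul, abs_pow]
    refine mul_le_mul_of_nonneg_left ?_ (by positivity)
    refine (abs_add_le _ _).trans ?_
    rw [abs_div, abs_div, abs_neg]
    norm_num
    linarith
  rw [h3]
  refine (abs_add_le _ _).trans ?_
  rw [mul_add (|a| ^ 3) (|z| + 1)]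
  linarith

theorem integrable_exp_mul_abs_gaussianReal (t : ℝ) :
    Integrable (fun z => Real.exp (t * |z|)) (gaussianReal 0 1) := by
  refine ((integrable_exp_mul_gaussianReal t).add (integrable_exp_mul_gaussianReal (-t))).mono'
    (by fun_prop) (ae_of_all _ fun z => ?_)
  simp only [Pi.add_apply, Real.norm_eq_abs, Real.abs_exp]
  rcases abs_choice z with h | h <;> rw [h]
  · linarith [Real.exp_pos (-t * z)]
  · rw [show t * -z = -t * z by ring]; linarith [Real.exp_pos (t * z)]

theorem integral_gaussianReal_add_eq (G : ℝ → ℝ) (hG : Measurable G) (a : ℝ) :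
    ∫ z, G (z + a) ∂(gaussianReal 0 1)
      = ∫ z, Real.exp (a * z - a ^ 2 / 2) * G z ∂(gaussianReal 0 1) := by
  have h1 : ∫ z, G (z + a) ∂(gaussianReal 0 1) = ∫ z, G z ∂(gaussianReal a 1) := by
    rw [← zero_add a, ← gaussianReal_map_add_const a, integral_map (by fun_prop)
      hG.aestronglyMeasurable, zero_add]
  rw [h1, integral_gaussianReal_eq_integral_smul one_ne_zero,
    integral_gaussianReal_eq_integral_smul one_ne_zero]
  congr 1
  ext z
  simp only [smul_eq_mul, gaussianPDFReal, ← mul_assoc]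
  rw [mul_assoc _ (Real.exp _) (Real.exp _), ← Real.exp_add]
  congr 4
  simp
  ring

/-- Second-order expansion of a Gaussian-smoothed Lipschitz function on the line. -/
theorem exists_gaussian_shift_expansion : ∃ C : ℝ, 0 ≤ C ∧ ∀ (K : NNReal) (F : ℝ → ℝ),
    LipschitzWith K F → ∀ a : ℝ,
    |∫ z, F (z + a) ∂(gaussianReal 0 1) - ∫ z, F z ∂(gaussianReal 0 1)
      - a * ∫ z, z * F z ∂(gaussianReal 0 1)
      - a ^ 2 / 2 * ∫ z, (z ^ 2 - 1) * F z ∂(gaussianReal 0 1)| ≤ C * K * |a| ^ 3 := by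
  set γ := gaussianReal 0 1 with hγ
  set m : ℝ → ℝ := fun z => 8 * Real.exp 3 * Real.exp (3 * |z|) with hm
  have hmi : Integrable m γ := (integrable_exp_mul_abs_gaussianReal 3).const_mul _
  have hm0 : ∀ z, 0 ≤ m z := fun z => by positivity
  have hmb : ∀ z, |z| * (|z| + 1 + (|z| + 1) ^ 3 * Real.exp (|z| + 1)) ≤ m z := fun z => by
    have hz := abs_nonneg z
    set s := |z| + 1 with hs
    have e1 : m z = 8 * Real.exp s ^ 3 := by
      rw [hm, ← Real.exp_nat_mul]
      simp only [mul_assoc, ← Real.exp_add]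
      congr 2
      rw [hs]; push_cast; ring
    have hs1 : 1 ≤ s := by linarith
    have h1 : s ≤ Real.exp s := (by linarith [Real.add_one_le_exp s])
    have h3 : s ^ 3 / 6 ≤ Real.exp s := by
      have := Real.pow_div_factorial_le_exp s (by linarith) 3
      norm_num [Nat.factorial] at this
      exact this
    have hE : 1 ≤ Real.exp s := by linarith
    rw [e1]
    calc |z| * (s + s ^ 3 * Real.exp s) ≤ Real.exp s * (Real.exp s + 6 * Real.exp s * Real.exp s) := by
          gcongr <;> linarith
      _ ≤ _ := by nlinarith [sq_nonneg (Real.exp s), mul_nonneg (sq_nonneg (Real.exp s)) (sub_nonneg.2 hE)]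
  have hb1 : ∀ z : ℝ, |z| ≤ m z := fun z => by
    refine le_trans ?_ (hmb z)
    have h0 := abs_nonneg z
    have : 0 ≤ (|z| + 1) ^ 3 * Real.exp (|z| + 1) := by positivity
    nlinarith
  have hb2 : ∀ z : ℝ, |z| ^ 2 ≤ m z := fun z => by
    refine le_trans ?_ (hmb z)
    have h0 := abs_nonneg z
    have : 0 ≤ (|z| + 1) ^ 3 * Real.exp (|z| + 1) := by positivity
    nlinarith
  have hb3 : ∀ z : ℝ, |z ^ 2 - 1| * |z| ≤ m z := fun z => by
    refine le_trans ?_ (hmb z)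
    have h0 := abs_nonneg z
    rw [mul_comm]
    refine mul_le_mul_of_nonneg_left ?_ h0
    have h1 : |z ^ 2 - 1| ≤ |z| ^ 2 + 1 := by
      refine (abs_sub _ _).trans ?_
      simp
    have h2 : (1 : ℝ) ≤ Real.exp (|z| + 1) := Real.one_le_exp (by positivity)
    have h3 : (|z| + 1) ^ 3 * 1 ≤ (|z| + 1) ^ 3 * Real.exp (|z| + 1) := by gcongr
    nlinarith [pow_nonneg h0 3]
  refine ⟨3 * ∫ z, m z ∂γ + 1, by
    have := integral_nonneg (f := m) (μ := γ) hm0; linarith, ?_⟩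
  intro K F hF a
  set I := ∫ z, m z ∂γ with hI
  have hI0 : 0 ≤ I := integral_nonneg hm0
  set G : ℝ → ℝ := fun z => F z - F 0 with hG
  have hFm : Measurable F := hF.continuous.measurable
  have hGm : Measurable G := hFm.sub_const _
  have hGb : ∀ z, |G z| ≤ K * |z| := fun z => by
    have := hF.dist_le_mul z 0
    simpa [Real.dist_eq] using this
  have hK : (0 : ℝ) ≤ K := K.2
  have hmono : ∀ (g : ℝ → ℝ) (c : ℝ), Measurable g → (∀ z, |g z| ≤ c * m z) → Integrable g γ :=
    fun g c hg hb => (hmi.const_mul c).mono' hg.aestronglyMeasurable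
      (ae_of_all _ fun z => by simpa using hb z)
  have hbound : ∀ (g : ℝ → ℝ) (c : ℝ), (∀ z, |g z| ≤ c * m z) → |∫ z, g z ∂γ| ≤ c * I := by
    intro g c hb
    rw [hI, ← integral_const_mul]
    refine (norm_integral_le_integral_norm g).trans (integral_mono_of_nonneg
      (ae_of_all _ fun z => norm_nonneg _) (hmi.const_mul c) (ae_of_all _ fun z => hb z))
  have iz : Integrable (fun z : ℝ => z) γ := hmono _ 1 measurable_id fun z => by
    simpa using hb1 z
  have iz2 : Integrable (fun z : ℝ => z ^ 2) γ := hmono _ 1 (by fun_prop) fun z => by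
    simpa [abs_pow] using hb2 z
  have gz : ∀ z, |G z| ≤ K * m z := fun z => (hGb z).trans (by gcongr; exact hb1 z)
  have gz1 : ∀ z, |z * G z| ≤ K * m z := fun z => by
    rw [abs_mul]
    calc |z| * |G z| ≤ |z| * (K * |z|) := by gcongr; exact hGb z
      _ = K * |z| ^ 2 := by ring
      _ ≤ _ := by gcongr; exact hb2 z
  have gz2 : ∀ z, |(z ^ 2 - 1) * G z| ≤ K * m z := fun z => by
    rw [abs_mul]
    calc |z ^ 2 - 1| * |G z| ≤ |z ^ 2 - 1| * (K * |z|) := by gcongr; exact hGb z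
      _ = K * (|z ^ 2 - 1| * |z|) := by ring
      _ ≤ _ := by gcongr; exact hb3 z
  have iG : Integrable G γ := hmono _ K hGm gz
  have iG1 : Integrable (fun z => z * G z) γ := hmono _ K (by fun_prop) gz1
  have iG2 : Integrable (fun z => (z ^ 2 - 1) * G z) γ := hmono _ K (by fun_prop) gz2
  have iGa : Integrable (fun z => G (z + a)) γ := by
    refine ((iz.norm.add (integrable_const |a|)).const_mul (K : ℝ)).mono'
      (hGm.comp (measurable_id.add_const a)).aestronglyMeasurable (ae_of_all _ fun z => ?_)
    refine (hGb _).trans ?_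
    simp only [Pi.add_apply, Real.norm_eq_abs]
    gcongr
    exact abs_add_le _ _
  have e0 : ∫ z, z ∂γ = 0 := by simp [hγ]
  have e02 : ∫ z, (z ^ 2 - 1) ∂γ = 0 := by
    rw [integral_sub iz2 (integrable_const _)]
    have hv : Var[fun x => x; γ] = 1 := by
      rw [hγ, variance_fun_id_gaussianReal]; simp
    rw [variance_eq_integral (by fun_prop)] at hv
    simp only [e0, sub_zero] at hv
    rw [hv]; simp
  obtain ⟨c, hc⟩ : ∃ c, c = F 0 := ⟨_, rfl⟩
  have hFG : ∀ z, F z = G z + c := fun z => by simp [hG, hc]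
  have r1 : ∫ z, F (z + a) ∂γ = ∫ z, G (z + a) ∂γ + c := by
    simp_rw [hFG]; rw [integral_add iGa (integrable_const _)]; simp
  have r2 : ∫ z, F z ∂γ = ∫ z, G z ∂γ + c := by
    simp_rw [hFG]; rw [integral_add iG (integrable_const _)]; simp
  have r3 : ∫ z, z * F z ∂γ = ∫ z, z * G z ∂γ := by
    simp_rw [hFG, mul_add]
    rw [integral_add iG1 (iz.mul_const _), integral_mul_const, e0]; simp
  have r4 : ∫ z, (z ^ 2 - 1) * F z ∂γ = ∫ z, (z ^ 2 - 1) * G z ∂γ := by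
    simp_rw [hFG, mul_add]
    have i21 : Integrable (fun z : ℝ => z ^ 2 - 1) γ := iz2.sub (integrable_const _)
    rw [integral_add iG2 (i21.mul_const _), integral_mul_const, e02]; simp
  rw [r1, r2, r3, r4, add_sub_add_right_eq_sub]
  rcases le_or_gt |a| 1 with ha | ha
  · rw [hγ, integral_gaussianReal_add_eq G hGm a, ← hγ]
    have hRb : ∀ z, |(Real.exp (a * z - a ^ 2 / 2) - 1 - a * z - a ^ 2 / 2 * (z ^ 2 - 1)) * G z|
        ≤ (|a| ^ 3 * K) * m z := fun z => by
      rw [abs_mul]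
      calc _ ≤ (|a| ^ 3 * (|z| + 1 + (|z| + 1) ^ 3 * Real.exp (|z| + 1))) * (K * |z|) :=
            mul_le_mul (abs_gaussian_ratio_remainder_le ha) (hGb z) (abs_nonneg _) (by positivity)
        _ = (|a| ^ 3 * K) * (|z| * (|z| + 1 + (|z| + 1) ^ 3 * Real.exp (|z| + 1))) := by ring
        _ ≤ _ := by gcongr; exact hmb z
    have iR := hmono _ _ (by fun_prop) hRb
    have iE : Integrable (fun z => Real.exp (a * z - a ^ 2 / 2) * G z) γ := by
      refine (((iR.add iG).add (iG1.const_mul a)).add (iG2.const_mul (a ^ 2 / 2))).congr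
        (ae_of_all _ fun z => ?_)
      simp only [Pi.add_apply]; ring
    have := hbound _ _ hRb
    have e : ∫ z, (Real.exp (a * z - a ^ 2 / 2) - 1 - a * z - a ^ 2 / 2 * (z ^ 2 - 1)) * G z ∂γ
        = ∫ z, Real.exp (a * z - a ^ 2 / 2) * G z ∂γ - ∫ z, G z ∂γ - a * ∫ z, z * G z ∂γ
          - a ^ 2 / 2 * ∫ z, (z ^ 2 - 1) * G z ∂γ := by
      rw [← integral_const_mul, ← integral_const_mul, ← integral_sub' iE iG,
        ← integral_sub' (iE.sub iG) (iG1.const_mul a),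
        ← integral_sub' ((iE.sub iG).sub (iG1.const_mul a)) (iG2.const_mul _)]
      congr 1
      ext z
      simp only [Pi.sub_apply]; ring
    rw [e] at this
    refine this.trans ?_
    have : 0 ≤ |a| ^ 3 * K := by positivity
    nlinarith
  · have h1 : |∫ z, G (z + a) ∂γ - ∫ z, G z ∂γ| ≤ K * |a| := by
      rw [← integral_sub iGa iG]
      have hb : ∀ z, ‖G (z + a) - G z‖ ≤ K * |a| := fun z => by
        have := hF.dist_le_mul (z + a) z
        simpa [Real.dist_eq, hG] using this
      have := norm_integral_le_of_norm_le_const (μ := γ) (ae_of_all _ hb)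
      rwa [probReal_univ, mul_one] at this
    have h2 := hbound _ _ gz1
    have h3 := hbound _ _ gz2
    have ha3 : |a| ≤ |a| ^ 3 := by nlinarith [mul_pos (by linarith : 0 < |a|) (by linarith : 0 < |a|)]
    have ha23 : |a| ^ 2 ≤ |a| ^ 3 := by nlinarith [sq_nonneg |a|]
    have h4 : |a * ∫ z, z * G z ∂γ| ≤ |a| ^ 3 * (K * I) := by
      rw [abs_mul]; exact mul_le_mul ha3 h2 (abs_nonneg _) (by positivity)
    have h5 : |a ^ 2 / 2 * ∫ z, (z ^ 2 - 1) * G z ∂γ| ≤ |a| ^ 3 * (K * I) := by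
      rw [abs_mul]
      refine mul_le_mul ?_ h3 (abs_nonneg _) (by positivity)
      rw [abs_div, abs_pow]; norm_num
      nlinarith [sq_nonneg |a|, sq_abs a]
    have h6 : K * |a| ≤ K * |a| ^ 3 := by gcongr
    calc _ ≤ |∫ z, G (z + a) ∂γ - ∫ z, G z ∂γ| + |a * ∫ z, z * G z ∂γ|
          + |a ^ 2 / 2 * ∫ z, (z ^ 2 - 1) * G z ∂γ| :=
          (abs_sub _ _).trans (add_le_add_left (abs_sub _ _) _)
      _ ≤ K * |a| ^ 3 + |a| ^ 3 * (K * I) + |a| ^ 3 * (K * I) := by linarith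
      _ ≤ _ := by
        have : 0 ≤ |a| ^ 3 * (K * I) := by positivity
        nlinarith

section Smoothing

variable {E : Type*} [NormedAddCommGroup E] [InnerProductSpace ℝ E] [FiniteDimensional ℝ E]
  [MeasurableSpace E] [BorelSpace E]

open scoped RealInnerProductSpace

/-- Resampling the component of a standard Gaussian vector along a unit vector. -/
theorem map_resample_stdGaussian (e : E) (he : ‖e‖ = 1) :
    ((stdGaussian E).prod (gaussianReal 0 1)).map
      (fun p : E × ℝ => p.1 + (p.2 - ⟪e, p.1⟫) • e) = stdGaussian E := by
  have hm : Measurable (fun p : E × ℝ => p.1 + (p.2 - ⟪e, p.1⟫) • e) := by fun_prop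
  haveI : IsProbabilityMeasure (((stdGaussian E).prod (gaussianReal 0 1)).map
      (fun p : E × ℝ => p.1 + (p.2 - ⟪e, p.1⟫) • e)) :=
    Measure.isProbabilityMeasure_map hm.aemeasurable
  refine Measure.ext_of_charFun ?_
  ext t
  rw [charFun_apply, integral_map hm.aemeasurable (by fun_prop)]
  have h1 : ∀ p : E × ℝ, Complex.exp (⟪p.1 + (p.2 - ⟪e, p.1⟫) • e, t⟫ * Complex.I)
      = Complex.exp (⟪p.1, t - ⟪e, t⟫ • e⟫ * Complex.I)
        * Complex.exp (⟪p.2, ⟪e, t⟫⟫ * Complex.I) := fun p => by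
    rw [← Complex.exp_add]
    congr 1
    simp only [inner_add_left, inner_smul_left, inner_sub_right, inner_smul_right,
      real_inner_comm e, RCLike.inner_apply, conj_trivial]
    push_cast
    ring
  simp_rw [h1]
  rw [integral_prod_mul (fun w : E => Complex.exp (⟪w, t - ⟪e, t⟫ • e⟫ * Complex.I))
    (fun z : ℝ => Complex.exp (⟪z, ⟪e, t⟫⟫ * Complex.I)), ← charFun_apply, ← charFun_apply,
    charFun_stdGaussian, charFun_stdGaussian, charFun_gaussianReal, ← Complex.exp_add]
  congr 1
  have h2 : ‖t - ⟪e, t⟫ • e‖ ^ 2 = ‖t‖ ^ 2 - ⟪e, t⟫ ^ 2 := by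
    rw [norm_sub_sq_real, inner_smul_right, norm_smul, he, real_inner_comm, Real.norm_eq_abs,
      mul_one, sq_abs]
    ring
  have h3 : ((‖t - ⟪e, t⟫ • e‖ ^ 2 : ℝ) : ℂ) = ((‖t‖ ^ 2 - ⟪e, t⟫ ^ 2 : ℝ) : ℂ) := by rw [h2]
  push_cast at h3 ⊢
  rw [h3]
  ring

theorem integrable_norm_pow_stdGaussian (k : ℕ) :
    Integrable (fun w : E => ‖w‖ ^ k) (stdGaussian E) := by
  rcases Nat.eq_zero_or_pos k with rfl | hk
  · simp
  · exact (IsGaussian.memLp_id (stdGaussian E) k (by simp)).integrable_norm_pow hk.ne'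

end Smoothing

/-- A constant for which the expansion in `exists_gaussian_shift_expansion` holds. -/
def gaussShiftConst : ℝ := Classical.choose exists_gaussian_shift_expansion

theorem gaussShiftConst_nonneg : 0 ≤ gaussShiftConst :=
  (Classical.choose_spec exists_gaussian_shift_expansion).1

theorem abs_gaussian_shift_expansion_le {K : NNReal} {F : ℝ → ℝ} (hF : LipschitzWith K F) (a : ℝ) :
    |∫ z, F (z + a) ∂(gaussianReal 0 1) - ∫ z, F z ∂(gaussianReal 0 1)
      - a * ∫ z, z * F z ∂(gaussianReal 0 1)
      - a ^ 2 / 2 * ∫ z, (z ^ 2 - 1) * F z ∂(gaussianReal 0 1)| ≤ gaussShiftConst * K * |a| ^ 3 :=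
  (Classical.choose_spec exists_gaussian_shift_expansion).2 K F hF a

section Smoothing

variable {E : Type*} [NormedAddCommGroup E] [InnerProductSpace ℝ E] [FiniteDimensional ℝ E]
  [MeasurableSpace E] [BorelSpace E]

open scoped RealInnerProductSpace

theorem integrable_one_add_norm_cube_stdGaussian :
    Integrable (fun w : E => 1 + ‖w‖ ^ 3) (stdGaussian E) :=
  (integrable_const _).add (integrable_norm_pow_stdGaussian 3)

theorem abs_lipschitz_smul_le {f : E → ℝ} (hf : LipschitzWith 1 f) {σ : ℝ} (hσ : 0 < σ) (w : E) :
    |f (σ • w)| ≤ (|f 0| + σ) * (1 + ‖w‖) := by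
  have := hf.dist_le_mul (σ • w) 0
  simp only [Real.dist_eq, NNReal.coe_one, one_mul, dist_zero_right, norm_smul,
    Real.norm_of_nonneg hσ.le] at this
  have h2 := abs_sub_abs_le_abs_sub (f (σ • w)) (f 0)
  nlinarith [norm_nonneg w, abs_nonneg (f 0), mul_nonneg (abs_nonneg (f 0)) (norm_nonneg w)]

theorem abs_inner_mul_lipschitz_le {f : E → ℝ} (hf : LipschitzWith 1 f) {σ : ℝ} (hσ : 0 < σ)
    (u w : E) : |⟪w, u⟫ * f (σ • w)| ≤ ‖u‖ * (2 * (|f 0| + σ) * (1 + ‖w‖ ^ 3)) := by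
  rw [abs_mul]
  have h1 := abs_real_inner_le_norm w u
  have h2 := abs_lipschitz_smul_le hf hσ w
  have hw := norm_nonneg w
  have hc : 0 ≤ |f 0| + σ := by positivity
  calc _ ≤ (‖w‖ * ‖u‖) * ((|f 0| + σ) * (1 + ‖w‖)) := by gcongr
    _ = ‖u‖ * ((|f 0| + σ) * (‖w‖ * (1 + ‖w‖))) := by ring
    _ ≤ ‖u‖ * ((|f 0| + σ) * (2 * (1 + ‖w‖ ^ 3))) := by
      have : ‖w‖ * (1 + ‖w‖) ≤ 2 * (1 + ‖w‖ ^ 3) := by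
        nlinarith [mul_nonneg hw (sq_nonneg (‖w‖ - 1)), sq_nonneg (‖w‖ - 1)]
      exact mul_le_mul_of_nonneg_left (mul_le_mul_of_nonneg_left this hc) (norm_nonneg u)
    _ = _ := by ring

theorem abs_inner_sq_mul_lipschitz_le {f : E → ℝ} (hf : LipschitzWith 1 f) {σ : ℝ} (hσ : 0 < σ)
    (u w : E) : |(⟪w, u⟫ ^ 2 - ‖u‖ ^ 2) * f (σ • w)|
      ≤ ‖u‖ ^ 2 * (4 * (|f 0| + σ) * (1 + ‖w‖ ^ 3)) := by
  rw [abs_mul]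
  have h1 := abs_real_inner_le_norm w u
  have h2 := abs_lipschitz_smul_le hf hσ w
  have hw := norm_nonneg w
  have hc : 0 ≤ |f 0| + σ := by positivity
  have h3 : |⟪w, u⟫ ^ 2 - ‖u‖ ^ 2| ≤ ‖u‖ ^ 2 * (1 + ‖w‖ ^ 2) := by
    refine (abs_sub _ _).trans ?_
    rw [abs_pow, abs_pow, abs_norm]
    have : |⟪w, u⟫| ^ 2 ≤ (‖w‖ * ‖u‖) ^ 2 := by gcongr
    nlinarith
  calc _ ≤ (‖u‖ ^ 2 * (1 + ‖w‖ ^ 2)) * ((|f 0| + σ) * (1 + ‖w‖)) := by gcongr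
    _ = ‖u‖ ^ 2 * ((|f 0| + σ) * ((1 + ‖w‖ ^ 2) * (1 + ‖w‖))) := by ring
    _ ≤ ‖u‖ ^ 2 * ((|f 0| + σ) * (4 * (1 + ‖w‖ ^ 3))) := by
      have : (1 + ‖w‖ ^ 2) * (1 + ‖w‖) ≤ 4 * (1 + ‖w‖ ^ 3) := by
        nlinarith [mul_nonneg hw (sq_nonneg (‖w‖ - 1)), sq_nonneg (‖w‖ - 1)]
      exact mul_le_mul_of_nonneg_left (mul_le_mul_of_nonneg_left this hc) (sq_nonneg _)
    _ = _ := by ring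

theorem integrable_resample {g : E → ℝ} (hg : Integrable g (stdGaussian E)) {e : E}
    (he : ‖e‖ = 1) :
    Integrable (fun p : E × ℝ => g (p.1 + (p.2 - ⟪e, p.1⟫) • e))
      ((stdGaussian E).prod (gaussianReal 0 1)) := by
  have hm : Measurable (fun p : E × ℝ => p.1 + (p.2 - ⟪e, p.1⟫) • e) := by fun_prop
  rw [← map_resample_stdGaussian e he] at hg
  exact hg.comp_measurable hm

theorem integral_resample {g : E → ℝ} (hg : Integrable g (stdGaussian E)) {e : E}
    (he : ‖e‖ = 1) :
    ∫ w, ∫ z, g (w + (z - ⟪e, w⟫) • e) ∂(gaussianReal 0 1) ∂(stdGaussian E)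
      = ∫ w, g w ∂(stdGaussian E) := by
  have hm : Measurable (fun p : E × ℝ => p.1 + (p.2 - ⟪e, p.1⟫) • e) := by fun_prop
  rw [← integral_prod _ (integrable_resample hg he)]
  conv_rhs => rw [← map_resample_stdGaussian e he]
  rw [integral_map hm.aemeasurable]
  rw [map_resample_stdGaussian e he]
  exact hg.1

theorem integrable_inner_mul_lipschitz {f : E → ℝ} (hf : LipschitzWith 1 f) {σ : ℝ} (hσ : 0 < σ)
    (u : E) : Integrable (fun w => ⟪w, u⟫ * f (σ • w)) (stdGaussian E) := by
  have hfc := hf.continuous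
  exact ((integrable_one_add_norm_cube_stdGaussian.const_mul _).const_mul _).mono'
    (by fun_prop) (ae_of_all _ fun w => abs_inner_mul_lipschitz_le hf hσ u w)

theorem integrable_inner_sq_mul_lipschitz {f : E → ℝ} (hf : LipschitzWith 1 f) {σ : ℝ}
    (hσ : 0 < σ) (u : E) :
    Integrable (fun w => (⟪w, u⟫ ^ 2 - ‖u‖ ^ 2) * f (σ • w)) (stdGaussian E) := by
  have hfc := hf.continuous
  exact ((integrable_one_add_norm_cube_stdGaussian.const_mul _).const_mul _).mono'
    (by fun_prop) (ae_of_all _ fun w => abs_inner_sq_mul_lipschitz_le hf hσ u w)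

theorem integrable_lipschitz_stdGaussian {f : E → ℝ} (hf : LipschitzWith 1 f) (σ : ℝ)
    (u : E) : Integrable (fun w => f (u + σ • w)) (stdGaussian E) :=
  integrable_comp_of_lipschitz hf
    ((integrable_const u).add (IsGaussian.integrable_fun_id.smul σ))

/-- Second-order expansion of a Gaussian-smoothed Lipschitz function, with a dimension-free
remainder. -/
theorem abs_gaussian_smoothing_expansion_le {f : E → ℝ} (hf : LipschitzWith 1 f) {σ : ℝ}
    (hσ : 0 < σ) (u : E) :
    |∫ w, f (u + σ • w) ∂(stdGaussian E) - ∫ w, f (σ • w) ∂(stdGaussian E)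
      - σ⁻¹ * ∫ w, ⟪w, u⟫ * f (σ • w) ∂(stdGaussian E)
      - σ⁻¹ ^ 2 / 2 * ∫ w, (⟪w, u⟫ ^ 2 - ‖u‖ ^ 2) * f (σ • w) ∂(stdGaussian E)|
      ≤ gaussShiftConst / σ ^ 2 * ‖u‖ ^ 3 := by
  rcases eq_or_ne u 0 with rfl | hu
  · simp
  have hu0 : 0 < ‖u‖ := norm_pos_iff.2 hu
  set e : E := ‖u‖⁻¹ • u with hedef
  have he : ‖e‖ = 1 := by rw [hedef, norm_smul, norm_inv, norm_norm, inv_mul_cancel₀ hu0.ne']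
  have hue : u = ‖u‖ • e := by rw [hedef, smul_smul, mul_inv_cancel₀ hu0.ne', one_smul]
  set Tf : E → ℝ → E := fun w z => w + (z - ⟪e, w⟫) • e with hT
  have hTu : ∀ w z, ⟪Tf w z, u⟫ = ‖u‖ * z := fun w z => by
    have h1 : ⟪e, u⟫ = ‖u‖ := by
      conv_lhs => rw [hue]
      rw [inner_smul_right, real_inner_self_eq_norm_sq, he]; ring
    have h2 : ⟪w, u⟫ = ‖u‖ * ⟪e, w⟫ := by
      conv_lhs => rw [hue]
      rw [inner_smul_right, real_inner_comm]
    simp only [hT, inner_add_left, inner_smul_left, h1, h2, conj_trivial]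
    ring
  have i1 := integrable_lipschitz_stdGaussian hf σ u
  have i2 : Integrable (fun w => f (σ • w)) (stdGaussian E) := by
    simpa using integrable_lipschitz_stdGaussian hf σ 0
  have i3 := integrable_inner_mul_lipschitz hf hσ u
  have i4 := integrable_inner_sq_mul_lipschitz hf hσ u
  have key : ∀ w, |∫ z, f (u + σ • Tf w z) ∂(gaussianReal 0 1)
      - ∫ z, f (σ • Tf w z) ∂(gaussianReal 0 1)
      - σ⁻¹ * ∫ z, ⟪Tf w z, u⟫ * f (σ • Tf w z) ∂(gaussianReal 0 1)
      - σ⁻¹ ^ 2 / 2 * ∫ z, (⟪Tf w z, u⟫ ^ 2 - ‖u‖ ^ 2) * f (σ • Tf w z) ∂(gaussianReal 0 1)|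
      ≤ gaussShiftConst / σ ^ 2 * ‖u‖ ^ 3 := fun w => by
    have hF : LipschitzWith σ.toNNReal (fun z => f (σ • Tf w z)) := by
      refine LipschitzWith.of_dist_le_mul fun z z' => ?_
      refine (hf.dist_le_mul _ _).trans ?_
      rw [dist_eq_norm, ← smul_sub, norm_smul, Real.norm_of_nonneg hσ.le, hT]
      simp only [add_sub_add_left_eq_sub, ← sub_smul, norm_smul, he, sub_sub_sub_cancel_right]
      rw [Real.coe_toNNReal _ hσ.le, Real.dist_eq, Real.norm_eq_abs]
      simp
    have h := abs_gaussian_shift_expansion_le hF (‖u‖ / σ)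
    have e1 : ∀ z, σ • Tf w (z + ‖u‖ / σ) = u + σ • Tf w z := fun z => by
      have : σ • Tf w (z + ‖u‖ / σ) = (σ * (‖u‖ / σ)) • e + σ • Tf w z := by
        simp only [hT]
        module
      rw [this, mul_div_cancel₀ _ hσ.ne', ← hue]
    simp_rw [e1] at h
    rw [Real.coe_toNNReal _ hσ.le, abs_of_nonneg (by positivity : 0 ≤ ‖u‖ / σ)] at h
    have e3 : σ⁻¹ * ∫ z, ⟪Tf w z, u⟫ * f (σ • Tf w z) ∂(gaussianReal 0 1)
        = ‖u‖ / σ * ∫ z, z * f (σ • Tf w z) ∂(gaussianReal 0 1) := by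
      simp_rw [hTu, mul_assoc]
      rw [integral_const_mul]; ring
    have e4 : σ⁻¹ ^ 2 / 2 * ∫ z, (⟪Tf w z, u⟫ ^ 2 - ‖u‖ ^ 2) * f (σ • Tf w z) ∂(gaussianReal 0 1)
        = (‖u‖ / σ) ^ 2 / 2 * ∫ z, (z ^ 2 - 1) * f (σ • Tf w z) ∂(gaussianReal 0 1) := by
      have : ∀ z, (⟪Tf w z, u⟫ ^ 2 - ‖u‖ ^ 2) * f (σ • Tf w z)
          = ‖u‖ ^ 2 * ((z ^ 2 - 1) * f (σ • Tf w z)) := fun z => by rw [hTu]; ring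
      simp_rw [this]
      rw [integral_const_mul]; ring
    rw [e3, e4]
    refine h.trans (le_of_eq ?_)
    field_simp
  have j1 := (integrable_resample i1 he).integral_prod_left
  have j2 := (integrable_resample i2 he).integral_prod_left
  have j3 := (integrable_resample i3 he).integral_prod_left
  have j4 := (integrable_resample i4 he).integral_prod_left
  rw [← integral_resample i1 he, ← integral_resample i2 he, ← integral_resample i3 he,
    ← integral_resample i4 he, ← integral_const_mul, ← integral_const_mul, ← integral_sub' j1 j2,
    ← integral_sub' (j1.sub j2) (j3.const_mul _),
    ← integral_sub' ((j1.sub j2).sub (j3.const_mul _)) (j4.const_mul _)]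
  rw [← Real.norm_eq_abs]
  refine (norm_integral_le_of_norm_le_const (C := gaussShiftConst / σ ^ 2 * ‖u‖ ^ 3)
    (ae_of_all _ fun w => ?_)).trans_eq ?_
  · exact key w
  · rw [probReal_univ, mul_one]

/-- The law of `σ W` with `W` standard Gaussian. -/
def scaledGaussian (E : Type*) [NormedAddCommGroup E] [InnerProductSpace ℝ E]
    [FiniteDimensional ℝ E] [MeasurableSpace E] [BorelSpace E] (σ : ℝ) : Measure E :=
  (stdGaussian E).map (fun w => σ • w)

instance (σ : ℝ) : IsProbabilityMeasure (scaledGaussian E σ) :=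
  Measure.isProbabilityMeasure_map (by fun_prop)

theorem integrable_id_scaledGaussian (σ : ℝ) : Integrable id (scaledGaussian E σ) := by
  rw [scaledGaussian, integrable_map_measure (by fun_prop) (by fun_prop)]
  exact IsGaussian.integrable_fun_id.smul σ

theorem integrable_id_conv {μ ν : Measure E} [IsProbabilityMeasure μ] [IsProbabilityMeasure ν]
    (hμ : Integrable id μ) (hν : Integrable id ν) : Integrable id (μ ∗ ν) := by
  rw [Measure.conv, integrable_map_measure (by fun_prop) (by fun_prop)]
  exact (hμ.comp_fst ν).add (hν.comp_snd μ)

theorem integral_conv_lipschitz {μ ν : Measure E} [IsProbabilityMeasure μ] [IsProbabilityMeasure ν]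
    (hμ : Integrable id μ) (hν : Integrable id ν) {f : E → ℝ} (hf : LipschitzWith 1 f) :
    ∫ x, f x ∂(μ ∗ ν) = ∫ x, ∫ y, f (x + y) ∂ν ∂μ :=
  integral_conv (integrable_comp_of_lipschitz hf (integrable_id_conv hμ hν))

theorem integral_conv_scaledGaussian {μ : Measure E} [IsProbabilityMeasure μ]
    (hμ : Integrable id μ) {f : E → ℝ} (hf : LipschitzWith 1 f) (σ : ℝ) :
    ∫ x, f x ∂(μ ∗ scaledGaussian E σ) = ∫ u, ∫ w, f (u + σ • w) ∂(stdGaussian E) ∂μ := by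
  rw [integral_conv_lipschitz hμ (integrable_id_scaledGaussian σ) hf]
  congr 1
  ext u
  have hfc := hf.continuous
  rw [scaledGaussian, integral_map (by fun_prop) (by fun_prop)]

theorem lipschitz_integral_add {ν : Measure E} [IsProbabilityMeasure ν] (hν : Integrable id ν)
    {f : E → ℝ} (hf : LipschitzWith 1 f) : LipschitzWith 1 (fun x => ∫ y, f (x + y) ∂ν) := by
  have hi : ∀ x, Integrable (fun y => f (x + y)) ν := fun x =>
    integrable_comp_of_lipschitz hf ((integrable_const x).add hν)
  refine LipschitzWith.of_dist_le_mul fun x x' => ?_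
  rw [Real.dist_eq, ← integral_sub (hi x) (hi x')]
  have hb : ∀ y, ‖f (x + y) - f (x' + y)‖ ≤ 1 * dist x x' := fun y => by
    have := hf.dist_le_mul (x + y) (x' + y)
    simpa [Real.dist_eq] using this
  have := norm_integral_le_of_norm_le_const (μ := ν) (ae_of_all _ hb)
  rwa [probReal_univ, mul_one] at this

/-- The Gaussian smoothing of a law depends, up to third order, only on its first two moments. -/
theorem abs_integral_smoothing_sub_le {μ : Measure E} [IsProbabilityMeasure μ]
    (hμ : MemLp id 3 μ) {f : E → ℝ} (hf : LipschitzWith 1 f) {σ : ℝ} (hσ : 0 < σ)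
    {m₁ m₂ : E → ℝ} {t : ℝ} (h1 : ∀ w, ∫ u, ⟪w, u⟫ ∂μ = m₁ w)
    (h2 : ∀ w, ∫ u, ⟪w, u⟫ ^ 2 ∂μ = m₂ w) (ht : ∫ u, ‖u‖ ^ 2 ∂μ = t) :
    |∫ x, f x ∂(μ ∗ scaledGaussian E σ) - (∫ w, f (σ • w) ∂(stdGaussian E)
      + σ⁻¹ * ∫ w, m₁ w * f (σ • w) ∂(stdGaussian E)
      + σ⁻¹ ^ 2 / 2 * ∫ w, (m₂ w - t) * f (σ • w) ∂(stdGaussian E))|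
      ≤ gaussShiftConst / σ ^ 2 * ∫ u, ‖u‖ ^ 3 ∂μ := by
  have hfc := hf.continuous
  have hμ1 : Integrable id μ := hμ.integrable (by norm_num)
  have hn3 : Integrable (fun u : E => ‖u‖ ^ 3) μ := by
    have := hμ.integrable_norm_pow (p := 3) (by norm_num); simpa using this
  have hn2 : Integrable (fun u : E => ‖u‖ ^ 2) μ := by
    have := (hμ.mono_exponent (q := 3) (p := 2) (by norm_num)).integrable_norm_pow (p := 2)
      (by norm_num)
    simpa using this
  have hn1 : Integrable (fun u : E => ‖u‖) μ := hμ1.norm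
  have hI := integrable_one_add_norm_cube_stdGaussian (E := E)
  have p3 : Integrable (fun q : E × E => ⟪q.2, q.1⟫ * f (σ • q.2)) (μ.prod (stdGaussian E)) :=
    (hn1.mul_prod (hI.const_mul (2 * (|f 0| + σ)))).mono' (by fun_prop)
      (ae_of_all _ fun q => abs_inner_mul_lipschitz_le hf hσ q.1 q.2)
  have p4 : Integrable (fun q : E × E => (⟪q.2, q.1⟫ ^ 2 - ‖q.1‖ ^ 2) * f (σ • q.2))
      (μ.prod (stdGaussian E)) :=
    (hn2.mul_prod (hI.const_mul (4 * (|f 0| + σ)))).mono' (by fun_prop)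
      (ae_of_all _ fun q => abs_inner_sq_mul_lipschitz_le hf hσ q.1 q.2)
  have s3 : ∫ u, ∫ w, ⟪w, u⟫ * f (σ • w) ∂(stdGaussian E) ∂μ
      = ∫ w, m₁ w * f (σ • w) ∂(stdGaussian E) := by
    rw [integral_integral_swap p3]
    congr 1; ext w
    rw [integral_mul_const, h1]
  have s4 : ∫ u, ∫ w, (⟪w, u⟫ ^ 2 - ‖u‖ ^ 2) * f (σ • w) ∂(stdGaussian E) ∂μ
      = ∫ w, (m₂ w - t) * f (σ • w) ∂(stdGaussian E) := by
    rw [integral_integral_swap p4]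
    congr 1; ext w
    have hi : Integrable (fun u => ⟪w, u⟫ ^ 2) μ := by
      refine (hn2.const_mul (‖w‖ ^ 2)).mono' (by fun_prop) (ae_of_all _ fun u => ?_)
      rw [Real.norm_eq_abs, abs_pow, ← mul_pow]
      gcongr
      exact abs_real_inner_le_norm w u
    rw [integral_mul_const, integral_sub hi hn2, h2, ht]
  have i1 : Integrable (fun u => ∫ w, f (u + σ • w) ∂(stdGaussian E)) μ := by
    have := lipschitz_integral_add (integrable_id_scaledGaussian (E := E) σ) hf
    have h := integrable_comp_of_lipschitz this hμ1
    refine h.congr (ae_of_all _ fun u => ?_)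
    simp only [scaledGaussian, id]
    rw [integral_map (by fun_prop) (by fun_prop)]
  have i3 := p3.integral_prod_left
  have i4 := p4.integral_prod_left
  rw [integral_conv_scaledGaussian hμ1 hf, ← s3, ← s4, ← sub_sub, ← sub_sub]
  have e0 : ∫ w, f (σ • w) ∂(stdGaussian E) = ∫ _u, ∫ w, f (σ • w) ∂(stdGaussian E) ∂μ := by simp
  rw [e0, ← integral_const_mul, ← integral_const_mul, ← integral_sub' i1 (integrable_const _),
    ← integral_sub' (i1.sub (integrable_const _)) (i3.const_mul _),
    ← integral_sub' ((i1.sub (integrable_const _)).sub (i3.const_mul _)) (i4.const_mul _),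
    ← integral_const_mul, ← Real.norm_eq_abs]
  refine norm_integral_le_of_norm_le (hn3.const_mul _) (ae_of_all _ fun u => ?_)
  exact abs_gaussian_smoothing_expansion_le hf hσ u

end Smoothing

section Lindeberg

open scoped RealInnerProductSpace

variable {ι : Type*} [Fintype ι]

theorem memLp_coord_of_memLp_id {μ : Measure (EuclideanSpace ℝ ι)} {k : ENNReal}
    (hμ : MemLp id k μ) (p : ι) : MemLp (fun u : EuclideanSpace ℝ ι => u p) k μ :=
  hμ.mono (by fun_prop) (ae_of_all _ fun u => PiLp.norm_apply_le u p)

theorem integral_inner_of_coord {μ : Measure (EuclideanSpace ℝ ι)} [IsProbabilityMeasure μ]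
    (hμ : MemLp id 2 μ) (h0 : ∀ p, ∫ u, u p ∂μ = 0) (w : EuclideanSpace ℝ ι) :
    ∫ u, ⟪w, u⟫ ∂μ = 0 := by
  have hi : ∀ p, Integrable (fun u : EuclideanSpace ℝ ι => u p) μ := fun p =>
    (memLp_coord_of_memLp_id hμ p).integrable (by norm_num)
  simp only [PiLp.inner_apply, RCLike.inner_apply, conj_trivial]
  rw [integral_finsetSum _ fun p _ => (hi p).mul_const _]
  simp [integral_mul_const, h0]

theorem integral_inner_sq_of_coord {μ : Measure (EuclideanSpace ℝ ι)} [IsProbabilityMeasure μ]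
    (hμ : MemLp id 2 μ) {S : Matrix ι ι ℝ} (hS : ∀ p q, ∫ u, u p * u q ∂μ = S p q)
    (w : EuclideanSpace ℝ ι) : ∫ u, ⟪w, u⟫ ^ 2 ∂μ = ∑ p, ∑ q, w p * w q * S p q := by
  have hi : ∀ p q, Integrable (fun u : EuclideanSpace ℝ ι => u p * u q) μ := fun p q =>
    (memLp_coord_of_memLp_id hμ p).integrable_mul (memLp_coord_of_memLp_id hμ q)
  have e : ∀ u : EuclideanSpace ℝ ι, ⟪w, u⟫ ^ 2 = ∑ p, ∑ q, w p * w q * (u p * u q) := fun u => by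
    simp only [PiLp.inner_apply, RCLike.inner_apply, conj_trivial]
    rw [sq, Finset.sum_mul_sum]
    refine Finset.sum_congr rfl fun p _ => Finset.sum_congr rfl fun q _ => by ring
  simp_rw [e]
  rw [integral_finsetSum _ fun p _ => integrable_finsetSum _ fun q _ => (hi p q).const_mul _]
  refine Finset.sum_congr rfl fun p _ => ?_
  rw [integral_finsetSum _ fun q _ => (hi p q).const_mul _]
  refine Finset.sum_congr rfl fun q _ => ?_
  rw [integral_const_mul, hS]

theorem integral_norm_sq_of_coord {μ : Measure (EuclideanSpace ℝ ι)} [IsProbabilityMeasure μ]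
    (hμ : MemLp id 2 μ) {S : Matrix ι ι ℝ} (hS : ∀ p q, ∫ u, u p * u q ∂μ = S p q) :
    ∫ u, ‖u‖ ^ 2 ∂μ = ∑ p, S p p := by
  have hi : ∀ p q, Integrable (fun u : EuclideanSpace ℝ ι => u p * u q) μ := fun p q =>
    (memLp_coord_of_memLp_id hμ p).integrable_mul (memLp_coord_of_memLp_id hμ q)
  simp_rw [EuclideanSpace.real_norm_sq_eq, sq]
  rw [integral_finsetSum _ fun p _ => hi p p]
  simp_rw [hS]

theorem posSemidef_of_second_moments {μ : Measure (EuclideanSpace ℝ ι)} [IsProbabilityMeasure μ]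
    (hμ : MemLp id 2 μ) {S : Matrix ι ι ℝ} (hS : ∀ p q, ∫ u, u p * u q ∂μ = S p q) :
    S.PosSemidef := by
  refine Matrix.PosSemidef.of_dotProduct_mulVec_nonneg ?_ fun x => ?_
  · ext p q
    rw [Matrix.conjTranspose_apply, star_trivial, ← hS, ← hS]
    simp_rw [mul_comm]
  · have := integral_inner_sq_of_coord hμ hS (WithLp.toLp 2 x)
    have h0 : 0 ≤ ∫ u, ⟪WithLp.toLp 2 x, u⟫ ^ 2 ∂μ := integral_nonneg fun u => sq_nonneg _
    rw [this] at h0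
    refine h0.trans_eq ?_
    simp only [dotProduct, Matrix.mulVec, star_trivial, Finset.mul_sum]
    refine Finset.sum_congr rfl fun p _ => Finset.sum_congr rfl fun q _ => by ring

/-- The fourth moment of the standard Gaussian law. -/
def gaussM4 : ℝ := ∫ z, z ^ 4 ∂(gaussianReal 0 1)

theorem gaussM4_nonneg : 0 ≤ gaussM4 := integral_nonneg fun z => by positivity

theorem integral_pow_four_gaussianReal (v : NNReal) :
    ∫ z, z ^ 4 ∂(gaussianReal 0 v) = gaussM4 * (v : ℝ) ^ 2 := by
  have h : gaussianReal 0 v = (gaussianReal 0 1).map (fun z => Real.sqrt v * z) := by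
    rw [gaussianReal_map_const_mul]
    congr 1
    · simp
    · ext; simp
  rw [h, integral_map (by fun_prop) (by fun_prop)]
  simp_rw [mul_pow]
  rw [integral_const_mul, gaussM4, show Real.sqrt v ^ 4 = (Real.sqrt v ^ 2) ^ 2 by ring,
    Real.sq_sqrt (NNReal.coe_nonneg v), mul_comm]

variable [DecidableEq ι]

theorem integral_mul_multivariateGaussian {S : Matrix ι ι ℝ} (hS : S.PosSemidef) (p q : ι) :
    ∫ u, u p * u q ∂(multivariateGaussian 0 S) = S p q := by
  have hc := covariance_eval_multivariateGaussian (μ := 0) hS p q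
  have hm := memLp_coord_of_memLp_id
    (IsGaussian.memLp_two_id (μ := multivariateGaussian (0 : EuclideanSpace ℝ ι) S))
  rw [covariance_eq_sub (hm p) (hm q)] at hc
  have h0 : ∀ p, ∫ u, u p ∂(multivariateGaussian (0 : EuclideanSpace ℝ ι) S) = 0 := fun p => by
    have := (EuclideanSpace.proj (𝕜 := ℝ) p).integral_comp_comm
      (IsGaussian.integrable_id (μ := multivariateGaussian (0 : EuclideanSpace ℝ ι) S))
    simpa using this
  rw [h0 p, zero_mul, sub_zero] at hc
  exact hc

theorem integral_eval_multivariateGaussian (S : Matrix ι ι ℝ) (p : ι) :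
    ∫ u, u p ∂(multivariateGaussian (0 : EuclideanSpace ℝ ι) S) = 0 := by
  have := (EuclideanSpace.proj (𝕜 := ℝ) p).integral_comp_comm
    (IsGaussian.integrable_id (μ := multivariateGaussian (0 : EuclideanSpace ℝ ι) S))
  simpa using this

theorem integral_norm_pow_four_multivariateGaussian_le {S : Matrix ι ι ℝ} (hS : S.PosSemidef) :
    ∫ u, ‖u‖ ^ 4 ∂(multivariateGaussian (0 : EuclideanSpace ℝ ι) S)
      ≤ gaussM4 * (∑ p, S p p) ^ 2 := by
  set γ := multivariateGaussian (0 : EuclideanSpace ℝ ι) S with hγ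
  have hd : ∀ p, 0 ≤ S p p := fun p => hS.diag_nonneg
  have hm := memLp_coord_of_memLp_id (IsGaussian.memLp_id γ 4 (by norm_num))
  have hi4 : ∀ p, Integrable (fun u : EuclideanSpace ℝ ι => u p ^ 4) γ := fun p => by
    have := (hm p).integrable_norm_pow (p := 4) (by norm_num)
    refine this.congr (ae_of_all _ fun u => ?_)
    simp only [Real.norm_eq_abs]
    exact (show Even 4 by decide).pow_abs _
  have h4 : ∀ p, ∫ u, u p ^ 4 ∂γ = gaussM4 * S p p ^ 2 := fun p => by
    have hmp := measurePreserving_eval_multivariateGaussian (μ := 0) hS (i := p)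
    have e := integral_pow_four_gaussianReal (S p p).toNNReal
    rw [show (0 : ℝ) = (0 : EuclideanSpace ℝ ι) p from rfl, ← hmp.map_eq,
      integral_map (by fun_prop) (by fun_prop), Real.coe_toNNReal _ (hd p)] at e
    exact e
  have key : ∀ ε : ℝ, 0 < ε → ∫ u, ‖u‖ ^ 4 ∂γ ≤ gaussM4 * (∑ p, (S p p + ε)) ^ 2 := by
    intro ε hε
    have hpos : ∀ p, 0 < S p p + ε := fun p => by linarith [hd p]
    have hpt : ∀ u : EuclideanSpace ℝ ι,
        ‖u‖ ^ 4 ≤ (∑ p, (S p p + ε)) * ∑ p, (S p p + ε)⁻¹ * u p ^ 4 := fun u => by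
      rw [show ‖u‖ ^ 4 = (‖u‖ ^ 2) ^ 2 by ring, EuclideanSpace.real_norm_sq_eq]
      refine Finset.sum_sq_le_sum_mul_sum_of_sq_le_mul _ (fun p _ => (hpos p).le)
        (fun p _ => by have := hpos p; positivity) fun p _ => ?_
      have := (hpos p).ne'
      refine le_of_eq ?_
      field_simp
    refine (integral_mono_of_nonneg (ae_of_all _ fun u => by positivity) ?_
      (ae_of_all _ hpt)).trans ?_
    · exact (integrable_finsetSum _ fun p _ => (hi4 p).const_mul _).const_mul _
    · rw [integral_const_mul, integral_finsetSum _ fun p _ => (hi4 p).const_mul _]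
      simp_rw [integral_const_mul, h4]
      have hle : ∑ p, (S p p + ε)⁻¹ * (gaussM4 * S p p ^ 2) ≤ ∑ p, gaussM4 * (S p p + ε) := by
        refine Finset.sum_le_sum fun p _ => ?_
        rw [inv_mul_le_iff₀ (hpos p)]
        have : S p p ^ 2 ≤ (S p p + ε) ^ 2 := by have := hd p; gcongr; linarith
        nlinarith [gaussM4_nonneg]
      have h0 : 0 ≤ ∑ p, (S p p + ε) := Finset.sum_nonneg fun p _ => (hpos p).le
      refine (mul_le_mul_of_nonneg_left hle h0).trans_eq ?_
      rw [← Finset.mul_sum]; ring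
  have hlim : Tendsto (fun ε : ℝ => gaussM4 * (∑ p, (S p p + ε)) ^ 2) (𝓝[>] 0)
      (𝓝 (gaussM4 * (∑ p, (S p p + 0)) ^ 2)) := by
    refine Tendsto.mono_left ?_ nhdsWithin_le_nhds
    have : Continuous (fun ε : ℝ => gaussM4 * (∑ p, (S p p + ε)) ^ 2) := by fun_prop
    exact this.tendsto 0
  simp only [add_zero] at hlim
  exact ge_of_tendsto hlim (eventually_mem_nhdsWithin.mono fun ε hε => key ε hε)

theorem multivariateGaussian_conv {S S' : Matrix ι ι ℝ} (hS : S.PosSemidef) (hS' : S'.PosSemidef) :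
    multivariateGaussian (0 : EuclideanSpace ℝ ι) S ∗ multivariateGaussian 0 S'
      = multivariateGaussian 0 (S + S') := by
  refine Measure.ext_of_charFun ?_
  ext t
  rw [charFun_conv, charFun_multivariateGaussian hS, charFun_multivariateGaussian hS',
    charFun_multivariateGaussian (hS.add hS'), ← Complex.exp_add]
  congr 1
  simp only [inner_zero_right, Matrix.add_mulVec, dotProduct_add]
  push_cast
  ring

theorem pow_three_le_add_pow_four_div {x r : ℝ} (hx : 0 ≤ x) (hr : 0 < r) :
    x ^ 3 ≤ r ^ 3 + x ^ 4 / r := by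
  rcases le_total x r with h | h
  · have : x ^ 3 ≤ r ^ 3 := by gcongr
    have : 0 ≤ x ^ 4 / r := by positivity
    linarith
  · have : x ^ 3 ≤ x ^ 4 / r := by
      rw [le_div_iff₀ hr, pow_succ x 3]
      gcongr
    have : 0 ≤ r ^ 3 := by positivity
    linarith

theorem integral_norm_cube_le {μ : Measure (EuclideanSpace ℝ ι)} [IsProbabilityMeasure μ]
    (hμ : MemLp id 4 μ) {r : ℝ} (hr : 0 < r) :
    ∫ u, ‖u‖ ^ 3 ∂μ ≤ r ^ 3 + (∫ u, ‖u‖ ^ 4 ∂μ) / r := by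
  have h4 : Integrable (fun u : EuclideanSpace ℝ ι => ‖u‖ ^ 4) μ := by
    have := hμ.integrable_norm_pow (p := 4) (by norm_num); simpa using this
  refine (integral_mono_of_nonneg (ae_of_all _ fun u => by positivity)
    ((integrable_const (r ^ 3)).add (h4.div_const r))
    (ae_of_all _ fun u => pow_three_le_add_pow_four_div (norm_nonneg u) hr)).trans_eq ?_
  simp only [Pi.add_apply]
  rw [integral_add (integrable_const _) (h4.div_const r), integral_div]
  simp

/-- Replacing a centred law by the Gaussian law with the same covariance, under smoothing. -/
theorem abs_integral_smoothing_sub_gaussian_le {μ : Measure (EuclideanSpace ℝ ι)}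
    [IsProbabilityMeasure μ] (hμ : MemLp id 4 μ) (h0 : ∀ p, ∫ u, u p ∂μ = 0) {S : Matrix ι ι ℝ}
    (hS : ∀ p q, ∫ u, u p * u q ∂μ = S p q) {f : EuclideanSpace ℝ ι → ℝ}
    (hf : LipschitzWith 1 f) {σ r : ℝ} (hσ : 0 < σ) (hr : 0 < r) :
    |∫ x, f x ∂(μ ∗ scaledGaussian _ σ) - ∫ x, f x ∂(multivariateGaussian 0 S ∗ scaledGaussian _ σ)|
      ≤ gaussShiftConst / σ ^ 2 * (2 * r ^ 3 + (1 + gaussM4) * (∫ u, ‖u‖ ^ 4 ∂μ) / r) := by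
  have hμ2 : MemLp id 2 μ := hμ.mono_exponent (by norm_num)
  have hμ3 : MemLp id 3 μ := hμ.mono_exponent (by norm_num)
  have hps := posSemidef_of_second_moments hμ2 hS
  set γ := multivariateGaussian (0 : EuclideanSpace ℝ ι) S with hγ
  have hγk : ∀ k : ENNReal, k ≠ ⊤ → MemLp id k γ := fun k hk => IsGaussian.memLp_id γ k hk
  have hγ2 := hγk 2 (by norm_num)
  have a1 := abs_integral_smoothing_sub_le hμ3 hf hσ (integral_inner_of_coord hμ2 h0)
    (integral_inner_sq_of_coord hμ2 hS) (integral_norm_sq_of_coord hμ2 hS)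
  have a2 := abs_integral_smoothing_sub_le (hγk 3 (by norm_num)) hf hσ
    (integral_inner_of_coord hγ2 (integral_eval_multivariateGaussian S))
    (integral_inner_sq_of_coord hγ2 (integral_mul_multivariateGaussian hps))
    (integral_norm_sq_of_coord hγ2 (integral_mul_multivariateGaussian hps))
  have b1 := integral_norm_cube_le hμ hr
  have b2 := integral_norm_cube_le (hγk 4 (by norm_num)) hr
  have b3 := integral_norm_pow_four_multivariateGaussian_le hps
  have b4 : (∑ p, S p p) ^ 2 ≤ ∫ u, ‖u‖ ^ 4 ∂μ := by
    rw [← integral_norm_sq_of_coord hμ2 hS]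
    have h4 : Integrable (fun u : EuclideanSpace ℝ ι => ‖u‖ ^ 4) μ := by
      have := hμ.integrable_norm_pow (p := 4) (by norm_num); simpa using this
    have hm : MemLp (fun u : EuclideanSpace ℝ ι => ‖u‖ ^ 2) 2 μ := by
      rw [memLp_two_iff_integrable_sq (by fun_prop)]
      refine h4.congr (ae_of_all _ fun u => by ring)
    have hv := variance_nonneg (fun u : EuclideanSpace ℝ ι => ‖u‖ ^ 2) μ
    rw [variance_eq_sub hm] at hv
    have e : ∫ u, ((fun u : EuclideanSpace ℝ ι => ‖u‖ ^ 2) ^ 2) u ∂μ = ∫ u, ‖u‖ ^ 4 ∂μ := by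
      congr 1; ext u; simp only [Pi.pow_apply]; ring
    rw [e] at hv
    linarith
  have b5 : (∫ u, ‖u‖ ^ 4 ∂γ) / r ≤ gaussM4 * (∫ u, ‖u‖ ^ 4 ∂μ) / r := by
    gcongr
    exact b3.trans (mul_le_mul_of_nonneg_left b4 gaussM4_nonneg)
  have hc : 0 ≤ gaussShiftConst / σ ^ 2 := div_nonneg gaussShiftConst_nonneg (sq_nonneg _)
  calc _ ≤ gaussShiftConst / σ ^ 2 * ∫ u, ‖u‖ ^ 3 ∂μ + gaussShiftConst / σ ^ 2 * ∫ u, ‖u‖ ^ 3 ∂γ := by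
        rw [abs_sub_comm] at a2
        exact (abs_sub_le _ _ _).trans (add_le_add a1 a2)
    _ ≤ _ := by
        rw [← mul_add]
        refine mul_le_mul_of_nonneg_left ?_ hc
        have : (1 + gaussM4) * (∫ u, ‖u‖ ^ 4 ∂μ) / r
          = (∫ u, ‖u‖ ^ 4 ∂μ) / r + gaussM4 * (∫ u, ‖u‖ ^ 4 ∂μ) / r := by ring
        linarith

variable {Ω : Type*} [MeasurableSpace Ω] {P : Measure Ω} [IsProbabilityMeasure P] {κ : Type*}

/-- Lindeberg's replacement argument for a sum of independent centred random vectors. -/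
theorem abs_integral_sum_smoothing_sub_gaussian_le {X : κ → Ω → EuclideanSpace ℝ ι}
    (hXm : ∀ i, Measurable (X i)) (hX : ∀ i, MemLp (X i) 4 P) (hind : iIndepFun X P)
    (h0 : ∀ i p, ∫ ω, X i ω p ∂P = 0) {S : κ → Matrix ι ι ℝ}
    (hS : ∀ i p q, ∫ ω, X i ω p * X i ω q ∂P = S i p q) {σ r : ℝ} (hσ : 0 < σ) (hr : 0 < r)
    (s : Finset κ) : (∑ i ∈ s, S i).PosSemidef ∧ ∀ f : EuclideanSpace ℝ ι → ℝ, LipschitzWith 1 f →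
    |∫ x, f x ∂(P.map (fun ω => ∑ i ∈ s, X i ω) ∗ scaledGaussian _ σ)
      - ∫ x, f x ∂(multivariateGaussian 0 (∑ i ∈ s, S i) ∗ scaledGaussian _ σ)|
      ≤ ∑ i ∈ s, gaussShiftConst / σ ^ 2
          * (2 * r ^ 3 + (1 + gaussM4) * (∫ ω, ‖X i ω‖ ^ 4 ∂P) / r) := by
  classical
  induction s using Finset.induction_on with
  | empty =>
    refine ⟨by simpa using Matrix.PosSemidef.zero, fun f _ => ?_⟩
    have h1 : P.map (fun _ : Ω => (0 : EuclideanSpace ℝ ι)) = Measure.dirac 0 := by simp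
    have h2 : multivariateGaussian (0 : EuclideanSpace ℝ ι) (0 : Matrix ι ι ℝ) = Measure.dirac 0 := by
      simp [multivariateGaussian]
    simp only [Finset.sum_empty]
    rw [h1, h2]
    simp
  | insert i s his ih =>
    obtain ⟨hps, ih⟩ := ih
    set μ := P.map (X i) with hμ
    haveI : IsProbabilityMeasure μ := Measure.isProbabilityMeasure_map (hXm i).aemeasurable
    have hμ4 : MemLp id 4 μ := by
      rw [hμ, memLp_map_measure_iff (by fun_prop) (hXm i).aemeasurable]
      exact hX i
    have hμ2 : MemLp id 2 μ := hμ4.mono_exponent (by norm_num)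
    have hSμ : ∀ p q, ∫ u, u p * u q ∂μ = S i p q := fun p q => by
      rw [hμ, integral_map (hXm i).aemeasurable (by fun_prop)]
      exact hS i p q
    have h0μ : ∀ p, ∫ u, u p ∂μ = 0 := fun p => by
      rw [hμ, integral_map (hXm i).aemeasurable (by fun_prop)]
      exact h0 i p
    have hnμ : ∫ u, ‖u‖ ^ 4 ∂μ = ∫ ω, ‖X i ω‖ ^ 4 ∂P := by
      rw [hμ, integral_map (hXm i).aemeasurable (by fun_prop)]
    have hpi := posSemidef_of_second_moments hμ2 hSμ
    rw [Finset.sum_insert his]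
    refine ⟨hpi.add hps, fun f hf => ?_⟩
    set ν := P.map (fun ω => ∑ j ∈ s, X j ω) with hν
    have hsm : Measurable (fun ω => ∑ j ∈ s, X j ω) := Finset.measurable_sum _ fun j _ => hXm j
    haveI : IsProbabilityMeasure ν := Measure.isProbabilityMeasure_map hsm.aemeasurable
    have hlaw : P.map (fun ω => ∑ j ∈ insert i s, X j ω) = μ ∗ ν := by
      have e1 : ∑ j ∈ s, X j = fun ω => ∑ j ∈ s, X j ω := by
        funext ω
        exact Finset.sum_apply _ _ _
      have e2 : (fun ω => ∑ j ∈ insert i s, X j ω) = X i + fun ω => ∑ j ∈ s, X j ω := by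
        funext ω
        exact Finset.sum_insert his
      have hI := (hind.indepFun_finsetSum_of_notMem hXm his).symm
      rw [e1] at hI
      rw [e2]
      exact hI.map_add_eq_map_conv_map (hXm i) hsm
    have hμi : Integrable id μ := hμ4.integrable (by norm_num)
    have hνi : Integrable id ν := by
      rw [hν, integrable_map_measure (by fun_prop) hsm.aemeasurable]
      exact integrable_finsetSum _ fun j _ => (hX j).integrable (by norm_num)
    set γi := multivariateGaussian (0 : EuclideanSpace ℝ ι) (S i) with hγi
    set γs := multivariateGaussian (0 : EuclideanSpace ℝ ι) (∑ j ∈ s, S j) with hγs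
    have hγii : Integrable id γi := IsGaussian.integrable_id
    have hγsi : Integrable id γs := IsGaussian.integrable_id
    set Gσ := scaledGaussian (EuclideanSpace ℝ ι) σ with hGσ
    have hGi : Integrable id Gσ := integrable_id_scaledGaussian σ
    have swap : ∀ (α β : Measure (EuclideanSpace ℝ ι)) [IsProbabilityMeasure α]
        [IsProbabilityMeasure β], Integrable id α → Integrable id β →
        ∫ x, f x ∂((α ∗ β) ∗ Gσ) = ∫ x, (∫ y, f (x + y) ∂β) ∂(α ∗ Gσ) := by
      intro α β _ _ hα hβ
      rw [Measure.conv_assoc, Measure.conv_comm β Gσ, ← Measure.conv_assoc,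
        integral_conv_lipschitz (integrable_id_conv hα hGi) hβ hf]
    rw [hlaw, ← multivariateGaussian_conv hpi hps, ← hγi, ← hγs, Finset.sum_insert his]
    have t1 := abs_integral_smoothing_sub_gaussian_le hμ4 h0μ hSμ
      (lipschitz_integral_add hνi hf) hσ hr
    rw [← hγi, ← hGσ, ← swap μ ν hμi hνi, ← swap γi ν hγii hνi, hnμ] at t1
    have t2 := ih _ (lipschitz_integral_add hγii hf)
    rw [← swap ν γi hνi hγii, ← swap γs γi hγsi hγii, Measure.conv_comm ν γi,
      Measure.conv_comm γs γi] at t2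
    exact (abs_sub_le _ _ _).trans (add_le_add t1 t2)

theorem integral_norm_scaledGaussian_le [Nonempty ι] {σ : ℝ} (hσ : 0 < σ) :
    ∫ w, ‖w‖ ∂(scaledGaussian (EuclideanSpace ℝ ι) σ) ≤ σ * Real.sqrt (Fintype.card ι) := by
  rw [scaledGaussian, integral_map (by fun_prop) (by fun_prop)]
  simp_rw [norm_smul, Real.norm_of_nonneg hσ.le]
  rw [integral_const_mul]
  refine mul_le_mul_of_nonneg_left ?_ hσ.le
  set d := Real.sqrt (Fintype.card ι) with hd
  have hd0 : 0 < d := Real.sqrt_pos.2 (by exact_mod_cast Fintype.card_pos)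
  have h2 : ∫ w, ‖w‖ ^ 2 ∂(stdGaussian (EuclideanSpace ℝ ι)) = d ^ 2 := by
    rw [← multivariateGaussian_zero_one, integral_norm_sq_of_coord IsGaussian.memLp_two_id
      (integral_mul_multivariateGaussian Matrix.PosSemidef.one), hd,
      Real.sq_sqrt (Nat.cast_nonneg _)]
    simp
  have hi := integrable_norm_pow_stdGaussian (E := EuclideanSpace ℝ ι) 2
  refine (integral_mono_of_nonneg (ae_of_all _ fun w => norm_nonneg w)
    (((integrable_const (d ^ 2)).add hi).div_const (2 * d)) (ae_of_all _ fun w => ?_)).trans_eq ?_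
  · simp only [Pi.add_apply]
    rw [le_div_iff₀ (by positivity)]
    nlinarith [sq_nonneg (d - ‖w‖)]
  · simp only [Pi.add_apply]
    rw [integral_div, integral_add (integrable_const _) hi, h2]
    simp
    field_simp
    ring

theorem abs_integral_conv_scaledGaussian_sub_le [Nonempty ι] {μ : Measure (EuclideanSpace ℝ ι)}
    [IsProbabilityMeasure μ] (hμ : Integrable id μ) {f : EuclideanSpace ℝ ι → ℝ}
    (hf : LipschitzWith 1 f) {σ : ℝ} (hσ : 0 < σ) :
    |∫ x, f x ∂(μ ∗ scaledGaussian _ σ) - ∫ x, f x ∂μ| ≤ σ * Real.sqrt (Fintype.card ι) := by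
  set Gσ := scaledGaussian (EuclideanSpace ℝ ι) σ with hGσ
  have hGi : Integrable id Gσ := integrable_id_scaledGaussian σ
  rw [Measure.conv_comm, integral_conv_lipschitz hGi hμ hf]
  have e : ∫ x, f x ∂μ = ∫ _x, ∫ y, f y ∂μ ∂Gσ := by simp
  have hl := lipschitz_integral_add hμ hf
  have hi : Integrable (fun x => ∫ y, f (x + y) ∂μ) Gσ := integrable_comp_of_lipschitz hl hGi
  rw [e, ← integral_sub hi (integrable_const _),
    ← Real.norm_eq_abs]
  refine (norm_integral_le_of_norm_le hGi.norm (ae_of_all _ fun x => ?_)).trans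
    (integral_norm_scaledGaussian_le hσ)
  have := hl.dist_le_mul x 0
  simpa [Real.dist_eq] using this

/-- A Gaussian coupling, in `L¹`, of a sum of independent centred random vectors, on an extension
of the probability space. -/
theorem exists_gaussian_coupling [Nonempty ι] [Fintype κ] {X : κ → Ω → EuclideanSpace ℝ ι}
    (hXm : ∀ i, Measurable (X i)) (hX : ∀ i, MemLp (X i) 4 P) (hind : iIndepFun X P)
    (h0 : ∀ i p, ∫ ω, X i ω p ∂P = 0) {S : Matrix ι ι ℝ}
    (hS : ∀ p q, ∑ i, ∫ ω, X i ω p * X i ω q ∂P = S p q) {σ r : ℝ} (hσ : 0 < σ) (hr : 0 < r) :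
    S.PosSemidef ∧ ∃ P' : Measure (Ω × EuclideanSpace ℝ ι), P'.map Prod.fst = P ∧
      P'.map Prod.snd = multivariateGaussian 0 S ∧
      Integrable (fun z => ‖∑ i, X i z.1 - z.2‖) P' ∧
      ∫ z, ‖∑ i, X i z.1 - z.2‖ ∂P' ≤ 3 * σ * Real.sqrt (Fintype.card ι)
        + gaussShiftConst / σ ^ 2 * (2 * Fintype.card κ * r ^ 3
          + (1 + gaussM4) * (∑ i, ∫ ω, ‖X i ω‖ ^ 4 ∂P) / r) := by
  set Si : κ → Matrix ι ι ℝ := fun i => Matrix.of fun p q => ∫ ω, X i ω p * X i ω q ∂P with hSi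
  have hSsum : ∑ i, Si i = S := by
    ext p q
    rw [Matrix.sum_apply, ← hS]
    rfl
  obtain ⟨hps, hL⟩ := abs_integral_sum_smoothing_sub_gaussian_le hXm hX hind h0 (S := Si)
    (fun i p q => rfl) hσ hr Finset.univ
  rw [hSsum] at hps hL
  refine ⟨hps, ?_⟩
  set γ := multivariateGaussian (0 : EuclideanSpace ℝ ι) S with hγ
  have hsm : Measurable (fun ω => ∑ j, X j ω) := Finset.measurable_sum _ fun j _ => hXm j
  have hsi : Integrable (fun ω => ∑ j, X j ω) P :=
    integrable_finsetSum _ fun j _ => (hX j).integrable (by norm_num)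
  set d := Real.sqrt (Fintype.card ι) with hd
  have hd0 : 0 < d := Real.sqrt_pos.2 (by exact_mod_cast Fintype.card_pos)
  suffices hdual : ∀ f : EuclideanSpace ℝ ι → ℝ, LipschitzWith 1 f →
      ∫ ω, f (∑ j, X j ω) ∂P - ∫ e, f e ∂γ ≤ 2 * σ * d + gaussShiftConst / σ ^ 2
        * (2 * Fintype.card κ * r ^ 3 + (1 + gaussM4) * (∑ i, ∫ ω, ‖X i ω‖ ^ 4 ∂P) / r) by
    obtain ⟨P', h1, h2, h3, h4⟩ := exists_coupling_of_lipschitz P γ _ hsm hsi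
      IsGaussian.integrable_id _ hdual (σ * d) (by positivity)
    exact ⟨P', h1, h2, h3, h4.trans_eq (by ring)⟩
  intro f hf
  set ν := P.map (fun ω => ∑ j, X j ω) with hν
  haveI : IsProbabilityMeasure ν := Measure.isProbabilityMeasure_map hsm.aemeasurable
  have hνi : Integrable id ν := by
    rw [hν, integrable_map_measure (by fun_prop) hsm.aemeasurable]
    exact hsi
  have hfc := hf.continuous
  have e1 : ∫ ω, f (∑ j, X j ω) ∂P = ∫ x, f x ∂ν := by
    rw [hν, integral_map hsm.aemeasurable (by fun_prop)]
  have a1 := abs_le.1 (abs_integral_conv_scaledGaussian_sub_le hνi hf hσ)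
  have a2 := abs_le.1 (abs_integral_conv_scaledGaussian_sub_le
    (IsGaussian.integrable_id (μ := γ)) hf hσ)
  have a3 := abs_le.1 (hL f hf)
  have e2 : ∑ i, gaussShiftConst / σ ^ 2
          * (2 * r ^ 3 + (1 + gaussM4) * (∫ ω, ‖X i ω‖ ^ 4 ∂P) / r)
      = gaussShiftConst / σ ^ 2 * (2 * Fintype.card κ * r ^ 3
          + (1 + gaussM4) * (∑ i, ∫ ω, ‖X i ω‖ ^ 4 ∂P) / r) := by
    rw [← Finset.mul_sum, Finset.sum_add_distrib, ← Finset.sum_div,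
      ← Finset.mul_sum _ _ (1 + gaussM4), Finset.sum_const, Finset.card_univ, nsmul_eq_mul]
    ring
  rw [e2] at a3
  rw [e1]
  linarith [a1.1, a2.2, a3.2]

end Lindeberg

/-! ### Euclidean and Frobenius norms -/

section Norms

variable {ι κ τ : Type*} [Fintype ι] [Fintype κ] [Fintype τ]

attribute [local instance] Matrix.frobeniusNormedAddCommGroup Matrix.frobeniusNormedSpace

theorem frobNorm_eq_norm (A : Matrix ι κ ℝ) : frobNorm A = ‖A‖ := by
  rw [frobNorm, Matrix.frobenius_norm_def, Real.sqrt_eq_rpow]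
  simp

theorem frobNorm_nonneg (A : Matrix ι κ ℝ) : 0 ≤ frobNorm A := Real.sqrt_nonneg _

theorem frobNorm_sq (A : Matrix ι κ ℝ) : frobNorm A ^ 2 = ∑ i, ∑ j, A i j ^ 2 :=
  Real.sq_sqrt (Finset.sum_nonneg fun _ _ => Finset.sum_nonneg fun _ _ => sq_nonneg _)

theorem frobNorm_add_le (A B : Matrix ι κ ℝ) : frobNorm (A + B) ≤ frobNorm A + frobNorm B := by
  simp only [frobNorm_eq_norm]; exact norm_add_le _ _

theorem frobNorm_sub_le (A B : Matrix ι κ ℝ) : frobNorm (A - B) ≤ frobNorm A + frobNorm B := by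
  simp only [frobNorm_eq_norm]; exact norm_sub_le _ _

theorem frobNorm_add_le_of_le {A B : Matrix ι κ ℝ} {a b : ℝ} (hA : frobNorm A ≤ a)
    (hB : frobNorm B ≤ b) : frobNorm (A + B) ≤ a + b :=
  (frobNorm_add_le A B).trans (add_le_add hA hB)

theorem frobNorm_sub_le_of_le {A B : Matrix ι κ ℝ} {a b : ℝ} (hA : frobNorm A ≤ a)
    (hB : frobNorm B ≤ b) : frobNorm (A - B) ≤ a + b :=
  (frobNorm_sub_le A B).trans (add_le_add hA hB)

theorem frobNorm_sub_rev (A B : Matrix ι κ ℝ) : frobNorm (A - B) = frobNorm (B - A) := by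
  simp only [frobNorm_eq_norm]; exact norm_sub_rev _ _

theorem frobNorm_smul (c : ℝ) (A : Matrix ι κ ℝ) : frobNorm (c • A) = |c| * frobNorm A := by
  simp only [frobNorm_eq_norm]; exact norm_smul _ _

theorem frobNorm_mul_le (A : Matrix ι κ ℝ) (B : Matrix κ τ ℝ) :
    frobNorm (A * B) ≤ frobNorm A * frobNorm B := by
  simp only [frobNorm_eq_norm]; exact Matrix.frobenius_norm_mul _ _

theorem frobNorm_mul_le_of_le {A : Matrix ι κ ℝ} {B : Matrix κ τ ℝ} {a b : ℝ}
    (hA : frobNorm A ≤ a) (hB : frobNorm B ≤ b) : frobNorm (A * B) ≤ a * b :=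
  (frobNorm_mul_le A B).trans
    (mul_le_mul hA hB (frobNorm_nonneg B) ((frobNorm_nonneg A).trans hA))

theorem frobNorm_transpose (A : Matrix ι κ ℝ) : frobNorm Aᵀ = frobNorm A := by
  simp only [frobNorm_eq_norm]; exact Matrix.frobenius_norm_transpose _

theorem abs_le_frobNorm (A : Matrix ι κ ℝ) (i : ι) (j : κ) : |A i j| ≤ frobNorm A := by
  refine Real.abs_le_sqrt ?_
  refine (Finset.single_le_sum (f := fun j => A i j ^ 2) (fun _ _ => sq_nonneg _)
    (Finset.mem_univ j)).trans ?_
  exact Finset.single_le_sum (f := fun i => ∑ j, A i j ^ 2)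
    (fun _ _ => Finset.sum_nonneg fun _ _ => sq_nonneg _) (Finset.mem_univ i)

theorem frobNorm_le_of_abs_le {A : Matrix ι κ ℝ} {c : ℝ} (hc : 0 ≤ c) (h : ∀ i j, |A i j| ≤ c) :
    frobNorm A ≤ Fintype.card ι * Fintype.card κ * c := by
  have h1 : ∑ i, ∑ j, A i j ^ 2 ≤ (∑ i, ∑ j, |A i j|) ^ 2 := by
    rw [← Fintype.sum_prod_type' (f := fun i j => A i j ^ 2),
      ← Fintype.sum_prod_type' (f := fun i j => |A i j|)]
    simp_rw [← sq_abs (A _ _)]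
    exact Finset.sum_sq_le_sq_sum_of_nonneg fun _ _ => abs_nonneg _
  have h2 : Real.sqrt ((∑ i, ∑ j, |A i j|) ^ 2) = ∑ i, ∑ j, |A i j| :=
    Real.sqrt_sq (Finset.sum_nonneg fun _ _ => Finset.sum_nonneg fun _ _ => abs_nonneg _)
  refine (Real.sqrt_le_sqrt h1).trans (h2.trans_le ?_)
  refine (Finset.sum_le_sum fun i _ => Finset.sum_le_sum fun j _ => h i j).trans_eq ?_
  simp [mul_assoc]

theorem frobNorm_sq_eq_trace (A : Matrix ι κ ℝ) : frobNorm A ^ 2 = (Aᵀ * A).trace := by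
  rw [frobNorm_sq, Finset.sum_comm]
  simp only [Matrix.trace, Matrix.diag, Matrix.mul_apply, Matrix.transpose_apply, sq]

theorem euclNorm_nonneg (x : ι → ℝ) : 0 ≤ euclNorm x := norm_nonneg _

theorem euclNorm_sq (x : ι → ℝ) : euclNorm x ^ 2 = ∑ i, x i ^ 2 := by
  rw [euclNorm, EuclideanSpace.real_norm_sq_eq]

theorem euclNorm_sq_eq_dotProduct (x : ι → ℝ) : euclNorm x ^ 2 = x ⬝ᵥ x := by
  rw [euclNorm_sq]; simp [dotProduct, sq]

theorem euclNorm_add_le (x y : ι → ℝ) : euclNorm (x + y) ≤ euclNorm x + euclNorm y := by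
  simp only [euclNorm, WithLp.toLp_add]; exact norm_add_le _ _

theorem euclNorm_sub_le (x y : ι → ℝ) : euclNorm (x - y) ≤ euclNorm x + euclNorm y := by
  simp only [euclNorm, WithLp.toLp_sub]; exact norm_sub_le _ _

theorem euclNorm_smul (c : ℝ) (x : ι → ℝ) : euclNorm (c • x) = |c| * euclNorm x := by
  simp only [euclNorm, WithLp.toLp_smul]; exact norm_smul _ _

theorem euclNorm_sum_le {α : Type*} (s : Finset α) (x : α → ι → ℝ) :
    euclNorm (∑ a ∈ s, x a) ≤ ∑ a ∈ s, euclNorm (x a) := by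
  simp only [euclNorm, WithLp.toLp_sum]; exact norm_sum_le _ _

theorem euclNorm_eq_frobNorm (x : ι → ℝ) :
    euclNorm x = frobNorm (Matrix.replicateCol Unit x) := by
  rw [frobNorm_eq_norm, Matrix.frobenius_norm_replicateCol, euclNorm]

theorem euclNorm_mulVec_le (A : Matrix ι κ ℝ) (x : κ → ℝ) :
    euclNorm (A *ᵥ x) ≤ frobNorm A * euclNorm x := by
  rw [euclNorm_eq_frobNorm, euclNorm_eq_frobNorm, Matrix.replicateCol_mulVec]
  exact frobNorm_mul_le _ _

theorem euclNorm_mulVec_le_of_le {A : Matrix ι κ ℝ} {x : κ → ℝ} {a b : ℝ}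
    (hA : frobNorm A ≤ a) (hx : euclNorm x ≤ b) : euclNorm (A *ᵥ x) ≤ a * b :=
  (euclNorm_mulVec_le A x).trans
    (mul_le_mul hA hx (euclNorm_nonneg x) ((frobNorm_nonneg A).trans hA))

theorem abs_dotProduct_le (x y : ι → ℝ) : |x ⬝ᵥ y| ≤ euclNorm x * euclNorm y := by
  have := abs_real_inner_le_norm (WithLp.toLp 2 x : EuclideanSpace ℝ ι) (WithLp.toLp 2 y)
  simpa [PiLp.inner_apply, dotProduct, euclNorm, mul_comm] using this

theorem abs_dotProduct_mulVec_le (A : Matrix ι κ ℝ) (x : ι → ℝ) (y : κ → ℝ) :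
    |x ⬝ᵥ A *ᵥ y| ≤ frobNorm A * (euclNorm x * euclNorm y) :=
  (abs_dotProduct_le _ _).trans ((mul_le_mul_of_nonneg_left (euclNorm_mulVec_le A y)
    (euclNorm_nonneg x)).trans_eq (by ring))

theorem frobNorm_diagonal_le [DecidableEq ι] {d : ι → ℝ} {c : ℝ} (hc : 0 ≤ c)
    (h : ∀ i, |d i| ≤ c) : frobNorm (Matrix.diagonal d) ≤ Fintype.card ι * c := by
  have h1 : frobNorm (Matrix.diagonal d) ^ 2 = ∑ i, d i ^ 2 := by
    rw [frobNorm_sq]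
    refine Finset.sum_congr rfl fun i _ => ?_
    rw [Finset.sum_eq_single i] <;> simp +contextual [eq_comm]
  have h2 : ∑ i, d i ^ 2 ≤ (∑ i, |d i|) ^ 2 := by
    simp_rw [← sq_abs (d _)]
    exact Finset.sum_sq_le_sq_sum_of_nonneg fun _ _ => abs_nonneg _
  have h3 : ∑ i, |d i| ≤ Fintype.card ι * c := by
    refine (Finset.sum_le_sum fun i _ => h i).trans_eq ?_
    simp
  have h4 : 0 ≤ ∑ i, |d i| := Finset.sum_nonneg fun _ _ => abs_nonneg _
  refine le_trans (abs_le_of_sq_le_sq' (h1.trans_le h2) h4).2 h3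

theorem frobNorm_of_orthonormal [DecidableEq κ] {U : Matrix ι κ ℝ} (hU : Uᵀ * U = 1) :
    frobNorm U = Real.sqrt (Fintype.card κ) := by
  have h := frobNorm_sq_eq_trace U
  rw [hU, Matrix.trace_one] at h
  rw [← h, Real.sqrt_sq (frobNorm_nonneg U)]

end Norms

/-! ### Eigenvalue perturbation -/

section Weyl

variable {ι : Type*} [Fintype ι] [DecidableEq ι] {K : ℕ}

theorem dotProduct_mulVec_of_orthonormal {V : Matrix ι (Fin K) ℝ} (hV : Vᵀ * V = 1)
    (c d : Fin K → ℝ) : (V *ᵥ c) ⬝ᵥ (V *ᵥ d) = c ⬝ᵥ d := by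
  rw [Matrix.dotProduct_mulVec, Matrix.vecMul_mulVec, hV, Matrix.vecMul_one]

theorem quadForm_of_eigenvectors {W : Matrix ι ι ℝ} {V : Matrix ι (Fin K) ℝ} {l : Fin K → ℝ}
    (hV : Vᵀ * V = 1) (hWV : W * V = V * Matrix.diagonal l) (c : Fin K → ℝ) :
    (V *ᵥ c) ⬝ᵥ (W *ᵥ (V *ᵥ c)) = ∑ j, l j * c j ^ 2 := by
  rw [Matrix.mulVec_mulVec, hWV, ← Matrix.mulVec_mulVec, dotProduct_mulVec_of_orthonormal hV]
  simp only [dotProduct, Matrix.mulVec_diagonal]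
  exact Finset.sum_congr rfl fun j _ => by ring

theorem quadForm_le_of_orthogonal {W : Matrix ι ι ℝ} (hW : W.IsHermitian)
    {V : Matrix ι (Fin K) ℝ} {l : Fin K → ℝ} (hV : Vᵀ * V = 1)
    (hWV : W * V = V * Matrix.diagonal l) {m : ℝ} (hm : 0 ≤ m)
    (hmax : ∀ (x : ι → ℝ) (μ : ℝ), x ≠ 0 → W *ᵥ x = μ • x → Vᵀ *ᵥ x = 0 → μ ≤ m)
    {y : ι → ℝ} (hy : Vᵀ *ᵥ y = 0) : y ⬝ᵥ W *ᵥ y ≤ m * (y ⬝ᵥ y) := by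
  have hWt : Wᵀ = W := by simpa [Matrix.IsHermitian, Matrix.conjTranspose_eq_transpose_of_trivial] using hW
  set Q : Matrix ι ι ℝ := 1 - V * Vᵀ with hQ
  have hQt : Qᵀ = Q := by simp [hQ, Matrix.transpose_sub, Matrix.transpose_mul]
  have hVQ : Vᵀ * Q = 0 := by
    rw [hQ, Matrix.mul_sub, Matrix.mul_one, ← Matrix.mul_assoc, hV, Matrix.one_mul, sub_self]
  have hQx : ∀ x, Vᵀ *ᵥ x = 0 → Q *ᵥ x = x := fun x hx => by
    rw [hQ, Matrix.sub_mulVec, Matrix.one_mulVec, ← Matrix.mulVec_mulVec, hx, Matrix.mulVec_zero,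
      sub_zero]
  have hVW : Vᵀ * W = Matrix.diagonal l * Vᵀ := by
    have := congrArg Matrix.transpose hWV
    rwa [Matrix.transpose_mul, Matrix.transpose_mul, hWt, Matrix.diagonal_transpose] at this
  set N : Matrix ι ι ℝ := m • (1 : Matrix ι ι ℝ) - Q * W * Q with hN
  have hNh : N.IsHermitian := by
    rw [Matrix.IsHermitian, Matrix.conjTranspose_eq_transpose_of_trivial, hN]
    simp [Matrix.transpose_sub, Matrix.transpose_mul, hQt, hWt, Matrix.mul_assoc]
  have hps : N.PosSemidef := by
    rw [hNh.posSemidef_iff_eigenvalues_nonneg]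
    intro i
    by_contra hneg
    simp only [Pi.zero_apply, not_le] at hneg
    have hu := hNh.mulVec_eigenvectorBasis i
    set u : ι → ℝ := ⇑(hNh.eigenvectorBasis i) with hudef
    have hu0 : u ≠ 0 := by
      intro h0
      have := hNh.eigenvectorBasis.toBasis.ne_zero i
      apply this
      ext j
      simpa [hudef] using congrFun h0 j
    set lam := hNh.eigenvalues i with hlam
    have h1 : (Q * W * Q) *ᵥ u = (m - lam) • u := by
      have : N *ᵥ u = m • u - (Q * W * Q) *ᵥ u := by
        rw [hN, Matrix.sub_mulVec, Matrix.smul_mulVec, Matrix.one_mulVec]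
      rw [this] at hu
      rw [sub_smul, ← hu, sub_sub_cancel]
    have hpos : 0 < m - lam := by linarith
    have h2 : Vᵀ *ᵥ u = 0 := by
      have := congrArg (fun x => Vᵀ *ᵥ x) h1
      simp only [Matrix.mulVec_mulVec, Matrix.mulVec_smul] at this
      rw [← Matrix.mul_assoc, ← Matrix.mul_assoc, hVQ, Matrix.zero_mul, Matrix.zero_mul,
        Matrix.zero_mulVec] at this
      exact (smul_eq_zero.1 this.symm).resolve_left hpos.ne'
    have h3 : W *ᵥ u = (m - lam) • u := by
      rw [← h1, ← Matrix.mulVec_mulVec, hQx u h2, ← Matrix.mulVec_mulVec, hQx]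
      rw [Matrix.mulVec_mulVec, hVW, ← Matrix.mulVec_mulVec, h2, Matrix.mulVec_zero]
    have := hmax u _ hu0 h3 h2
    linarith
  have := hps.dotProduct_mulVec_nonneg y
  rw [star_trivial, hN, Matrix.sub_mulVec, Matrix.smul_mulVec, Matrix.one_mulVec, dotProduct_sub,
    dotProduct_smul, smul_eq_mul, ← Matrix.mulVec_mulVec, ← Matrix.mulVec_mulVec, hQx y hy,
    Matrix.dotProduct_mulVec, ← Matrix.mulVec_transpose, hQt, hQx y hy] at this
  linarith

/-- One half of Weyl's inequality, for the leading eigenvalues of `W` and eigenvalues of `W'`. -/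
theorem eigenvalue_le_add_frobNorm {W W' : Matrix ι ι ℝ} (hW : W.PosSemidef)
    {V V' : Matrix ι (Fin K) ℝ} {l l' : Fin K → ℝ} (hV : Vᵀ * V = 1)
    (hWV : W * V = V * Matrix.diagonal l) (hl : Antitone l)
    (hmax : ∀ (x : ι → ℝ) (μ : ℝ), x ≠ 0 → W *ᵥ x = μ • x → Vᵀ *ᵥ x = 0 → ∀ k, μ ≤ l k)
    (hV' : V'ᵀ * V' = 1) (hWV' : W' * V' = V' * Matrix.diagonal l') (hl' : Antitone l')
    (k : Fin K) : l' k ≤ l k + frobNorm (W - W') := by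
  have hWt : Wᵀ = W := by
    simpa [Matrix.IsHermitian, Matrix.conjTranspose_eq_transpose_of_trivial] using hW.1
  have hlk : 0 ≤ l k := by
    have h1 := quadForm_of_eigenvectors hV hWV (Pi.single k 1)
    have h2 := hW.dotProduct_mulVec_nonneg (V *ᵥ Pi.single k 1)
    rw [star_trivial, h1] at h2
    simpa [Pi.single_apply] using h2
  obtain ⟨c, hc0, hcsupp, hcorth⟩ : ∃ c : Fin K → ℝ, c ≠ 0 ∧ (∀ j, k < j → c j = 0) ∧
      ∀ j, j < k → (Vᵀ *ᵥ (V' *ᵥ c)) j = 0 := by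
    let ext : ({j : Fin K // j ≤ k} → ℝ) →ₗ[ℝ] (Fin K → ℝ) :=
      { toFun := fun d j => if h : j ≤ k then d ⟨j, h⟩ else 0
        map_add' := fun a b => by ext j; by_cases h : j ≤ k <;> simp [h]
        map_smul' := fun a b => by ext j; by_cases h : j ≤ k <;> simp [h] }
    let L : ({j : Fin K // j ≤ k} → ℝ) →ₗ[ℝ] ({j : Fin K // j < k} → ℝ) :=
      (LinearMap.funLeft ℝ ℝ (fun j : {j : Fin K // j < k} => j.1)) ∘ₗ
        (Matrix.mulVecLin (Vᵀ * V')) ∘ₗ ext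
    have hfr : Module.finrank ℝ ({j : Fin K // j < k} → ℝ)
        < Module.finrank ℝ ({j : Fin K // j ≤ k} → ℝ) := by
      rw [Module.finrank_pi, Module.finrank_pi]
      refine Fintype.card_lt_of_injective_of_notMem
        (fun j : {j : Fin K // j < k} => (⟨j.1, j.2.le⟩ : {j : Fin K // j ≤ k}))
        (fun a b h => Subtype.ext (congrArg (fun j : {j : Fin K // j ≤ k} => j.1) h))
        (b := ⟨k, le_rfl⟩) ?_
      rintro ⟨j, hj⟩
      exact j.2.ne (congrArg Subtype.val hj)
    obtain ⟨d, hd, hd0⟩ := Submodule.exists_mem_ne_zero_of_ne_bot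
      (LinearMap.ker_ne_bot_of_finrank_lt (f := L) hfr)
    refine ⟨ext d, fun h => hd0 ?_, fun j hj => ?_, fun j hj => ?_⟩
    · ext j
      have := congrFun h j.1
      simpa [ext, j.2] using this
    · simp [ext, not_le.2 hj]
    · have := congrFun (LinearMap.mem_ker.1 hd) ⟨j, hj⟩
      rw [Matrix.mulVec_mulVec]
      exact this
  set x := V' *ᵥ c with hx
  have hxx : x ⬝ᵥ x = c ⬝ᵥ c := dotProduct_mulVec_of_orthonormal hV' c c
  have hcpos : 0 < c ⬝ᵥ c := by
    rcases (dotProduct_self_star_nonneg c).eq_or_lt with h | h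
    · exact absurd (dotProduct_self_eq_zero.1 (by simpa using h.symm)) hc0
    · simpa using h
  have low : l' k * (x ⬝ᵥ x) ≤ x ⬝ᵥ W' *ᵥ x := by
    rw [quadForm_of_eigenvectors hV' hWV', hxx, dotProduct, Finset.mul_sum]
    refine Finset.sum_le_sum fun j _ => ?_
    rcases le_or_gt j k with h | h
    · rw [← sq]; exact mul_le_mul_of_nonneg_right (hl' h) (sq_nonneg _)
    · simp [hcsupp j h]
  set e := Vᵀ *ᵥ x with he
  set y := x - V *ᵥ e with hy
  have hVy : Vᵀ *ᵥ y = 0 := by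
    have h1 : Vᵀ *ᵥ (V *ᵥ e) = e := by rw [Matrix.mulVec_mulVec, hV, Matrix.one_mulVec]
    rw [hy, Matrix.mulVec_sub, h1, sub_self]
  have hxe : x = V *ᵥ e + y := by rw [hy]; abel
  have hVd : ∀ z : Fin K → ℝ, (V *ᵥ z) ⬝ᵥ y = 0 := fun z => by
    rw [dotProduct_comm, Matrix.dotProduct_mulVec, ← Matrix.mulVec_transpose, hVy,
      zero_dotProduct]
  have hcross : y ⬝ᵥ W *ᵥ (V *ᵥ e) = 0 := by
    rw [Matrix.mulVec_mulVec, hWV, ← Matrix.mulVec_mulVec, dotProduct_comm, hVd]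
  have hcross' : (V *ᵥ e) ⬝ᵥ W *ᵥ y = 0 := by
    rw [Matrix.dotProduct_mulVec, ← Matrix.mulVec_transpose, hWt, dotProduct_comm, hcross]
  have up : x ⬝ᵥ W *ᵥ x ≤ l k * (x ⬝ᵥ x) := by
    have h1 : x ⬝ᵥ W *ᵥ x = ∑ j, l j * e j ^ 2 + y ⬝ᵥ W *ᵥ y := by
      conv_lhs => rw [hxe]
      rw [Matrix.mulVec_add, dotProduct_add, add_dotProduct, add_dotProduct, hcross, hcross',
        quadForm_of_eigenvectors hV hWV]
      ring
    have h2 : x ⬝ᵥ x = e ⬝ᵥ e + y ⬝ᵥ y := by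
      conv_lhs => rw [hxe]
      rw [dotProduct_add, add_dotProduct, add_dotProduct, hVd, dotProduct_comm y, hVd,
        dotProduct_mulVec_of_orthonormal hV]
      ring
    have h3 := quadForm_le_of_orthogonal hW.1 hV hWV hlk
      (fun x μ h1 h2 h3 => hmax x μ h1 h2 h3 k) hVy
    have h4 : ∑ j, l j * e j ^ 2 ≤ l k * (e ⬝ᵥ e) := by
      rw [dotProduct, Finset.mul_sum]
      refine Finset.sum_le_sum fun j _ => ?_
      rcases lt_or_ge j k with h | h
      · rw [hcorth j h]; simp
      · rw [← sq]; exact mul_le_mul_of_nonneg_right (hl h) (sq_nonneg _)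
    rw [h1, h2, mul_add]
    exact add_le_add h4 h3
  have hdiff : x ⬝ᵥ W' *ᵥ x - x ⬝ᵥ W *ᵥ x ≤ frobNorm (W - W') * (x ⬝ᵥ x) := by
    rw [← dotProduct_sub, ← Matrix.sub_mulVec, frobNorm_sub_rev, ← euclNorm_sq_eq_dotProduct, sq]
    exact (le_abs_self _).trans (abs_dotProduct_mulVec_le _ _ _)
  rw [hxx] at low up hdiff
  refine le_of_mul_le_mul_right ?_ hcpos
  linarith

end Weyl

/-! ### Perturbation of principal components -/

section PCA

variable {p τ : Type*} [Fintype p] [DecidableEq p] [Fintype τ] {K : ℕ}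

/-- Leading eigenvectors `Bh` of `A Aᵀ`, where `A = B Gᵀ + R` perturbs a matrix `B Gᵀ` of rank `K`
whose left singular vectors are the columns of `B Hh`; everything is controlled by `Λ`. -/
structure PCASetup (Λ : ℝ) (B : Matrix p (Fin K) ℝ) (G : Matrix τ (Fin K) ℝ) (R : Matrix p τ ℝ)
    (Hh : Matrix (Fin K) (Fin K) ℝ) (v ℓ : Fin K → ℝ) (Bh : Matrix p (Fin K) ℝ) : Prop where
  one_le : 1 ≤ Λ
  card_le : (K : ℝ) ≤ Λ
  B_le : frobNorm B ≤ Λ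
  G_le : frobNorm G ≤ Λ
  Hh_le : frobNorm Hh ≤ Λ
  gram : Gᵀ * G = Hh * Matrix.diagonal v * Hhᵀ
  orth : (B * Hh)ᵀ * (B * Hh) = 1
  v_anti : Antitone v
  v_ge : ∀ k, 1 ≤ Λ * v k
  gap : ∀ j k, j ≠ k → 1 ≤ Λ * |v j - v k|
  Bh_orth : Bhᵀ * Bh = 1
  ℓ_anti : Antitone ℓ
  eigen : (B * Gᵀ + R) * (B * Gᵀ + R)ᵀ * Bh = Bh * Matrix.diagonal ℓ
  leading : ∀ (x : p → ℝ) (μ : ℝ), x ≠ 0 →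
    ((B * Gᵀ + R) * (B * Gᵀ + R)ᵀ) *ᵥ x = μ • x → Bhᵀ *ᵥ x = 0 → ∀ k, μ ≤ ℓ k
  sign : ∀ k, 0 ≤ ((B * Hh)ᵀ * Bh) k k

theorem frobNorm_le_of_orthonormal {Λ : ℝ} (h1 : 1 ≤ Λ) (hK : (K : ℝ) ≤ Λ)
    {U : Matrix p (Fin K) ℝ} (hU : Uᵀ * U = 1) : frobNorm U ≤ Λ := by
  rw [frobNorm_of_orthonormal hU, Fintype.card_fin]
  refine Real.sqrt_le_iff.2 ⟨by linarith, hK.trans ?_⟩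
  nlinarith

theorem frobNorm_one_sub_mul_le {Λ : ℝ} (h1 : 1 ≤ Λ) {U V : Matrix p (Fin K) ℝ}
    (hU : frobNorm U ≤ Λ) (hV : frobNorm V ≤ Λ) {κ : Type*} [Fintype κ] {Y : Matrix p κ ℝ} {y : ℝ}
    (hY : frobNorm Y ≤ y) : frobNorm ((1 - U * Vᵀ) * Y) ≤ 2 * Λ ^ 2 * y := by
  have hy : 0 ≤ y := (frobNorm_nonneg Y).trans hY
  rw [Matrix.sub_mul, Matrix.one_mul]
  have h2 : frobNorm (U * Vᵀ * Y) ≤ Λ * Λ * y :=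
    frobNorm_mul_le_of_le (frobNorm_mul_le_of_le hU ((frobNorm_transpose V).trans_le hV)) hY
  have h3 : y ≤ Λ ^ 2 * y := le_mul_of_one_le_left hy (one_le_pow₀ h1)
  refine (frobNorm_sub_le _ _).trans ?_
  nlinarith

namespace PCASetup

variable {Λ δ : ℝ} {B Bh : Matrix p (Fin K) ℝ} {G : Matrix τ (Fin K) ℝ} {R : Matrix p τ ℝ}
  {Hh : Matrix (Fin K) (Fin K) ℝ} {v ℓ : Fin K → ℝ}

theorem pos (h : PCASetup Λ B G R Hh v ℓ Bh) : 0 < Λ := by linarith [h.one_le]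

theorem Bh_le (h : PCASetup Λ B G R Hh v ℓ Bh) : frobNorm Bh ≤ Λ :=
  frobNorm_le_of_orthonormal h.one_le h.card_le h.Bh_orth

theorem U_le (h : PCASetup Λ B G R Hh v ℓ Bh) : frobNorm (B * Hh) ≤ Λ :=
  frobNorm_le_of_orthonormal h.one_le h.card_le h.orth

theorem left_inv (h : PCASetup Λ B G R Hh v ℓ Bh) : ((B * Hh)ᵀ * B) * Hh = 1 := by
  rw [Matrix.mul_assoc]; exact h.orth

theorem right_inv (h : PCASetup Λ B G R Hh v ℓ Bh) : Hh * ((B * Hh)ᵀ * B) = 1 :=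
  mul_eq_one_comm.1 h.left_inv

theorem inv_eq (h : PCASetup Λ B G R Hh v ℓ Bh) : Hh⁻¹ = (B * Hh)ᵀ * B :=
  Matrix.inv_eq_left_inv h.left_inv

theorem inv_le (h : PCASetup Λ B G R Hh v ℓ Bh) : frobNorm Hh⁻¹ ≤ Λ ^ 2 := by
  rw [h.inv_eq, sq]
  exact frobNorm_mul_le_of_le ((frobNorm_transpose _).trans_le h.U_le) h.B_le

theorem v_pos (h : PCASetup Λ B G R Hh v ℓ Bh) (k : Fin K) : 0 < v k := by
  have := h.v_ge k
  by_contra hn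
  nlinarith [h.pos]

theorem proj_B (h : PCASetup Λ B G R Hh v ℓ Bh) : (1 - (B * Hh) * (B * Hh)ᵀ) * B = 0 := by
  rw [Matrix.sub_mul, Matrix.one_mul, Matrix.mul_assoc, Matrix.mul_assoc B Hh, h.right_inv,
    Matrix.mul_one, sub_self]

theorem gram_eigen (h : PCASetup Λ B G R Hh v ℓ Bh) :
    B * (Gᵀ * G) * Bᵀ = (B * Hh) * Matrix.diagonal v * (B * Hh)ᵀ := by
  rw [h.gram]; simp only [Matrix.transpose_mul, Matrix.mul_assoc]

theorem frobNorm_sub_le (h : PCASetup Λ B G R Hh v ℓ Bh) (hR : frobNorm R ≤ δ) (hδ : δ ≤ 1) :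
    frobNorm ((B * Gᵀ + R) * (B * Gᵀ + R)ᵀ - B * (Gᵀ * G) * Bᵀ) ≤ 3 * Λ ^ 2 * δ := by
  have e : (B * Gᵀ + R) * (B * Gᵀ + R)ᵀ - B * (Gᵀ * G) * Bᵀ
      = B * Gᵀ * Rᵀ + R * (G * Bᵀ) + R * Rᵀ := by
    simp only [Matrix.transpose_add, Matrix.transpose_mul, Matrix.transpose_transpose,
      Matrix.add_mul, Matrix.mul_add, Matrix.mul_assoc]
    abel
  have hδ0 : 0 ≤ δ := (frobNorm_nonneg R).trans hR
  have hRt : frobNorm Rᵀ ≤ δ := (frobNorm_transpose R).trans_le hR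
  have h1 : frobNorm (B * Gᵀ * Rᵀ) ≤ Λ * Λ * δ :=
    frobNorm_mul_le_of_le (frobNorm_mul_le_of_le h.B_le ((frobNorm_transpose G).trans_le h.G_le)) hRt
  have h2 : frobNorm (R * (G * Bᵀ)) ≤ δ * (Λ * Λ) :=
    frobNorm_mul_le_of_le hR (frobNorm_mul_le_of_le h.G_le ((frobNorm_transpose B).trans_le h.B_le))
  have h3 : frobNorm (R * Rᵀ) ≤ δ * δ := frobNorm_mul_le_of_le hR hRt
  have h4 : δ * δ ≤ Λ ^ 2 * δ :=
    mul_le_mul_of_nonneg_right (hδ.trans (one_le_pow₀ h.one_le)) hδ0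
  rw [e]
  have := frobNorm_add_le (B * Gᵀ * Rᵀ + R * (G * Bᵀ)) (R * Rᵀ)
  have := frobNorm_add_le (B * Gᵀ * Rᵀ) (R * (G * Bᵀ))
  nlinarith

theorem abs_eigenvalue_sub_le (h : PCASetup Λ B G R Hh v ℓ Bh) (hR : frobNorm R ≤ δ)
    (hδ : δ ≤ 1) (k : Fin K) : |ℓ k - v k| ≤ 3 * Λ ^ 2 * δ := by
  have hW := h.frobNorm_sub_le hR hδ
  set W := (B * Gᵀ + R) * (B * Gᵀ + R)ᵀ with hWdef
  set W0 := B * (Gᵀ * G) * Bᵀ with hW0def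
  have hWp : W.PosSemidef := by
    have := Matrix.posSemidef_self_mul_conjTranspose (B * Gᵀ + R)
    rwa [Matrix.conjTranspose_eq_transpose_of_trivial] at this
  have hW0p : W0.PosSemidef := by
    have := Matrix.posSemidef_self_mul_conjTranspose (B * Gᵀ)
    rw [Matrix.conjTranspose_eq_transpose_of_trivial] at this
    convert this using 1
    simp [hW0def, Matrix.transpose_mul, Matrix.mul_assoc]
  have hW0U : W0 * (B * Hh) = (B * Hh) * Matrix.diagonal v := by
    rw [hW0def, h.gram_eigen, Matrix.mul_assoc, h.orth, Matrix.mul_one]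
  have hmax0 : ∀ (x : p → ℝ) (μ : ℝ), x ≠ 0 → W0 *ᵥ x = μ • x → (B * Hh)ᵀ *ᵥ x = 0 →
      ∀ k, μ ≤ v k := by
    intro x μ hx hμ hU k
    rw [hW0def, h.gram_eigen, ← Matrix.mulVec_mulVec, hU, Matrix.mulVec_zero] at hμ
    rw [(smul_eq_zero.1 hμ.symm).resolve_right hx]
    exact (h.v_pos k).le
  have h1 := eigenvalue_le_add_frobNorm hWp h.Bh_orth h.eigen h.ℓ_anti h.leading h.orth hW0U
    h.v_anti k
  have h2 := eigenvalue_le_add_frobNorm hW0p h.orth hW0U h.v_anti hmax0 h.Bh_orth h.eigen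
    h.ℓ_anti k
  rw [frobNorm_sub_rev] at h2
  rw [abs_le]; constructor <;> linarith

theorem eigenvalue_ge (h : PCASetup Λ B G R Hh v ℓ Bh) (hR : frobNorm R ≤ δ)
    (hδ : 6 * Λ ^ 3 * δ ≤ 1) (k : Fin K) : 1 ≤ 2 * Λ * ℓ k := by
  have hδ0 : 0 ≤ δ := (frobNorm_nonneg R).trans hR
  have hδ1 : δ ≤ 1 := by nlinarith [one_le_pow₀ h.one_le (n := 3)]
  have h1 := (abs_le.1 (h.abs_eigenvalue_sub_le hR hδ1 k)).1
  have h2 := h.v_ge k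
  nlinarith [mul_le_mul_of_nonneg_left h1 h.pos.le]

theorem eigenvalue_pos (h : PCASetup Λ B G R Hh v ℓ Bh) (hR : frobNorm R ≤ δ)
    (hδ : 6 * Λ ^ 3 * δ ≤ 1) (k : Fin K) : 0 < ℓ k := by
  have := h.eigenvalue_ge hR hδ k
  by_contra hn
  nlinarith [h.pos]

theorem diag_inv_le (h : PCASetup Λ B G R Hh v ℓ Bh) (hR : frobNorm R ≤ δ)
    (hδ : 6 * Λ ^ 3 * δ ≤ 1) :
    frobNorm (Matrix.diagonal fun k => (ℓ k)⁻¹) ≤ 2 * Λ ^ 2 := by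
  have h1 : ∀ k, |(ℓ k)⁻¹| ≤ 2 * Λ := fun k => by
    have := h.eigenvalue_pos hR hδ k
    rw [abs_of_pos (inv_pos.2 this)]
    exact (inv_le_iff_one_le_mul₀ this).2 (h.eigenvalue_ge hR hδ k)
  refine (frobNorm_diagonal_le (by linarith [h.pos]) h1).trans ?_
  rw [Fintype.card_fin]
  nlinarith [h.card_le, h.pos]

theorem diag_v_inv_le (h : PCASetup Λ B G R Hh v ℓ Bh) :
    frobNorm (Matrix.diagonal fun k => (v k)⁻¹) ≤ Λ ^ 2 := by
  have h1 : ∀ k, |(v k)⁻¹| ≤ Λ := fun k => by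
    have := h.v_pos k
    rw [abs_of_pos (inv_pos.2 this)]
    exact (inv_le_iff_one_le_mul₀ this).2 (h.v_ge k)
  refine (frobNorm_diagonal_le h.pos.le h1).trans ?_
  rw [Fintype.card_fin]
  nlinarith [h.card_le, h.pos]

theorem eigenvectors_eq (h : PCASetup Λ B G R Hh v ℓ Bh) (hℓ : ∀ k, 0 < ℓ k) :
    Bh = (B * Gᵀ + R) * ((B * Gᵀ + R)ᵀ * Bh * Matrix.diagonal fun k => (ℓ k)⁻¹) := by
  rw [← Matrix.mul_assoc, ← Matrix.mul_assoc, h.eigen, Matrix.mul_assoc,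
    Matrix.diagonal_mul_diagonal]
  simp [mul_inv_cancel₀ (hℓ _).ne']

/-- Linearization of the estimated eigenvectors around the rotated loadings. -/
theorem eigenvectors_sub_eq (h : PCASetup Λ B G R Hh v ℓ Bh) (hℓ : ∀ k, 0 < ℓ k) :
    Bh - B * (Gᵀ * ((B * Gᵀ + R)ᵀ * Bh * Matrix.diagonal fun k => (ℓ k)⁻¹))
      = R * ((B * Gᵀ + R)ᵀ * Bh * Matrix.diagonal fun k => (ℓ k)⁻¹) := by
  conv_lhs => enter [1]; rw [h.eigenvectors_eq hℓ]
  rw [Matrix.add_mul, ← Matrix.mul_assoc B, add_sub_cancel_left]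

theorem A_le (h : PCASetup Λ B G R Hh v ℓ Bh) (hR : frobNorm R ≤ δ) (hδ : δ ≤ 1) :
    frobNorm (B * Gᵀ + R)ᵀ ≤ 2 * Λ ^ 2 := by
  rw [frobNorm_transpose]
  have h1 : frobNorm (B * Gᵀ) ≤ Λ * Λ :=
    frobNorm_mul_le_of_le h.B_le ((frobNorm_transpose G).trans_le h.G_le)
  have := frobNorm_add_le (B * Gᵀ) R
  nlinarith [h.one_le]

/-- Consistency of the estimated eigenvalues, eigenvectors, and rotation. -/
theorem consistency (h : PCASetup Λ B G R Hh v ℓ Bh) (hR : frobNorm R ≤ δ)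
    (hδ : 6 * Λ ^ 3 * δ ≤ 1) {H : Matrix (Fin K) (Fin K) ℝ}
    (hH : H = Gᵀ * ((B * Gᵀ + R)ᵀ * Bh * Matrix.diagonal fun k => (ℓ k)⁻¹)) :
    frobNorm H ≤ 4 * Λ ^ 6 ∧ frobNorm (Bh - B * Hh) ≤ 108 * Λ ^ 17 * δ ∧
    frobNorm (H - Hh) ≤ 104 * Λ ^ 17 * δ ∧
    frobNorm (Bh * Matrix.diagonal (fun k => (ℓ k)⁻¹)
      - B * Hh * Matrix.diagonal fun k => (v k)⁻¹) ≤ 222 * Λ ^ 19 * δ := by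
  have hΛ := h.one_le
  have hΛ0 := h.pos
  have hδ0 : 0 ≤ δ := (frobNorm_nonneg R).trans hR
  have hδ1 : δ ≤ 1 := by nlinarith [one_le_pow₀ hΛ (n := 3)]
  have hℓ := h.eigenvalue_pos hR hδ
  have hsub := h.eigenvectors_sub_eq hℓ
  have hV : frobNorm ((B * Gᵀ + R)ᵀ * Bh * Matrix.diagonal fun k => (ℓ k)⁻¹)
      ≤ 2 * Λ ^ 2 * Λ * (2 * Λ ^ 2) :=
    frobNorm_mul_le_of_le (frobNorm_mul_le_of_le (h.A_le hR hδ1) h.Bh_le) (h.diag_inv_le hR hδ)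
  rw [← hH] at hsub
  have hHle : frobNorm H ≤ 4 * Λ ^ 6 := by
    rw [hH]
    refine (frobNorm_mul_le_of_le ((frobNorm_transpose G).trans_le h.G_le) hV).trans_eq (by ring)
  have hΔ : frobNorm (Bh - B * H) ≤ 4 * Λ ^ 5 * δ := by
    rw [hsub]
    exact (frobNorm_mul_le_of_le hR hV).trans_eq (by ring)
  set U := B * Hh with hU
  set X := Uᵀ * Bh with hX
  set Z := (1 - U * Uᵀ) * Bh with hZ
  have hUt : frobNorm Uᵀ ≤ Λ := (frobNorm_transpose _).trans_le h.U_le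
  have hZΔ : Z = (1 - U * Uᵀ) * (Bh - B * H) := by
    rw [Matrix.mul_sub, ← Matrix.mul_assoc, h.proj_B, Matrix.zero_mul, sub_zero]
  have hZle : frobNorm Z ≤ 8 * Λ ^ 7 * δ := by
    rw [hZΔ]
    exact (frobNorm_one_sub_mul_le hΛ h.U_le h.U_le hΔ).trans_eq (by ring)
  -- off-diagonal entries
  have hoff : ∀ j k, j ≠ k → |X j k| ≤ 6 * Λ ^ 5 * δ := by
    intro j k hjk
    have h1 : (v j - ℓ k) * X j k
        = (Uᵀ * (B * (Gᵀ * G) * Bᵀ - (B * Gᵀ + R) * (B * Gᵀ + R)ᵀ) * Bh) j k := by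
      have h2 : Uᵀ * (B * (Gᵀ * G) * Bᵀ) = Matrix.diagonal v * Uᵀ := by
        rw [h.gram_eigen, ← Matrix.mul_assoc, ← Matrix.mul_assoc, h.orth, Matrix.one_mul]
      rw [Matrix.mul_sub, Matrix.sub_mul, h2, Matrix.mul_assoc Uᵀ, h.eigen, Matrix.mul_assoc,
        ← Matrix.mul_assoc Uᵀ, ← hX, Matrix.sub_apply, Matrix.diagonal_mul, Matrix.mul_diagonal]
      ring
    have h3 : |(v j - ℓ k) * X j k| ≤ 3 * Λ ^ 4 * δ := by
      rw [h1]
      refine (abs_le_frobNorm _ _ _).trans ?_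
      refine (frobNorm_mul_le_of_le (frobNorm_mul_le_of_le hUt
        ((frobNorm_sub_rev _ _).trans_le (h.frobNorm_sub_le hR hδ1))) h.Bh_le).trans_eq (by ring)
    have h4 : 1 ≤ 2 * Λ * |v j - ℓ k| := by
      have h5 := h.gap j k hjk
      have h6 := h.abs_eigenvalue_sub_le hR hδ1 k
      have h7 : |v j - v k| ≤ |v j - ℓ k| + |ℓ k - v k| := abs_sub_le _ _ _
      nlinarith [mul_le_mul_of_nonneg_left h6 hΛ0.le, mul_le_mul_of_nonneg_left h7 hΛ0.le]
    rw [abs_mul] at h3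
    calc |X j k| ≤ (2 * Λ * |v j - ℓ k|) * |X j k| := le_mul_of_one_le_left (abs_nonneg _) h4
      _ = 2 * Λ * (|v j - ℓ k| * |X j k|) := by ring
      _ ≤ 2 * Λ * (3 * Λ ^ 4 * δ) := by gcongr
      _ = _ := by ring
  have hdiag : ∀ k, |1 - X k k| ≤ 100 * Λ ^ 14 * δ := by
    intro k
    have h1 : Xᵀ * X = 1 - Zᵀ * Z := by
      have h2 : (1 - U * Uᵀ)ᵀ * (1 - U * Uᵀ) = 1 - U * Uᵀ := by
        rw [Matrix.transpose_sub, Matrix.transpose_one, Matrix.transpose_mul,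
          Matrix.transpose_transpose, Matrix.sub_mul, Matrix.one_mul, Matrix.mul_sub,
          Matrix.mul_one]
        have : U * Uᵀ * (U * Uᵀ) = U * Uᵀ := by
          rw [Matrix.mul_assoc, ← Matrix.mul_assoc Uᵀ, h.orth, Matrix.one_mul]
        rw [this, sub_self, sub_zero]
      have h3 : Zᵀ * Z = Bhᵀ * ((1 - U * Uᵀ)ᵀ * (1 - U * Uᵀ)) * Bh := by
        rw [hZ, Matrix.transpose_mul]; simp only [Matrix.mul_assoc]
      rw [h3, h2, Matrix.mul_sub, Matrix.mul_one, Matrix.sub_mul, h.Bh_orth, sub_sub_cancel, hX,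
        Matrix.transpose_mul, Matrix.transpose_transpose]
      simp only [Matrix.mul_assoc]
    have h2 := congrFun (congrFun h1 k) k
    rw [Matrix.sub_apply, Matrix.one_apply_eq, Matrix.mul_apply] at h2
    simp only [Matrix.transpose_apply] at h2
    rw [← Finset.add_sum_erase _ _ (Finset.mem_univ k)] at h2
    have h3 : |(Zᵀ * Z) k k| ≤ 64 * Λ ^ 14 * δ := by
      refine (abs_le_frobNorm _ _ _).trans ((frobNorm_mul_le_of_le
        ((frobNorm_transpose _).trans_le hZle) hZle).trans ?_)
      calc 8 * Λ ^ 7 * δ * (8 * Λ ^ 7 * δ) = 64 * Λ ^ 14 * δ * δ := by ring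
        _ ≤ 64 * Λ ^ 14 * δ * 1 := by gcongr
        _ = _ := by ring
    have h4 : ∑ j ∈ Finset.univ.erase k, X j k * X j k ≤ 36 * Λ ^ 14 * δ := by
      calc ∑ j ∈ Finset.univ.erase k, X j k * X j k
          ≤ ∑ j ∈ Finset.univ.erase k, 36 * Λ ^ 10 * δ := by
            refine Finset.sum_le_sum fun j hj => ?_
            have h5 := hoff j k (Finset.ne_of_mem_erase hj)
            rw [← abs_mul_abs_self]
            calc |X j k| * |X j k| ≤ 6 * Λ ^ 5 * δ * (6 * Λ ^ 5 * δ) := by gcongr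
              _ = 36 * Λ ^ 10 * δ * δ := by ring
              _ ≤ 36 * Λ ^ 10 * δ * 1 := by gcongr
              _ = _ := by ring
        _ ≤ ∑ j : Fin K, 36 * Λ ^ 10 * δ :=
            Finset.sum_le_sum_of_subset_of_nonneg (Finset.subset_univ _)
              fun _ _ _ => by positivity
        _ = K * (36 * Λ ^ 10 * δ) := by simp
        _ ≤ Λ * (36 * Λ ^ 10 * δ) := by gcongr; exact h.card_le
        _ = 36 * Λ ^ 11 * δ := by ring
        _ ≤ 36 * Λ ^ 14 * δ := by gcongr; norm_num
    have h5 : 0 ≤ ∑ j ∈ Finset.univ.erase k, X j k * X j k :=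
      Finset.sum_nonneg fun _ _ => mul_self_nonneg _
    have h6 : 0 ≤ X k k := h.sign k
    have h7 := abs_le.1 h3
    have h8 : |1 - X k k * X k k| ≤ 100 * Λ ^ 14 * δ := by
      rw [abs_le]; constructor <;> linarith
    have h9 : 1 - X k k * X k k = (1 - X k k) * (1 + X k k) := by ring
    rw [h9, abs_mul, abs_of_nonneg (by linarith : 0 ≤ 1 + X k k)] at h8
    nlinarith [abs_nonneg (1 - X k k)]
  have hX1 : frobNorm (X - 1) ≤ 100 * Λ ^ 16 * δ := by
    have h1 : ∀ j k, |(X - 1) j k| ≤ 100 * Λ ^ 14 * δ := by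
      intro j k
      rcases eq_or_ne j k with rfl | hjk
      · rw [Matrix.sub_apply, Matrix.one_apply_eq, abs_sub_comm]; exact hdiag j
      · rw [Matrix.sub_apply, Matrix.one_apply_ne hjk, sub_zero]
        refine (hoff j k hjk).trans ?_
        gcongr <;> norm_num
    refine (frobNorm_le_of_abs_le (by positivity) h1).trans ?_
    rw [Fintype.card_fin]
    calc (K : ℝ) * K * (100 * Λ ^ 14 * δ) ≤ Λ * Λ * (100 * Λ ^ 14 * δ) := by
          gcongr <;> exact h.card_le
      _ = _ := by ring
  have hBU : frobNorm (Bh - U) ≤ 108 * Λ ^ 17 * δ := by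
    have e : Bh - U = Z + U * (X - 1) := by
      rw [hZ, hX, Matrix.sub_mul, Matrix.one_mul, Matrix.mul_sub, Matrix.mul_one, Matrix.mul_assoc]
      abel
    have h1 := frobNorm_mul_le_of_le h.U_le hX1
    have h2 : 8 * Λ ^ 7 * δ ≤ 8 * Λ ^ 17 * δ := by gcongr; norm_num
    have := frobNorm_add_le Z (U * (X - 1))
    rw [e]; nlinarith
  refine ⟨hHle, hBU, ?_, ?_⟩
  · have e : H - Hh = Hh * (X - 1 - Uᵀ * (Bh - B * H)) := by
      rw [Matrix.mul_sub Uᵀ, ← hX, ← Matrix.mul_assoc Uᵀ,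
        show X - 1 - (X - Uᵀ * B * H) = Uᵀ * B * H - 1 by abel, Matrix.mul_sub, Matrix.mul_one,
        ← Matrix.mul_assoc, h.right_inv, Matrix.one_mul]
    have h1 := frobNorm_mul_le_of_le hUt hΔ
    have h2 := frobNorm_sub_le_of_le hX1 h1
    rw [e]
    refine (frobNorm_mul_le_of_le h.Hh_le h2).trans ?_
    have h3 : Λ * (Λ * (4 * Λ ^ 5 * δ)) ≤ 4 * Λ ^ 17 * δ := by
      rw [show Λ * (Λ * (4 * Λ ^ 5 * δ)) = 4 * Λ ^ 7 * δ by ring]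
      gcongr; norm_num
    nlinarith
  · have e : Bh * Matrix.diagonal (fun k => (ℓ k)⁻¹) - U * Matrix.diagonal (fun k => (v k)⁻¹)
        = (Bh - U) * Matrix.diagonal (fun k => (ℓ k)⁻¹)
          + U * Matrix.diagonal (fun k => (ℓ k)⁻¹ - (v k)⁻¹) := by
      rw [← Matrix.diagonal_sub, Matrix.sub_mul, Matrix.mul_sub]; abel
    have h1 : ∀ k, |(ℓ k)⁻¹ - (v k)⁻¹| ≤ 6 * Λ ^ 4 * δ := by
      intro k
      have hl := hℓ k
      have hv := h.v_pos k
      have h2 : (ℓ k)⁻¹ - (v k)⁻¹ = (v k - ℓ k) * ((ℓ k)⁻¹ * (v k)⁻¹) := by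
        field_simp
      have h3 : (ℓ k)⁻¹ ≤ 2 * Λ :=
        (inv_le_iff_one_le_mul₀ hl).2 (h.eigenvalue_ge hR hδ k)
      have h4 : (v k)⁻¹ ≤ Λ := (inv_le_iff_one_le_mul₀ hv).2 (h.v_ge k)
      have h5 := h.abs_eigenvalue_sub_le hR hδ1 k
      rw [abs_sub_comm] at h5
      rw [h2, abs_mul, abs_of_pos (a := (ℓ k)⁻¹ * (v k)⁻¹) (by positivity)]
      calc |v k - ℓ k| * ((ℓ k)⁻¹ * (v k)⁻¹) ≤ (3 * Λ ^ 2 * δ) * ((2 * Λ) * Λ) := by gcongr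
        _ = _ := by ring
    have h2 := frobNorm_mul_le_of_le hBU (h.diag_inv_le hR hδ)
    have h3 := frobNorm_mul_le_of_le h.U_le (frobNorm_diagonal_le (by positivity) h1)
    rw [Fintype.card_fin] at h3
    have h4 : Λ * ((K : ℝ) * (6 * Λ ^ 4 * δ)) ≤ 6 * Λ ^ 19 * δ := by
      calc Λ * ((K : ℝ) * (6 * Λ ^ 4 * δ)) ≤ Λ * (Λ * (6 * Λ ^ 4 * δ)) := by
            gcongr; exact h.card_le
        _ = 6 * Λ ^ 6 * δ := by ring
        _ ≤ _ := by gcongr; norm_num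
    rw [e]
    have := frobNorm_add_le ((Bh - U) * Matrix.diagonal (fun k => (ℓ k)⁻¹))
      (U * Matrix.diagonal (fun k => (ℓ k)⁻¹ - (v k)⁻¹))
    nlinarith

end PCASetup

end PCA

/-! ### Second-order expansion of the estimators -/

section Expansion

variable {p τ : Type*} [Fintype p] [DecidableEq p] [Fintype τ] {K : ℕ}

theorem euclNorm_one_sub_mulVec_le {Λ : ℝ} (h1 : 1 ≤ Λ) {U V : Matrix p (Fin K) ℝ}
    (hU : frobNorm U ≤ Λ) (hV : frobNorm V ≤ Λ) {x : p → ℝ} {y : ℝ}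
    (hx : euclNorm x ≤ y) : euclNorm ((1 - U * Vᵀ) *ᵥ x) ≤ 2 * Λ ^ 2 * y := by
  rw [euclNorm_eq_frobNorm, Matrix.replicateCol_mulVec]
  exact frobNorm_one_sub_mul_le h1 hU hV (by rwa [← euclNorm_eq_frobNorm])

theorem euclNorm_add_le_of_le {ι : Type*} [Fintype ι] {x y : ι → ℝ} {a b : ℝ}
    (hx : euclNorm x ≤ a) (hy : euclNorm y ≤ b) : euclNorm (x + y) ≤ a + b :=
  (euclNorm_add_le x y).trans (add_le_add hx hy)

theorem euclNorm_sub_le_of_le {ι : Type*} [Fintype ι] {x y : ι → ℝ} {a b : ℝ}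
    (hx : euclNorm x ≤ a) (hy : euclNorm y ≤ b) : euclNorm (x - y) ≤ a + b :=
  (euclNorm_sub_le x y).trans (add_le_add hx hy)

theorem frobNorm_smul_le_of_le {ι κ : Type*} [Fintype ι] [Fintype κ] {s a : ℝ} (hs : 0 ≤ s)
    {A : Matrix ι κ ℝ} (hA : frobNorm A ≤ a) : frobNorm (s • A) ≤ s * a := by
  rw [frobNorm_smul, abs_of_nonneg hs]; exact mul_le_mul_of_nonneg_left hA hs

/-- Bounds on the error terms `D`, `E` of the perturbation `R = D + E`, on the leading noise term
`s E G` and its approximation `N2`, and a bound `ρ` for all resulting remainders. -/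
structure NoiseBounds (s d e eB nn g ρ : ℝ) (B : Matrix p (Fin K) ℝ) (G : Matrix τ (Fin K) ℝ)
    (D E : Matrix p τ ℝ) (N2 : Matrix p (Fin K) ℝ) : Prop where
  s_nonneg : 0 ≤ s
  D_le : frobNorm D ≤ d
  E_le : frobNorm E ≤ e
  EB_le : frobNorm (Eᵀ * B) ≤ eB
  noise_le : frobNorm (s • (E * G)) ≤ nn
  approx_le : frobNorm (s • (E * G) - N2) ≤ g
  bias_le : s * d ≤ ρ
  cross_le : s * e * eB ≤ ρ
  cube_le : s * e ^ 3 ≤ ρ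
  noise_mul_le : nn * (d + e) ≤ ρ
  g_le : g ≤ ρ

theorem le_one_of_threshold {Λ x : ℝ} (hΛ : 1 ≤ Λ) (hx : 0 ≤ x) (h : 208 * Λ ^ 19 * x ≤ 1) :
    x ≤ 1 ∧ 6 * Λ ^ 3 * x ≤ 1 := by
  have h1 := one_le_pow₀ hΛ (n := 19)
  refine ⟨by nlinarith, le_trans ?_ h⟩
  gcongr <;> norm_num

namespace PCASetup

variable {Λ s d e eB nn g ρ : ℝ} {B Bh N2 : Matrix p (Fin K) ℝ} {G : Matrix τ (Fin K) ℝ}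
  {D E : Matrix p τ ℝ} {Hh H : Matrix (Fin K) (Fin K) ℝ} {v ℓ : Fin K → ℝ}

set_option maxHeartbeats 800000 in
/-- The estimation error of the eigenvectors: crude bound and first-order approximation. -/
theorem eigenvectors_expansion (h : PCASetup Λ B G (D + E) Hh v ℓ Bh)
    (hn : NoiseBounds s d e eB nn g ρ B G D E N2) (hδ : 208 * Λ ^ 19 * (d + e) ≤ 1)
    (hH : H = Gᵀ * ((B * Gᵀ + (D + E))ᵀ * Bh * Matrix.diagonal fun k => (ℓ k)⁻¹))
    {Γ : ℝ} (hΓ : Γ = 222 * Λ ^ 19) :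
    frobNorm (s • (Bh - B * H)) * (d + e) ≤ 8 * Γ ^ 2 * ρ ∧
    frobNorm (s • (Bh - B * H) - N2 * (Bᵀ * B) * (Hh * Matrix.diagonal fun k => (v k)⁻¹))
      ≤ 11 * Γ ^ 3 * ρ := by
  have hΛ := h.one_le
  have hΛ0 := h.pos
  have hs := hn.s_nonneg
  have hd0 : 0 ≤ d := (frobNorm_nonneg D).trans hn.D_le
  have he0 : 0 ≤ e := (frobNorm_nonneg E).trans hn.E_le
  have hnn0 : 0 ≤ nn := (frobNorm_nonneg _).trans hn.noise_le
  have heB0 : 0 ≤ eB := (frobNorm_nonneg _).trans hn.EB_le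
  have hg0 : 0 ≤ g := (frobNorm_nonneg _).trans hn.approx_le
  have hρ0 : 0 ≤ ρ := hg0.trans hn.g_le
  have hpow : ∀ n ≤ 19, Λ ^ n ≤ Λ ^ 19 := fun n hn => pow_le_pow_right₀ hΛ hn
  have hΛΓ : ∀ n ≤ 19, 222 * Λ ^ n ≤ Γ := fun n hn => by rw [hΓ]; linarith [hpow n hn]
  have hΓ1 : 1 ≤ Γ := by linarith [hΛΓ 0 (by norm_num), pow_zero Λ]
  have hΓ0 : 0 < Γ := by linarith
  obtain ⟨hδ1, hδ6⟩ := le_one_of_threshold hΛ (by linarith) hδ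
  have hR : frobNorm (D + E) ≤ d + e := frobNorm_add_le_of_le hn.D_le hn.E_le
  obtain ⟨hHle, hBU, -, hXi⟩ := h.consistency hR hδ6 hH
  have hℓ := h.eigenvalue_pos hR hδ6
  have hsub := h.eigenvectors_sub_eq hℓ
  rw [← hH] at hsub
  set dl : Matrix (Fin K) (Fin K) ℝ := Matrix.diagonal fun k => (ℓ k)⁻¹ with hdl
  set dv : Matrix (Fin K) (Fin K) ℝ := Matrix.diagonal fun k => (v k)⁻¹ with hdv
  have hdl_le : frobNorm dl ≤ 2 * Λ ^ 2 := h.diag_inv_le hR hδ6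
  have hdv_le : frobNorm dv ≤ Λ ^ 2 := h.diag_v_inv_le
  set V := (B * Gᵀ + (D + E))ᵀ * Bh * dl with hV
  set Ξ := Bh * dl with hΞ
  set Δ := Bh - B * H with hΔ
  have hBt : frobNorm Bᵀ ≤ Λ := (frobNorm_transpose B).trans_le h.B_le
  have hDt : frobNorm Dᵀ ≤ d := (frobNorm_transpose D).trans_le hn.D_le
  have hEt : frobNorm Eᵀ ≤ e := (frobNorm_transpose E).trans_le hn.E_le
  have hVle : frobNorm V ≤ Γ := by
    refine (frobNorm_mul_le_of_le (frobNorm_mul_le_of_le (h.A_le hR hδ1) h.Bh_le) hdl_le).trans ?_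
    have := hΛΓ 5 (by norm_num)
    have : 0 < Λ ^ 5 := by positivity
    rw [show 2 * Λ ^ 2 * Λ * (2 * Λ ^ 2) = 4 * Λ ^ 5 by ring]
    linarith
  have hΞle : frobNorm Ξ ≤ 2 * Λ ^ 3 :=
    (frobNorm_mul_le_of_le h.Bh_le hdl_le).trans_eq (by ring)
  have hΞle' : frobNorm Ξ ≤ Γ := by
    have := hΛΓ 3 (by norm_num)
    have : 0 < Λ ^ 3 := by positivity
    linarith
  have eV : V = G * (Bᵀ * Ξ) + Dᵀ * Ξ + Eᵀ * Ξ := by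
    simp only [hV, hΞ, Matrix.transpose_add, Matrix.transpose_mul, Matrix.transpose_transpose,
      Matrix.add_mul, Matrix.mul_assoc]
    abel
  have eΔ : s • Δ = s • (D * V) + (s • (E * G)) * (Bᵀ * Ξ) + s • (E * (Dᵀ * Ξ))
      + s • (E * (Eᵀ * Ξ)) := by
    rw [hsub, Matrix.add_mul, smul_add]
    conv_lhs => enter [2]; rw [eV]
    simp only [Matrix.mul_add, smul_add, Matrix.smul_mul, Matrix.mul_assoc]
    abel
  have b1 : frobNorm (s • (D * V)) ≤ Γ * (s * d) :=
    (frobNorm_smul_le_of_le hs (frobNorm_mul_le_of_le hn.D_le hVle)).trans_eq (by ring)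
  have b2 : frobNorm ((s • (E * G)) * (Bᵀ * Ξ)) ≤ Γ * nn := by
    refine (frobNorm_mul_le_of_le hn.noise_le (frobNorm_mul_le_of_le hBt hΞle)).trans ?_
    rw [mul_comm]
    refine mul_le_mul_of_nonneg_right ?_ hnn0
    have := hΛΓ 4 (by norm_num)
    have : 0 < Λ ^ 4 := by positivity
    rw [show Λ * (2 * Λ ^ 3) = 2 * Λ ^ 4 by ring]
    linarith
  have b3 : frobNorm (s • (E * (Dᵀ * Ξ))) ≤ Γ * (s * d) := by
    refine (frobNorm_smul_le_of_le hs (frobNorm_mul_le_of_le hn.E_le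
      (frobNorm_mul_le_of_le hDt hΞle'))).trans ?_
    calc s * (e * (d * Γ)) = e * (Γ * (s * d)) := by ring
      _ ≤ 1 * (Γ * (s * d)) := by gcongr; linarith
      _ = _ := one_mul _
  have b4 : frobNorm (s • (E * (Eᵀ * Ξ))) ≤ Γ * (s * e ^ 2) :=
    (frobNorm_smul_le_of_le hs (frobNorm_mul_le_of_le hn.E_le
      (frobNorm_mul_le_of_le hEt hΞle'))).trans_eq (by ring)
  have crude : frobNorm (s • Δ) ≤ 2 * Γ * (s * d + nn + s * e ^ 2) := by
    rw [eΔ]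
    refine (frobNorm_add_le_of_le (frobNorm_add_le_of_le (frobNorm_add_le_of_le b1 b2) b3)
      b4).trans ?_
    have : 0 ≤ Γ * nn := by positivity
    have : 0 ≤ Γ * (s * e ^ 2) := by positivity
    rw [show 2 * Γ * (s * d + nn + s * e ^ 2)
      = 2 * (Γ * (s * d)) + 2 * (Γ * nn) + 2 * (Γ * (s * e ^ 2)) by ring]
    linarith
  have k1 : s * d * e ≤ ρ := (mul_le_of_le_one_right (by positivity) (by linarith)).trans hn.bias_le
  have k2 : nn * e ≤ ρ :=
    (mul_le_mul_of_nonneg_left (by linarith) hnn0).trans hn.noise_mul_le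
  have k4 : s * d * e ^ 2 ≤ ρ :=
    (mul_le_of_le_one_right (by positivity) (pow_le_one₀ he0 (by linarith))).trans hn.bias_le
  refine ⟨?_, ?_⟩
  · refine (mul_le_mul_of_nonneg_right crude (by linarith)).trans ?_
    have k3 : s * d * (d + e) ≤ ρ :=
      (mul_le_of_le_one_right (by positivity) hδ1).trans hn.bias_le
    have k6 : (s * d + nn + s * e ^ 2) * (d + e) ≤ 4 * ρ := by
      rw [show (s * d + nn + s * e ^ 2) * (d + e)
        = s * d * (d + e) + nn * (d + e) + s * d * e ^ 2 + s * e ^ 3 by ring]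
      linarith [hn.noise_mul_le, hn.cube_le]
    calc 2 * Γ * (s * d + nn + s * e ^ 2) * (d + e)
        = 2 * Γ * ((s * d + nn + s * e ^ 2) * (d + e)) := by ring
      _ ≤ 2 * Γ * (4 * ρ) := by gcongr
      _ = 8 * Γ ^ 1 * ρ := by ring
      _ ≤ 8 * Γ ^ 2 * ρ := by gcongr <;> norm_num [hΓ1]
  · have hBh : Bh = B * H + Δ := by rw [hΔ]; abel
    have eEE : s • (E * (Eᵀ * Ξ))
        = s • (E * (Eᵀ * B * (H * dl))) + E * (Eᵀ * (s • Δ * dl)) := by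
      rw [hΞ]
      conv_lhs => rw [hBh]
      simp only [Matrix.add_mul, Matrix.mul_add, smul_add, Matrix.smul_mul, Matrix.mul_smul,
        Matrix.mul_assoc]
    have b5 : frobNorm (s • (E * (Eᵀ * B * (H * dl)))) ≤ Γ * ρ := by
      refine (frobNorm_smul_le_of_le hs (frobNorm_mul_le_of_le hn.E_le
        (frobNorm_mul_le_of_le hn.EB_le (frobNorm_mul_le_of_le hHle hdl_le)))).trans ?_
      have k6 := hΛΓ 8 (by norm_num)
      have k7 : 4 * Λ ^ 6 * (2 * Λ ^ 2) ≤ Γ := by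
        have : 0 < Λ ^ 8 := by positivity
        rw [show 4 * Λ ^ 6 * (2 * Λ ^ 2) = 8 * Λ ^ 8 by ring]
        linarith
      calc s * (e * (eB * (4 * Λ ^ 6 * (2 * Λ ^ 2))))
          = 4 * Λ ^ 6 * (2 * Λ ^ 2) * (s * e * eB) := by ring
        _ ≤ Γ * ρ := by gcongr; exact hn.cross_le
    have b6 : frobNorm (E * (Eᵀ * (s • Δ * dl))) ≤ 6 * Γ ^ 2 * ρ := by
      have hdlΓ : frobNorm dl ≤ Γ := by
        have := hΛΓ 2 (by norm_num)
        have : 0 < Λ ^ 2 := by positivity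
        linarith
      refine (frobNorm_mul_le_of_le hn.E_le (frobNorm_mul_le_of_le hEt
        (frobNorm_mul_le_of_le crude hdlΓ))).trans ?_
      have k7 : nn * e ^ 2 ≤ ρ := by
        refine le_trans ?_ k2
        gcongr
        exact pow_le_of_le_one he0 (by linarith) two_ne_zero
      have k8 : s * e ^ 2 * e ^ 2 ≤ ρ := by
        refine le_trans ?_ hn.cube_le
        calc s * e ^ 2 * e ^ 2 = e * (s * e ^ 3) := by ring
          _ ≤ 1 * (s * e ^ 3) := by gcongr; linarith
          _ = _ := one_mul _
      calc e * (e * (2 * Γ * (s * d + nn + s * e ^ 2) * Γ))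
          = 2 * Γ ^ 2 * (s * d * e ^ 2 + nn * e ^ 2 + s * e ^ 2 * e ^ 2) := by ring
        _ ≤ 2 * Γ ^ 2 * (ρ + ρ + ρ) := by gcongr
        _ = _ := by ring
    have b7 : frobNorm ((s • (E * G)) * (Bᵀ * (Ξ - B * Hh * dv))) ≤ Γ ^ 2 * ρ := by
      refine (frobNorm_mul_le_of_le hn.noise_le (frobNorm_mul_le_of_le hBt hXi)).trans ?_
      have k9 : Λ ≤ Γ := by linarith [hΛΓ 1 (by norm_num), pow_one Λ]
      calc nn * (Λ * (222 * Λ ^ 19 * (d + e))) = Λ * (222 * Λ ^ 19) * (nn * (d + e)) := by ring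
        _ ≤ Γ * Γ * ρ := by rw [← hΓ]; gcongr; exact hn.noise_mul_le
        _ = _ := by ring
    have b8 : frobNorm ((s • (E * G) - N2) * (Bᵀ * (B * Hh * dv))) ≤ Γ * ρ := by
      refine (frobNorm_mul_le_of_le hn.approx_le (frobNorm_mul_le_of_le hBt
        (frobNorm_mul_le_of_le h.U_le hdv_le))).trans ?_
      have k9 : Λ * (Λ * Λ ^ 2) ≤ Γ := by
        have := hΛΓ 4 (by norm_num)
        have : 0 < Λ ^ 4 := by positivity
        rw [show Λ * (Λ * Λ ^ 2) = Λ ^ 4 by ring]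
        linarith
      rw [mul_comm]
      exact mul_le_mul k9 hn.g_le hg0 hΓ0.le
    have eq : s • Δ - N2 * (Bᵀ * B) * (Hh * dv)
        = s • (D * V) + s • (E * (Dᵀ * Ξ))
          + (s • (E * (Eᵀ * B * (H * dl))) + E * (Eᵀ * (s • Δ * dl)))
          + (s • (E * G)) * (Bᵀ * (Ξ - B * Hh * dv))
          + (s • (E * G) - N2) * (Bᵀ * (B * Hh * dv)) := by
      rw [← eEE, eΔ]
      simp only [Matrix.mul_sub, Matrix.sub_mul, Matrix.mul_assoc]
      abel
    rw [eq]
    refine (frobNorm_add_le_of_le (frobNorm_add_le_of_le (frobNorm_add_le_of_le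
      (frobNorm_add_le_of_le b1 b3) (frobNorm_add_le_of_le b5 b6)) b7) b8).trans ?_
    have m1 : Γ * (s * d) ≤ Γ * ρ := mul_le_mul_of_nonneg_left hn.bias_le hΓ0.le
    have m2 : Γ * ρ ≤ Γ ^ 3 * ρ := by
      refine mul_le_mul_of_nonneg_right (le_self_pow₀ hΓ1 (by norm_num)) hρ0
    have m3 : Γ ^ 2 * ρ ≤ Γ ^ 3 * ρ :=
      mul_le_mul_of_nonneg_right (pow_le_pow_right₀ hΓ1 (by norm_num)) hρ0
    linarith

set_option maxHeartbeats 800000 in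
/-- First-order approximation of the estimated intercept coefficients. -/
theorem intercept_expansion (h : PCASetup Λ B G (D + E) Hh v ℓ Bh)
    (hn : NoiseBounds s d e eB nn g ρ B G D E N2) (hδ : 208 * Λ ^ 19 * (d + e) ≤ 1)
    (hH : H = Gᵀ * ((B * Gᵀ + (D + E))ᵀ * Bh * Matrix.diagonal fun k => (ℓ k)⁻¹))
    {Γ : ℝ} (hΓ : Γ = 222 * Λ ^ 19) {a db eb N1 : p → ℝ} {fb : Fin K → ℝ}
    (ha : euclNorm a ≤ Λ) (hfb : euclNorm fb ≤ Λ) (haB : a ᵥ* B = 0) (hdb : euclNorm db ≤ d)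
    (heb : euclNorm (s • eb) ≤ nn) (hN1 : euclNorm (s • eb - N1) ≤ g)
    {GB : Matrix p (Fin K) ℝ}
    (hGB : GB = N2 * (Bᵀ * B) * (Hh * Matrix.diagonal fun k => (v k)⁻¹)) :
    euclNorm (s • ((1 - Bh * Bhᵀ) *ᵥ (a + B *ᵥ fb + db + eb) - a)
      - ((1 - B * Hh * Hhᵀ * Bᵀ) *ᵥ (N1 - (GB * Hh⁻¹) *ᵥ fb) - (B * Hh * GBᵀ) *ᵥ a))
      ≤ 120 * Γ ^ 7 * ρ := by
  obtain ⟨hΔδ, hΔGB⟩ := h.eigenvectors_expansion hn hδ hH hΓ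
  rw [← hGB] at hΔGB
  have hΛ := h.one_le
  have hΛ0 := h.pos
  have hs := hn.s_nonneg
  have hd0 : 0 ≤ d := (frobNorm_nonneg D).trans hn.D_le
  have he0 : 0 ≤ e := (frobNorm_nonneg E).trans hn.E_le
  have hnn0 : 0 ≤ nn := (frobNorm_nonneg _).trans hn.noise_le
  have hg0 : 0 ≤ g := (frobNorm_nonneg _).trans hn.approx_le
  have hρ0 : 0 ≤ ρ := hg0.trans hn.g_le
  have hpow : ∀ n ≤ 19, Λ ^ n ≤ Λ ^ 19 := fun n hn => pow_le_pow_right₀ hΛ hn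
  have hΛΓ : ∀ n ≤ 19, 222 * Λ ^ n ≤ Γ := fun n hn => by rw [hΓ]; linarith [hpow n hn]
  have hΓ1 : 1 ≤ Γ := by linarith [hΛΓ 0 (by norm_num), pow_zero Λ]
  have hΓ0 : 0 < Γ := by linarith
  have hΛle : Λ ≤ Γ := by linarith [hΛΓ 1 (by norm_num), pow_one Λ]
  obtain ⟨hδ1, hδ6⟩ := le_one_of_threshold hΛ (by linarith) hδ
  have hδ0 : 0 ≤ d + e := by linarith
  have hR : frobNorm (D + E) ≤ d + e := frobNorm_add_le_of_le hn.D_le hn.E_le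
  obtain ⟨-, hBU, hHH, -⟩ := h.consistency hR hδ6 hH
  set U := B * Hh with hU
  set Δ := Bh - B * H with hΔ
  set P := Bh * Bhᵀ with hP
  have hUle : frobNorm U ≤ Λ := h.U_le
  have hBU' : frobNorm (Bh - U) ≤ Γ * (d + e) := by
    refine hBU.trans (mul_le_mul_of_nonneg_right ?_ hδ0)
    have := hΛΓ 17 (by norm_num)
    have : 0 < Λ ^ 17 := by positivity
    linarith
  have hPU : frobNorm (P - U * Uᵀ) ≤ Γ * (d + e) := by
    have e1 : P - U * Uᵀ = Bh * (Bh - U)ᵀ + (Bh - U) * Uᵀ := by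
      rw [hP, Matrix.transpose_sub, Matrix.mul_sub, Matrix.sub_mul]; abel
    rw [e1]
    refine (frobNorm_add_le_of_le
      (frobNorm_mul_le_of_le h.Bh_le ((frobNorm_transpose _).trans_le hBU))
      (frobNorm_mul_le_of_le hBU ((frobNorm_transpose _).trans_le hUle))).trans ?_
    have := hΛΓ 18 (by norm_num)
    have h3 : 0 < Λ ^ 18 := by positivity
    calc Λ * (108 * Λ ^ 17 * (d + e)) + 108 * Λ ^ 17 * (d + e) * Λ
        = 216 * Λ ^ 18 * (d + e) := by ring
      _ ≤ Γ * (d + e) := by gcongr; linarith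
  have hGBδ : frobNorm GB * (d + e) ≤ 19 * Γ ^ 3 * ρ := by
    have e1 : GB = s • Δ - (s • Δ - GB) := by abel
    have h1 : frobNorm GB ≤ frobNorm (s • Δ) + 11 * Γ ^ 3 * ρ := by
      conv_lhs => rw [e1]
      exact frobNorm_sub_le_of_le le_rfl hΔGB
    have h2 : 11 * Γ ^ 3 * ρ * (d + e) ≤ 11 * Γ ^ 3 * ρ :=
      mul_le_of_le_one_right (by positivity) hδ1
    have h3 : 8 * Γ ^ 2 * ρ ≤ 8 * Γ ^ 3 * ρ := by gcongr; norm_num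
    have h4 := mul_le_mul_of_nonneg_right h1 hδ0
    rw [add_mul] at h4
    linarith
  have hN1δ : euclNorm N1 * (d + e) ≤ 2 * ρ := by
    have e1 : N1 = s • eb - (s • eb - N1) := by abel
    have h1 : euclNorm N1 ≤ nn + g := by
      conv_lhs => rw [e1]
      exact euclNorm_sub_le_of_le heb hN1
    have h2 : g * (d + e) ≤ g := mul_le_of_le_one_right hg0 hδ1
    have h4 := mul_le_mul_of_nonneg_right h1 hδ0
    rw [add_mul] at h4
    linarith [hn.noise_mul_le, hn.g_le]
  have hBP : ∀ {κ : Type} [Fintype κ] {Y : Matrix p κ ℝ} {y : ℝ}, frobNorm Y ≤ y →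
      frobNorm ((1 - P) * Y) ≤ 2 * Λ ^ 2 * y := fun hY =>
    frobNorm_one_sub_mul_le hΛ h.Bh_le h.Bh_le hY
  have hBPv : ∀ {x : p → ℝ} {y : ℝ}, euclNorm x ≤ y →
      euclNorm ((1 - P) *ᵥ x) ≤ 2 * Λ ^ 2 * y := fun hY =>
    euclNorm_one_sub_mulVec_le hΛ h.Bh_le h.Bh_le hY
  have hHi : Hh * Hh⁻¹ = 1 := by rw [h.inv_eq]; exact h.right_inv
  have hHi_le := h.inv_le
  have h2Λ : 2 * Λ ^ 2 ≤ Γ := by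
    have := hΛΓ 2 (by norm_num)
    have : 0 < Λ ^ 2 := by positivity
    linarith
  have hΛ2 : Λ ^ 2 ≤ Γ := by linarith [pow_pos hΛ0 2]
  have hHiΓ : frobNorm Hh⁻¹ ≤ Γ := hHi_le.trans hΛ2
  -- the annihilated loadings
  set L := (1 - P) * B with hL
  have hPBh : (1 - P) * Bh = 0 := by
    rw [hP, Matrix.sub_mul, Matrix.one_mul, Matrix.mul_assoc, h.Bh_orth, Matrix.mul_one, sub_self]
  have eL : L = L * ((Hh - H) * Hh⁻¹) - (1 - P) * (Δ * Hh⁻¹) := by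
    have h1 : L * H = -((1 - P) * Δ) := by
      rw [hΔ, Matrix.mul_sub, hPBh, zero_sub, neg_neg, hL, Matrix.mul_assoc]
    have h2 : L = L * Hh * Hh⁻¹ := by rw [Matrix.mul_assoc, hHi, Matrix.mul_one]
    have h3 : L * ((Hh - H) * Hh⁻¹) = L * Hh * Hh⁻¹ - L * H * Hh⁻¹ := by
      simp only [Matrix.sub_mul, Matrix.mul_sub, Matrix.mul_assoc]
    rw [h3, ← h2, h1, Matrix.neg_mul, Matrix.mul_assoc, sub_neg_eq_add, add_sub_cancel_right]
  have hHdiff : frobNorm (Hh - H) ≤ 104 * Λ ^ 17 * (d + e) := by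
    rw [frobNorm_sub_rev]; exact hHH
  have hLle : frobNorm L ≤ 4 * Λ ^ 4 * frobNorm Δ := by
    have h1 : frobNorm L ≤ frobNorm L * (104 * Λ ^ 17 * (d + e) * Λ ^ 2)
        + 2 * Λ ^ 2 * (frobNorm Δ * Λ ^ 2) := by
      conv_lhs => rw [eL]
      exact frobNorm_sub_le_of_le (frobNorm_mul_le_of_le le_rfl
        (frobNorm_mul_le_of_le hHdiff hHi_le)) (hBP (frobNorm_mul_le_of_le le_rfl hHi_le))
    have h2 : 104 * Λ ^ 17 * (d + e) * Λ ^ 2 ≤ 1 / 2 := by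
      rw [show 104 * Λ ^ 17 * (d + e) * Λ ^ 2 = (208 * Λ ^ 19 * (d + e)) / 2 by ring]
      linarith
    have h3 := mul_le_mul_of_nonneg_left h2 (frobNorm_nonneg L)
    rw [show 4 * Λ ^ 4 * frobNorm Δ = 2 * (2 * Λ ^ 2 * (frobNorm Δ * Λ ^ 2)) by ring]
    linarith
  have hsL : frobNorm (s • (L * ((Hh - H) * Hh⁻¹))) ≤ 32 * Γ ^ 5 * ρ := by
    have h1 : frobNorm (s • L) ≤ 4 * Λ ^ 4 * frobNorm (s • Δ) := by
      rw [frobNorm_smul, frobNorm_smul]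
      exact (mul_le_mul_of_nonneg_left hLle (abs_nonneg s)).trans_eq (by ring)
    rw [← Matrix.smul_mul]
    refine (frobNorm_mul_le_of_le h1 (frobNorm_mul_le_of_le hHdiff hHi_le)).trans ?_
    have h4 : Λ ^ 4 ≤ Γ := by
      have := hΛΓ 4 (by norm_num)
      have : 0 < Λ ^ 4 := by positivity
      linarith
    have h5 : 104 * Λ ^ 17 ≤ Γ := by
      have := hΛΓ 17 (by norm_num)
      have : 0 < Λ ^ 17 := by positivity
      linarith
    have h6 := frobNorm_nonneg (s • Δ)
    calc 4 * Λ ^ 4 * frobNorm (s • Δ) * (104 * Λ ^ 17 * (d + e) * Λ ^ 2)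
        = 4 * Λ ^ 4 * (104 * Λ ^ 17) * Λ ^ 2 * (frobNorm (s • Δ) * (d + e)) := by ring
      _ ≤ 4 * Γ * Γ * Γ * (8 * Γ ^ 2 * ρ) := by gcongr
      _ = _ := by ring
  -- the three pieces of the expansion
  have hBha : Bhᵀ *ᵥ a = Δᵀ *ᵥ a := by
    have h1 : Bᵀ *ᵥ a = 0 := by rw [Matrix.mulVec_transpose, haB]
    rw [hΔ, Matrix.transpose_sub, Matrix.sub_mulVec, Matrix.transpose_mul, ← Matrix.mulVec_mulVec,
      h1, Matrix.mulVec_zero, sub_zero]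
  have t1 : euclNorm ((Bh * (s • Δ - GB)ᵀ + (Bh - U) * GBᵀ) *ᵥ a) ≤ 30 * Γ ^ 5 * ρ := by
    have h1 : frobNorm (Bh * (s • Δ - GB)ᵀ) ≤ Γ * (11 * Γ ^ 3 * ρ) :=
      frobNorm_mul_le_of_le (h.Bh_le.trans hΛle) ((frobNorm_transpose _).trans_le hΔGB)
    have h2 : frobNorm ((Bh - U) * GBᵀ) ≤ Γ * (19 * Γ ^ 3 * ρ) := by
      refine (frobNorm_mul_le_of_le hBU' ((frobNorm_transpose GB).le)).trans ?_
      calc Γ * (d + e) * frobNorm GB = Γ * (frobNorm GB * (d + e)) := by ring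
        _ ≤ _ := by gcongr
    exact (euclNorm_mulVec_le_of_le (frobNorm_add_le_of_le h1 h2) (ha.trans hΛle)).trans_eq
      (by ring)
  have t2 : euclNorm ((1 - P) *ᵥ (s • eb - N1) - (P - U * Uᵀ) *ᵥ N1) ≤ 3 * Γ * ρ := by
    have h1 : euclNorm ((1 - P) *ᵥ (s • eb - N1)) ≤ Γ * ρ :=
      (hBPv (hN1.trans hn.g_le)).trans (mul_le_mul_of_nonneg_right h2Λ hρ0)
    have h2 : euclNorm ((P - U * Uᵀ) *ᵥ N1) ≤ Γ * (2 * ρ) := by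
      refine (euclNorm_mulVec_le_of_le hPU le_rfl).trans ?_
      calc Γ * (d + e) * euclNorm N1 = Γ * (euclNorm N1 * (d + e)) := by ring
        _ ≤ _ := by gcongr
    exact (euclNorm_sub_le_of_le h1 h2).trans_eq (by ring)
  have t3 : euclNorm ((1 - P) *ᵥ (s • db)) ≤ Γ * ρ := by
    have h1 : euclNorm (s • db) ≤ ρ := by
      rw [euclNorm_smul, abs_of_nonneg hs]
      exact (mul_le_mul_of_nonneg_left hdb hs).trans hn.bias_le
    exact (hBPv h1).trans (mul_le_mul_of_nonneg_right h2Λ hρ0)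
  have t4 : euclNorm ((s • (L * ((Hh - H) * Hh⁻¹)) + ((P - U * Uᵀ) * GB * Hh⁻¹)
      - (1 - P) * ((s • Δ - GB) * Hh⁻¹)) *ᵥ fb) ≤ 62 * Γ ^ 6 * ρ := by
    have h1 : frobNorm ((P - U * Uᵀ) * GB * Hh⁻¹) ≤ 19 * Γ ^ 5 * ρ := by
      refine (frobNorm_mul_le_of_le (frobNorm_mul_le_of_le hPU le_rfl) hHiΓ).trans ?_
      calc Γ * (d + e) * frobNorm GB * Γ = Γ * (frobNorm GB * (d + e)) * Γ := by ring
        _ ≤ Γ * (19 * Γ ^ 3 * ρ) * Γ := by gcongr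
        _ = _ := by ring
    have h2 : frobNorm ((1 - P) * ((s • Δ - GB) * Hh⁻¹)) ≤ 11 * Γ ^ 5 * ρ := by
      refine (hBP (frobNorm_mul_le_of_le hΔGB hHiΓ)).trans ?_
      calc 2 * Λ ^ 2 * (11 * Γ ^ 3 * ρ * Γ) ≤ Γ * (11 * Γ ^ 3 * ρ * Γ) := by gcongr
        _ = _ := by ring
    exact (euclNorm_mulVec_le_of_le (frobNorm_sub_le_of_le (frobNorm_add_le_of_le hsL h1) h2)
      (hfb.trans hΛle)).trans_eq (by ring)
  have sL : s • L = s • (L * ((Hh - H) * Hh⁻¹)) - (1 - P) * (s • Δ * Hh⁻¹) := by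
    conv_lhs => rw [eL]
    rw [smul_sub, Matrix.smul_mul, Matrix.mul_smul (1 - P)]
  have eq : s • ((1 - P) *ᵥ (a + B *ᵥ fb + db + eb) - a)
      - ((1 - B * Hh * Hhᵀ * Bᵀ) *ᵥ (N1 - (GB * Hh⁻¹) *ᵥ fb) - (B * Hh * GBᵀ) *ᵥ a)
      = ((1 - P) *ᵥ (s • eb - N1) - (P - U * Uᵀ) *ᵥ N1) + (1 - P) *ᵥ (s • db)
        + ((s • (L * ((Hh - H) * Hh⁻¹)) + ((P - U * Uᵀ) * GB * Hh⁻¹)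
          - (1 - P) * ((s • Δ - GB) * Hh⁻¹)) *ᵥ fb)
        - (Bh * (s • Δ - GB)ᵀ + (Bh - U) * GBᵀ) *ᵥ a := by
    have e1 : B * Hh * Hhᵀ * Bᵀ = U * Uᵀ := by
      rw [hU, Matrix.transpose_mul, ← Matrix.mul_assoc]
    have e2 : (s • (L * ((Hh - H) * Hh⁻¹)) + ((P - U * Uᵀ) * GB * Hh⁻¹)
          - (1 - P) * ((s • Δ - GB) * Hh⁻¹)) = s • L + (1 - U * Uᵀ) * (GB * Hh⁻¹) := by
      rw [sL]
      simp only [Matrix.sub_mul, Matrix.mul_sub, Matrix.one_mul, Matrix.mul_assoc]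
      abel
    have e3 : (Bh * (s • Δ - GB)ᵀ + (Bh - U) * GBᵀ) *ᵥ a
        = s • (P *ᵥ a) - (U * GBᵀ) *ᵥ a := by
      rw [hP, ← Matrix.mulVec_mulVec a Bh, hBha]
      simp only [Matrix.transpose_sub, Matrix.transpose_smul, Matrix.mul_sub, Matrix.sub_mul,
        Matrix.add_mulVec, Matrix.sub_mulVec, Matrix.mul_smul, Matrix.smul_mulVec,
        Matrix.mulVec_mulVec]
      abel
    rw [e1, e2, e3, ← hU]
    simp only [hL, Matrix.mulVec_add, Matrix.mulVec_sub, Matrix.sub_mulVec, Matrix.add_mulVec,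
      Matrix.one_mulVec, Matrix.smul_mulVec, Matrix.mulVec_smul, Matrix.mulVec_mulVec,
      Matrix.sub_mul, Matrix.one_mul, smul_add, smul_sub]
    abel
  rw [eq]
  refine (euclNorm_sub_le_of_le (euclNorm_add_le_of_le (euclNorm_add_le_of_le t2 t3) t4)
    t1).trans ?_
  have m1 : Γ * ρ ≤ Γ ^ 7 * ρ :=
    mul_le_mul_of_nonneg_right (le_self_pow₀ hΓ1 (by norm_num)) hρ0
  have m2 : Γ ^ 6 * ρ ≤ Γ ^ 7 * ρ :=
    mul_le_mul_of_nonneg_right (pow_le_pow_right₀ hΓ1 (by norm_num)) hρ0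
  have m3 : Γ ^ 5 * ρ ≤ Γ ^ 7 * ρ :=
    mul_le_mul_of_nonneg_right (pow_le_pow_right₀ hΓ1 (by norm_num)) hρ0
  linarith [mul_nonneg (pow_nonneg hΓ0.le 7) hρ0]

end PCASetup

end Expansion

/-! ### Spectral bounds as quadratic form bounds -/

section Spectral

variable {ι : Type*} [Fintype ι] [DecidableEq ι]

theorem isHermitian_iff_transpose_eq {S : Matrix ι ι ℝ} : S.IsHermitian ↔ Sᵀ = S := by
  rw [Matrix.IsHermitian, Matrix.conjTranspose_eq_transpose_of_trivial]

theorem mem_spectrum_of_mulVec {S : Matrix ι ι ℝ} {x : ι → ℝ} {μ : ℝ} (hx : x ≠ 0)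
    (h : S *ᵥ x = μ • x) : μ ∈ spectrum ℝ S := by
  rw [← Matrix.spectrum_toLin']
  refine Module.End.HasEigenvalue.mem_spectrum (Module.End.hasEigenvalue_of_hasEigenvector
    (x := x) ⟨?_, hx⟩)
  rw [Module.End.mem_eigenspace_iff, Matrix.toLin'_apply, h]

theorem posSemidef_sub_smul_one {S : Matrix ι ι ℝ} (hS : S.IsHermitian) {c : ℝ}
    (h : spectrum ℝ S ⊆ Set.Ici c) : (S - c • (1 : Matrix ι ι ℝ)).PosSemidef := by
  have hh : (S - c • (1 : Matrix ι ι ℝ)).IsHermitian := by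
    rw [isHermitian_iff_transpose_eq] at hS ⊢
    rw [Matrix.transpose_sub, hS, Matrix.transpose_smul, Matrix.transpose_one]
  rw [hh.posSemidef_iff_eigenvalues_nonneg]
  intro i
  have hu := hh.mulVec_eigenvectorBasis i
  have hu0 : (⇑(hh.eigenvectorBasis i) : ι → ℝ) ≠ 0 := by
    intro h0
    apply hh.eigenvectorBasis.toBasis.ne_zero i
    ext j
    simpa using congrFun h0 j
  rw [Matrix.sub_mulVec, Matrix.smul_mulVec, Matrix.one_mulVec, sub_eq_iff_eq_add,
    ← add_smul] at hu
  have := h (mem_spectrum_of_mulVec hu0 hu)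
  simp only [Set.mem_Ici] at this
  simp only [Pi.zero_apply]
  linarith

theorem le_quadForm_of_posSemidef {S : Matrix ι ι ℝ} {c : ℝ}
    (h : (S - c • (1 : Matrix ι ι ℝ)).PosSemidef) (x : ι → ℝ) :
    c * (x ⬝ᵥ x) ≤ x ⬝ᵥ S *ᵥ x := by
  have := h.dotProduct_mulVec_nonneg x
  rw [star_trivial, Matrix.sub_mulVec, dotProduct_sub, Matrix.smul_mulVec, Matrix.one_mulVec,
    dotProduct_smul, smul_eq_mul] at this
  linarith

theorem trace_le_of_spectrum_subset {S : Matrix ι ι ℝ} (hS : S.IsHermitian) {C : ℝ}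
    (h : spectrum ℝ S ⊆ Set.Iic C) : S.trace ≤ Fintype.card ι * C := by
  rw [hS.trace_eq_sum_eigenvalues]
  refine (Finset.sum_le_sum fun i _ => h (hS.eigenvalues_mem_spectrum_real i)).trans_eq ?_
  simp

theorem isHermitian_transpose_mul_self' {κ : Type*} [Fintype κ] (A : Matrix κ ι ℝ) :
    (Aᵀ * A).IsHermitian := by
  rw [isHermitian_iff_transpose_eq, Matrix.transpose_mul, Matrix.transpose_transpose]

theorem posSemidef_transpose_mul_self {κ : Type*} [Fintype κ] (A : Matrix κ ι ℝ) :
    (Aᵀ * A).PosSemidef := by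
  have := Matrix.posSemidef_conjTranspose_mul_self A
  rwa [Matrix.conjTranspose_eq_transpose_of_trivial] at this

end Spectral

/-! ### The centering matrix -/

section Centering

variable {T : ℕ}

theorem centering_transpose : (centering T)ᵀ = centering T := by
  ext i j
  simp [centering, Matrix.one_apply, eq_comm]

theorem centering_apply_sum (x : Fin T → ℝ) (t : Fin T) :
    ∑ s, x s * centering T s t = x t - (1 / (T : ℝ)) * ∑ s, x s := by
  have h : ∀ s, x s * centering T s t = (if s = t then x s else 0) - (1 / (T : ℝ)) * x s := by
    intro s
    rw [centering, Matrix.sub_apply, Matrix.smul_apply, Matrix.of_apply, Matrix.one_apply]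
    split_ifs <;> simp <;> ring
  simp [h, Finset.sum_sub_distrib, Finset.mul_sum]

theorem centering_mul_self (hT : T ≠ 0) : centering T * centering T = centering T := by
  ext i j
  rw [Matrix.mul_apply, centering_apply_sum (fun s => centering T i s)]
  have h1 : ∑ s, centering T i s = 0 := by
    have hT' : (T : ℝ) ≠ 0 := by exact_mod_cast hT
    simp [centering, Matrix.one_apply, Finset.sum_sub_distrib, hT']
  rw [h1, mul_zero, sub_zero]

theorem frobNorm_mul_centering_le {ι : Type*} [Fintype ι] (hT : T ≠ 0)
    (X : Matrix ι (Fin T) ℝ) : frobNorm (X * centering T) ≤ frobNorm X := by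
  have hT' : (T : ℝ) ≠ 0 := by exact_mod_cast hT
  refine abs_le_of_sq_le_sq' ?_ (frobNorm_nonneg _) |>.2
  rw [frobNorm_sq, frobNorm_sq]
  refine Finset.sum_le_sum fun i _ => ?_
  simp only [Matrix.mul_apply, centering_apply_sum]
  set m := (1 / (T : ℝ)) * ∑ s, X i s with hm
  have h1 : ∑ s, X i s = T * m := by rw [hm]; field_simp
  have h2 : ∑ t, (X i t - m) ^ 2 = ∑ t, X i t ^ 2 - T * m ^ 2 := by
    have : ∀ t, (X i t - m) ^ 2 = X i t ^ 2 - 2 * m * X i t + m ^ 2 := fun t => by ring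
    simp only [this, Finset.sum_add_distrib, Finset.sum_sub_distrib, ← Finset.mul_sum, h1]
    simp
    ring
  rw [h2]
  have : 0 ≤ (T : ℝ) * m ^ 2 := by positivity
  linarith

end Centering

/-! ### The estimators in terms of the sieve bias and the noise -/

namespace FactorModel

variable {M K : ℕ} {Ω : Type u} (D : FactorModel M K Ω)

/-- The sieve approximation error of the systematic part of `y_it`. -/
def sieveError (i : Fin D.N) (t : Fin D.T) (ω : Ω) : ℝ :=
  (∑ m, D.r m (D.z i t ω m)) + ∑ k, (∑ m, D.δ k m (D.z i t ω m)) * D.f t k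

/-- The columns are the least squares coefficients of the sieve errors. -/
def biasMat (ω : Ω) : Matrix (Fin M × Fin D.J) (Fin D.T) ℝ :=
  Matrix.of fun p t =>
    (((D.Phi t ω)ᵀ * D.Phi t ω)⁻¹ *ᵥ ((D.Phi t ω)ᵀ *ᵥ fun i => D.sieveError i t ω)) p

/-- The columns are the least squares coefficients of the idiosyncratic errors. -/
def noiseMat (ω : Ω) : Matrix (Fin M × Fin D.J) (Fin D.T) ℝ :=
  Matrix.of fun p t =>
    (((D.Phi t ω)ᵀ * D.Phi t ω)⁻¹ *ᵥ ((D.Phi t ω)ᵀ *ᵥ fun i => D.ε i t ω)) p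

/-- The normalized sum of the noise weighted with `f†_t`. -/
def noiseScore (ω : Ω) : Matrix (Fin M × Fin D.J) (Fin (K + 1)) ℝ :=
  Matrix.of fun p k => Real.sqrt D.N / Real.sqrt D.T * ∑ t, D.noiseMat ω p t * D.fdag t k

/-- Normalized centered factors. -/
def Gmat : Matrix (Fin D.T) (Fin K) ℝ := (1 / Real.sqrt D.T) • (centering D.T * D.F)

theorem y_eq (i : Fin D.N) (t : Fin D.T) (ω : Ω) :
    D.y i t ω = (D.Phi t ω *ᵥ (D.a + D.B *ᵥ D.f t)) i + D.sieveError i t ω + D.ε i t ω := by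
  have h1 : (D.Phi t ω *ᵥ (D.a + D.B *ᵥ D.f t)) i
      = ∑ m, ∑ j, D.a (m, j) * D.φ j (D.z i t ω m)
        + ∑ k, (∑ m, ∑ j, D.B (m, j) k * D.φ j (D.z i t ω m)) * D.f t k := by
    have h2 : ∀ m j, D.Phi t ω i (m, j) = D.φ j (D.z i t ω m) := fun _ _ => rfl
    rw [Matrix.mulVec_add, Matrix.mulVec_mulVec, Pi.add_apply, Matrix.mulVec, dotProduct,
      Fintype.sum_prod_type, Matrix.mulVec, dotProduct]
    congr 1
    · exact Finset.sum_congr rfl fun m _ => Finset.sum_congr rfl fun j _ => by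
        rw [h2, mul_comm]
    · refine Finset.sum_congr rfl fun k _ => ?_
      rw [Matrix.mul_apply, Fintype.sum_prod_type]
      congr 1
      exact Finset.sum_congr rfl fun m _ => Finset.sum_congr rfl fun j _ => by
        rw [h2, mul_comm]
  rw [h1, y, sieveError]
  simp only [r, δ, Finset.sum_sub_distrib, sub_mul]
  ring

theorem Ytilde_eq {ω : Ω} {t : Fin D.T} (h : IsUnit ((D.Phi t ω)ᵀ * D.Phi t ω).det)
    (p : Fin M × Fin D.J) :
    D.Ytilde ω p t = D.a p + (D.B *ᵥ D.f t) p + D.biasMat ω p t + D.noiseMat ω p t := by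
  have h1 : (fun i => D.y i t ω) = D.Phi t ω *ᵥ (D.a + D.B *ᵥ D.f t)
      + (fun i => D.sieveError i t ω) + fun i => D.ε i t ω := by
    ext i; exact D.y_eq i t ω
  simp only [Ytilde, biasMat, noiseMat, Matrix.of_apply]
  rw [h1, Matrix.mulVec_add, Matrix.mulVec_add, Matrix.mulVec_add, Matrix.mulVec_add,
    Matrix.mulVec_mulVec, Matrix.mulVec_mulVec, Matrix.mul_assoc, Matrix.nonsing_inv_mul _ h,
    Matrix.one_mulVec]
  rfl

theorem Ybar_eq {ω : Ω} (hT : D.T ≠ 0) (h : ∀ t, IsUnit ((D.Phi t ω)ᵀ * D.Phi t ω).det) :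
    D.Ybar ω = D.a + D.B *ᵥ D.fbar + (fun p => (1 / (D.T : ℝ)) * ∑ t, D.biasMat ω p t)
      + fun p => (1 / (D.T : ℝ)) * ∑ t, D.noiseMat ω p t := by
  have hT' : (D.T : ℝ) ≠ 0 := by exact_mod_cast hT
  ext p
  have h1 : (D.B *ᵥ D.fbar) p = (1 / (D.T : ℝ)) * ∑ t, (D.B *ᵥ D.f t) p := by
    rw [fbar, Matrix.mulVec_smul, Matrix.mulVec_sum, Pi.smul_apply, Finset.sum_apply, smul_eq_mul]
  simp only [Ybar, Pi.add_apply, h1]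
  simp only [fun t => D.Ytilde_eq (h t) p, Finset.sum_add_distrib, mul_add]
  simp [hT']

theorem centered_Ytilde_eq {ω : Ω} (hT : D.T ≠ 0)
    (h : ∀ t, IsUnit ((D.Phi t ω)ᵀ * D.Phi t ω).det) :
    (1 / Real.sqrt D.T) • (D.Ytilde ω * centering D.T)
      = D.B * D.Gmatᵀ + ((1 / Real.sqrt D.T) • (D.biasMat ω * centering D.T)
        + (1 / Real.sqrt D.T) • (D.noiseMat ω * centering D.T)) := by
  have hT' : (D.T : ℝ) ≠ 0 := by exact_mod_cast hT
  have h1 : D.Ytilde ω = Matrix.of (fun p _ => D.a p) + D.B * D.Fᵀ + D.biasMat ω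
      + D.noiseMat ω := by
    ext p t
    rw [D.Ytilde_eq (h t) p]
    rfl
  have h2 : (Matrix.of fun p _ => D.a p : Matrix (Fin M × Fin D.J) (Fin D.T) ℝ) * centering D.T
      = 0 := by
    ext p t
    rw [Matrix.mul_apply, centering_apply_sum
      (fun s => (Matrix.of fun p _ => D.a p : Matrix (Fin M × Fin D.J) (Fin D.T) ℝ) p s)]
    simp [hT']
  rw [h1, Matrix.add_mul, Matrix.add_mul, Matrix.add_mul, h2, zero_add, smul_add, smul_add,
    Gmat, Matrix.transpose_smul, Matrix.transpose_mul, centering_transpose, Matrix.mul_smul,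
    Matrix.mul_assoc, add_assoc]

theorem pcaMatrix_eq (ω : Ω) (hT : D.T ≠ 0) :
    D.pcaMatrix ω = ((1 / Real.sqrt D.T) • (D.Ytilde ω * centering D.T))
      * ((1 / Real.sqrt D.T) • (D.Ytilde ω * centering D.T))ᵀ := by
  have h1 : 1 / (D.T : ℝ) = (1 / Real.sqrt D.T) * (1 / Real.sqrt D.T) := by
    rw [one_div_mul_one_div, Real.mul_self_sqrt (Nat.cast_nonneg _)]
  rw [pcaMatrix, Matrix.transpose_smul, Matrix.transpose_mul, centering_transpose,
    Matrix.smul_mul, Matrix.mul_smul, smul_smul, ← h1, Matrix.mul_assoc (D.Ytilde ω) _ (_ * _),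
    ← Matrix.mul_assoc (centering D.T), centering_mul_self hT, Matrix.mul_assoc]

theorem SigmaF_eq (hT : D.T ≠ 0) : D.SigmaF = D.Gmatᵀ * D.Gmat := by
  have h1 : 1 / (D.T : ℝ) = (1 / Real.sqrt D.T) * (1 / Real.sqrt D.T) := by
    rw [one_div_mul_one_div, Real.mul_self_sqrt (Nat.cast_nonneg _)]
  rw [SigmaF, Gmat, Matrix.transpose_smul, Matrix.transpose_mul, centering_transpose,
    Matrix.smul_mul, Matrix.mul_smul, smul_smul, ← h1, Matrix.mul_assoc (D.Fᵀ) _ (_ * _),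
    ← Matrix.mul_assoc (centering D.T), centering_mul_self hT, Matrix.mul_assoc]

theorem H_eq {ω : Ω} (hT : D.T ≠ 0) {Bh : Matrix (Fin M × Fin D.J) (Fin K) ℝ} {ℓ : Fin K → ℝ}
    (hBh : Bhᵀ * Bh = 1) (hW : D.pcaMatrix ω * Bh = Bh * Matrix.diagonal ℓ) (hℓ : ∀ k, 0 < ℓ k) :
    D.H Bh ω = D.Gmatᵀ * (((1 / Real.sqrt D.T) • (D.Ytilde ω * centering D.T))ᵀ * Bh
      * Matrix.diagonal fun k => (ℓ k)⁻¹) := by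
  have hT' : (D.T : ℝ) ≠ 0 := by exact_mod_cast hT
  have h1 : 1 / (D.T : ℝ) = (1 / Real.sqrt D.T) * (1 / Real.sqrt D.T) := by
    rw [one_div_mul_one_div, Real.mul_self_sqrt (Nat.cast_nonneg _)]
  have h2 : (D.Fhat Bh ω)ᵀ * centering D.T * D.Fhat Bh ω
      = (D.T : ℝ) • Matrix.diagonal ℓ := by
    have : (D.Fhat Bh ω)ᵀ * centering D.T * D.Fhat Bh ω
        = (D.T : ℝ) • (Bhᵀ * (D.pcaMatrix ω * Bh)) := by
      rw [Fhat, pcaMatrix, Matrix.transpose_mul, Matrix.transpose_transpose, Matrix.smul_mul,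
        Matrix.mul_smul, smul_smul, mul_one_div_cancel hT', one_smul]
      simp only [Matrix.mul_assoc]
    rw [this, hW, ← Matrix.mul_assoc, hBh, Matrix.one_mul]
  have h3 : ((D.T : ℝ) • Matrix.diagonal ℓ)⁻¹
      = (1 / (D.T : ℝ)) • Matrix.diagonal fun k => (ℓ k)⁻¹ := by
    refine Matrix.inv_eq_left_inv ?_
    rw [Matrix.smul_mul, Matrix.mul_smul, smul_smul, one_div_mul_cancel hT', one_smul,
      Matrix.diagonal_mul_diagonal]
    simp [inv_mul_cancel₀ (hℓ _).ne']
  rw [H, h2, h3, Gmat, Matrix.mul_smul, Matrix.transpose_smul, Matrix.transpose_smul,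
    Matrix.transpose_mul, Matrix.transpose_mul, centering_transpose, Fhat, Matrix.smul_mul,
    Matrix.smul_mul, Matrix.smul_mul, Matrix.mul_smul, smul_smul, h1]
  congr 1
  have h4 : centering D.T * (centering D.T * (D.Ytilde ω)ᵀ) = centering D.T * (D.Ytilde ω)ᵀ := by
    rw [← Matrix.mul_assoc, centering_mul_self hT]
  simp only [Matrix.mul_assoc]
  rw [← Matrix.mul_assoc (centering D.T) (centering D.T), centering_mul_self hT]

theorem fdag_succ (t : Fin D.T) (k : Fin K) : D.fdag t k.succ = D.f t k - D.fbar k := rfl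

theorem centering_mul_F_apply (t : Fin D.T) (k : Fin K) :
    (centering D.T * D.F) t k = D.fdag t k.succ := by
  have h := centering_apply_sum (fun s => D.F s k) t
  rw [Matrix.mul_apply, fdag_succ]
  have h2 : D.fbar k = (1 / (D.T : ℝ)) * ∑ s, D.F s k := by
    rw [fbar, Pi.smul_apply, Finset.sum_apply, smul_eq_mul]; rfl
  rw [h2, ← show D.F t k = D.f t k from rfl, ← h]
  refine Finset.sum_congr rfl fun s _ => ?_
  rw [mul_comm, ← Matrix.transpose_apply (centering D.T) s t, centering_transpose]

theorem noiseScore_succ (ω : Ω) (hT : D.T ≠ 0) :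
    (D.noiseScore ω).submatrix id Fin.succ = Real.sqrt (D.N * D.T) •
      ((1 / Real.sqrt D.T) • (D.noiseMat ω * centering D.T) * D.Gmat) := by
  have hT' : 0 < Real.sqrt D.T := Real.sqrt_pos.2 (by exact_mod_cast Nat.pos_of_ne_zero hT)
  rw [Gmat, Matrix.smul_mul, Matrix.mul_smul, smul_smul, smul_smul, Matrix.mul_assoc,
    ← Matrix.mul_assoc (centering D.T), centering_mul_self hT]
  ext p k
  rw [Matrix.smul_apply, Matrix.mul_apply, smul_eq_mul]
  simp only [centering_mul_F_apply, noiseScore, Matrix.submatrix_apply, Matrix.of_apply, id]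
  rw [Real.sqrt_mul (Nat.cast_nonneg _)]
  congr 1
  field_simp

theorem noiseScore_zero (ω : Ω) (hT : D.T ≠ 0) (p : Fin M × Fin D.J) :
    D.noiseScore ω p 0 = Real.sqrt (D.N * D.T) * ((1 / (D.T : ℝ)) * ∑ t, D.noiseMat ω p t) := by
  have hT' : 0 < Real.sqrt D.T := Real.sqrt_pos.2 (by exact_mod_cast Nat.pos_of_ne_zero hT)
  have h1 : (1 : ℝ) / D.T = (1 / Real.sqrt D.T) * (1 / Real.sqrt D.T) := by
    rw [one_div_mul_one_div, Real.mul_self_sqrt (Nat.cast_nonneg _)]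
  have h2 : ∀ t, D.fdag t 0 = 1 := fun _ => rfl
  simp only [noiseScore, Matrix.of_apply, h2, mul_one]
  rw [Real.sqrt_mul (Nat.cast_nonneg _), h1, ← mul_assoc]
  congr 1
  field_simp

end FactorModel

namespace FactorModel

variable {M K : ℕ} {Ω : Type u} (D : FactorModel M K Ω)

/-! ### Population eigenvalues and rotation -/

theorem SigmaF_posSemidef (hT : D.T ≠ 0) : D.SigmaF.PosSemidef := by
  rw [D.SigmaF_eq hT]; exact posSemidef_transpose_mul_self _

theorem sqrt_SigmaF_mul_self (hT : D.T ≠ 0) :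
    CFC.sqrt D.SigmaF * CFC.sqrt D.SigmaF = D.SigmaF :=
  CFC.sqrt_mul_sqrt_self _ (D.SigmaF_posSemidef hT).nonneg

theorem sqrt_SigmaF_transpose : (CFC.sqrt D.SigmaF)ᵀ = CFC.sqrt D.SigmaF :=
  isHermitian_iff_transpose_eq.1 (Matrix.nonneg_iff_posSemidef.1 (CFC.sqrt_nonneg D.SigmaF)).1

variable {D} {Υ : Matrix (Fin K) (Fin K) ℝ} {v : Fin K → ℝ} {dmin dmax : ℝ}

theorem sq_le_eigenvalue (hT : D.T ≠ 0) (hd : 0 < dmin)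
    (hB : spectrum ℝ (D.Bᵀ * D.B) ⊆ Set.Ici dmin) (hF : spectrum ℝ D.SigmaF ⊆ Set.Ici dmin)
    (hΥ : IsSpectralDecomposition D.spectralMatrix Υ v) (k : Fin K) : dmin ^ 2 ≤ v k := by
  set S := CFC.sqrt D.SigmaF with hS
  have hSt : Sᵀ = S := D.sqrt_SigmaF_transpose
  set x : Fin K → ℝ := Υ *ᵥ Pi.single k 1 with hx
  have hxx : x ⬝ᵥ x = 1 := by
    rw [hx, dotProduct_mulVec_of_orthonormal hΥ.1]; simp
  have hv : x ⬝ᵥ D.spectralMatrix *ᵥ x = v k := by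
    rw [hx, quadForm_of_eigenvectors hΥ.1 hΥ.2.2]
    simp [Pi.single_apply]
  have h1 : x ⬝ᵥ D.spectralMatrix *ᵥ x = (S *ᵥ x) ⬝ᵥ (D.Bᵀ * D.B) *ᵥ (S *ᵥ x) := by
    rw [spectralMatrix, ← Matrix.mulVec_mulVec, ← Matrix.mulVec_mulVec, Matrix.dotProduct_mulVec,
      ← Matrix.mulVec_transpose, hSt]
  have h2 : (S *ᵥ x) ⬝ᵥ (S *ᵥ x) = x ⬝ᵥ D.SigmaF *ᵥ x := by
    rw [← D.sqrt_SigmaF_mul_self hT, ← Matrix.mulVec_mulVec, Matrix.dotProduct_mulVec x,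
      ← Matrix.mulVec_transpose, hSt]
  have h3 := le_quadForm_of_posSemidef
    (posSemidef_sub_smul_one (isHermitian_transpose_mul_self' D.B) hB) (S *ᵥ x)
  have h4 := le_quadForm_of_posSemidef
    (posSemidef_sub_smul_one (D.SigmaF_posSemidef hT).1 hF) x
  rw [h2, ← h1, hv] at h3
  rw [hxx, mul_one] at h4
  nlinarith

theorem limH_gram (hT : D.T ≠ 0) (hΥ : IsSpectralDecomposition D.spectralMatrix Υ v)
    (hv : ∀ k, 0 < v k) :
    D.SigmaF = D.limH Υ v * Matrix.diagonal v * (D.limH Υ v)ᵀ := by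
  have h1 : Matrix.diagonal (fun k => (Real.sqrt (v k))⁻¹) * Matrix.diagonal v
      * Matrix.diagonal (fun k => (Real.sqrt (v k))⁻¹) = 1 := by
    rw [Matrix.diagonal_mul_diagonal, Matrix.diagonal_mul_diagonal, ← Matrix.diagonal_one]
    congr 1; ext k
    have := Real.sqrt_pos.2 (hv k)
    have h2 := Real.mul_self_sqrt (hv k).le
    field_simp
    linarith
  have h2 : Υ * Υᵀ = 1 := mul_eq_one_comm.1 hΥ.1
  rw [limH, Matrix.transpose_mul, Matrix.transpose_mul, Matrix.diagonal_transpose,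
    D.sqrt_SigmaF_transpose]
  calc D.SigmaF = CFC.sqrt D.SigmaF * (Υ * 1 * Υᵀ) * CFC.sqrt D.SigmaF := by
        rw [Matrix.mul_one, h2, Matrix.mul_one, D.sqrt_SigmaF_mul_self hT]
    _ = _ := by rw [← h1]; simp only [Matrix.mul_assoc]

theorem limH_orth (hΥ : IsSpectralDecomposition D.spectralMatrix Υ v)
    (hv : ∀ k, 0 < v k) : (D.B * D.limH Υ v)ᵀ * (D.B * D.limH Υ v) = 1 := by
  have h1 : Matrix.diagonal (fun k => (Real.sqrt (v k))⁻¹) * Matrix.diagonal v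
      * Matrix.diagonal (fun k => (Real.sqrt (v k))⁻¹) = 1 := by
    rw [Matrix.diagonal_mul_diagonal, Matrix.diagonal_mul_diagonal, ← Matrix.diagonal_one]
    congr 1; ext k
    have := Real.sqrt_pos.2 (hv k)
    have h2 := Real.mul_self_sqrt (hv k).le
    field_simp
    linarith
  have h2 : Υᵀ * (D.spectralMatrix * Υ) = Matrix.diagonal v := by
    rw [hΥ.2.2, ← Matrix.mul_assoc, hΥ.1, Matrix.one_mul]
  rw [← h1, ← h2, limH, spectralMatrix]
  simp only [Matrix.transpose_mul, Matrix.diagonal_transpose, D.sqrt_SigmaF_transpose,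
    Matrix.mul_assoc]

theorem eigenvalue_gap (hT : D.T ≠ 0) (hΥ : IsSpectralDecomposition D.spectralMatrix Υ v)
    (hv : ∀ k, 0 < v k) {c : ℝ}
    (hcard : (spectrum ℝ (D.SigmaF * (D.Bᵀ * D.B))).ncard = K)
    (hgap : (spectrum ℝ (D.SigmaF * (D.Bᵀ * D.B))).Pairwise fun x y => c ≤ |x - y|)
    {j k : Fin K} (hjk : j ≠ k) : c ≤ |v j - v k| := by
  have h1 : D.limH Υ v * ((D.B * D.limH Υ v)ᵀ * D.B) = 1 :=
    mul_eq_one_comm.1 (by rw [Matrix.mul_assoc]; exact limH_orth hΥ hv)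
  have h2 : ((D.B * D.limH Υ v)ᵀ * D.B) * D.limH Υ v = 1 := mul_eq_one_comm.1 h1
  let U : (Matrix (Fin K) (Fin K) ℝ)ˣ := ⟨D.limH Υ v, _, h1, h2⟩
  have h3 : spectrum ℝ (D.SigmaF * (D.Bᵀ * D.B)) = Set.range v := by
    have h4 : D.SigmaF * (D.Bᵀ * D.B) = (U : Matrix (Fin K) (Fin K) ℝ) * Matrix.diagonal v
        * ((U⁻¹ : (Matrix (Fin K) (Fin K) ℝ)ˣ) : Matrix (Fin K) (Fin K) ℝ) := by
      change D.SigmaF * (D.Bᵀ * D.B) = D.limH Υ v * Matrix.diagonal v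
        * ((D.B * D.limH Υ v)ᵀ * D.B)
      conv_lhs => rw [limH_gram hT hΥ hv]
      simp only [Matrix.transpose_mul, Matrix.mul_assoc]
    rw [h4, spectrum.units_conjugate, spectrum_diagonal]
  rw [h3] at hcard hgap
  have hinj : Function.Injective v := by
    rw [← Set.image_univ] at hcard
    have := (Set.ncard_image_iff (Set.finite_univ (α := Fin K))).1
      (by rw [hcard, Set.ncard_univ, Nat.card_fin])
    exact Set.injOn_univ.1 this
  exact hgap ⟨j, rfl⟩ ⟨k, rfl⟩ (hinj.ne hjk)

theorem frobNorm_F_sq_le (hd : 0 ≤ dmax) (hf : ∀ t, euclNorm (D.f t) ≤ dmax) :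
    frobNorm D.F ^ 2 ≤ D.T * dmax ^ 2 := by
  rw [frobNorm_sq]
  calc ∑ t, ∑ k, D.F t k ^ 2 = ∑ t, euclNorm (D.f t) ^ 2 :=
        Finset.sum_congr rfl fun t _ => (euclNorm_sq _).symm
    _ ≤ ∑ _t : Fin D.T, dmax ^ 2 :=
        Finset.sum_le_sum fun t _ => pow_le_pow_left₀ (euclNorm_nonneg _) (hf t) 2
    _ = _ := by simp

theorem frobNorm_Gmat_le (hT : D.T ≠ 0) (hd : 0 ≤ dmax) (hf : ∀ t, euclNorm (D.f t) ≤ dmax) :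
    frobNorm D.Gmat ≤ dmax := by
  have hT' : 0 < Real.sqrt D.T := Real.sqrt_pos.2 (by exact_mod_cast Nat.pos_of_ne_zero hT)
  have h1 : frobNorm (centering D.T * D.F) ≤ frobNorm D.F := by
    rw [← frobNorm_transpose, Matrix.transpose_mul, centering_transpose, ← frobNorm_transpose D.F]
    exact frobNorm_mul_centering_le hT _
  have h2 : frobNorm D.F ≤ Real.sqrt D.T * dmax := by
    refine (abs_le_of_sq_le_sq' ?_ (by positivity)).2
    rw [mul_pow, Real.sq_sqrt (Nat.cast_nonneg _)]
    exact frobNorm_F_sq_le hd hf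
  rw [Gmat, frobNorm_smul, abs_of_pos (by positivity), one_div, inv_mul_le_iff₀ hT']
  exact h1.trans h2

theorem euclNorm_fbar_le (hT : D.T ≠ 0) (hf : ∀ t, euclNorm (D.f t) ≤ dmax) :
    euclNorm D.fbar ≤ dmax := by
  have hT' : 0 < (D.T : ℝ) := by exact_mod_cast Nat.pos_of_ne_zero hT
  rw [fbar, euclNorm_smul, abs_of_pos (by positivity), one_div, inv_mul_le_iff₀ hT']
  refine (euclNorm_sum_le _ _).trans ((Finset.sum_le_sum fun t _ => hf t).trans_eq ?_)
  simp

theorem frobNorm_B_sq_le (hB : spectrum ℝ (D.Bᵀ * D.B) ⊆ Set.Iic dmax) :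
    frobNorm D.B ^ 2 ≤ K * dmax := by
  rw [frobNorm_sq_eq_trace]
  simpa using trace_le_of_spectrum_subset (isHermitian_transpose_mul_self' D.B) hB

theorem frobNorm_limH_le (hT : D.T ≠ 0) (hd : 0 < dmin)
    (hΥ : IsSpectralDecomposition D.spectralMatrix Υ v) (hv : ∀ k, dmin ^ 2 ≤ v k)
    {g : ℝ} (hG : frobNorm D.Gmat ≤ g) : dmin * frobNorm (D.limH Υ v) ≤ g := by
  have hg : 0 ≤ g := (frobNorm_nonneg _).trans hG
  have hv0 : ∀ k, 0 < v k := fun k => (pow_pos hd 2).trans_le (hv k)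
  have h1 : frobNorm D.Gmat ^ 2 = ∑ i, ∑ k, v k * D.limH Υ v i k ^ 2 := by
    rw [frobNorm_sq_eq_trace, ← D.SigmaF_eq hT, limH_gram hT hΥ hv0, Matrix.trace]
    refine Finset.sum_congr rfl fun i _ => ?_
    rw [Matrix.diag_apply, Matrix.mul_apply]
    refine Finset.sum_congr rfl fun k _ => ?_
    rw [Matrix.mul_diagonal, Matrix.transpose_apply]
    ring
  refine (abs_le_of_sq_le_sq' ?_ hg).2
  refine le_trans ?_ (pow_le_pow_left₀ (frobNorm_nonneg _) hG 2)
  rw [h1, mul_pow, frobNorm_sq, Finset.mul_sum]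
  refine Finset.sum_le_sum fun i _ => ?_
  rw [Finset.mul_sum]
  exact Finset.sum_le_sum fun k _ => mul_le_mul_of_nonneg_right (hv k) (sq_nonneg _)

/-- The nonrandom conditions on the model at one stage, with all constants combined into `Λ`. -/
structure Bounded (D : FactorModel M K Ω) (Υ : Matrix (Fin K) (Fin K) ℝ) (v : Fin K → ℝ)
    (Λ : ℝ) : Prop where
  one_le : 1 ≤ Λ
  card_le : (K : ℝ) ≤ Λ
  T_ne : D.T ≠ 0
  B_le : frobNorm D.B ≤ Λ
  G_le : frobNorm D.Gmat ≤ Λ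
  f_le : ∀ t, euclNorm (D.f t) ≤ Λ
  fbar_le : euclNorm D.fbar ≤ Λ
  a_le : euclNorm D.a ≤ Λ
  aB : D.a ᵥ* D.B = 0
  limH_le : frobNorm (D.limH Υ v) ≤ Λ
  gram : D.Gmatᵀ * D.Gmat = D.limH Υ v * Matrix.diagonal v * (D.limH Υ v)ᵀ
  orth : (D.B * D.limH Υ v)ᵀ * (D.B * D.limH Υ v) = 1
  v_anti : Antitone v
  v_ge : ∀ k, 1 ≤ Λ * v k
  gap : ∀ j k, j ≠ k → 1 ≤ Λ * |v j - v k|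

theorem exists_bounded (M K : ℕ) {dmin dmax c C₀ : ℝ} (hd : 0 < dmin) (hd' : 0 < dmax)
    (hc : 0 < c) : ∃ Λ : ℝ, 1 ≤ Λ ∧ ∀ {Ω : Type u} (D : FactorModel M K Ω)
      (Υ : Matrix (Fin K) (Fin K) ℝ) (v : Fin K → ℝ), D.T ≠ 0 →
      spectrum ℝ (D.Bᵀ * D.B) ⊆ Set.Ioo dmin dmax → (∀ t, euclNorm (D.f t) < dmax) →
      spectrum ℝ D.SigmaF ⊆ Set.Ioi dmin → D.a ᵥ* D.B = 0 → euclNorm D.a < C₀ →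
      (spectrum ℝ (D.SigmaF * (D.Bᵀ * D.B))).ncard = K →
      ((spectrum ℝ (D.SigmaF * (D.Bᵀ * D.B))).Pairwise fun x y => c ≤ |x - y|) →
      IsSpectralDecomposition D.spectralMatrix Υ v → D.Bounded Υ v Λ := by
  refine ⟨1 + K + dmax + dmax / dmin + 1 / dmin ^ 2 + 1 / c + |C₀|, ?_, ?_⟩
  · have : 0 ≤ (K : ℝ) + dmax + dmax / dmin + 1 / dmin ^ 2 + 1 / c + |C₀| := by positivity
    linarith
  intro Ω D Υ v hT hB hf hF haB ha hcard hgap hΥ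
  set Λ := 1 + K + dmax + dmax / dmin + 1 / dmin ^ 2 + 1 / c + |C₀| with hΛ
  have p1 : 0 ≤ (K : ℝ) := Nat.cast_nonneg _
  have p2 : 0 ≤ dmax / dmin := by positivity
  have p3 : 0 ≤ 1 / dmin ^ 2 := by positivity
  have p4 : 0 ≤ 1 / c := by positivity
  have p5 : 0 ≤ |C₀| := abs_nonneg _
  have hv := sq_le_eigenvalue hT hd (hB.trans fun x hx => hx.1.le)
    (hF.trans Set.Ioi_subset_Ici_self) hΥ
  have hv0 : ∀ k, 0 < v k := fun k => (pow_pos hd 2).trans_le (hv k)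
  have hG := frobNorm_Gmat_le hT hd'.le fun t => (hf t).le
  refine ⟨by linarith, by linarith, hT, ?_, by linarith, fun t => by linarith [hf t], ?_,
    by linarith [le_abs_self C₀], haB, ?_, ?_, limH_orth hΥ hv0, hΥ.2.1, fun k => ?_,
    fun j k hjk => ?_⟩
  · refine (abs_le_of_sq_le_sq' ?_ (by linarith)).2
    refine (frobNorm_B_sq_le (hB.trans fun x hx => hx.2.le)).trans ?_
    rw [sq]
    exact mul_le_mul (by linarith) (by linarith) hd'.le (by linarith)
  · exact (euclNorm_fbar_le hT fun t => (hf t).le).trans (by linarith)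
  · have h1 := frobNorm_limH_le hT hd hΥ hv hG
    rw [mul_comm, ← le_div_iff₀ hd] at h1
    linarith
  · rw [← D.SigmaF_eq hT, ← limH_gram hT hΥ hv0]
  · have h1 : 1 / dmin ^ 2 * dmin ^ 2 = 1 := one_div_mul_cancel (by positivity)
    rw [← h1]
    exact mul_le_mul (by linarith) (hv k) (by positivity) (by linarith)
  · have h1 : 1 / c * c = 1 := one_div_mul_cancel hc.ne'
    rw [← h1]
    exact mul_le_mul (by linarith) (eigenvalue_gap hT hΥ hv0 hcard hgap hjk) hc.le (by linarith)

/-! ### Deterministic expansion of the estimators -/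

/-- On the event where all `Φ(Z_t)ᵀ Φ(Z_t)` are invertible, the estimators follow their
first-order approximation up to a multiple of `ρ`. -/
theorem Bounded.expansion {Λ : ℝ} (hb : D.Bounded Υ v Λ) {ω : Ω}
    (hinv : ∀ t, IsUnit ((D.Phi t ω)ᵀ * D.Phi t ω).det)
    {Bh : Matrix (Fin M × Fin D.J) (Fin K) ℝ} (hBh : IsLeadingEigenvectors (D.pcaMatrix ω) Bh)
    (hsign : ∀ k, 0 ≤ ((D.B * D.limH Υ v)ᵀ * Bh) k k)
    {NN : Matrix (Fin M × Fin D.J) (Fin (K + 1)) ℝ} {d e eB ρ : ℝ}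
    (hd : frobNorm (D.biasMat ω) ≤ Real.sqrt D.T * d)
    (he : frobNorm (D.noiseMat ω) ≤ Real.sqrt D.T * e)
    (heB : frobNorm ((D.noiseMat ω)ᵀ * D.B) ≤ Real.sqrt D.T * eB)
    (hδ : 208 * Λ ^ 19 * (d + e) ≤ 1)
    (h1 : Real.sqrt (D.N * D.T) * d ≤ ρ) (h2 : Real.sqrt (D.N * D.T) * e * eB ≤ ρ)
    (h3 : Real.sqrt (D.N * D.T) * e ^ 3 ≤ ρ)
    (h4 : frobNorm (D.noiseScore ω) * (d + e) ≤ ρ) (h5 : frobNorm (D.noiseScore ω - NN) ≤ ρ) :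
    frobNorm (Real.sqrt (D.N * D.T) • (Bh - D.B * D.H Bh ω) - D.GB Υ v NN)
      ≤ 11 * (222 * Λ ^ 19) ^ 3 * ρ ∧
    euclNorm (Real.sqrt (D.N * D.T) • (D.ahat Bh ω - D.a) - D.Ga Υ v NN)
      ≤ 120 * (222 * Λ ^ 19) ^ 7 * ρ := by
  have hT := hb.T_ne
  have hT' : 0 < Real.sqrt D.T := Real.sqrt_pos.2 (by exact_mod_cast Nat.pos_of_ne_zero hT)
  obtain ⟨hBo, ℓ, hℓ, hW, hlead⟩ := hBh
  set Dm := (1 / Real.sqrt D.T) • (D.biasMat ω * centering D.T) with hDm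
  set Em := (1 / Real.sqrt D.T) • (D.noiseMat ω * centering D.T) with hEm
  have hA := D.centered_Ytilde_eq hT hinv
  rw [← hDm, ← hEm] at hA
  have hW' := D.pcaMatrix_eq ω hT
  rw [hA] at hW'
  have hset : PCASetup Λ D.B D.Gmat (Dm + Em) (D.limH Υ v) v ℓ Bh :=
    ⟨hb.one_le, hb.card_le, hb.B_le, hb.G_le, hb.limH_le, hb.gram, hb.orth, hb.v_anti, hb.v_ge,
      hb.gap, hBo, hℓ, by rw [← hW', hW], by rw [← hW']; exact hlead, hsign⟩
  have hscale : ∀ {ι κ : Type} [Fintype ι] [Fintype κ] {X : Matrix ι κ ℝ} {x : ℝ},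
      frobNorm X ≤ Real.sqrt D.T * x → frobNorm ((1 / Real.sqrt D.T) • X) ≤ x := by
    intro ι κ _ _ X x hX
    rw [frobNorm_smul, abs_of_pos (by positivity), one_div, inv_mul_le_iff₀ hT']
    exact hX
  have hDle : frobNorm Dm ≤ d := hscale ((frobNorm_mul_centering_le hT _).trans hd)
  have hEle : frobNorm Em ≤ e := hscale ((frobNorm_mul_centering_le hT _).trans he)
  have hEBle : frobNorm (Emᵀ * D.B) ≤ eB := by
    have e1 : (Emᵀ * D.B)ᵀ
        = (1 / Real.sqrt D.T) • (((D.noiseMat ω)ᵀ * D.B)ᵀ * centering D.T) := by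
      rw [hEm]
      simp only [Matrix.transpose_mul, Matrix.transpose_transpose, Matrix.mul_smul,
        Matrix.mul_assoc]
    rw [← frobNorm_transpose, e1]
    exact hscale ((frobNorm_mul_centering_le hT _).trans ((frobNorm_transpose _).trans_le heB))
  set N2 := NN.submatrix id Fin.succ with hN2
  have hsub : ∀ X : Matrix (Fin M × Fin D.J) (Fin (K + 1)) ℝ,
      frobNorm (X.submatrix id Fin.succ) ≤ frobNorm X := fun X => by
    refine Real.sqrt_le_sqrt (Finset.sum_le_sum fun p _ => ?_)
    rw [Fin.sum_univ_succ]
    simp only [Matrix.submatrix_apply, id]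
    linarith [sq_nonneg (X p 0)]
  have hcol : ∀ X : Matrix (Fin M × Fin D.J) (Fin (K + 1)) ℝ,
      euclNorm (fun p => X p 0) ≤ frobNorm X := fun X => by
    refine (abs_le_of_sq_le_sq' ?_ (frobNorm_nonneg _)).2
    rw [euclNorm_sq, frobNorm_sq]
    exact Finset.sum_le_sum fun p _ =>
      Finset.single_le_sum (f := fun k => X p k ^ 2) (fun _ _ => sq_nonneg _) (Finset.mem_univ 0)
  have hsc := D.noiseScore_succ ω hT
  rw [← hEm] at hsc
  have hn : NoiseBounds (Real.sqrt (D.N * D.T)) d e eB (frobNorm (D.noiseScore ω))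
      (frobNorm (D.noiseScore ω - NN)) ρ D.B D.Gmat Dm Em N2 :=
    ⟨Real.sqrt_nonneg _, hDle, hEle, hEBle, by rw [← hsc]; exact hsub _,
      by rw [← hsc]; exact hsub (D.noiseScore ω - NN), h1, h2, h3, h4, h5⟩
  have hR : frobNorm (Dm + Em) ≤ d + e := frobNorm_add_le_of_le hDle hEle
  have hδ6 := (le_one_of_threshold hb.one_le ((frobNorm_nonneg _).trans hR) hδ).2
  have hHeq := D.H_eq hT hBo hW (hset.eigenvalue_pos hR hδ6)
  rw [hA] at hHeq
  refine ⟨(hset.eigenvectors_expansion hn hδ hHeq rfl).2, ?_⟩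
  set db : Fin M × Fin D.J → ℝ := fun p => (1 / (D.T : ℝ)) * ∑ t, D.biasMat ω p t with hdb
  set eb : Fin M × Fin D.J → ℝ := fun p => (1 / (D.T : ℝ)) * ∑ t, D.noiseMat ω p t with heb
  have hscol : (Real.sqrt (D.N * D.T)) • eb = fun p => D.noiseScore ω p 0 := by
    ext p; rw [D.noiseScore_zero ω hT]; rfl
  have hdble : euclNorm db ≤ d := by
    have e1 : db = D.biasMat ω *ᵥ (fun _ => 1 / (D.T : ℝ)) := by
      ext p; rw [Matrix.mulVec, dotProduct, ← Finset.sum_mul, mul_comm]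
    have e2 : euclNorm (fun _ : Fin D.T => 1 / (D.T : ℝ)) = 1 / Real.sqrt D.T := by
      rw [← Real.sqrt_sq (euclNorm_nonneg _), euclNorm_sq]
      have hT2 : (D.T : ℝ) ≠ 0 := by exact_mod_cast hT
      rw [← Real.sqrt_one, ← Real.sqrt_div zero_le_one, Real.sqrt_one]
      congr 1
      simp
      field_simp
    rw [e1]
    refine (euclNorm_mulVec_le_of_le hd e2.le).trans_eq ?_
    field_simp
  have := hset.intercept_expansion hn hδ hHeq rfl (a := D.a) (db := db) (eb := eb)
    (N1 := fun p => NN p 0) (fb := D.fbar) hb.a_le hb.fbar_le hb.aB hdble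
    (by rw [hscol]; exact hcol _)
    (by rw [hscol]; exact hcol (D.noiseScore ω - NN)) (GB := D.GB Υ v NN) rfl
  rw [← D.Ybar_eq hT hinv] at this
  exact this

end FactorModel

/-! ### Independence of pairs -/

section IndepPairs

variable {Ω α β ι : Type*} {mΩ : MeasurableSpace Ω} [MeasurableSpace α] [MeasurableSpace β]
  {P : Measure Ω} [Fintype ι]

theorem iIndepFun_prodMk_of_indepFun {X : ι → Ω → α} {Y : ι → Ω → β}
    (hX : iIndepFun X P) (hY : iIndepFun Y P) (hXm : ∀ i, Measurable (X i))
    (hYm : ∀ i, Measurable (Y i)) (h : IndepFun (fun ω i => X i ω) (fun ω i => Y i ω) P) :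
    iIndepFun (fun i ω => (X i ω, Y i ω)) P := by
  let C : Set (Set (α × β)) :=
    Set.image2 (fun s t => s ×ˢ t) {s : Set α | MeasurableSet s} {t : Set β | MeasurableSet t}
  refine iIndepSets.iIndep (m := fun i => MeasurableSpace.comap (fun ω => (X i ω, Y i ω)) inferInstance)
    (π := fun i => {s | ∃ t ∈ C, (fun ω => (X i ω, Y i ω)) ⁻¹' t = s})
    (fun i => ((hXm i).prodMk (hYm i)).comap_le) (fun i => isPiSystem_prod.comap _) (fun i => ?_) ?_
  · change MeasurableSpace.comap _ Prod.instMeasurableSpace = _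
    rw [← generateFrom_prod, MeasurableSpace.comap_generateFrom]
    rfl
  · rw [iIndepSets_iff]
    intro s f hf
    have hf' : ∀ i, ∃ A : Set α, ∃ B : Set β, MeasurableSet A ∧ MeasurableSet B ∧
        (i ∈ s → f i = X i ⁻¹' A ∩ Y i ⁻¹' B) := by
      intro i
      by_cases hi : i ∈ s
      · obtain ⟨t, ⟨A, hA, B, hB, rfl⟩, ht⟩ := hf i hi
        exact ⟨A, B, hA, hB, fun _ => ht.symm⟩
      · exact ⟨∅, ∅, MeasurableSet.empty, MeasurableSet.empty, fun h => absurd h hi⟩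
    choose A B hA hB hfAB using hf'
    have e1 : ⋂ i ∈ s, f i = (fun ω i => X i ω) ⁻¹' (Set.pi s A) ∩
        (fun ω i => Y i ω) ⁻¹' (Set.pi s B) := by
      ext ω
      simp only [Set.mem_iInter, Set.mem_inter_iff, Set.mem_preimage, Set.mem_pi, Finset.mem_coe]
      constructor
      · intro hω
        refine ⟨fun i hi => ?_, fun i hi => ?_⟩
        · have := hω i hi; rw [hfAB i hi] at this; exact this.1
        · have := hω i hi; rw [hfAB i hi] at this; exact this.2
      · rintro ⟨h1, h2⟩ i hi
        rw [hfAB i hi]; exact ⟨h1 i hi, h2 i hi⟩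
    have hpair : ∀ i, P (X i ⁻¹' A i ∩ Y i ⁻¹' B i) = P (X i ⁻¹' A i) * P (Y i ⁻¹' B i) := fun i =>
      (h.comp (measurable_pi_apply i) (measurable_pi_apply i)).measure_inter_preimage_eq_mul _ _
        (hA i) (hB i)
    rw [e1, h.measure_inter_preimage_eq_mul _ _
      (MeasurableSet.pi s.countable_toSet fun i _ => hA i)
      (MeasurableSet.pi s.countable_toSet fun i _ => hB i)]
    have e2 : (fun ω i => X i ω) ⁻¹' (Set.pi s A) = ⋂ i ∈ s, X i ⁻¹' A i := by
      ext ω; simp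
    have e3 : (fun ω i => Y i ω) ⁻¹' (Set.pi s B) = ⋂ i ∈ s, Y i ⁻¹' B i := by
      ext ω; simp
    rw [e2, e3, hX.measure_inter_preimage_eq_mul s fun i _ => hA i,
      hY.measure_inter_preimage_eq_mul s fun i _ => hB i, ← Finset.prod_mul_distrib]
    exact Finset.prod_congr rfl fun i hi => by rw [hfAB i hi, hpair]

end IndepPairs

/-! ### Bounded functions measurable with respect to a sub-σ-algebra -/

section BddMeas

variable {Ω : Type*} {mΩ : MeasurableSpace Ω} {P : Measure Ω}

/-- `w` is bounded and measurable with respect to `m`. -/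
def BddMeas (m : MeasurableSpace Ω) (w : Ω → ℝ) : Prop :=
  Measurable[m] w ∧ ∃ C, ∀ ω, |w ω| ≤ C

variable {m : MeasurableSpace Ω} {w w' : Ω → ℝ}

theorem BddMeas.mul (h : BddMeas m w) (h' : BddMeas m w') : BddMeas m fun ω => w ω * w' ω := by
  obtain ⟨C, hC⟩ := h.2
  obtain ⟨C', hC'⟩ := h'.2
  refine ⟨h.1.mul h'.1, C * C', fun ω => ?_⟩
  rw [abs_mul]
  exact mul_le_mul (hC ω) (hC' ω) (abs_nonneg _) ((abs_nonneg _).trans (hC ω))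

theorem BddMeas.add (h : BddMeas m w) (h' : BddMeas m w') : BddMeas m fun ω => w ω + w' ω := by
  obtain ⟨C, hC⟩ := h.2
  obtain ⟨C', hC'⟩ := h'.2
  exact ⟨h.1.add h'.1, C + C', fun ω => (abs_add_le _ _).trans (add_le_add (hC ω) (hC' ω))⟩

theorem bddMeas_const (c : ℝ) : BddMeas m fun _ : Ω => c := ⟨measurable_const, |c|, fun _ => le_rfl⟩

theorem BddMeas.const_mul (h : BddMeas m w) (c : ℝ) : BddMeas m fun ω => c * w ω :=
  (bddMeas_const c).mul h

theorem BddMeas.sub (h : BddMeas m w) (h' : BddMeas m w') : BddMeas m fun ω => w ω - w' ω := by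
  simpa [sub_eq_add_neg] using h.add (h'.const_mul (-1))

theorem BddMeas.sum {ι : Type*} {s : Finset ι} {w : ι → Ω → ℝ} (h : ∀ i ∈ s, BddMeas m (w i)) :
    BddMeas m fun ω => ∑ i ∈ s, w i ω := by
  classical
  induction s using Finset.induction_on with
  | empty => simpa using bddMeas_const 0
  | insert i s hi ih =>
    simp only [Finset.sum_insert hi]
    exact (h i (Finset.mem_insert_self i s)).add
      (ih fun j hj => h j (Finset.mem_insert_of_mem hj))

theorem BddMeas.memLp [IsFiniteMeasure P] (h : BddMeas m w) (hm : m ≤ mΩ) {q : ENNReal} :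
    MemLp w q P := by
  obtain ⟨C, hC⟩ := h.2
  exact MemLp.of_bound (h.1.mono hm le_rfl).aestronglyMeasurable C
    (ae_of_all _ fun ω => by rw [Real.norm_eq_abs]; exact hC ω)

theorem BddMeas.integrable [IsFiniteMeasure P] (h : BddMeas m w) (hm : m ≤ mΩ) :
    Integrable w P := memLp_one_iff_integrable.1 (h.memLp hm)

theorem BddMeas.integrable_mul [IsFiniteMeasure P] (h : BddMeas m w) (hm : m ≤ mΩ) {g : Ω → ℝ}
    (hg : Integrable g P) : Integrable (fun ω => w ω * g ω) P := by
  obtain ⟨C, hC⟩ := h.2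
  exact hg.bdd_mul (h.1.mono hm le_rfl).aestronglyMeasurable
    (ae_of_all _ fun ω => by rw [Real.norm_eq_abs]; exact hC ω)

theorem integral_mul_of_indep {mZ mE : MeasurableSpace Ω} (hZ : mZ ≤ mΩ) (hE : mE ≤ mΩ)
    (hind : Indep mZ mE P) {w g : Ω → ℝ} (hw : Measurable[mZ] w) (hg : Measurable[mE] g) :
    ∫ ω, w ω * g ω ∂P = (∫ ω, w ω ∂P) * ∫ ω, g ω ∂P := by
  have h : IndepFun w g P :=
    indep_of_indep_of_le_left (indep_of_indep_of_le_right hind hg.comap_le) hw.comap_le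
  exact h.integral_fun_mul_eq_mul_integral (hw.mono hZ le_rfl).aestronglyMeasurable
    (hg.mono hE le_rfl).aestronglyMeasurable

end BddMeas

/-! ### Measurability of matrix functions -/

section MatrixMeasurable

variable {Ω ι : Type*} [Fintype ι] [DecidableEq ι] {m : MeasurableSpace Ω}

theorem measurable_det {A : Ω → Matrix ι ι ℝ} (hA : ∀ i j, Measurable[m] fun ω => A ω i j) :
    Measurable[m] fun ω => (A ω).det := by
  simp only [Matrix.det_apply']
  exact Finset.measurable_sum _ fun σ _ =>
    measurable_const.mul (Finset.measurable_prod _ fun i _ => hA _ _)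

theorem measurable_matrix_inv {A : Ω → Matrix ι ι ℝ} (hA : ∀ i j, Measurable[m] fun ω => A ω i j)
    (i j : ι) : Measurable[m] fun ω => (A ω)⁻¹ i j := by
  have h : ∀ ω, (A ω)⁻¹ i j = ((A ω).det)⁻¹ * ((A ω).updateRow j (Pi.single i 1)).det := by
    intro ω
    rw [Matrix.inv_def, Matrix.smul_apply, Matrix.adjugate_apply, Ring.inverse_eq_inv', smul_eq_mul]
  simp only [h]
  refine (measurable_det hA).inv.mul (measurable_det fun k l => ?_)
  by_cases hk : k = j
  · subst hk
    simp only [Matrix.updateRow_self]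
    exact measurable_const
  · simp only [Matrix.updateRow_ne hk]
    exact hA k l

end MatrixMeasurable

/-! ### Moments of weighted sums of noise -/

section WeightedSums

variable {Ω : Type*} {mΩ : MeasurableSpace Ω} {P : Measure Ω} [IsProbabilityMeasure P]
  {mZ mE : MeasurableSpace Ω} {ι τ R : Type*} [Fintype ι] [Fintype τ] [Fintype R]

theorem integrable_mul_of_memLp_four {f g : Ω → ℝ} (hf : MemLp f 4 P) (hg : MemLp g 4 P) :
    Integrable (fun ω => f ω * g ω) P :=
  (hf.mono_exponent (by norm_num : (2 : ENNReal) ≤ 4)).integrable_mul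
    (hg.mono_exponent (by norm_num : (2 : ENNReal) ≤ 4))

theorem integrable_mul_four_of_memLp_four {a b c d : Ω → ℝ} (ha : MemLp a 4 P) (hb : MemLp b 4 P)
    (hc : MemLp c 4 P) (hd : MemLp d 4 P) :
    Integrable (fun ω => a ω * b ω * c ω * d ω) P := by
  have h4 : ∀ {f : Ω → ℝ}, MemLp f 4 P → Integrable (fun ω => f ω ^ 4) P := fun {f} hf => by
    have := hf.integrable_norm_pow (p := 4) (by norm_num)
    refine this.congr (ae_of_all _ fun ω => ?_)
    simp only [Real.norm_eq_abs]
    exact (Even.pow_abs (by decide) _)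
  refine ((((h4 ha).add (h4 hb)).add (h4 hc)).add (h4 hd)).mono'
    (((ha.1.mul hb.1).mul hc.1).mul hd.1) (ae_of_all _ fun ω => ?_)
  simp only [Pi.add_apply, Real.norm_eq_abs]
  rw [abs_le]
  constructor <;>
  nlinarith [sq_nonneg (a ω * b ω + c ω * d ω), sq_nonneg (a ω * b ω - c ω * d ω),
    sq_nonneg (a ω ^ 2 - b ω ^ 2), sq_nonneg (c ω ^ 2 - d ω ^ 2), sq_nonneg (a ω ^ 2),
    sq_nonneg (b ω ^ 2), sq_nonneg (c ω ^ 2), sq_nonneg (d ω ^ 2)]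

/-- Second moment of a sum of noise with random weights independent of the noise. -/
theorem integral_sq_sum_mul (hZ : mZ ≤ mΩ) (hE : mE ≤ mΩ) (hind : Indep mZ mE P)
    {w e : ι → τ → Ω → ℝ} (hw : ∀ i t, BddMeas mZ (w i t)) (heM : ∀ i t, Measurable[mE] (e i t))
    (heL : ∀ i t, MemLp (e i t) 4 P)
    (horth : ∀ i j, i ≠ j → ∀ t s, ∫ ω, e i t ω * e j s ω ∂P = 0) :
    Integrable (fun ω => (∑ i, ∑ t, w i t ω * e i t ω) ^ 2) P ∧
    ∫ ω, (∑ i, ∑ t, w i t ω * e i t ω) ^ 2 ∂P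
      = ∑ i, ∑ t, ∑ s, (∫ ω, w i t ω * w i s ω ∂P) * ∫ ω, e i t ω * e i s ω ∂P := by
  have hexp : ∀ ω, (∑ i, ∑ t, w i t ω * e i t ω) ^ 2 = ∑ i, ∑ j, ∑ t, ∑ s,
      (w i t ω * w j s ω) * (e i t ω * e j s ω) := by
    intro ω
    rw [sq, Finset.sum_mul_sum]
    refine Finset.sum_congr rfl fun i _ => Finset.sum_congr rfl fun j _ => ?_
    rw [Finset.sum_mul_sum]
    exact Finset.sum_congr rfl fun t _ => Finset.sum_congr rfl fun s _ => by ring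
  have hint : ∀ i j t s, Integrable (fun ω => (w i t ω * w j s ω) * (e i t ω * e j s ω)) P :=
    fun i j t s => ((hw i t).mul (hw j s)).integrable_mul hZ
      (integrable_mul_of_memLp_four (heL i t) (heL j s))
  simp only [hexp]
  refine ⟨integrable_finsetSum _ fun i _ => integrable_finsetSum _ fun j _ =>
    integrable_finsetSum _ fun t _ => integrable_finsetSum _ fun s _ => hint i j t s, ?_⟩
  rw [integral_finsetSum _ fun i _ => integrable_finsetSum _ fun j _ =>
    integrable_finsetSum _ fun t _ => integrable_finsetSum _ fun s _ => hint i j t s]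
  refine Finset.sum_congr rfl fun i _ => ?_
  rw [integral_finsetSum _ fun j _ =>
    integrable_finsetSum _ fun t _ => integrable_finsetSum _ fun s _ => hint i j t s]
  have hval : ∀ j, ∫ ω, ∑ t, ∑ s, (w i t ω * w j s ω) * (e i t ω * e j s ω) ∂P
      = ∑ t, ∑ s, (∫ ω, w i t ω * w j s ω ∂P) * ∫ ω, e i t ω * e j s ω ∂P := by
    intro j
    rw [integral_finsetSum _ fun t _ => integrable_finsetSum _ fun s _ => hint i j t s]
    refine Finset.sum_congr rfl fun t _ => ?_
    rw [integral_finsetSum _ fun s _ => hint i j t s]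
    refine Finset.sum_congr rfl fun s _ => ?_
    exact integral_mul_of_indep hZ hE hind ((hw i t).mul (hw j s)).1 ((heM i t).mul (heM j s))
  rw [Finset.sum_eq_single i, hval]
  · intro j _ hj
    rw [hval]
    exact Finset.sum_eq_zero fun t _ => Finset.sum_eq_zero fun s _ => by
      rw [horth i j hj.symm, mul_zero]
  · simp

theorem sum_integral_sq_sum_mul_le (hZ : mZ ≤ mΩ) (hE : mE ≤ mΩ) (hind : Indep mZ mE P)
    {w : R → ι → τ → Ω → ℝ} {e : ι → τ → Ω → ℝ} (hw : ∀ r i t, BddMeas mZ (w r i t))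
    (heM : ∀ i t, Measurable[mE] (e i t)) (heL : ∀ i t, MemLp (e i t) 4 P)
    (horth : ∀ i j, i ≠ j → ∀ t s, ∫ ω, e i t ω * e j s ω ∂P = 0) {V : ℝ}
    (hV : ∀ i t, ∫ ω, ∑ r, w r i t ω ^ 2 ∂P ≤ V) :
    Integrable (fun ω => ∑ r, (∑ i, ∑ t, w r i t ω * e i t ω) ^ 2) P ∧
    ∫ ω, ∑ r, (∑ i, ∑ t, w r i t ω * e i t ω) ^ 2 ∂P
      ≤ V * ∑ i, ∑ t, ∑ s, |∫ ω, e i t ω * e i s ω ∂P| := by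
  have h := fun r => integral_sq_sum_mul hZ hE hind (hw r) heM heL horth
  refine ⟨integrable_finsetSum _ fun r _ => (h r).1, ?_⟩
  rw [integral_finsetSum _ fun r _ => (h r).1]
  simp only [fun r => (h r).2]
  rw [Finset.sum_comm, Finset.mul_sum]
  refine Finset.sum_le_sum fun i _ => ?_
  rw [Finset.sum_comm, Finset.mul_sum]
  refine Finset.sum_le_sum fun t _ => ?_
  rw [Finset.sum_comm, Finset.mul_sum]
  refine Finset.sum_le_sum fun s _ => ?_
  rw [← Finset.sum_mul]
  have hi : ∀ r t s, Integrable (fun ω => w r i t ω * w r i s ω) P := fun r t s =>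
    ((hw r i t).mul (hw r i s)).integrable hZ
  have hi2 : ∀ t, Integrable (fun ω => ∑ r, w r i t ω ^ 2) P := fun t =>
    integrable_finsetSum _ fun r _ => by simpa only [sq] using hi r t t
  refine (le_abs_self _).trans ?_
  rw [abs_mul]
  refine mul_le_mul_of_nonneg_right ?_ (abs_nonneg _)
  rw [← integral_finsetSum _ fun r _ => hi r t s, ← Real.norm_eq_abs]
  refine (norm_integral_le_of_norm_le (((hi2 t).add (hi2 s)).const_mul (1 / 2))
    (ae_of_all _ fun ω => ?_)).trans ?_
  · rw [Real.norm_eq_abs, Pi.add_apply, ← Finset.sum_add_distrib, Finset.mul_sum]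
    refine (Finset.abs_sum_le_sum_abs _ _).trans (Finset.sum_le_sum fun r _ => ?_)
    rw [abs_le]
    constructor <;> nlinarith [sq_nonneg (w r i t ω + w r i s ω), sq_nonneg (w r i t ω - w r i s ω)]
  · rw [integral_const_mul, integral_add' (hi2 t) (hi2 s)]
    linarith [hV i t, hV i s]

/-- Fourth moment of the norm of a sum of noise with random weights independent of the noise. -/
theorem integral_sq_sum_sq_sum_mul_le (hZ : mZ ≤ mΩ) (hE : mE ≤ mΩ) (hind : Indep mZ mE P)
    {w : R → τ → Ω → ℝ} {e : τ → Ω → ℝ} (hw : ∀ r t, BddMeas mZ (w r t))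
    (heM : ∀ t, Measurable[mE] (e t)) (heL : ∀ t, MemLp (e t) 4 P) {V : ℝ}
    (hV : ∀ t, ∫ ω, (∑ r, w r t ω ^ 2) ^ 2 ∂P ≤ V) :
    ∫ ω, (∑ r, (∑ t, w r t ω * e t ω) ^ 2) ^ 2 ∂P
      ≤ V * ∑ t, ∑ s, ∑ a, ∑ b, |∫ ω, e t ω * e s ω * e a ω * e b ω ∂P| := by
  set g : τ → τ → Ω → ℝ := fun t s ω => ∑ r, w r t ω * w r s ω with hg
  have hgB : ∀ t s, BddMeas mZ (g t s) := fun t s =>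
    BddMeas.sum fun r _ => (hw r t).mul (hw r s)
  have hexp : ∀ ω, (∑ r, (∑ t, w r t ω * e t ω) ^ 2) ^ 2
      = ∑ t, ∑ s, ∑ a, ∑ b, (g t s ω * g a b ω) * (e t ω * e s ω * e a ω * e b ω) := by
    intro ω
    have h1 : ∑ r, (∑ t, w r t ω * e t ω) ^ 2 = ∑ t, ∑ s, g t s ω * (e t ω * e s ω) := by
      have h2 : ∀ r, (∑ t, w r t ω * e t ω) ^ 2
          = ∑ t, ∑ s, w r t ω * w r s ω * (e t ω * e s ω) := fun r => by
        rw [sq, Finset.sum_mul_sum]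
        exact Finset.sum_congr rfl fun t _ => Finset.sum_congr rfl fun s _ => by ring
      simp only [h2, hg, Finset.sum_mul]
      rw [Finset.sum_comm]
      exact Finset.sum_congr rfl fun t _ => Finset.sum_comm
    rw [h1, sq]
    simp only [Finset.sum_mul, Finset.mul_sum]
    refine Finset.sum_congr rfl fun t _ => Finset.sum_congr rfl fun s _ =>
      Finset.sum_congr rfl fun a _ => Finset.sum_congr rfl fun b _ => by ring
  have he4 : ∀ t s a b, Integrable (fun ω => e t ω * e s ω * e a ω * e b ω) P := fun t s a b =>
    integrable_mul_four_of_memLp_four (heL t) (heL s) (heL a) (heL b)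
  have hint : ∀ t s a b, Integrable
      (fun ω => (g t s ω * g a b ω) * (e t ω * e s ω * e a ω * e b ω)) P := fun t s a b =>
    ((hgB t s).mul (hgB a b)).integrable_mul hZ (he4 t s a b)
  simp only [hexp]
  rw [integral_finsetSum _ fun t _ => integrable_finsetSum _ fun s _ =>
    integrable_finsetSum _ fun a _ => integrable_finsetSum _ fun b _ => hint t s a b,
    Finset.mul_sum]
  refine Finset.sum_le_sum fun t _ => ?_
  rw [integral_finsetSum _ fun s _ =>
    integrable_finsetSum _ fun a _ => integrable_finsetSum _ fun b _ => hint t s a b,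
    Finset.mul_sum]
  refine Finset.sum_le_sum fun s _ => ?_
  rw [integral_finsetSum _ fun a _ => integrable_finsetSum _ fun b _ => hint t s a b,
    Finset.mul_sum]
  refine Finset.sum_le_sum fun a _ => ?_
  rw [integral_finsetSum _ fun b _ => hint t s a b, Finset.mul_sum]
  refine Finset.sum_le_sum fun b _ => ?_
  rw [integral_mul_of_indep (g := fun ω => e t ω * e s ω * e a ω * e b ω) hZ hE hind
    ((hgB t s).mul (hgB a b)).1 ((((heM t).mul (heM s)).mul (heM a)).mul (heM b))]
  refine (le_abs_self _).trans ?_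
  rw [abs_mul]
  refine mul_le_mul_of_nonneg_right ?_ (abs_nonneg _)
  have hnB : ∀ t, BddMeas mZ fun ω => (∑ r, w r t ω ^ 2) ^ 2 := fun t => by
    have := hgB t t
    simpa only [hg, ← sq] using this.mul this
  have hn := fun t => (hnB t).integrable (P := P) hZ
  have habs : ∀ t s ω, |g t s ω| ≤ (∑ r, w r t ω ^ 2 + ∑ r, w r s ω ^ 2) / 2 := by
    intro t s ω
    rw [← Finset.sum_add_distrib, Finset.sum_div]
    refine (Finset.abs_sum_le_sum_abs _ _).trans (Finset.sum_le_sum fun r _ => ?_)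
    rw [abs_le]
    constructor <;> nlinarith [sq_nonneg (w r t ω + w r s ω), sq_nonneg (w r t ω - w r s ω)]
  rw [← Real.norm_eq_abs]
  refine (norm_integral_le_of_norm_le
    (((((hn t).add (hn s)).add (hn a)).add (hn b)).const_mul (1 / 4))
    (ae_of_all _ fun ω => ?_)).trans ?_
  · rw [Real.norm_eq_abs, abs_mul]
    simp only [Pi.add_apply]
    have h1 := habs t s ω
    have h2 := habs a b ω
    set x := ∑ r, w r t ω ^ 2
    set y := ∑ r, w r s ω ^ 2
    set z := ∑ r, w r a ω ^ 2
    set u := ∑ r, w r b ω ^ 2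
    refine (mul_le_mul h1 h2 (abs_nonneg _) ((abs_nonneg _).trans h1)).trans ?_
    nlinarith [sq_nonneg (x - y), sq_nonneg (z - u), sq_nonneg (x + y - z - u)]
  · rw [integral_const_mul, integral_add' (((hn t).add (hn s)).add (hn a)) (hn b),
      integral_add' ((hn t).add (hn s)) (hn a), integral_add' (hn t) (hn s)]
    linarith [hV t, hV s, hV a, hV b]

end WeightedSums

/-! ### Coercive matrices -/

section Coercive

variable {ι κ R : Type*} [Fintype ι] [DecidableEq ι] [Fintype κ] [Fintype R]

/-- The quadratic form of `S` is at least `c` times the identity. -/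
def QuadFormGE (c : ℝ) (S : Matrix ι ι ℝ) : Prop := ∀ x : ι → ℝ, c * (x ⬝ᵥ x) ≤ x ⬝ᵥ S *ᵥ x

theorem frobNorm_sq_eq_sum_col (A : Matrix ι R ℝ) :
    frobNorm A ^ 2 = ∑ r, euclNorm (fun i => A i r) ^ 2 := by
  rw [frobNorm_sq, Finset.sum_comm]
  exact Finset.sum_congr rfl fun r _ => (euclNorm_sq _).symm

variable {c : ℝ} {S : Matrix ι ι ℝ}

theorem QuadFormGE.mul_euclNorm_le (h : QuadFormGE c S) (x : ι → ℝ) :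
    c * euclNorm x ≤ euclNorm (S *ᵥ x) := by
  have h1 := (h x).trans ((le_abs_self _).trans (abs_dotProduct_le x (S *ᵥ x)))
  rw [← euclNorm_sq_eq_dotProduct, sq] at h1
  rcases (euclNorm_nonneg x).eq_or_lt with h0 | h0
  · rw [← h0, mul_zero]; exact euclNorm_nonneg _
  · refine le_of_mul_le_mul_left ?_ h0
    linarith

theorem eq_zero_of_euclNorm_eq_zero {x : ι → ℝ} (h : euclNorm x = 0) : x = 0 := by
  rw [euclNorm, norm_eq_zero] at h
  ext i
  simpa using congrArg (fun y : EuclideanSpace ℝ ι => y i) h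

theorem QuadFormGE.isUnit_det (h : QuadFormGE c S) (hc : 0 < c) : IsUnit S.det := by
  rw [isUnit_iff_ne_zero]
  intro h0
  obtain ⟨x, hx, hSx⟩ := Matrix.exists_mulVec_eq_zero_iff.2 h0
  apply hx
  have := h.mul_euclNorm_le x
  rw [hSx] at this
  have h1 : euclNorm (0 : ι → ℝ) = 0 := by simp [euclNorm]
  rw [h1] at this
  exact eq_zero_of_euclNorm_eq_zero (le_antisymm (by nlinarith [euclNorm_nonneg x])
    (euclNorm_nonneg x))

theorem QuadFormGE.euclNorm_inv_mulVec_le (h : QuadFormGE c S) (hc : 0 < c) (x : ι → ℝ) :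
    euclNorm (S⁻¹ *ᵥ x) ≤ c⁻¹ * euclNorm x := by
  have h1 := h.mul_euclNorm_le (S⁻¹ *ᵥ x)
  rw [Matrix.mulVec_mulVec, Matrix.mul_nonsing_inv _ (h.isUnit_det hc), Matrix.one_mulVec] at h1
  rw [← div_eq_inv_mul, le_div_iff₀ hc]
  linarith

theorem QuadFormGE.smul (h : QuadFormGE c S) {a : ℝ} (ha : 0 ≤ a) : QuadFormGE (a * c) (a • S) := by
  intro x
  rw [Matrix.smul_mulVec, dotProduct_smul, smul_eq_mul, mul_assoc]
  exact mul_le_mul_of_nonneg_left (h x) ha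

/-- Least squares coefficients are bounded by the regressand. -/
theorem QuadFormGE.leastSquares_le {Φ : Matrix κ ι ℝ} (h : QuadFormGE c (Φᵀ * Φ)) (hc : 0 < c)
    (y : κ → ℝ) : c * euclNorm ((Φᵀ * Φ)⁻¹ *ᵥ (Φᵀ *ᵥ y)) ^ 2 ≤ euclNorm y ^ 2 := by
  set x := (Φᵀ * Φ)⁻¹ *ᵥ (Φᵀ *ᵥ y) with hx
  have h1 : (Φᵀ * Φ) *ᵥ x = Φᵀ *ᵥ y := by
    rw [hx, Matrix.mulVec_mulVec, Matrix.mul_nonsing_inv _ (h.isUnit_det hc), Matrix.one_mulVec]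
  have h2 : x ⬝ᵥ (Φᵀ * Φ) *ᵥ x = euclNorm (Φ *ᵥ x) ^ 2 := by
    rw [euclNorm_sq_eq_dotProduct, ← Matrix.mulVec_mulVec, Matrix.dotProduct_mulVec,
      Matrix.vecMul_transpose]
  have h3 : x ⬝ᵥ (Φᵀ * Φ) *ᵥ x = (Φ *ᵥ x) ⬝ᵥ y := by
    rw [h1, Matrix.dotProduct_mulVec, Matrix.vecMul_transpose]
  have h4 := (le_abs_self _).trans (abs_dotProduct_le (Φ *ᵥ x) y)
  have h5 := h x
  rw [← euclNorm_sq_eq_dotProduct] at h5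
  rw [h3] at h2
  nlinarith [sq_nonneg (euclNorm (Φ *ᵥ x) - euclNorm y)]

theorem QuadFormGE.frobNorm_leastSquares_sq_le {Φ : Matrix κ ι ℝ} (h : QuadFormGE c (Φᵀ * Φ))
    (hc : 0 < c) (A : Matrix ι R ℝ) :
    frobNorm (Aᵀ * (Φᵀ * Φ)⁻¹ * Φᵀ) ^ 2 ≤ c⁻¹ * frobNorm A ^ 2 := by
  have e : frobNorm (Aᵀ * (Φᵀ * Φ)⁻¹ * Φᵀ) = frobNorm (Φ * ((Φᵀ * Φ)⁻¹ * A)) := by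
    rw [← frobNorm_transpose]
    congr 1
    rw [Matrix.transpose_mul, Matrix.transpose_mul, Matrix.transpose_transpose,
      Matrix.transpose_transpose, Matrix.transpose_nonsing_inv, Matrix.transpose_mul,
      Matrix.transpose_transpose]
  rw [e]
  have hA : frobNorm A ^ 2 = ∑ r, euclNorm (fun i => A i r) ^ 2 := frobNorm_sq_eq_sum_col A
  rw [frobNorm_sq, Finset.sum_comm, hA, Finset.mul_sum]
  refine Finset.sum_le_sum fun r _ => ?_
  set a : ι → ℝ := fun i => A i r with ha
  set x := (Φᵀ * Φ)⁻¹ *ᵥ a with hx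
  have h0 : ∀ k, (Φ * ((Φᵀ * Φ)⁻¹ * A)) k r = (Φ *ᵥ x) k := fun k => rfl
  have h1 : (Φᵀ * Φ) *ᵥ x = a := by
    rw [hx, Matrix.mulVec_mulVec, Matrix.mul_nonsing_inv _ (h.isUnit_det hc), Matrix.one_mulVec]
  have h2 : x ⬝ᵥ a = euclNorm (Φ *ᵥ x) ^ 2 := by
    rw [euclNorm_sq_eq_dotProduct, ← h1, ← Matrix.mulVec_mulVec, Matrix.dotProduct_mulVec,
      Matrix.vecMul_transpose]
  simp only [h0]
  rw [← euclNorm_sq, ← h2]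
  refine (le_abs_self _).trans ((abs_dotProduct_le _ _).trans ?_)
  rw [sq, ← mul_assoc]
  exact mul_le_mul_of_nonneg_right (h.euclNorm_inv_mulVec_le hc a) (euclNorm_nonneg _)

theorem QuadFormGE.euclNorm_inv_sub_inv_mulVec_le {S' : Matrix ι ι ℝ} (h : QuadFormGE c S)
    (h' : QuadFormGE c S') (hc : 0 < c) (x : ι → ℝ) :
    euclNorm ((S⁻¹ - S'⁻¹) *ᵥ x) ≤ c⁻¹ * (frobNorm (S - S') * (c⁻¹ * euclNorm x)) := by
  have e : S⁻¹ - S'⁻¹ = S⁻¹ * ((S' - S) * S'⁻¹) := by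
    rw [Matrix.sub_mul, Matrix.mul_sub, Matrix.mul_nonsing_inv _ (h'.isUnit_det hc),
      Matrix.mul_one, ← Matrix.mul_assoc, Matrix.nonsing_inv_mul _ (h.isUnit_det hc),
      Matrix.one_mul]
  rw [e, ← Matrix.mulVec_mulVec, ← Matrix.mulVec_mulVec]
  refine (h.euclNorm_inv_mulVec_le hc _).trans ?_
  refine mul_le_mul_of_nonneg_left ?_ (inv_nonneg.2 hc.le)
  rw [frobNorm_sub_rev]
  exact euclNorm_mulVec_le_of_le le_rfl (h'.euclNorm_inv_mulVec_le hc x)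

end Coercive

/-! ### Stochastic bounds in the factor model -/

namespace FactorModel

variable {M K : ℕ} {Ω : Type u} (D : FactorModel M K Ω)

/-- The σ-algebra of the characteristics. -/
abbrev sigmaZ : MeasurableSpace Ω :=
  MeasurableSpace.comap (fun ω i t => D.z i t ω) inferInstance

/-- The σ-algebra of the errors. -/
abbrev sigmaE : MeasurableSpace Ω :=
  MeasurableSpace.comap (fun ω i t => D.ε i t ω) inferInstance

/-- The event that all `Q̂_t` are bounded below by `q`. -/
def goodEvent (q : ℝ) : Set Ω := {ω | ∀ t, QuadFormGE q (D.Qhat t ω)}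

/-- The summands of the leading noise term, with `Q̂_t` replaced by `Q_t`. -/
def scoreTerm [MeasurableSpace Ω] (P : Measure Ω) (i : Fin D.N) (ω : Ω) :
    EuclideanSpace ℝ (Fin (K + 1) × (Fin M × Fin D.J)) :=
  WithLp.toLp 2 fun r => ∑ t, (1 / Real.sqrt (D.N * D.T) * D.fdag t r.1
    * ((D.Q P t)⁻¹ *ᵥ D.phi (D.z i t ω)) r.2) * D.ε i t ω

/-- The stochastic conditions on the model at one stage, with constants `q` and `C`. -/
structure Tame [MeasurableSpace Ω] (P : Measure Ω) (q C : ℝ) : Prop where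
  reg : D.Regular P
  q_pos : 0 < q
  one_le : 1 ≤ C
  N_pos : 0 < D.N
  T_pos : 0 < D.T
  indep : IndepFun (fun ω i t => D.ε i t ω) (fun ω i t => D.z i t ω) P
  mean : ∀ i t, ∫ ω, D.ε i t ω ∂P = 0
  cov_le : ∀ i t, ∑ j, |∫ ω, D.ε i t ω * D.ε j t ω ∂P| ≤ C
  cov_sum : ∑ i, ∑ j, ∑ t, ∑ s, |∫ ω, D.ε i t ω * D.ε j s ω ∂P| ≤ C * (D.N * D.T)
  phi2 : ∀ m j i t, ∫ ω, D.φ j (D.z i t ω m) ^ 2 ∂P ≤ C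
  phi4 : ∀ m j i t, ∫ ω, D.φ j (D.z i t ω m) ^ 4 ∂P ≤ C
  cross : ∀ i t, spectrum ℝ (D.crossMoment P i t t) ⊆ Set.Ici q
  z_indep : iIndepFun (fun i ω t => D.z i t ω) P
  ε_indep : iIndepFun (fun i ω t => D.ε i t ω) P
  ε4 : ∀ i, ∑ t, ∑ s, ∑ w, ∑ x,
    |∫ ω, D.ε i t ω * D.ε i s ω * D.ε i w ω * D.ε i x ω ∂P| ≤ C * (D.T : ℝ) ^ 2

variable {D} [mΩ : MeasurableSpace Ω] {P : Measure Ω}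

namespace Regular

theorem sigmaZ_le (h : D.Regular P) : D.sigmaZ ≤ mΩ :=
  (measurable_pi_lambda _ fun i => measurable_pi_lambda _ fun t => h.2.1 i t).comap_le

theorem sigmaE_le (h : D.Regular P) : D.sigmaE ≤ mΩ :=
  (measurable_pi_lambda _ fun i => measurable_pi_lambda _ fun t => h.2.2.1 i t).comap_le

theorem measurable_ε (_h : D.Regular P) (i : Fin D.N) (t : Fin D.T) :
    Measurable[D.sigmaE] (D.ε i t) := by
  have h1 : Measurable[D.sigmaE] (fun ω i t => D.ε i t ω) := comap_measurable _
  exact (measurable_pi_apply t).comp ((measurable_pi_apply i).comp h1)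

theorem euclNorm_φ_le (h : D.Regular P) {x : ℝ} (hx : x ∈ D.dom) :
    euclNorm (fun j => D.φ j x) ≤ D.ξ := le_csSup h.2.2.2.2.1 ⟨x, hx, rfl⟩

theorem bddMeas_phi (h : D.Regular P) (i : Fin D.N) (t : Fin D.T) (p : Fin M × Fin D.J) :
    BddMeas D.sigmaZ fun ω => D.phi (D.z i t ω) p := by
  refine ⟨?_, D.ξ, fun ω => ?_⟩
  · have h1 : Measurable[D.sigmaZ] (fun ω i t => D.z i t ω) := comap_measurable _
    exact (h.1 p.2).comp ((measurable_pi_apply p.1).comp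
      ((measurable_pi_apply t).comp ((measurable_pi_apply i).comp h1)))
  · refine le_trans ?_ (h.euclNorm_φ_le (h.2.2.2.1 i t ω p.1))
    refine abs_le_of_sq_le_sq ?_ (euclNorm_nonneg _)
    rw [euclNorm_sq]
    exact Finset.single_le_sum (f := fun j => D.φ j (D.z i t ω p.1) ^ 2) (fun _ _ => sq_nonneg _)
      (Finset.mem_univ p.2)

theorem euclNorm_phi_sq_le (h : D.Regular P) (i : Fin D.N) (t : Fin D.T) (ω : Ω) :
    euclNorm (D.phi (D.z i t ω)) ^ 2 ≤ M * D.ξ ^ 2 := by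
  rw [euclNorm_sq, Fintype.sum_prod_type]
  calc ∑ m, ∑ j, D.phi (D.z i t ω) (m, j) ^ 2
      = ∑ m, euclNorm (fun j => D.φ j (D.z i t ω m)) ^ 2 :=
        Finset.sum_congr rfl fun m _ => (euclNorm_sq _).symm
    _ ≤ ∑ _m : Fin M, D.ξ ^ 2 := Finset.sum_le_sum fun m _ =>
        pow_le_pow_left₀ (euclNorm_nonneg _) (h.euclNorm_φ_le (h.2.2.2.1 i t ω m)) 2
    _ = _ := by simp

theorem bddMeas_Qhat (h : D.Regular P) (t : Fin D.T) (p r : Fin M × Fin D.J) :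
    BddMeas D.sigmaZ fun ω => D.Qhat t ω p r := by
  have e : ∀ ω, D.Qhat t ω p r
      = (1 / (D.N : ℝ)) * ∑ i, D.phi (D.z i t ω) p * D.phi (D.z i t ω) r := fun ω => rfl
  simp only [e]
  exact (BddMeas.sum fun i _ => (h.bddMeas_phi i t p).mul (h.bddMeas_phi i t r)).const_mul _

theorem measurableSet_goodEvent (h : D.Regular P) (q : ℝ) :
    MeasurableSet[D.sigmaZ] (D.goodEvent q) := by
  have e : D.goodEvent q = ⋂ t, ⋂ n : ℕ,
      {ω | q * (TopologicalSpace.denseSeq (Fin M × Fin D.J → ℝ) n ⬝ᵥ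
        TopologicalSpace.denseSeq (Fin M × Fin D.J → ℝ) n)
        ≤ TopologicalSpace.denseSeq (Fin M × Fin D.J → ℝ) n ⬝ᵥ D.Qhat t ω *ᵥ
          TopologicalSpace.denseSeq (Fin M × Fin D.J → ℝ) n} := by
    ext ω
    simp only [goodEvent, QuadFormGE, Set.mem_ofPred_eq, Set.mem_iInter]
    refine ⟨fun hω t n => hω t _, fun hω t => ?_⟩
    have hcl : IsClosed {x : Fin M × Fin D.J → ℝ | q * (x ⬝ᵥ x) ≤ x ⬝ᵥ D.Qhat t ω *ᵥ x} := by
      refine isClosed_le ?_ ?_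
      · simp only [dotProduct]; fun_prop
      · simp only [dotProduct, Matrix.mulVec]; fun_prop
    intro x
    have hx : x ∈ closure (Set.range (TopologicalSpace.denseSeq (Fin M × Fin D.J → ℝ))) := by
      rw [(TopologicalSpace.denseRange_denseSeq _).closure_range]; trivial
    exact closure_minimal (by rintro _ ⟨n, rfl⟩; exact hω t n) hcl hx
  rw [e]
  refine MeasurableSet.iInter fun t => MeasurableSet.iInter fun n => ?_
  refine measurableSet_le measurable_const ?_
  simp only [dotProduct, Matrix.mulVec]
  exact Finset.measurable_sum _ fun p _ => measurable_const.mul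
    (Finset.measurable_sum _ fun r _ => (h.bddMeas_Qhat t p r).1.mul measurable_const)

end Regular

theorem isHermitian_crossMoment (i : Fin D.N) (t : Fin D.T) :
    (D.crossMoment P i t t).IsHermitian := by
  rw [isHermitian_iff_transpose_eq]
  ext p r
  exact integral_congr_ae (ae_of_all _ fun ω => mul_comm _ _)

theorem Q_transpose (t : Fin D.T) : (D.Q P t)ᵀ = D.Q P t := by
  rw [Q, Matrix.transpose_smul, Matrix.transpose_sum]
  congr 1
  exact Finset.sum_congr rfl fun i _ => isHermitian_iff_transpose_eq.1 (isHermitian_crossMoment i t)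

namespace Tame

variable {q C : ℝ}

theorem quadFormGE_Q (h : D.Tame P q C) (t : Fin D.T) : QuadFormGE q (D.Q P t) := by
  intro x
  have hN : (0 : ℝ) < D.N := by exact_mod_cast h.N_pos
  have h1 : ∀ i, q * (x ⬝ᵥ x) ≤ x ⬝ᵥ D.crossMoment P i t t *ᵥ x := fun i =>
    le_quadForm_of_posSemidef (posSemidef_sub_smul_one (isHermitian_crossMoment i t) (h.cross i t)) x
  rw [Q, Matrix.smul_mulVec, Matrix.sum_mulVec, dotProduct_smul, dotProduct_sum, smul_eq_mul,
    one_div, ← div_eq_inv_mul, le_div_iff₀ hN]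
  calc q * (x ⬝ᵥ x) * D.N = ∑ _i : Fin D.N, q * (x ⬝ᵥ x) := by simp [mul_comm]
    _ ≤ _ := Finset.sum_le_sum fun i _ => h1 i

theorem indep_sigma (h : D.Tame P q C) : Indep D.sigmaZ D.sigmaE P := h.indep.symm

theorem memLp_ε (h : D.Tame P q C) (i : Fin D.N) (t : Fin D.T) : MemLp (D.ε i t) 4 P :=
  h.reg.2.2.2.2.2 i t

theorem integral_ε_mul_eq_zero (h : D.Tame P q C) {i j : Fin D.N} (hij : i ≠ j) (t s : Fin D.T) :
    ∫ ω, D.ε i t ω * D.ε j s ω ∂P = 0 := by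
  have h1 : IndepFun (D.ε i t) (D.ε j s) P :=
    (h.ε_indep.indepFun hij).comp (measurable_pi_apply t) (measurable_pi_apply s)
  rw [h1.integral_fun_mul_eq_mul_integral (h.memLp_ε i t).1 (h.memLp_ε j s).1, h.mean, zero_mul]

theorem integral_ε_sq_le (h : D.Tame P q C) (i : Fin D.N) (t : Fin D.T) :
    ∫ ω, D.ε i t ω * D.ε i t ω ∂P ≤ C :=
  (le_abs_self _).trans ((Finset.single_le_sum
    (f := fun j => |∫ ω, D.ε i t ω * D.ε j t ω ∂P|) (fun _ _ => abs_nonneg _)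
    (Finset.mem_univ i)).trans (h.cov_le i t))

theorem sum_cov_le (h : D.Tame P q C) :
    ∑ i, ∑ t, ∑ s, |∫ ω, D.ε i t ω * D.ε i s ω ∂P| ≤ C * (D.N * D.T) := by
  refine le_trans (Finset.sum_le_sum fun i _ => ?_) h.cov_sum
  exact Finset.single_le_sum
    (f := fun j => ∑ t, ∑ s, |∫ ω, D.ε i t ω * D.ε j s ω ∂P|)
    (fun _ _ => Finset.sum_nonneg fun _ _ => Finset.sum_nonneg fun _ _ => abs_nonneg _)
    (Finset.mem_univ i)

/-- On the good event the Gram matrices of the sieve regressions are coercive. -/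
theorem quadFormGE_gram (h : D.Tame P q C) {ω : Ω} (hω : ω ∈ D.goodEvent q) (t : Fin D.T) :
    QuadFormGE (D.N * q) ((D.Phi t ω)ᵀ * D.Phi t ω) := by
  have hN : (D.N : ℝ) ≠ 0 := by exact_mod_cast h.N_pos.ne'
  have := (hω t).smul (Nat.cast_nonneg D.N)
  rwa [Qhat, smul_smul, mul_one_div_cancel hN, one_smul] at this

variable [IsProbabilityMeasure P]

theorem integral_noise_sq_le (h : D.Tame P q C) {R : Type*} [Fintype R]
    (A : Matrix (Fin M × Fin D.J) R ℝ) (t : Fin D.T) :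
    Integrable ((D.goodEvent q).indicator
      fun ω => ∑ r, (Aᵀ *ᵥ fun p => D.noiseMat ω p t) r ^ 2) P ∧
    ∫ ω, (D.goodEvent q).indicator
      (fun ω => ∑ r, (Aᵀ *ᵥ fun p => D.noiseMat ω p t) r ^ 2) ω ∂P
      ≤ C * ((D.N * q)⁻¹ * frobNorm A ^ 2) := by
  have hN : (0 : ℝ) < D.N := by exact_mod_cast h.N_pos
  have hNq : 0 < D.N * q := mul_pos hN h.q_pos
  have hG := h.reg.measurableSet_goodEvent q
  set W : Ω → Matrix R (Fin D.N) ℝ := fun ω => Aᵀ * ((D.Phi t ω)ᵀ * D.Phi t ω)⁻¹ * (D.Phi t ω)ᵀ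
    with hW
  have hWm : ∀ r i, Measurable[D.sigmaZ] fun ω => W ω r i := by
    intro r i
    have h1 : ∀ j p, Measurable[D.sigmaZ] fun ω => D.Phi t ω j p := fun j p =>
      (h.reg.bddMeas_phi j t p).1
    have h2 : ∀ p p', Measurable[D.sigmaZ] fun ω => ((D.Phi t ω)ᵀ * D.Phi t ω) p p' := fun p p' => by
      simp only [Matrix.mul_apply, Matrix.transpose_apply]
      exact Finset.measurable_sum (f := fun j ω => D.Phi t ω j p * D.Phi t ω j p') _
        fun j _ => (h1 j p).mul (h1 j p')
    exact Finset.measurable_sum _ fun p _ => (Finset.measurable_sum _ fun p' _ =>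
      measurable_const.mul (measurable_matrix_inv h2 p' p)).mul (h1 i p)
  have hWle : ∀ ω ∈ D.goodEvent q, frobNorm (W ω) ^ 2 ≤ (D.N * q)⁻¹ * frobNorm A ^ 2 :=
    fun ω hω => (h.quadFormGE_gram hω t).frobNorm_leastSquares_sq_le hNq A
  have hB0 : 0 ≤ (D.N * q)⁻¹ * frobNorm A ^ 2 := by positivity
  set w : R → Fin D.N → Unit → Ω → ℝ := fun r i _ => (D.goodEvent q).indicator fun ω => W ω r i
    with hw
  have hwB : ∀ r i u, BddMeas D.sigmaZ (w r i u) := by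
    intro r i u
    refine ⟨(hWm r i).indicator hG, Real.sqrt ((D.N * q)⁻¹ * frobNorm A ^ 2), fun ω => ?_⟩
    by_cases hω : ω ∈ D.goodEvent q
    · simp only [hw, Set.indicator_of_mem hω]
      exact (abs_le_frobNorm _ _ _).trans (Real.le_sqrt_of_sq_le (hWle ω hω))
    · simp only [hw, Set.indicator_of_notMem hω, abs_zero]
      exact Real.sqrt_nonneg _
  have hm := fun r => integral_sq_sum_mul h.reg.sigmaZ_le h.reg.sigmaE_le h.indep_sigma (hwB r)
    (e := fun i (_ : Unit) => D.ε i t) (fun i _ => h.reg.measurable_ε i t)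
    (fun i _ => h.memLp_ε i t) (fun i j hij _ _ => h.integral_ε_mul_eq_zero hij t t)
  simp only [Finset.univ_unique, Finset.sum_singleton] at hm
  have e : (D.goodEvent q).indicator (fun ω => ∑ r, (Aᵀ *ᵥ fun p => D.noiseMat ω p t) r ^ 2)
      = fun ω => ∑ r, (∑ i, w r i default ω * D.ε i t ω) ^ 2 := by
    ext ω
    by_cases hω : ω ∈ D.goodEvent q
    · rw [Set.indicator_of_mem hω]
      refine Finset.sum_congr rfl fun r _ => ?_
      simp only [hw, Set.indicator_of_mem hω]
      congr 1
      have : (fun p => D.noiseMat ω p t)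
          = ((D.Phi t ω)ᵀ * D.Phi t ω)⁻¹ *ᵥ ((D.Phi t ω)ᵀ *ᵥ fun i => D.ε i t ω) := rfl
      rw [this, Matrix.mulVec_mulVec, Matrix.mulVec_mulVec]
      rfl
    · rw [Set.indicator_of_notMem hω]
      simp [hw, Set.indicator_of_notMem hω]
  rw [e]
  refine ⟨integrable_finsetSum _ fun r _ => (hm r).1, ?_⟩
  rw [integral_finsetSum _ fun r _ => (hm r).1]
  simp only [fun r => (hm r).2]
  have hi : ∀ r i, Integrable (fun ω => w r i default ω * w r i default ω) P := fun r i =>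
    ((hwB r i default).mul (hwB r i default)).integrable h.reg.sigmaZ_le
  calc ∑ r, ∑ i, (∫ ω, w r i default ω * w r i default ω ∂P) * ∫ ω, D.ε i t ω * D.ε i t ω ∂P
      ≤ ∑ r, ∑ i, (∫ ω, w r i default ω * w r i default ω ∂P) * C := by
        refine Finset.sum_le_sum fun r _ => Finset.sum_le_sum fun i _ => ?_
        exact mul_le_mul_of_nonneg_left (h.integral_ε_sq_le i t)
          (integral_nonneg fun ω => mul_self_nonneg _)
    _ = C * ∫ ω, ∑ r, ∑ i, w r i default ω * w r i default ω ∂P := by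
        rw [integral_finsetSum _ fun r _ => integrable_finsetSum _ fun i _ => hi r i,
          Finset.mul_sum]
        refine Finset.sum_congr rfl fun r _ => ?_
        rw [integral_finsetSum _ fun i _ => hi r i, Finset.mul_sum]
        exact Finset.sum_congr rfl fun i _ => mul_comm _ _
    _ ≤ C * ((D.N * q)⁻¹ * frobNorm A ^ 2) := by
        refine mul_le_mul_of_nonneg_left ?_ (by linarith [h.one_le])
        have h3 : ∫ _ω, (D.N * q)⁻¹ * frobNorm A ^ 2 ∂P = (D.N * q)⁻¹ * frobNorm A ^ 2 := by simp
        rw [← h3]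
        refine integral_mono (integrable_finsetSum _ fun r _ => integrable_finsetSum _ fun i _ =>
          hi r i) (integrable_const _) fun ω => ?_
        by_cases hω : ω ∈ D.goodEvent q
        · simp only [hw, Set.indicator_of_mem hω, ← sq]
          rw [← frobNorm_sq]
          exact hWle ω hω
        · simp only [hw, Set.indicator_of_notMem hω, mul_zero, Finset.sum_const_zero]
          exact hB0

/-- Second moment of linear combinations of the noise on the good event. -/
theorem integral_frobNorm_noise_sq_le (h : D.Tame P q C) {R : Type*} [Fintype R]
    (A : Matrix (Fin M × Fin D.J) R ℝ) :
    Integrable ((D.goodEvent q).indicator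
      fun ω => frobNorm ((D.noiseMat ω)ᵀ * A) ^ 2) P ∧
    ∫ ω, (D.goodEvent q).indicator (fun ω => frobNorm ((D.noiseMat ω)ᵀ * A) ^ 2) ω ∂P
      ≤ D.T * (C * ((D.N * q)⁻¹ * frobNorm A ^ 2)) := by
  have h1 := fun t => h.integral_noise_sq_le A t
  have e : (D.goodEvent q).indicator (fun ω => frobNorm ((D.noiseMat ω)ᵀ * A) ^ 2)
      = fun ω => ∑ t, (D.goodEvent q).indicator
        (fun ω => ∑ r, (Aᵀ *ᵥ fun p => D.noiseMat ω p t) r ^ 2) ω := by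
    ext ω
    by_cases hω : ω ∈ D.goodEvent q
    · simp only [Set.indicator_of_mem hω]
      rw [frobNorm_sq]
      refine Finset.sum_congr rfl fun t _ => Finset.sum_congr rfl fun r _ => ?_
      congr 1
      rw [Matrix.mul_apply, Matrix.mulVec, dotProduct]
      exact Finset.sum_congr rfl fun p _ => mul_comm _ _
    · simp [Set.indicator_of_notMem hω]
  rw [e]
  refine ⟨integrable_finsetSum _ fun t _ => (h1 t).1, ?_⟩
  rw [integral_finsetSum _ fun t _ => (h1 t).1]
  refine (Finset.sum_le_sum fun t _ => (h1 t).2).trans_eq ?_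
  simp

end Tame

end FactorModel

namespace FactorModel

variable {M K : ℕ} {Ω : Type u} {D : FactorModel M K Ω} [mΩ : MeasurableSpace Ω] {P : Measure Ω}

/-- The weight of `ε_it` in the leading noise term. -/
def scoreWeight (D : FactorModel M K Ω) (P : Measure Ω) (i : Fin D.N) (t : Fin D.T)
    (r : Fin (K + 1) × (Fin M × Fin D.J)) (ω : Ω) : ℝ :=
  1 / Real.sqrt (D.N * D.T) * D.fdag t r.1 * ((D.Q P t)⁻¹ *ᵥ D.phi (D.z i t ω)) r.2

theorem scoreTerm_apply (i : Fin D.N) (ω : Ω) (r : Fin (K + 1) × (Fin M × Fin D.J)) :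
    D.scoreTerm P i ω r = ∑ t, D.scoreWeight P i t r ω * D.ε i t ω := rfl

theorem sum_sq_weight (c : ℝ) (f : Fin (K + 1) → ℝ) (x : Fin M × Fin D.J → ℝ) :
    ∑ r : Fin (K + 1) × (Fin M × Fin D.J), (c * f r.1 * x r.2) ^ 2
      = c ^ 2 * (∑ k, f k ^ 2) * euclNorm x ^ 2 := by
  rw [Fintype.sum_prod_type, euclNorm_sq, mul_assoc, Finset.sum_mul_sum, Finset.mul_sum]
  refine Finset.sum_congr rfl fun k _ => ?_
  rw [Finset.mul_sum]
  exact Finset.sum_congr rfl fun p _ => by ring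

theorem bddMeas_mulVec {m : MeasurableSpace Ω} {ι : Type*} [Fintype ι] (A : Matrix ι ι ℝ)
    {x : Ω → ι → ℝ} (hx : ∀ i, BddMeas m fun ω => x ω i) (i : ι) :
    BddMeas m fun ω => (A *ᵥ x ω) i :=
  BddMeas.sum (w := fun j ω => A i j * x ω j) fun j _ => (hx j).const_mul _

theorem Regular.bddMeas_scoreWeight (h : D.Regular P) (i : Fin D.N) (t : Fin D.T)
    (r : Fin (K + 1) × (Fin M × Fin D.J)) : BddMeas D.sigmaZ (D.scoreWeight P i t r) :=
  (bddMeas_mulVec _ (fun p => h.bddMeas_phi i t p) r.2).const_mul _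

namespace Tame

variable {q C : ℝ}

section Moments

variable [IsProbabilityMeasure P]

theorem integrable_of_bddMeas (h : D.Tame P q C) {w : Ω → ℝ} (hw : BddMeas D.sigmaZ w) :
    Integrable w P := hw.integrable h.reg.sigmaZ_le

theorem integral_phi_sq_le (h : D.Tame P q C) (i : Fin D.N) (t : Fin D.T) :
    ∫ ω, euclNorm (D.phi (D.z i t ω)) ^ 2 ∂P ≤ M * D.J * C := by
  simp only [euclNorm_sq]
  rw [integral_finsetSum _ fun p _ => by
    simpa only [sq] using h.integrable_of_bddMeas
      ((h.reg.bddMeas_phi i t p).mul (h.reg.bddMeas_phi i t p))]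
  refine (Finset.sum_le_sum fun p _ => h.phi2 p.1 p.2 i t).trans_eq ?_
  simp

theorem bddMeas_phi_pow_four (h : D.Tame P q C) (i : Fin D.N) (t : Fin D.T)
    (p : Fin M × Fin D.J) : BddMeas D.sigmaZ fun ω => D.phi (D.z i t ω) p ^ 4 := by
  have h2 := (h.reg.bddMeas_phi i t p).mul (h.reg.bddMeas_phi i t p)
  have h4 := h2.mul h2
  convert h4 using 2 with ω
  ring

theorem integral_phi_pow_four_le (h : D.Tame P q C) (i : Fin D.N) (t : Fin D.T) :
    ∫ ω, (euclNorm (D.phi (D.z i t ω)) ^ 2) ^ 2 ∂P ≤ (M * D.J) ^ 2 * C := by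
  have hB := fun p => h.integrable_of_bddMeas (h.bddMeas_phi_pow_four i t p)
  have hint : Integrable (fun ω => (M * D.J : ℝ) * ∑ p, D.phi (D.z i t ω) p ^ 4) P :=
    (integrable_finsetSum _ fun p _ => hB p).const_mul _
  calc ∫ ω, (euclNorm (D.phi (D.z i t ω)) ^ 2) ^ 2 ∂P
      ≤ ∫ ω, (M * D.J : ℝ) * ∑ p, D.phi (D.z i t ω) p ^ 4 ∂P := by
        refine integral_mono_of_nonneg (ae_of_all _ fun ω => sq_nonneg _) hint
          (ae_of_all _ fun ω => ?_)
        simp only [euclNorm_sq]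
        refine sq_sum_le_card_mul_sum_sq.trans_eq ?_
        simp [← pow_mul]
    _ = (M * D.J : ℝ) * ∑ p : Fin M × Fin D.J, ∫ ω, D.phi (D.z i t ω) p ^ 4 ∂P := by
        rw [integral_const_mul, integral_finsetSum _ fun p _ => hB p]
    _ ≤ (M * D.J : ℝ) * ∑ _p : Fin M × Fin D.J, C := by
        refine mul_le_mul_of_nonneg_left (Finset.sum_le_sum fun p _ => h.phi4 p.1 p.2 i t)
          (by positivity)
    _ = _ := by simp; ring

/-- Mean square error of the sample second moment matrix. -/
theorem integral_Qhat_sub_Q_le (h : D.Tame P q C) (t : Fin D.T) :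
    ∫ ω, frobNorm (D.Qhat t ω - D.Q P t) ^ 2 ∂P ≤ (M * D.J) ^ 2 * (C / D.N) := by
  have hN : (0 : ℝ) < D.N := by exact_mod_cast h.N_pos
  have hB : ∀ p r, BddMeas D.sigmaZ fun ω => (D.Qhat t ω - D.Q P t) p r := fun p r =>
    (h.reg.bddMeas_Qhat t p r).sub (bddMeas_const _)
  have hI : ∀ p r, Integrable (fun ω => (D.Qhat t ω - D.Q P t) p r ^ 2) P := fun p r => by
    simpa only [sq] using h.integrable_of_bddMeas ((hB p r).mul (hB p r))
  simp only [frobNorm_sq]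
  rw [integral_finsetSum _ fun p _ => integrable_finsetSum _ fun r _ => hI p r]
  have hentry : ∀ p r, ∫ ω, (D.Qhat t ω - D.Q P t) p r ^ 2 ∂P ≤ C / D.N := by
    intro p r
    set ψ : Fin D.N → Ω → ℝ := fun i ω => D.phi (D.z i t ω) p * D.phi (D.z i t ω) r with hψ
    have hψB : ∀ i, BddMeas D.sigmaZ (ψ i) := fun i =>
      (h.reg.bddMeas_phi i t p).mul (h.reg.bddMeas_phi i t r)
    have hψL : ∀ i, MemLp (ψ i) 2 P := fun i => (hψB i).memLp h.reg.sigmaZ_le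
    have hφm : ∀ p : Fin M × Fin D.J, Measurable fun x : Fin M → ℝ => D.phi x p := fun p =>
      (h.reg.1 p.2).comp (measurable_pi_apply p.1)
    have hg : Measurable fun x : Fin D.T → Fin M → ℝ => D.phi (x t) p * D.phi (x t) r :=
      ((hφm p).comp (measurable_pi_apply t)).mul ((hφm r).comp (measurable_pi_apply t))
    have hind : Set.Pairwise (↑(Finset.univ : Finset (Fin D.N)))
        fun i j => IndepFun (ψ i) (ψ j) P := fun i _ j _ hij =>
      (h.z_indep.indepFun hij).comp hg hg
    have hvar := IndepFun.variance_sum (fun i _ => hψL i) hind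
    have hvi : ∀ i, variance (ψ i) P ≤ C := by
      intro i
      refine (variance_le_expectation_sq (hψL i).1).trans ?_
      have h4 := fun p => h.integrable_of_bddMeas (h.bddMeas_phi_pow_four i t p)
      calc ∫ ω, (ψ i ^ 2) ω ∂P
          ≤ ∫ ω, (1 / 2) * (D.phi (D.z i t ω) p ^ 4 + D.phi (D.z i t ω) r ^ 4) ∂P := by
            refine integral_mono_of_nonneg (ae_of_all _ fun ω => ?_)
              (((h4 p).add (h4 r)).const_mul _) (ae_of_all _ fun ω => ?_)
            · exact sq_nonneg (ψ i ω)
            · simp only [Pi.pow_apply, hψ]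
              nlinarith [sq_nonneg (D.phi (D.z i t ω) p ^ 2 - D.phi (D.z i t ω) r ^ 2)]
        _ ≤ C := by
            rw [integral_const_mul, integral_add (h4 p) (h4 r)]
            have h5 : ∫ ω, D.phi (D.z i t ω) p ^ 4 ∂P ≤ C := h.phi4 p.1 p.2 i t
            have h6 : ∫ ω, D.phi (D.z i t ω) r ^ 4 ∂P ≤ C := h.phi4 r.1 r.2 i t
            linarith
    have hsum : variance (∑ i, ψ i) P ≤ D.N * C := by
      rw [hvar]
      refine (Finset.sum_le_sum fun i _ => hvi i).trans_eq ?_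
      simp
    rw [variance_eq_integral (Finset.aemeasurable_sum _ fun i _ => (hψL i).1.aemeasurable)] at hsum
    have hmean : ∫ ω, (∑ i, ψ i) ω ∂P = ∑ i, ∫ ω, ψ i ω ∂P := by
      simp only [Finset.sum_apply]
      exact integral_finsetSum _ fun i _ => h.integrable_of_bddMeas (hψB i)
    have e : ∀ ω, (D.Qhat t ω - D.Q P t) p r ^ 2
        = (1 / (D.N : ℝ)) ^ 2 * ((∑ i, ψ i) ω - ∑ i, ∫ ω, ψ i ω ∂P) ^ 2 := by
      intro ω
      rw [← mul_pow, mul_sub]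
      congr 1
      have e1 : D.Qhat t ω p r = 1 / (D.N : ℝ) * ∑ i, ψ i ω := rfl
      have e2 : D.Q P t p r = 1 / (D.N : ℝ) * ∑ i, ∫ ω, ψ i ω ∂P := by
        rw [Q, Matrix.smul_apply, Matrix.sum_apply]; rfl
      rw [Matrix.sub_apply, e1, e2, Finset.sum_apply]
    simp only [e]
    rw [integral_const_mul, ← hmean]
    refine (mul_le_mul_of_nonneg_left hsum (by positivity)).trans_eq ?_
    field_simp
  calc ∑ p, ∫ ω, ∑ r, (D.Qhat t ω - D.Q P t) p r ^ 2 ∂P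
      = ∑ p, ∑ r, ∫ ω, (D.Qhat t ω - D.Q P t) p r ^ 2 ∂P :=
        Finset.sum_congr rfl fun p _ => integral_finsetSum _ fun r _ => hI p r
    _ ≤ ∑ _p : Fin M × Fin D.J, ∑ _r : Fin M × Fin D.J, C / D.N :=
        Finset.sum_le_sum fun p _ => Finset.sum_le_sum fun r _ => hentry p r
    _ = _ := by simp; ring

theorem euclNorm_invQ_phi_sq_le (h : D.Tame P q C) (i : Fin D.N) (t : Fin D.T) (ω : Ω) :
    euclNorm ((D.Q P t)⁻¹ *ᵥ D.phi (D.z i t ω)) ^ 2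
      ≤ q⁻¹ ^ 2 * euclNorm (D.phi (D.z i t ω)) ^ 2 := by
  rw [← mul_pow]
  exact pow_le_pow_left₀ (euclNorm_nonneg _)
    ((h.quadFormGE_Q t).euclNorm_inv_mulVec_le h.q_pos _) 2

theorem one_div_sqrt_sq (h : D.Tame P q C) :
    (1 / Real.sqrt (D.N * D.T)) ^ 2 * (D.N * D.T) = 1 := by
  have h1 : (0 : ℝ) < D.N * D.T := by
    have := h.N_pos; have := h.T_pos; positivity
  rw [div_pow, Real.sq_sqrt h1.le, one_pow, one_div_mul_cancel h1.ne']

theorem integrable_phi_sq (h : D.Tame P q C) (i : Fin D.N) (t : Fin D.T) :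
    Integrable (fun ω => euclNorm (D.phi (D.z i t ω)) ^ 2) P := by
  simp only [euclNorm_sq]
  simp only [sq]
  exact h.integrable_of_bddMeas
    (BddMeas.sum fun p _ => (h.reg.bddMeas_phi i t p).mul (h.reg.bddMeas_phi i t p))

theorem integrable_phi_sq_sq (h : D.Tame P q C) (i : Fin D.N) (t : Fin D.T) :
    Integrable (fun ω => (euclNorm (D.phi (D.z i t ω)) ^ 2) ^ 2) P := by
  have h1 : BddMeas D.sigmaZ fun ω => euclNorm (D.phi (D.z i t ω)) ^ 2 := by
    simp only [euclNorm_sq]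
    simp only [sq]
    exact BddMeas.sum fun p _ => (h.reg.bddMeas_phi i t p).mul (h.reg.bddMeas_phi i t p)
  simpa only [sq] using h.integrable_of_bddMeas (h1.mul h1)

variable {f2 : ℝ}

theorem integral_score_sq_le (h : D.Tame P q C) (hf : ∀ t, ∑ k, D.fdag t k ^ 2 ≤ f2) :
    Integrable (fun ω => ‖∑ i, D.scoreTerm P i ω‖ ^ 2) P ∧
    ∫ ω, ‖∑ i, D.scoreTerm P i ω‖ ^ 2 ∂P ≤ f2 * q⁻¹ ^ 2 * M * C ^ 2 * D.J := by
  have hNT := h.one_div_sqrt_sq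
  have hf0 : 0 ≤ f2 := (Finset.sum_nonneg fun k _ => sq_nonneg _).trans (hf ⟨0, h.T_pos⟩)
  set c := 1 / Real.sqrt ((D.N : ℝ) * D.T) with hc
  have e : ∀ ω, ‖∑ i, D.scoreTerm P i ω‖ ^ 2
      = ∑ r, (∑ i, ∑ t, D.scoreWeight P i t r ω * D.ε i t ω) ^ 2 := by
    intro ω
    rw [EuclideanSpace.real_norm_sq_eq]
    refine Finset.sum_congr rfl fun r _ => ?_
    rw [WithLp.ofLp_sum, Finset.sum_apply]
    rfl
  simp only [e]
  have hV : ∀ i t, ∫ ω, ∑ r, D.scoreWeight P i t r ω ^ 2 ∂P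
      ≤ c ^ 2 * f2 * (q⁻¹ ^ 2 * (M * D.J * C)) := by
    intro i t
    refine (integral_mono_of_nonneg (ae_of_all _ fun ω => Finset.sum_nonneg fun r _ => sq_nonneg _)
      (((h.integrable_phi_sq i t).const_mul (q⁻¹ ^ 2)).const_mul (c ^ 2 * f2))
      (ae_of_all _ fun ω => ?_)).trans ?_
    · simp only [scoreWeight, sum_sq_weight]
      exact mul_le_mul (mul_le_mul_of_nonneg_left (hf t) (sq_nonneg _))
        (h.euclNorm_invQ_phi_sq_le i t ω) (sq_nonneg _) (by positivity)
    · rw [integral_const_mul, integral_const_mul]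
      have := h.integral_phi_sq_le i t
      gcongr
  obtain ⟨h1, h2⟩ := sum_integral_sq_sum_mul_le h.reg.sigmaZ_le h.reg.sigmaE_le h.indep_sigma
    (w := fun r i t => D.scoreWeight P i t r) (e := D.ε)
    (fun r i t => h.reg.bddMeas_scoreWeight i t r) h.reg.measurable_ε h.memLp_ε
    (fun i j hij t s => h.integral_ε_mul_eq_zero hij t s) hV
  refine ⟨h1, h2.trans ?_⟩
  have hC : 0 ≤ C := by linarith [h.one_le]
  calc c ^ 2 * f2 * (q⁻¹ ^ 2 * (M * D.J * C)) * ∑ i, ∑ t, ∑ s, |∫ ω, D.ε i t ω * D.ε i s ω ∂P|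
      ≤ c ^ 2 * f2 * (q⁻¹ ^ 2 * (M * D.J * C)) * (C * (D.N * D.T)) :=
        mul_le_mul_of_nonneg_left h.sum_cov_le (by positivity)
    _ = (c ^ 2 * (D.N * D.T)) * (f2 * q⁻¹ ^ 2 * M * C ^ 2 * D.J) := by ring
    _ = _ := by rw [hNT, one_mul]

theorem integral_scoreTerm_pow_four_le (h : D.Tame P q C) (hf : ∀ t, ∑ k, D.fdag t k ^ 2 ≤ f2)
    (i : Fin D.N) : ∫ ω, ‖D.scoreTerm P i ω‖ ^ 4 ∂P
      ≤ f2 ^ 2 * q⁻¹ ^ 4 * M ^ 2 * C ^ 2 * (D.J ^ 2 / (D.N : ℝ) ^ 2) := by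
  have hNT := h.one_div_sqrt_sq
  have hN : (0 : ℝ) < D.N := by exact_mod_cast h.N_pos
  have hf0 : 0 ≤ f2 := (Finset.sum_nonneg fun k _ => sq_nonneg _).trans (hf ⟨0, h.T_pos⟩)
  set c := 1 / Real.sqrt ((D.N : ℝ) * D.T) with hc
  have e : ∀ ω, ‖D.scoreTerm P i ω‖ ^ 4
      = (∑ r, (∑ t, D.scoreWeight P i t r ω * D.ε i t ω) ^ 2) ^ 2 := by
    intro ω
    rw [show ‖D.scoreTerm P i ω‖ ^ 4 = (‖D.scoreTerm P i ω‖ ^ 2) ^ 2 by ring,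
      EuclideanSpace.real_norm_sq_eq]
    rfl
  simp only [e]
  have hV : ∀ t, ∫ ω, (∑ r, D.scoreWeight P i t r ω ^ 2) ^ 2 ∂P
      ≤ (c ^ 2 * f2 * q⁻¹ ^ 2) ^ 2 * ((M * D.J) ^ 2 * C) := by
    intro t
    refine (integral_mono_of_nonneg (ae_of_all _ fun ω => sq_nonneg _)
      ((h.integrable_phi_sq_sq i t).const_mul ((c ^ 2 * f2 * q⁻¹ ^ 2) ^ 2))
      (ae_of_all _ fun ω => ?_)).trans ?_
    · simp only [scoreWeight, sum_sq_weight]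
      rw [← mul_pow]
      refine pow_le_pow_left₀ (mul_nonneg (mul_nonneg (sq_nonneg _)
        (Finset.sum_nonneg fun k _ => sq_nonneg _)) (sq_nonneg _)) ?_ 2
      rw [mul_assoc _ (q⁻¹ ^ 2)]
      exact mul_le_mul (mul_le_mul_of_nonneg_left (hf t) (sq_nonneg _))
        (h.euclNorm_invQ_phi_sq_le i t ω) (sq_nonneg _) (by positivity)
    · rw [integral_const_mul]
      exact mul_le_mul_of_nonneg_left (h.integral_phi_pow_four_le i t) (sq_nonneg _)
  have h2 := integral_sq_sum_sq_sum_mul_le h.reg.sigmaZ_le h.reg.sigmaE_le h.indep_sigma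
    (w := fun r t => D.scoreWeight P i t r) (e := D.ε i)
    (fun r t => h.reg.bddMeas_scoreWeight i t r) (h.reg.measurable_ε i) (h.memLp_ε i) hV
  refine h2.trans ?_
  have hC : 0 ≤ C := by linarith [h.one_le]
  refine (mul_le_mul_of_nonneg_left (h.ε4 i) (by positivity)).trans_eq ?_
  have e2 : (c ^ 2 * D.T) = 1 / D.N := by
    rw [eq_div_iff hN.ne']; linarith
  calc (c ^ 2 * f2 * q⁻¹ ^ 2) ^ 2 * ((M * D.J) ^ 2 * C) * (C * D.T ^ 2)
      = (c ^ 2 * D.T) ^ 2 * (f2 ^ 2 * q⁻¹ ^ 4 * M ^ 2 * C ^ 2 * D.J ^ 2) := by ring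
    _ = _ := by rw [e2]; field_simp

theorem invQhat_mulVec (h : D.Tame P q C) {ω : Ω} (hω : ω ∈ D.goodEvent q) (t : Fin D.T)
    (x : Fin M × Fin D.J → ℝ) :
    ((D.Phi t ω)ᵀ * D.Phi t ω)⁻¹ *ᵥ x = (1 / (D.N : ℝ)) • ((D.Qhat t ω)⁻¹ *ᵥ x) := by
  have hN : (0 : ℝ) < D.N := by exact_mod_cast h.N_pos
  have hu := (h.quadFormGE_gram hω t).isUnit_det (mul_pos hN h.q_pos)
  have e : (D.Qhat t ω)⁻¹ = (D.N : ℝ) • ((D.Phi t ω)ᵀ * D.Phi t ω)⁻¹ := by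
    refine Matrix.inv_eq_left_inv ?_
    rw [Qhat, Matrix.smul_mul, Matrix.mul_smul, smul_smul, mul_one_div_cancel hN.ne', one_smul,
      Matrix.nonsing_inv_mul _ hu]
  rw [e, Matrix.smul_mulVec, smul_smul, one_div_mul_cancel hN.ne', one_smul]

theorem noiseMat_apply (h : D.Tame P q C) {ω : Ω} (hω : ω ∈ D.goodEvent q) (t : Fin D.T)
    (p : Fin M × Fin D.J) : D.noiseMat ω p t
      = 1 / (D.N : ℝ) * ∑ i, ((D.Qhat t ω)⁻¹ *ᵥ D.phi (D.z i t ω)) p * D.ε i t ω := by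
  have e1 : (D.Phi t ω)ᵀ *ᵥ (fun i => D.ε i t ω) = ∑ i, D.ε i t ω • D.phi (D.z i t ω) := by
    ext p'
    rw [Finset.sum_apply, Matrix.mulVec, dotProduct]
    exact Finset.sum_congr rfl fun i _ => mul_comm _ _
  have e2 : D.noiseMat ω p t
      = (((D.Phi t ω)ᵀ * D.Phi t ω)⁻¹ *ᵥ ((D.Phi t ω)ᵀ *ᵥ fun i => D.ε i t ω)) p := rfl
  rw [e2, h.invQhat_mulVec hω, e1, Matrix.mulVec_sum, Pi.smul_apply, Finset.sum_apply, smul_eq_mul]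
  congr 1
  refine Finset.sum_congr rfl fun i _ => ?_
  rw [Matrix.mulVec_smul, Pi.smul_apply, smul_eq_mul, mul_comm]

/-- Mean square error from replacing `Q̂_t` by `Q_t` in the leading noise term. -/
theorem integral_noiseScore_sub_score_sq_le (h : D.Tame P q C)
    (hf : ∀ t, ∑ k, D.fdag t k ^ 2 ≤ f2) :
    Integrable ((D.goodEvent q).indicator fun ω =>
      ∑ r, (D.noiseScore ω r.2 r.1 - (∑ i, D.scoreTerm P i ω) r) ^ 2) P ∧
    ∫ ω, (D.goodEvent q).indicator (fun ω =>
      ∑ r, (D.noiseScore ω r.2 r.1 - (∑ i, D.scoreTerm P i ω) r) ^ 2) ω ∂P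
      ≤ f2 * q⁻¹ ^ 4 * M ^ 3 * C ^ 2 * (D.ξ ^ 2 * D.J ^ 2 / D.N) := by
  have hNT := h.one_div_sqrt_sq
  have hN : (0 : ℝ) < D.N := by exact_mod_cast h.N_pos
  have hT : (0 : ℝ) < D.T := by exact_mod_cast h.T_pos
  have hf0 : 0 ≤ f2 := (Finset.sum_nonneg fun k _ => sq_nonneg _).trans (hf ⟨0, h.T_pos⟩)
  have hG := h.reg.measurableSet_goodEvent q
  have hq := h.q_pos
  set c := 1 / Real.sqrt ((D.N : ℝ) * D.T) with hc
  set u : Fin D.N → Fin D.T → Ω → Fin M × Fin D.J → ℝ := fun i t ω =>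
    ((D.Qhat t ω)⁻¹ - (D.Q P t)⁻¹) *ᵥ D.phi (D.z i t ω) with hu
  set w : Fin (K + 1) × (Fin M × Fin D.J) → Fin D.N → Fin D.T → Ω → ℝ := fun r i t =>
    (D.goodEvent q).indicator fun ω => c * D.fdag t r.1 * u i t ω r.2 with hw
  have hule : ∀ i t, ∀ ω ∈ D.goodEvent q,
      euclNorm (u i t ω) ^ 2 ≤ q⁻¹ ^ 4 * (M * D.ξ ^ 2) * frobNorm (D.Qhat t ω - D.Q P t) ^ 2 := by
    intro i t ω hω
    have h1 := QuadFormGE.euclNorm_inv_sub_inv_mulVec_le (hω t) (h.quadFormGE_Q t) hq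
      (D.phi (D.z i t ω))
    refine (pow_le_pow_left₀ (euclNorm_nonneg _) h1 2).trans ?_
    calc (q⁻¹ * (frobNorm (D.Qhat t ω - D.Q P t) * (q⁻¹ * euclNorm (D.phi (D.z i t ω))))) ^ 2
        = q⁻¹ ^ 4 * euclNorm (D.phi (D.z i t ω)) ^ 2 * frobNorm (D.Qhat t ω - D.Q P t) ^ 2 := by
          ring
      _ ≤ _ := by
          have := h.reg.euclNorm_phi_sq_le i t ω
          gcongr
  have hQB : ∀ t, BddMeas D.sigmaZ fun ω => frobNorm (D.Qhat t ω - D.Q P t) ^ 2 := by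
    intro t
    simp only [frobNorm_sq]
    simp only [sq]
    refine BddMeas.sum fun p _ => BddMeas.sum fun r _ => ?_
    have := (h.reg.bddMeas_Qhat t p r).sub (bddMeas_const (D.Q P t p r))
    exact this.mul this
  have hum : ∀ i t p, Measurable[D.sigmaZ] fun ω => u i t ω p := by
    intro i t p
    refine Finset.measurable_sum (f := fun p' ω =>
      ((D.Qhat t ω)⁻¹ p p' - (D.Q P t)⁻¹ p p') * D.phi (D.z i t ω) p') _ fun p' _ => ?_
    exact ((measurable_matrix_inv (fun a b => (h.reg.bddMeas_Qhat t a b).1) p p').sub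
      measurable_const).mul (h.reg.bddMeas_phi i t p').1
  have hwB : ∀ r i t, BddMeas D.sigmaZ (w r i t) := by
    intro r i t
    obtain ⟨b, hb⟩ := (hQB t).2
    have hm : Measurable[D.sigmaZ] fun ω => c * D.fdag t r.1 * u i t ω r.2 :=
      (hum i t r.2).const_mul _
    refine ⟨hm.indicator hG, |c * D.fdag t r.1| * Real.sqrt (q⁻¹ ^ 4 * (M * D.ξ ^ 2) * b),
      fun ω => ?_⟩
    by_cases hω : ω ∈ D.goodEvent q
    · simp only [hw, Set.indicator_of_mem hω]
      rw [abs_mul]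
      refine mul_le_mul_of_nonneg_left ?_ (abs_nonneg _)
      refine Real.abs_le_sqrt ?_
      have h1 : u i t ω r.2 ^ 2 ≤ euclNorm (u i t ω) ^ 2 := by
        rw [euclNorm_sq]
        exact Finset.single_le_sum (f := fun p => u i t ω p ^ 2) (fun _ _ => sq_nonneg _)
          (Finset.mem_univ r.2)
      refine h1.trans ((hule i t ω hω).trans ?_)
      have := (le_abs_self _).trans (hb ω)
      gcongr
    · simp only [hw, Set.indicator_of_notMem hω, abs_zero]
      positivity
  have hV : ∀ i t, ∫ ω, ∑ r, w r i t ω ^ 2 ∂P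
      ≤ c ^ 2 * f2 * (q⁻¹ ^ 4 * (M * D.ξ ^ 2) * ((M * D.J) ^ 2 * (C / D.N))) := by
    intro i t
    have hI := h.integrable_of_bddMeas (hQB t)
    refine (integral_mono_of_nonneg (ae_of_all _ fun ω => Finset.sum_nonneg fun r _ => sq_nonneg _)
      ((hI.const_mul (q⁻¹ ^ 4 * (M * D.ξ ^ 2))).const_mul (c ^ 2 * f2))
      (ae_of_all _ fun ω => ?_)).trans ?_
    · by_cases hω : ω ∈ D.goodEvent q
      · simp only [hw, Set.indicator_of_mem hω, sum_sq_weight]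
        exact mul_le_mul (mul_le_mul_of_nonneg_left (hf t) (sq_nonneg _))
          (hule i t ω hω) (sq_nonneg _) (by positivity)
      · simp only [hw, Set.indicator_of_notMem hω]
        simp only [ne_eq, OfNat.ofNat_ne_zero, not_false_eq_true, zero_pow, Finset.sum_const_zero]
        positivity
    · rw [integral_const_mul, integral_const_mul]
      have := h.integral_Qhat_sub_Q_le t
      gcongr
  obtain ⟨h1, h2⟩ := sum_integral_sq_sum_mul_le h.reg.sigmaZ_le h.reg.sigmaE_le h.indep_sigma
    hwB h.reg.measurable_ε h.memLp_ε
    (fun i j hij t s => h.integral_ε_mul_eq_zero hij t s) hV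
  have e : (D.goodEvent q).indicator (fun ω =>
      ∑ r, (D.noiseScore ω r.2 r.1 - (∑ i, D.scoreTerm P i ω) r) ^ 2)
      = fun ω => ∑ r, (∑ i, ∑ t, w r i t ω * D.ε i t ω) ^ 2 := by
    ext ω
    by_cases hω : ω ∈ D.goodEvent q
    · rw [Set.indicator_of_mem hω]
      refine Finset.sum_congr rfl fun r _ => ?_
      congr 1
      have hsc : Real.sqrt D.N / Real.sqrt D.T * (1 / (D.N : ℝ)) = c := by
        have h3 : (0 : ℝ) < Real.sqrt D.N := Real.sqrt_pos.2 hN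
        have h4 : (0 : ℝ) < Real.sqrt D.T := Real.sqrt_pos.2 hT
        have h5 : Real.sqrt D.N * Real.sqrt D.N = D.N := Real.mul_self_sqrt hN.le
        rw [hc, Real.sqrt_mul hN.le]
        rw [show (1 : ℝ) / D.N = 1 / (Real.sqrt D.N * Real.sqrt D.N) by rw [h5]]
        field_simp
      have e1 : D.noiseScore ω r.2 r.1 = ∑ i, ∑ t,
          c * D.fdag t r.1 * ((D.Qhat t ω)⁻¹ *ᵥ D.phi (D.z i t ω)) r.2 * D.ε i t ω := by
        rw [Finset.sum_comm]
        simp only [noiseScore, Matrix.of_apply, h.noiseMat_apply hω]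
        rw [Finset.mul_sum]
        refine Finset.sum_congr rfl fun t _ => ?_
        rw [← hsc, Finset.mul_sum, Finset.sum_mul, Finset.mul_sum]
        exact Finset.sum_congr rfl fun i _ => by ring
      have e2 : (∑ i, D.scoreTerm P i ω) r = ∑ i, ∑ t,
          c * D.fdag t r.1 * ((D.Q P t)⁻¹ *ᵥ D.phi (D.z i t ω)) r.2 * D.ε i t ω := by
        rw [WithLp.ofLp_sum, Finset.sum_apply]
        rfl
      rw [e1, e2, ← Finset.sum_sub_distrib]
      refine Finset.sum_congr rfl fun i _ => ?_
      rw [← Finset.sum_sub_distrib]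
      refine Finset.sum_congr rfl fun t _ => ?_
      simp only [hw, Set.indicator_of_mem hω, hu, Matrix.sub_mulVec, Pi.sub_apply]
      ring
    · rw [Set.indicator_of_notMem hω]
      simp [hw, Set.indicator_of_notMem hω]
  rw [e]
  refine ⟨h1, h2.trans ?_⟩
  have hC : 0 ≤ C := by linarith [h.one_le]
  calc _ ≤ c ^ 2 * f2 * (q⁻¹ ^ 4 * (M * D.ξ ^ 2) * ((M * D.J) ^ 2 * (C / D.N)))
          * (C * (D.N * D.T)) := mul_le_mul_of_nonneg_left h.sum_cov_le (by positivity)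
    _ = (c ^ 2 * (D.N * D.T)) * (f2 * q⁻¹ ^ 4 * M ^ 3 * C ^ 2 * (D.ξ ^ 2 * D.J ^ 2 / D.N)) := by
        ring
    _ = _ := by rw [hNT, one_mul]

end Moments

end Tame

end FactorModel

namespace FactorModel

variable {M K : ℕ} {Ω : Type u} {D : FactorModel M K Ω} [mΩ : MeasurableSpace Ω] {P : Measure Ω}

namespace Tame

variable {q C : ℝ}

theorem measurable_phi_apply (h : D.Tame P q C) (p : Fin M × Fin D.J) :
    Measurable fun x : Fin M → ℝ => D.phi x p := (h.reg.1 p.2).comp (measurable_pi_apply p.1)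

/-- The score term of unit `i` as a function of the data of unit `i`. -/
theorem exists_scoreTerm_eq_comp (h : D.Tame P q C) (i : Fin D.N) :
    ∃ g : (Fin D.T → Fin M → ℝ) × (Fin D.T → ℝ) →
      EuclideanSpace ℝ (Fin (K + 1) × (Fin M × Fin D.J)), Measurable g ∧
      D.scoreTerm P i = g ∘ fun ω => (fun t => D.z i t ω, fun t => D.ε i t ω) := by
  refine ⟨fun x => WithLp.toLp 2 fun r => ∑ t, (1 / Real.sqrt (D.N * D.T) * D.fdag t r.1
    * ((D.Q P t)⁻¹ *ᵥ D.phi (x.1 t)) r.2) * x.2 t, ?_, rfl⟩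
  refine (WithLp.measurable_toLp 2 _).comp (measurable_pi_lambda _ fun r => ?_)
  refine Finset.measurable_sum (f := fun t (x : (Fin D.T → Fin M → ℝ) × (Fin D.T → ℝ)) =>
    (1 / Real.sqrt (D.N * D.T) * D.fdag t r.1 * ((D.Q P t)⁻¹ *ᵥ D.phi (x.1 t)) r.2) * x.2 t) _
    fun t _ => ?_
  refine Measurable.mul ?_ ((measurable_pi_apply t).comp measurable_snd)
  refine measurable_const.mul (Finset.measurable_sum
    (f := fun p (x : (Fin D.T → Fin M → ℝ) × (Fin D.T → ℝ)) =>
      (D.Q P t)⁻¹ r.2 p * D.phi (x.1 t) p) _ fun p _ => ?_)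
  exact measurable_const.mul
    ((h.measurable_phi_apply p).comp ((measurable_pi_apply t).comp measurable_fst))

theorem measurable_unit_data (h : D.Tame P q C) (i : Fin D.N) :
    Measurable (fun ω => (fun t => D.z i t ω)) ∧ Measurable (fun ω => (fun t => D.ε i t ω)) :=
  ⟨measurable_pi_lambda _ fun t => h.reg.2.1 i t, measurable_pi_lambda _ fun t => h.reg.2.2.1 i t⟩

theorem measurable_scoreTerm (h : D.Tame P q C) (i : Fin D.N) : Measurable (D.scoreTerm P i) := by
  obtain ⟨g, hg, e⟩ := h.exists_scoreTerm_eq_comp i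
  rw [e]
  exact hg.comp ((h.measurable_unit_data i).1.prodMk (h.measurable_unit_data i).2)

theorem iIndepFun_scoreTerm (h : D.Tame P q C) : iIndepFun (D.scoreTerm P) P := by
  choose g hg e using h.exists_scoreTerm_eq_comp
  have h1 := iIndepFun_prodMk_of_indepFun h.z_indep h.ε_indep
    (fun i => (h.measurable_unit_data i).1) (fun i => (h.measurable_unit_data i).2) h.indep.symm
  have h2 := h1.comp g hg
  have e2 : D.scoreTerm P = fun i => g i ∘ fun ω => (fun t => D.z i t ω, fun t => D.ε i t ω) :=
    funext e
  rw [e2]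
  exact h2

variable [IsProbabilityMeasure P]

theorem memLp_scoreWeight_mul (h : D.Tame P q C) (i : Fin D.N) (t : Fin D.T)
    (r : Fin (K + 1) × (Fin M × Fin D.J)) :
    MemLp (fun ω => D.scoreWeight P i t r ω * D.ε i t ω) 4 P := by
  have hB := h.reg.bddMeas_scoreWeight i t r
  obtain ⟨b, hb⟩ := hB.2
  refine (h.memLp_ε i t).of_le_mul (c := b)
    ((hB.1.mono h.reg.sigmaZ_le le_rfl).aestronglyMeasurable.mul (h.memLp_ε i t).1)
    (ae_of_all _ fun ω => ?_)
  rw [norm_mul]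
  exact mul_le_mul_of_nonneg_right (hb ω) (norm_nonneg _)

theorem memLp_scoreTerm (h : D.Tame P q C) (i : Fin D.N) : MemLp (D.scoreTerm P i) 4 P := by
  refine MemLp.of_eval_piLp fun r => ?_
  simp only [scoreTerm_apply]
  exact memLp_finsetSum _ fun t _ => h.memLp_scoreWeight_mul i t r

theorem integral_scoreTerm_eq_zero (h : D.Tame P q C) (i : Fin D.N)
    (r : Fin (K + 1) × (Fin M × Fin D.J)) : ∫ ω, D.scoreTerm P i ω r ∂P = 0 := by
  simp only [scoreTerm_apply]
  rw [integral_finsetSum _ fun t _ => (h.memLp_scoreWeight_mul i t r).integrable (by norm_num)]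
  refine Finset.sum_eq_zero fun t _ => ?_
  rw [integral_mul_of_indep h.reg.sigmaZ_le h.reg.sigmaE_le h.indep_sigma
    (h.reg.bddMeas_scoreWeight i t r).1 (h.reg.measurable_ε i t), h.mean, mul_zero]

theorem integral_invQ_phi_mul (h : D.Tame P q C) (i : Fin D.N) (t s : Fin D.T)
    (p p' : Fin M × Fin D.J) :
    ∫ ω, ((D.Q P t)⁻¹ *ᵥ D.phi (D.z i t ω)) p * ((D.Q P s)⁻¹ *ᵥ D.phi (D.z i s ω)) p' ∂P
      = ((D.Q P t)⁻¹ * D.crossMoment P i t s * (D.Q P s)⁻¹) p p' := by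
  have hsym : ∀ b, (D.Q P s)⁻¹ p' b = (D.Q P s)⁻¹ b p' := fun b => by
    rw [← Matrix.transpose_apply (D.Q P s)⁻¹ b p', Matrix.transpose_nonsing_inv, Q_transpose]
  have hI : ∀ a b, Integrable (fun ω => (D.Q P t)⁻¹ p a * (D.Q P s)⁻¹ p' b *
      (D.phi (D.z i t ω) a * D.phi (D.z i s ω) b)) P := fun a b =>
    (h.integrable_of_bddMeas
      ((h.reg.bddMeas_phi i t a).mul (h.reg.bddMeas_phi i s b))).const_mul _
  have e : ∀ ω, ((D.Q P t)⁻¹ *ᵥ D.phi (D.z i t ω)) p * ((D.Q P s)⁻¹ *ᵥ D.phi (D.z i s ω)) p'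
      = ∑ a, ∑ b, (D.Q P t)⁻¹ p a * (D.Q P s)⁻¹ p' b *
        (D.phi (D.z i t ω) a * D.phi (D.z i s ω) b) := by
    intro ω
    rw [Matrix.mulVec, dotProduct, Matrix.mulVec, dotProduct, Finset.sum_mul_sum]
    exact Finset.sum_congr rfl fun a _ => Finset.sum_congr rfl fun b _ => by ring
  simp only [e]
  rw [integral_finsetSum _ fun a _ => integrable_finsetSum _ fun b _ => hI a b]
  rw [Matrix.mul_apply]
  simp only [Matrix.mul_apply, Finset.sum_mul]
  rw [Finset.sum_comm]
  refine Finset.sum_congr rfl fun a _ => ?_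
  rw [integral_finsetSum _ fun b _ => hI a b]
  refine Finset.sum_congr rfl fun b _ => ?_
  rw [integral_const_mul, hsym]
  have : D.crossMoment P i t s a b = ∫ ω, D.phi (D.z i t ω) a * D.phi (D.z i s ω) b ∂P := rfl
  rw [this]
  ring

theorem sum_integral_scoreTerm_mul (h : D.Tame P q C) (r r' : Fin (K + 1) × (Fin M × Fin D.J)) :
    ∑ i, ∫ ω, D.scoreTerm P i ω r * D.scoreTerm P i ω r' ∂P = D.Omega P r r' := by
  have hNT := h.one_div_sqrt_sq
  set c := 1 / Real.sqrt ((D.N : ℝ) * D.T) with hc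
  have hc2 : c * c = 1 / ((D.N : ℝ) * D.T) := by
    rw [hc, one_div_mul_one_div, Real.mul_self_sqrt (by positivity)]
  rw [Omega, Matrix.smul_apply, Matrix.sum_apply, smul_eq_mul, Finset.mul_sum]
  refine Finset.sum_congr rfl fun i _ => ?_
  rw [Matrix.sum_apply, Finset.mul_sum]
  simp only [scoreTerm_apply, Finset.sum_mul_sum]
  have hI : ∀ t s, Integrable (fun ω => D.scoreWeight P i t r ω * D.ε i t ω *
      (D.scoreWeight P i s r' ω * D.ε i s ω)) P := fun t s =>
    integrable_mul_of_memLp_four (h.memLp_scoreWeight_mul i t r) (h.memLp_scoreWeight_mul i s r')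
  rw [integral_finsetSum _ fun t _ => integrable_finsetSum _ fun s _ => hI t s]
  refine Finset.sum_congr rfl fun t _ => ?_
  rw [integral_finsetSum _ fun s _ => hI t s, Matrix.sum_apply, Finset.mul_sum]
  refine Finset.sum_congr rfl fun s _ => ?_
  have e : ∀ ω, D.scoreWeight P i t r ω * D.ε i t ω * (D.scoreWeight P i s r' ω * D.ε i s ω)
      = (D.scoreWeight P i t r ω * D.scoreWeight P i s r' ω) * (D.ε i t ω * D.ε i s ω) :=
    fun ω => by ring
  simp only [e]
  rw [integral_mul_of_indep (g := fun ω => D.ε i t ω * D.ε i s ω) h.reg.sigmaZ_le h.reg.sigmaE_le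
    h.indep_sigma ((h.reg.bddMeas_scoreWeight i t r).mul (h.reg.bddMeas_scoreWeight i s r')).1
    ((h.reg.measurable_ε i t).mul (h.reg.measurable_ε i s))]
  have e2 : ∀ ω, D.scoreWeight P i t r ω * D.scoreWeight P i s r' ω
      = (c * c * (D.fdag t r.1 * D.fdag s r'.1)) *
        (((D.Q P t)⁻¹ *ᵥ D.phi (D.z i t ω)) r.2 * ((D.Q P s)⁻¹ *ᵥ D.phi (D.z i s ω)) r'.2) :=
    fun ω => by simp only [scoreWeight]; ring
  simp only [e2]
  rw [integral_const_mul, h.integral_invQ_phi_mul, hc2, Matrix.smul_apply,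
    Matrix.kroneckerMap_apply, Matrix.vecMulVec_apply, smul_eq_mul]
  ring

variable {f2 : ℝ}

/-- The leading noise term can be coupled with a Gaussian matrix. -/
theorem exists_coupling (h : D.Tame P q C) (hf : ∀ t, ∑ k, D.fdag t k ^ 2 ≤ f2) :
    (D.Omega P).PosSemidef ∧
    ∃ P' : Measure (Ω × EuclideanSpace ℝ (Fin (K + 1) × (Fin M × Fin D.J))),
      P'.map Prod.fst = P ∧ P'.map Prod.snd = multivariateGaussian 0 (D.Omega P) ∧
      (0 < M → 0 < D.J →
      Integrable (fun z => ‖∑ i, D.scoreTerm P i z.1 - z.2‖) P' ∧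
      ∫ z, ‖∑ i, D.scoreTerm P i z.1 - z.2‖ ∂P' ≤
        (3 * Real.sqrt ((K + 1) * M) + gaussShiftConst * (2 + (1 + gaussM4) *
          (f2 ^ 2 * q⁻¹ ^ 4 * M ^ 2 * C ^ 2)))
          * ((D.J : ℝ) ^ (5 / 6 : ℝ) / (D.N : ℝ) ^ (1 / 6 : ℝ))) := by
  have hN : (0 : ℝ) < D.N := by exact_mod_cast h.N_pos
  rcases Nat.eq_zero_or_pos (M * D.J) with h0 | h0
  · have hemp : IsEmpty (Fin (K + 1) × (Fin M × Fin D.J)) := by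
      rw [← Fintype.card_eq_zero_iff]; simp; simpa using h0
    have hps : (D.Omega P).PosSemidef := by
      rw [show D.Omega P = 0 from Subsingleton.elim _ _]; exact Matrix.PosSemidef.zero
    refine ⟨hps, P.prod (multivariateGaussian 0 (D.Omega P)), ?_, ?_, fun hM hJ => ?_⟩
    · rw [Measure.map_fst_prod]; simp
    · rw [Measure.map_snd_prod]; simp
    · exact absurd h0 (Nat.mul_pos hM hJ).ne'
  · have hM : 0 < M := Nat.pos_of_mul_pos_right h0
    have hJ : 0 < D.J := Nat.pos_of_mul_pos_left h0
    have hJ' : (0 : ℝ) < D.J := by exact_mod_cast hJ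
    haveI : Nonempty (Fin (K + 1) × (Fin M × Fin D.J)) := ⟨(0, ⟨0, hM⟩, ⟨0, hJ⟩)⟩
    set σ : ℝ := (D.J : ℝ) ^ (1 / 3 : ℝ) / (D.N : ℝ) ^ (1 / 6 : ℝ) with hσ
    set r : ℝ := (D.J : ℝ) ^ (1 / 2 : ℝ) / (D.N : ℝ) ^ (1 / 2 : ℝ) with hr
    have hσ0 : 0 < σ := by positivity
    have hr0 : 0 < r := by positivity
    obtain ⟨hps, P', hfst, hsnd, hint, hle⟩ := exists_gaussian_coupling h.measurable_scoreTerm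
      h.memLp_scoreTerm h.iIndepFun_scoreTerm h.integral_scoreTerm_eq_zero
      h.sum_integral_scoreTerm_mul hσ0 hr0
    refine ⟨hps, P', hfst, hsnd, fun _ _ => ⟨hint, hle.trans ?_⟩⟩
    set A := f2 ^ 2 * q⁻¹ ^ 4 * M ^ 2 * C ^ 2 with hA
    set R := (D.J : ℝ) ^ (5 / 6 : ℝ) / (D.N : ℝ) ^ (1 / 6 : ℝ) with hR
    have hsum : ∑ i, ∫ ω, ‖D.scoreTerm P i ω‖ ^ 4 ∂P ≤ A * (D.J ^ 2 / D.N) := by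
      refine (Finset.sum_le_sum fun i _ => h.integral_scoreTerm_pow_four_le hf i).trans_eq ?_
      simp only [Finset.sum_const, Finset.card_univ, Fintype.card_fin, nsmul_eq_mul, hA]
      field_simp
    have hcard : Real.sqrt (Fintype.card (Fin (K + 1) × (Fin M × Fin D.J)))
        = Real.sqrt ((K + 1) * M) * (D.J : ℝ) ^ (1 / 2 : ℝ) := by
      rw [← Real.sqrt_eq_rpow, ← Real.sqrt_mul (by positivity)]
      congr 1
      simp
      ring
    have hJh : (D.J : ℝ) ^ (1 / 3 : ℝ) * (D.J : ℝ) ^ (1 / 2 : ℝ) = (D.J : ℝ) ^ (5 / 6 : ℝ) := by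
      rw [← Real.rpow_add hJ']; norm_num
    have t1 : σ * (D.J : ℝ) ^ (1 / 2 : ℝ) = R := by
      rw [hσ, hR, div_mul_eq_mul_div, hJh]
    have hσ2 : σ ^ 2 = (D.J : ℝ) ^ (2 / 3 : ℝ) / (D.N : ℝ) ^ (1 / 3 : ℝ) := by
      rw [hσ, div_pow, ← Real.rpow_mul_natCast hJ'.le, ← Real.rpow_mul_natCast hN.le]
      norm_num
    have hr3 : (D.N : ℝ) * r ^ 3 = (D.J : ℝ) ^ (3 / 2 : ℝ) / (D.N : ℝ) ^ (1 / 2 : ℝ) := by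
      rw [hr, div_pow, ← Real.rpow_mul_natCast hJ'.le, ← Real.rpow_mul_natCast hN.le]
      have : (D.N : ℝ) ^ (1 / 2 * (3 : ℕ) : ℝ) = D.N * (D.N : ℝ) ^ (1 / 2 : ℝ) := by
        rw [← Real.rpow_one_add' hN.le (by norm_num)]; norm_num
      rw [this]
      have h2 : (0 : ℝ) < (D.N : ℝ) ^ (1 / 2 : ℝ) := by positivity
      field_simp
      norm_num
    have hr4 : (D.J : ℝ) ^ 2 / D.N / r = (D.J : ℝ) ^ (3 / 2 : ℝ) / (D.N : ℝ) ^ (1 / 2 : ℝ) := by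
      have hJ2 : (D.J : ℝ) ^ 2 = (D.J : ℝ) ^ (3 / 2 : ℝ) * (D.J : ℝ) ^ (1 / 2 : ℝ) := by
        rw [← Real.rpow_add hJ', ← Real.rpow_natCast]; norm_num
      have hN1 : (D.N : ℝ) = (D.N : ℝ) ^ (1 / 2 : ℝ) * (D.N : ℝ) ^ (1 / 2 : ℝ) := by
        rw [← Real.rpow_add hN]; norm_num
      have h2 : (0 : ℝ) < (D.N : ℝ) ^ (1 / 2 : ℝ) := by positivity
      have h3 : (0 : ℝ) < (D.J : ℝ) ^ (1 / 2 : ℝ) := by positivity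
      rw [hJ2, hr]
      conv_lhs => enter [1, 2]; rw [hN1]
      field_simp
    have t2 : (D.J : ℝ) ^ (3 / 2 : ℝ) / (D.N : ℝ) ^ (1 / 2 : ℝ) / σ ^ 2 = R := by
      have hJ2 : (D.J : ℝ) ^ (3 / 2 : ℝ) = (D.J : ℝ) ^ (5 / 6 : ℝ) * (D.J : ℝ) ^ (2 / 3 : ℝ) := by
        rw [← Real.rpow_add hJ']; norm_num
      have hN1 : (D.N : ℝ) ^ (1 / 2 : ℝ) = (D.N : ℝ) ^ (1 / 6 : ℝ) * (D.N : ℝ) ^ (1 / 3 : ℝ) := by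
        rw [← Real.rpow_add hN]; norm_num
      have h2 : (0 : ℝ) < (D.N : ℝ) ^ (1 / 6 : ℝ) := by positivity
      have h4 : (0 : ℝ) < (D.N : ℝ) ^ (1 / 3 : ℝ) := by positivity
      have h3 : (0 : ℝ) < (D.J : ℝ) ^ (2 / 3 : ℝ) := by positivity
      rw [hJ2, hN1, hσ2, hR]
      field_simp
    have hG := gaussShiftConst_nonneg
    have hg4 := gaussM4_nonneg
    rw [hcard, Fintype.card_fin]
    calc 3 * σ * (Real.sqrt ((K + 1) * M) * (D.J : ℝ) ^ (1 / 2 : ℝ))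
          + gaussShiftConst / σ ^ 2 * (2 * D.N * r ^ 3
            + (1 + gaussM4) * (∑ i, ∫ ω, ‖D.scoreTerm P i ω‖ ^ 4 ∂P) / r)
        ≤ 3 * σ * (Real.sqrt ((K + 1) * M) * (D.J : ℝ) ^ (1 / 2 : ℝ))
          + gaussShiftConst / σ ^ 2 * (2 * D.N * r ^ 3
            + (1 + gaussM4) * (A * (D.J ^ 2 / D.N)) / r) := by gcongr
      _ = 3 * Real.sqrt ((K + 1) * M) * (σ * (D.J : ℝ) ^ (1 / 2 : ℝ))
          + gaussShiftConst * (2 * (D.N * r ^ 3) + (1 + gaussM4) * A * ((D.J : ℝ) ^ 2 / D.N / r))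
            / σ ^ 2 := by ring
      _ = 3 * Real.sqrt ((K + 1) * M) * (σ * (D.J : ℝ) ^ (1 / 2 : ℝ))
          + gaussShiftConst * (2 + (1 + gaussM4) * A) *
            ((D.J : ℝ) ^ (3 / 2 : ℝ) / (D.N : ℝ) ^ (1 / 2 : ℝ) / σ ^ 2) := by
          rw [hr3, hr4]; ring
      _ = _ := by rw [t1, t2]; ring

end Tame

end FactorModel

namespace FactorModel

variable {M K : ℕ} {Ω : Type u} {D : FactorModel M K Ω} [mΩ : MeasurableSpace Ω] {P : Measure Ω}
  {q C Λ b : ℝ} {Υ : Matrix (Fin K) (Fin K) ℝ} {v : Fin K → ℝ}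

theorem ξ_nonneg (D : FactorModel M K Ω) : 0 ≤ D.ξ :=
  Real.sSup_nonneg (by rintro _ ⟨x, _, rfl⟩; exact euclNorm_nonneg _)

/-- The sieve basis grows at least like the square root of its dimension. -/
theorem Tame.mul_J_le_ξ_sq [IsProbabilityMeasure P] (h : D.Tame P q C) (hM : 0 < M) :
    q * D.J ≤ D.ξ ^ 2 := by
  set i : Fin D.N := ⟨0, h.N_pos⟩
  set t : Fin D.T := ⟨0, h.T_pos⟩
  set m : Fin M := ⟨0, hM⟩
  have hB : ∀ j, Integrable (fun ω => D.φ j (D.z i t ω m) ^ 2) P := fun j => by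
    simp only [sq]
    exact h.integrable_of_bddMeas
      ((h.reg.bddMeas_phi i t (m, j)).mul (h.reg.bddMeas_phi i t (m, j)))
  have h1 : ∀ j, q ≤ ∫ ω, D.φ j (D.z i t ω m) ^ 2 ∂P := by
    intro j
    have h2 := le_quadForm_of_posSemidef (posSemidef_sub_smul_one
      (isHermitian_crossMoment (P := P) i t) (h.cross i t)) (Pi.single (m, j) 1)
    have e : D.crossMoment P i t t (m, j) (m, j) = ∫ ω, D.φ j (D.z i t ω m) ^ 2 ∂P := by
      simp only [sq]; rfl
    rw [← e]
    simpa using h2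
  calc q * D.J = ∑ _j : Fin D.J, q := by simp [mul_comm]
    _ ≤ ∑ j, ∫ ω, D.φ j (D.z i t ω m) ^ 2 ∂P := Finset.sum_le_sum fun j _ => h1 j
    _ = ∫ ω, ∑ j, D.φ j (D.z i t ω m) ^ 2 ∂P := (integral_finsetSum _ fun j _ => hB j).symm
    _ ≤ ∫ _ω, D.ξ ^ 2 ∂P := by
        refine integral_mono (integrable_finsetSum _ fun j _ => hB j) (integrable_const _)
          fun ω => ?_
        change ∑ j, D.φ j (D.z i t ω m) ^ 2 ≤ D.ξ ^ 2
        rw [← euclNorm_sq]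
        exact pow_le_pow_left₀ (euclNorm_nonneg _)
          (h.reg.euclNorm_φ_le (h.reg.2.2.2.1 i t ω m)) 2
    _ = D.ξ ^ 2 := by simp

theorem Bounded.sum_fdag_sq_le (hb : D.Bounded Υ v Λ) (t : Fin D.T) :
    ∑ k, D.fdag t k ^ 2 ≤ 1 + 4 * Λ ^ 2 := by
  have h0 : D.fdag t 0 = 1 := rfl
  rw [Fin.sum_univ_succ, h0]
  simp only [fdag_succ]
  have h1 : ∑ k, (D.f t k - D.fbar k) ^ 2 = euclNorm (D.f t - D.fbar) ^ 2 := (euclNorm_sq _).symm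
  have h2 := euclNorm_sub_le_of_le (hb.f_le t) hb.fbar_le
  have h3 := pow_le_pow_left₀ (euclNorm_nonneg _) h2 2
  rw [h1]
  linarith [show (Λ + Λ) ^ 2 = 4 * Λ ^ 2 by ring]

theorem abs_sieveError_le (hb : D.Bounded Υ v Λ) (hb0 : 0 ≤ b)
    (hdom : ∀ i t ω m, D.z i t ω m ∈ D.dom)
    (hs : ∀ m, ∀ x ∈ D.dom, (∀ k, |D.δ k m x| ≤ b) ∧ |D.r m x| ≤ b)
    (i : Fin D.N) (t : Fin D.T) (ω : Ω) :
    |D.sieveError i t ω| ≤ M * (1 + K * Λ) * b := by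
  have hΛ : 0 ≤ Λ := by linarith [hb.one_le]
  have h1 : |∑ m, D.r m (D.z i t ω m)| ≤ M * b := by
    refine (Finset.abs_sum_le_sum_abs _ _).trans
      ((Finset.sum_le_sum fun m _ => (hs m _ (hdom i t ω m)).2).trans_eq ?_)
    simp
  have h2 : ∀ k, |(∑ m, D.δ k m (D.z i t ω m)) * D.f t k| ≤ M * b * Λ := by
    intro k
    rw [abs_mul]
    have h3 : |∑ m, D.δ k m (D.z i t ω m)| ≤ M * b := by
      refine (Finset.abs_sum_le_sum_abs _ _).trans
        ((Finset.sum_le_sum fun m _ => (hs m _ (hdom i t ω m)).1 k).trans_eq ?_)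
      simp
    have h4 : |D.f t k| ≤ Λ := by
      refine le_trans (abs_le_of_sq_le_sq ?_ (euclNorm_nonneg _)) (hb.f_le t)
      rw [euclNorm_sq]
      exact Finset.single_le_sum (f := fun k => D.f t k ^ 2) (fun _ _ => sq_nonneg _)
        (Finset.mem_univ k)
    gcongr
  refine (abs_add_le _ _).trans ((add_le_add h1 ((Finset.abs_sum_le_sum_abs _ _).trans
    (Finset.sum_le_sum fun k _ => h2 k))).trans_eq ?_)
  simp
  ring

/-- The sieve bias of the least squares coefficients on the good event. -/
theorem Tame.frobNorm_biasMat_le (h : D.Tame P q C) {ω : Ω} (hω : ω ∈ D.goodEvent q) {s : ℝ}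
    (hs0 : 0 ≤ s) (hs : ∀ i t, |D.sieveError i t ω| ≤ s) :
    frobNorm (D.biasMat ω) ≤ Real.sqrt D.T * (s / Real.sqrt q) := by
  have hN : (0 : ℝ) < D.N := by exact_mod_cast h.N_pos
  have hNq : 0 < D.N * q := mul_pos hN h.q_pos
  have hq := Real.sqrt_pos.2 h.q_pos
  refine (abs_le_of_sq_le_sq' ?_ (by positivity)).2
  rw [frobNorm_sq_eq_sum_col, mul_pow, Real.sq_sqrt (Nat.cast_nonneg _), div_pow,
    Real.sq_sqrt h.q_pos.le]
  have h1 : ∀ t, euclNorm (fun p => D.biasMat ω p t) ^ 2 ≤ s ^ 2 / q := by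
    intro t
    have h2 := (h.quadFormGE_gram hω t).leastSquares_le hNq fun i => D.sieveError i t ω
    have h3 : euclNorm (fun i => D.sieveError i t ω) ^ 2 ≤ D.N * s ^ 2 := by
      rw [euclNorm_sq]
      refine (Finset.sum_le_sum fun i _ => sq_le_sq' (abs_le.1 (hs i t)).1
        (abs_le.1 (hs i t)).2).trans_eq ?_
      simp
    have h4 : D.N * (q * euclNorm (fun p => D.biasMat ω p t) ^ 2) ≤ D.N * s ^ 2 := by
      rw [← mul_assoc]; exact h2.trans h3
    rw [le_div_iff₀ h.q_pos, mul_comm]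
    exact le_of_mul_le_mul_left h4 hN
  refine (Finset.sum_le_sum fun t _ => h1 t).trans_eq ?_
  simp

/-- The Gaussian vector rearranged as a matrix. -/
def gaussMatrix (D : FactorModel M K Ω) (g : EuclideanSpace ℝ (Fin (K + 1) × (Fin M × Fin D.J))) :
    Matrix (Fin M × Fin D.J) (Fin (K + 1)) ℝ := Matrix.of fun p k => g (k, p)

theorem frobNorm_gaussMatrix (g : EuclideanSpace ℝ (Fin (K + 1) × (Fin M × Fin D.J))) :
    frobNorm (D.gaussMatrix g) = ‖g‖ := by
  rw [← Real.sqrt_sq (norm_nonneg g), EuclideanSpace.real_norm_sq_eq, frobNorm, Finset.sum_comm,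
    Fintype.sum_prod_type]
  rfl

theorem rate_terms_nonneg (D : FactorModel M K Ω) (κ : ℝ) :
    0 ≤ Real.sqrt (D.N * D.T) / (D.J : ℝ) ^ κ ∧ 0 ≤ Real.sqrt (D.T * D.J) / Real.sqrt D.N ∧
    0 ≤ (D.J : ℝ) ^ (5 / 6 : ℝ) / (D.N : ℝ) ^ (1 / 6 : ℝ) ∧
    0 ≤ Real.sqrt (D.J * D.ξ) * Real.log D.J ^ (1 / 4 : ℝ) / (D.N : ℝ) ^ (1 / 4 : ℝ) := by
  refine ⟨by positivity, by positivity, by positivity, ?_⟩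
  have := Real.rpow_nonneg (Real.log_natCast_nonneg D.J) (1 / 4 : ℝ)
  positivity

theorem rate_nonneg (D : FactorModel M K Ω) (κ : ℝ) : 0 ≤ D.rate κ := by
  obtain ⟨h1, h2, h3, h4⟩ := D.rate_terms_nonneg κ
  rw [rate]; linarith

/-- The growth conditions that the rate calculations use. -/
structure Growth (D : FactorModel M K Ω) : Prop where
  N_pos : 0 < D.N
  T_pos : 0 < D.T
  J_pos : 0 < D.J
  J_sq_le : (D.J : ℝ) ^ 2 ≤ D.N
  Jξ_sq_le : (D.J : ℝ) ^ 2 * D.ξ ^ 2 ≤ D.N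
  log_ge : 1 ≤ Real.log D.J

namespace Growth

variable (h : D.Growth) (κ : ℝ)
include h

theorem J_le_sqrt : (D.J : ℝ) ≤ Real.sqrt D.N := Real.le_sqrt_of_sq_le h.J_sq_le

theorem Jξ_le_sqrt : (D.J : ℝ) * D.ξ ≤ Real.sqrt D.N :=
  Real.le_sqrt_of_sq_le (by rw [mul_pow]; exact h.Jξ_sq_le)

theorem J_div_sqrt_le : (D.J : ℝ) / Real.sqrt D.N
    ≤ (D.J : ℝ) ^ (5 / 6 : ℝ) / (D.N : ℝ) ^ (1 / 6 : ℝ) := by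
  have hN : (0 : ℝ) < D.N := by exact_mod_cast h.N_pos
  have hN1 : (1 : ℝ) ≤ D.N := by exact_mod_cast h.N_pos
  have hJ : (0 : ℝ) < D.J := by exact_mod_cast h.J_pos
  have hJ1 : (1 : ℝ) ≤ D.J := by exact_mod_cast h.J_pos
  have hJN : (D.J : ℝ) ≤ D.N := by nlinarith [h.J_sq_le]
  have e1 : (D.J : ℝ) = (D.J : ℝ) ^ (5 / 6 : ℝ) * (D.J : ℝ) ^ (1 / 6 : ℝ) := by
    rw [← Real.rpow_add hJ]; norm_num
  have e2 : Real.sqrt D.N = (D.N : ℝ) ^ (1 / 6 : ℝ) * (D.N : ℝ) ^ (1 / 3 : ℝ) := by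
    rw [← Real.rpow_add hN, Real.sqrt_eq_rpow]; norm_num
  have h1 : (D.J : ℝ) ^ (1 / 6 : ℝ) ≤ (D.N : ℝ) ^ (1 / 3 : ℝ) :=
    (Real.rpow_le_rpow hJ.le hJN (by norm_num)).trans
      (Real.rpow_le_rpow_of_exponent_le hN1 (by norm_num))
  rw [div_le_div_iff₀ (Real.sqrt_pos.2 hN) (by positivity), e2]
  calc (D.J : ℝ) * (D.N : ℝ) ^ (1 / 6 : ℝ)
      = (D.J : ℝ) ^ (5 / 6 : ℝ) * (D.J : ℝ) ^ (1 / 6 : ℝ) * (D.N : ℝ) ^ (1 / 6 : ℝ) := by rw [← e1]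
    _ ≤ (D.J : ℝ) ^ (5 / 6 : ℝ) * (D.N : ℝ) ^ (1 / 3 : ℝ) * (D.N : ℝ) ^ (1 / 6 : ℝ) := by gcongr
    _ = _ := by ring

theorem ξJ_div_sqrt_le : D.ξ * D.J / Real.sqrt D.N
    ≤ Real.sqrt (D.J * D.ξ) * Real.log D.J ^ (1 / 4 : ℝ) / (D.N : ℝ) ^ (1 / 4 : ℝ) := by
  have hN : (0 : ℝ) < D.N := by exact_mod_cast h.N_pos
  have hξ := D.ξ_nonneg
  have e1 : D.ξ * D.J = Real.sqrt (D.J * D.ξ) * Real.sqrt (D.J * D.ξ) := by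
    rw [Real.mul_self_sqrt (by positivity), mul_comm]
  have e2 : Real.sqrt D.N = (D.N : ℝ) ^ (1 / 4 : ℝ) * (D.N : ℝ) ^ (1 / 4 : ℝ) := by
    rw [← Real.rpow_add hN, Real.sqrt_eq_rpow]; norm_num
  have h1 : Real.sqrt (D.J * D.ξ) ≤ (D.N : ℝ) ^ (1 / 4 : ℝ) := by
    refine Real.sqrt_le_iff.2 ⟨by positivity, ?_⟩
    rw [sq, ← e2]; exact h.Jξ_le_sqrt
  have h2 : 1 ≤ Real.log D.J ^ (1 / 4 : ℝ) := Real.one_le_rpow h.log_ge (by norm_num)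
  have h3 : (0 : ℝ) < (D.N : ℝ) ^ (1 / 4 : ℝ) := by positivity
  rw [div_le_div_iff₀ (Real.sqrt_pos.2 hN) h3, e2, e1]
  calc Real.sqrt (D.J * D.ξ) * Real.sqrt (D.J * D.ξ) * (D.N : ℝ) ^ (1 / 4 : ℝ)
      ≤ Real.sqrt (D.J * D.ξ) * 1 * ((D.N : ℝ) ^ (1 / 4 : ℝ) * (D.N : ℝ) ^ (1 / 4 : ℝ)) := by
        rw [mul_one, mul_assoc]; gcongr
    _ ≤ _ := by gcongr

theorem sqrt_J_mul_le : Real.sqrt D.J * (D.J : ℝ) ^ (-κ)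
    ≤ Real.sqrt (D.N * D.T) / (D.J : ℝ) ^ κ := by
  have hT1 : (1 : ℝ) ≤ D.T := by exact_mod_cast h.T_pos
  have hJ1 : (1 : ℝ) ≤ D.J := by exact_mod_cast h.J_pos
  have hJN : (D.J : ℝ) ≤ D.N := by nlinarith [h.J_sq_le]
  rw [Real.rpow_neg (by positivity), ← div_eq_mul_inv]
  gcongr
  nlinarith

theorem cube_le : Real.sqrt (D.N * D.T) * (Real.sqrt D.J / Real.sqrt D.N) ^ 3
    ≤ Real.sqrt (D.T * D.J) / Real.sqrt D.N := by
  have hN : (0 : ℝ) < D.N := by exact_mod_cast h.N_pos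
  have hsN := Real.sqrt_pos.2 hN
  have hJ : (0 : ℝ) ≤ D.J := Nat.cast_nonneg _
  have e : Real.sqrt (D.N * D.T) * (Real.sqrt D.J / Real.sqrt D.N) ^ 3
      = Real.sqrt (D.T * D.J) / Real.sqrt D.N * (Real.sqrt D.J ^ 2 / Real.sqrt D.N) := by
    rw [Real.sqrt_mul hN.le, Real.sqrt_mul (Nat.cast_nonneg _)]
    field_simp
  rw [e, Real.sq_sqrt hJ]
  exact mul_le_of_le_one_right (by positivity) ((div_le_one hsN).2 h.J_le_sqrt)

end Growth

/-- Deterministic consequence of the moment events for the errors of the strong approximation. -/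
theorem Tame.expansion_le_of_moments (h : D.Tame P q C) (hb : D.Bounded Υ v Λ) (hg : D.Growth) {κ : ℝ}
    {R : ℝ} (hR : 1 ≤ R) (hb0 : 0 ≤ b)
    (hs : ∀ m, ∀ x ∈ D.dom, (∀ k, |D.δ k m x| ≤ b * (D.J : ℝ) ^ (-κ)) ∧
      |D.r m x| ≤ b * (D.J : ℝ) ^ (-κ)) {b' : ℝ} (hb' : b' = M * (1 + K * Λ) * b / Real.sqrt q)
    (hδ : 208 * Λ ^ 19 * (b' * (D.J : ℝ) ^ (-κ) + R * (Real.sqrt D.J / Real.sqrt D.N)) ≤ 1)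
    {ω : Ω} (hω : ω ∈ D.goodEvent q) {Bh : Matrix (Fin M × Fin D.J) (Fin K) ℝ}
    (hBh : IsLeadingEigenvectors (D.pcaMatrix ω) Bh)
    (hsign : ∀ k, 0 ≤ ((D.B * D.limH Υ v)ᵀ * Bh) k k)
    {g : EuclideanSpace ℝ (Fin (K + 1) × (Fin M × Fin D.J))}
    (h1 : frobNorm ((D.noiseMat ω)ᵀ * (1 : Matrix (Fin M × Fin D.J) (Fin M × Fin D.J) ℝ)) ^ 2
      ≤ R ^ 2 * (D.T * D.J / D.N))
    (h2 : frobNorm ((D.noiseMat ω)ᵀ * D.B) ^ 2 ≤ R ^ 2 * (D.T / D.N))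
    (h3 : ∑ r, (D.noiseScore ω r.2 r.1 - (∑ i, D.scoreTerm P i ω) r) ^ 2
      ≤ R ^ 2 * (D.ξ ^ 2 * D.J ^ 2 / D.N))
    (h4 : ‖∑ i, D.scoreTerm P i ω‖ ^ 2 ≤ R ^ 2 * D.J)
    (h5 : ‖∑ i, D.scoreTerm P i ω - g‖
      ≤ R * ((D.J : ℝ) ^ (5 / 6 : ℝ) / (D.N : ℝ) ^ (1 / 6 : ℝ))) :
    frobNorm (Real.sqrt (D.N * D.T) • (Bh - D.B * D.H Bh ω) - D.GB Υ v (D.gaussMatrix g))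
      ≤ 120 * (222 * Λ ^ 19) ^ 7 * ((b' + 2 * R * b' + 3 * R ^ 2 + R ^ 3 + R) * D.rate κ) ∧
    euclNorm (Real.sqrt (D.N * D.T) • (D.ahat Bh ω - D.a) - D.Ga Υ v (D.gaussMatrix g))
      ≤ 120 * (222 * Λ ^ 19) ^ 7 * ((b' + 2 * R * b' + 3 * R ^ 2 + R ^ 3 + R) * D.rate κ) := by
  have hN : (0 : ℝ) < D.N := by exact_mod_cast h.N_pos
  have hsN := Real.sqrt_pos.2 hN
  have hsNsq := Real.sq_sqrt hN.le
  have hT : (0 : ℝ) < D.T := by exact_mod_cast h.T_pos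
  have hJ : (0 : ℝ) < D.J := by exact_mod_cast hg.J_pos
  have hJ1 : (1 : ℝ) ≤ D.J := by exact_mod_cast hg.J_pos
  have hΛ := hb.one_le
  have hR0 : 0 ≤ R := by linarith
  have hξ := D.ξ_nonneg
  have hq := Real.sqrt_pos.2 h.q_pos
  have hJκ : 0 ≤ (D.J : ℝ) ^ (-κ) := by positivity
  have hb'0 : 0 ≤ b' := by rw [hb']; positivity
  obtain ⟨r1, r2, r3, r4⟩ := D.rate_terms_nonneg κ
  set ρ1 := Real.sqrt (D.N * D.T) / (D.J : ℝ) ^ κ with hρ1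
  set ρ2 := Real.sqrt (D.T * D.J) / Real.sqrt D.N with hρ2
  set ρ3 := (D.J : ℝ) ^ (5 / 6 : ℝ) / (D.N : ℝ) ^ (1 / 6 : ℝ) with hρ3
  set ρ4 := Real.sqrt (D.J * D.ξ) * Real.log D.J ^ (1 / 4 : ℝ) / (D.N : ℝ) ^ (1 / 4 : ℝ) with hρ4
  have hrate : D.rate κ = ρ1 + ρ2 + ρ3 + ρ4 := rfl
  set S : EuclideanSpace ℝ (Fin (K + 1) × (Fin M × Fin D.J)) := ∑ i, D.scoreTerm P i ω with hS
  -- the individual error bounds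
  have hd : frobNorm (D.biasMat ω) ≤ Real.sqrt D.T * (b' * (D.J : ℝ) ^ (-κ)) := by
    have hse := fun i t => abs_sieveError_le hb (mul_nonneg hb0 hJκ) h.reg.2.2.2.1 hs i t ω
    refine (h.frobNorm_biasMat_le hω (by positivity) hse).trans_eq ?_
    rw [hb']; ring
  have he : frobNorm (D.noiseMat ω) ≤ Real.sqrt D.T * (R * (Real.sqrt D.J / Real.sqrt D.N)) := by
    rw [Matrix.mul_one, frobNorm_transpose] at h1
    refine (abs_le_of_sq_le_sq' (h1.trans_eq ?_) (by positivity)).2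
    rw [mul_pow, mul_pow, div_pow, Real.sq_sqrt hT.le, Real.sq_sqrt hJ.le, hsNsq]
    ring
  have heB : frobNorm ((D.noiseMat ω)ᵀ * D.B) ≤ Real.sqrt D.T * (R * (1 / Real.sqrt D.N)) := by
    refine (abs_le_of_sq_le_sq' (h2.trans_eq ?_) (by positivity)).2
    rw [mul_pow, mul_pow, div_pow, Real.sq_sqrt hT.le, hsNsq]
    ring
  have hdiff : frobNorm (D.noiseScore ω - D.gaussMatrix S) ≤ R * (D.ξ * D.J / Real.sqrt D.N) := by
    refine (abs_le_of_sq_le_sq' (le_trans ?_ (h3.trans_eq ?_)) (by positivity)).2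
    · rw [frobNorm_sq, Finset.sum_comm, Fintype.sum_prod_type]
      exact le_rfl
    · rw [mul_pow, div_pow, hsNsq]; ring
  have hSle : ‖S‖ ≤ R * Real.sqrt D.J := by
    refine (abs_le_of_sq_le_sq' (h4.trans_eq ?_) (by positivity)).2
    rw [mul_pow, Real.sq_sqrt hJ.le]
  have hξ1 : D.ξ * D.J / Real.sqrt D.N ≤ Real.sqrt D.J := by
    have h6 : D.ξ * D.J / Real.sqrt D.N ≤ 1 := by
      rw [div_le_one hsN, mul_comm]; exact hg.Jξ_le_sqrt
    exact h6.trans (Real.one_le_sqrt.2 hJ1)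
  have hscore : frobNorm (D.noiseScore ω) ≤ 2 * R * Real.sqrt D.J := by
    have e : D.noiseScore ω = (D.noiseScore ω - D.gaussMatrix S) + D.gaussMatrix S := by abel
    rw [e]
    refine (frobNorm_add_le_of_le hdiff ((frobNorm_gaussMatrix S).trans_le hSle)).trans ?_
    nlinarith
  have happrox : frobNorm (D.noiseScore ω - D.gaussMatrix g) ≤ R * ρ4 + R * ρ3 := by
    have e : D.noiseScore ω - D.gaussMatrix g
        = (D.noiseScore ω - D.gaussMatrix S) + D.gaussMatrix (S - g) := by
      have : D.gaussMatrix (S - g) = D.gaussMatrix S - D.gaussMatrix g := rfl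
      rw [this]; abel
    rw [e]
    refine frobNorm_add_le_of_le (hdiff.trans ?_) ((frobNorm_gaussMatrix _).trans_le h5)
    exact mul_le_mul_of_nonneg_left hg.ξJ_div_sqrt_le hR0
  set κR := b' + 2 * R * b' + 3 * R ^ 2 + R ^ 3 + R with hκR
  have hRb : 0 ≤ R * b' := mul_nonneg hR0 hb'0
  have hR2 : 0 ≤ R ^ 2 := by positivity
  have hR3 : 0 ≤ R ^ 3 := by positivity
  have hrle : ∀ {c x : ℝ}, 0 ≤ c → c ≤ κR → 0 ≤ x → x ≤ D.rate κ → c * x ≤ κR * D.rate κ :=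
    fun hc hcR hx hxr => mul_le_mul hcR hxr hx (hc.trans hcR)
  have hinv : ∀ t, IsUnit ((D.Phi t ω)ᵀ * D.Phi t ω).det := fun t =>
    (h.quadFormGE_gram hω t).isUnit_det (mul_pos hN h.q_pos)
  have hsNT : Real.sqrt (D.N * D.T) = Real.sqrt D.N * Real.sqrt D.T := Real.sqrt_mul hN.le _
  have hsTJ : Real.sqrt (D.T * D.J) = Real.sqrt D.T * Real.sqrt D.J := Real.sqrt_mul hT.le _
  have main := hb.expansion hinv hBh hsign (NN := D.gaussMatrix g) (ρ := κR * D.rate κ)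
    hd he heB hδ ?_ ?_ ?_ ?_ ?_
  · refine ⟨main.1.trans ?_, main.2⟩
    have hΓ1 : (1 : ℝ) ≤ 222 * Λ ^ 19 := by linarith [one_le_pow₀ hΛ (n := 19)]
    have hpow : (222 * Λ ^ 19) ^ 3 ≤ (222 * Λ ^ 19) ^ 7 := pow_le_pow_right₀ hΓ1 (by norm_num)
    have hκ0 : 0 ≤ κR * D.rate κ := mul_nonneg (by linarith) (D.rate_nonneg κ)
    refine mul_le_mul_of_nonneg_right ?_ hκ0
    have : 0 ≤ (222 * Λ ^ 19) ^ 3 := by positivity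
    linarith
  · have e : Real.sqrt (D.N * D.T) * (b' * (D.J : ℝ) ^ (-κ)) = b' * ρ1 := by
      rw [hρ1, Real.rpow_neg hJ.le]; ring
    rw [e]
    exact hrle hb'0 (by linarith) r1 (by linarith)
  · have e : Real.sqrt (D.N * D.T) * (R * (Real.sqrt D.J / Real.sqrt D.N))
        * (R * (1 / Real.sqrt D.N)) = R ^ 2 * ρ2 := by
      rw [hρ2, hsNT, hsTJ]; field_simp
    rw [e]
    exact hrle hR2 (by linarith) r2 (by linarith)
  · have e : Real.sqrt (D.N * D.T) * (R * (Real.sqrt D.J / Real.sqrt D.N)) ^ 3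
        = R ^ 3 * (Real.sqrt (D.N * D.T) * (Real.sqrt D.J / Real.sqrt D.N) ^ 3) := by ring
    rw [e]
    exact (mul_le_mul_of_nonneg_left hg.cube_le hR3).trans
      (hrle hR3 (by linarith) r2 (by linarith))
  · have hJdiv : Real.sqrt D.J * (Real.sqrt D.J / Real.sqrt D.N) ≤ ρ3 := by
      rw [← mul_div_assoc, Real.mul_self_sqrt hJ.le]; exact hg.J_div_sqrt_le
    have hx0 : 0 ≤ b' * (D.J : ℝ) ^ (-κ) + R * (Real.sqrt D.J / Real.sqrt D.N) := by positivity
    calc frobNorm (D.noiseScore ω)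
          * (b' * (D.J : ℝ) ^ (-κ) + R * (Real.sqrt D.J / Real.sqrt D.N))
        ≤ 2 * R * Real.sqrt D.J
          * (b' * (D.J : ℝ) ^ (-κ) + R * (Real.sqrt D.J / Real.sqrt D.N)) :=
          mul_le_mul_of_nonneg_right hscore hx0
      _ = 2 * R * b' * (Real.sqrt D.J * (D.J : ℝ) ^ (-κ))
          + 2 * R ^ 2 * (Real.sqrt D.J * (Real.sqrt D.J / Real.sqrt D.N)) := by ring
      _ ≤ 2 * R * b' * ρ1 + 2 * R ^ 2 * ρ3 := by
          have := hg.sqrt_J_mul_le κ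
          gcongr
      _ ≤ (2 * R * b' + 2 * R ^ 2) * D.rate κ := by
          rw [add_mul]
          gcongr <;> linarith
      _ ≤ κR * D.rate κ := mul_le_mul_of_nonneg_right (by linarith) (D.rate_nonneg κ)
  · refine happrox.trans ?_
    rw [← mul_add]
    exact hrle hR0 (by linarith) (by linarith) (by linarith)

end FactorModel

/-- Markov's inequality at a multiple of the bound for the mean. -/
theorem measure_mul_lt_le {α : Type*} {mα : MeasurableSpace α} {μ : Measure α}
    [IsFiniteMeasure μ] {f : α → ℝ} (hf : ∀ x, 0 ≤ f x) (hi : Integrable f μ) {A x R η : ℝ}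
    (hI : ∫ ω, f ω ∂μ ≤ A * x) (hx : 0 < x) (hR : 0 < R) (hA : A ≤ η * R) :
    μ {ω | R * x < f ω} ≤ ENNReal.ofReal η := by
  have h1 := mul_meas_ge_le_integral_of_nonneg (ae_of_all _ hf) hi (R * x)
  have hRx : 0 < R * x := mul_pos hR hx
  have h2 : μ.real {ω | R * x ≤ f ω} ≤ η := by
    refine le_of_mul_le_mul_left (h1.trans (hI.trans ?_)) hRx
    calc A * x ≤ η * R * x := mul_le_mul_of_nonneg_right hA hx.le
      _ = R * x * η := by ring
  calc μ {ω | R * x < f ω} ≤ μ {ω | R * x ≤ f ω} := measure_mono fun ω (hω : R * x < f ω) => hω.le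
    _ = ENNReal.ofReal (μ.real {ω | R * x ≤ f ω}) := (ofReal_measureReal).symm
    _ ≤ ENNReal.ofReal η := ENNReal.ofReal_le_ofReal h2

theorem measure_union_le_of_le {α : Type*} {mα : MeasurableSpace α} {μ : Measure α}
    {s t : Set α} {x y : ENNReal} (hs : μ s ≤ x) (ht : μ t ≤ y) : μ (s ∪ t) ≤ x + y :=
  (measure_union_le _ _).trans (add_le_add hs ht)

namespace FactorModel

variable {M K : ℕ} {Ω : Type u} {D : FactorModel M K Ω} [mΩ : MeasurableSpace Ω] {P : Measure Ω}
  {q C Λ b : ℝ} {Υ : Matrix (Fin K) (Fin K) ℝ} {v : Fin K → ℝ}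

theorem mem_goodEvent_of_spectrum_subset {ω : Ω} {x y : ℝ} (hq : q ≤ x)
    (h : ∀ t, spectrum ℝ (D.Qhat t ω) ⊆ Set.Ioo x y) : ω ∈ D.goodEvent q := by
  intro t
  have hh : (D.Qhat t ω).IsHermitian := by
    rw [isHermitian_iff_transpose_eq, Qhat, Matrix.transpose_smul, Matrix.transpose_mul,
      Matrix.transpose_transpose]
  exact le_quadForm_of_posSemidef (posSemidef_sub_smul_one hh
    fun s hs => hq.trans (h t hs).1.le)

/-- The constant in the coupling of the score with a Gaussian vector. -/
def couplingConst (M K : ℕ) (q C Λ : ℝ) : ℝ :=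
  3 * Real.sqrt ((K + 1) * M) + gaussShiftConst * (2 + (1 + gaussM4) *
    ((1 + 4 * Λ ^ 2) ^ 2 * q⁻¹ ^ 4 * M ^ 2 * C ^ 2))

/-- A common bound for the constants of the moment inequalities. -/
def momentConst (M K : ℕ) (q C Λ : ℝ) : ℝ :=
  C * q⁻¹ * M + C * q⁻¹ * Λ ^ 2 + (1 + 4 * Λ ^ 2) * q⁻¹ ^ 4 * M ^ 3 * C ^ 2
    + (1 + 4 * Λ ^ 2) * q⁻¹ ^ 2 * M * C ^ 2 + couplingConst M K q C Λ

theorem couplingConst_nonneg (M K : ℕ) (q C Λ : ℝ) : 0 ≤ couplingConst M K q C Λ := by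
  have h1 := gaussShiftConst_nonneg
  have h2 := gaussM4_nonneg
  unfold couplingConst
  positivity

/-- The constant in the error bound of the strong approximation at level `R`. -/
def errorConst (Λ b R : ℝ) : ℝ :=
  120 * (222 * Λ ^ 19) ^ 7 * (b + 2 * R * b + 3 * R ^ 2 + R ^ 3 + R)

/-- Off an event of small probability the strong approximation errors are of the order of the
rate. -/
theorem Tame.exists_small_event [IsProbabilityMeasure P] (h : D.Tame P q C)
    (hb : D.Bounded Υ v Λ) (hg : D.Growth) (hM : 0 < M) {κ R η : ℝ} (hη : 0 < η) (hR : 1 ≤ R)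
    (hRη : momentConst M K q C Λ ≤ η * R) (hb0 : 0 ≤ b)
    (hs : ∀ m, ∀ x ∈ D.dom, (∀ k, |D.δ k m x| ≤ b * (D.J : ℝ) ^ (-κ)) ∧
      |D.r m x| ≤ b * (D.J : ℝ) ^ (-κ)) {b' : ℝ} (hb' : b' = M * (1 + K * Λ) * b / Real.sqrt q)
    (hδ : 208 * Λ ^ 19 * (b' * (D.J : ℝ) ^ (-κ) + R * (Real.sqrt D.J / Real.sqrt D.N)) ≤ 1)
    {Bhat : Ω → Matrix (Fin M × Fin D.J) (Fin K) ℝ}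
    (hBhat : ∀ ω, IsLeadingEigenvectors (D.pcaMatrix ω) (Bhat ω)) {x y : ℝ} (hx : q ≤ x)
    (hspec : P {ω | ¬ ∀ t, spectrum ℝ (D.Qhat t ω) ⊆ Set.Ioo x y} ≤ ENNReal.ofReal η)
    (hsign : P {ω | ¬ ∀ k, 0 ≤ ((D.B * D.limH Υ v)ᵀ * Bhat ω) k k} ≤ ENNReal.ofReal η)
    {P' : Measure (Ω × EuclideanSpace ℝ (Fin (K + 1) × (Fin M × Fin D.J)))}
    (hP' : P'.map Prod.fst = P)
    (hint : Integrable (fun z => ‖∑ i, D.scoreTerm P i z.1 - z.2‖) P')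
    (hmean : ∫ z, ‖∑ i, D.scoreTerm P i z.1 - z.2‖ ∂P' ≤ couplingConst M K q C Λ
      * ((D.J : ℝ) ^ (5 / 6 : ℝ) / (D.N : ℝ) ^ (1 / 6 : ℝ))) :
    ∃ S : Set (Ω × EuclideanSpace ℝ (Fin (K + 1) × (Fin M × Fin D.J))),
      P' S ≤ ENNReal.ofReal (7 * η) ∧ ∀ z ∉ S,
      frobNorm (Real.sqrt (D.N * D.T) • (Bhat z.1 - D.B * D.H (Bhat z.1) z.1)
        - D.GB Υ v (D.gaussMatrix z.2)) ≤ errorConst Λ b' R * D.rate κ ∧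
      euclNorm (Real.sqrt (D.N * D.T) • (D.ahat (Bhat z.1) z.1 - D.a)
        - D.Ga Υ v (D.gaussMatrix z.2)) ≤ errorConst Λ b' R * D.rate κ := by
  have hN : (0 : ℝ) < D.N := by exact_mod_cast h.N_pos
  have hT : (0 : ℝ) < D.T := by exact_mod_cast h.T_pos
  have hJ : (0 : ℝ) < D.J := by exact_mod_cast hg.J_pos
  have hq := h.q_pos
  have hC : 0 ≤ C := by linarith [h.one_le]
  have hR0 : 0 < R := by linarith
  have hRR : R ≤ R ^ 2 := by nlinarith
  have hξ : 0 < D.ξ ^ 2 := (mul_pos hq hJ).trans_le (h.mul_J_le_ξ_sq hM)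
  have hprob : IsProbabilityMeasure P' := ⟨by
    have h1 : P'.map Prod.fst Set.univ = 1 := by rw [hP']; exact measure_univ
    rwa [Measure.map_apply measurable_fst MeasurableSet.univ] at h1⟩
  have hpull : ∀ A : Set Ω, P' (Prod.fst ⁻¹' A) ≤ P A := fun A => by
    conv_rhs => rw [← hP']
    exact Measure.le_map_apply measurable_fst.aemeasurable A
  have c0 := couplingConst_nonneg M K q C Λ
  have c1 : 0 ≤ C * q⁻¹ * M := by positivity
  have c2 : 0 ≤ C * q⁻¹ * Λ ^ 2 := by positivity
  have c3 : 0 ≤ (1 + 4 * Λ ^ 2) * q⁻¹ ^ 4 * M ^ 3 * C ^ 2 := by positivity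
  have c4 : 0 ≤ (1 + 4 * Λ ^ 2) * q⁻¹ ^ 2 * M * C ^ 2 := by positivity
  have hRη2 : η * R ≤ η * R ^ 2 := mul_le_mul_of_nonneg_left hRR hη.le
  unfold momentConst at hRη
  have hf := hb.sum_fdag_sq_le
  have hR2 : 0 < R ^ 2 := by positivity
  -- the five Markov events
  obtain ⟨i1, m1⟩ := h.integral_frobNorm_noise_sq_le
    (1 : Matrix (Fin M × Fin D.J) (Fin M × Fin D.J) ℝ)
  obtain ⟨i2, m2⟩ := h.integral_frobNorm_noise_sq_le D.B
  obtain ⟨i3, m3⟩ := h.integral_noiseScore_sub_score_sq_le hf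
  obtain ⟨i4, m4⟩ := h.integral_score_sq_le hf
  have n1 := measure_mul_lt_le (fun ω => Set.indicator_nonneg (fun _ _ => sq_nonneg _) ω) i1
    (η := η) (A := C * q⁻¹ * M) (x := D.T * D.J / D.N) (m1.trans_eq (by
      rw [frobNorm_sq]
      simp only [Matrix.one_apply, ite_pow, one_pow, ne_eq, OfNat.ofNat_ne_zero,
        not_false_eq_true, zero_pow, Finset.sum_ite_eq, Finset.mem_univ, if_true,
        Finset.sum_const, Finset.card_univ, Fintype.card_prod, Fintype.card_fin, nsmul_eq_mul,
        Nat.cast_mul, mul_one]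
      rw [mul_inv]
      ring)) (by positivity) hR2 (by linarith)
  have n2 := measure_mul_lt_le (fun ω => Set.indicator_nonneg (fun _ _ => sq_nonneg _) ω) i2
    (η := η) (A := C * q⁻¹ * Λ ^ 2) (x := D.T / D.N) (m2.trans (by
      have := pow_le_pow_left₀ (frobNorm_nonneg _) hb.B_le 2
      calc D.T * (C * ((D.N * q)⁻¹ * frobNorm D.B ^ 2))
          ≤ D.T * (C * ((D.N * q)⁻¹ * Λ ^ 2)) := by gcongr
        _ = _ := by rw [mul_inv]; ring)) (by positivity) hR2 (by linarith)
  have n3 := measure_mul_lt_le (η := η) (fun ω => Set.indicator_nonneg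
    (fun _ _ => Finset.sum_nonneg fun _ _ => sq_nonneg _) ω) i3 m3 (by positivity) hR2
    (by linarith)
  have n4 := measure_mul_lt_le (η := η) (fun ω => sq_nonneg _) i4 m4 hJ hR2 (by linarith)
  have n5 := measure_mul_lt_le (η := η) (fun ω => norm_nonneg _) hint hmean (by positivity) hR0
    (by linarith)
  have n0 := measure_union_le_of_le ((hpull _).trans hspec) <| measure_union_le_of_le
    ((hpull _).trans hsign) <| measure_union_le_of_le ((hpull _).trans n1) <|
    measure_union_le_of_le ((hpull _).trans n2) <| measure_union_le_of_le
    ((hpull _).trans n3) <| measure_union_le_of_le ((hpull _).trans n4) n5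
  refine ⟨_, n0.trans_eq ?_, fun z hz => ?_⟩
  · rw [show 7 * η = η + (η + (η + (η + (η + (η + η))))) by ring]
    repeat rw [ENNReal.ofReal_add (by positivity) (by positivity)]
  · simp only [Set.mem_union, Set.mem_preimage, Set.mem_ofPred_eq, not_or, not_not, not_lt] at hz
    obtain ⟨z1, z2, z3, z4, z5, z6, z7⟩ := hz
    have hω := mem_goodEvent_of_spectrum_subset (D := D) hx z1
    rw [Set.indicator_of_mem hω] at z3 z4 z5
    have := h.expansion_le_of_moments hb hg hR hb0 hs hb' hδ hω (hBhat z.1) z2 z3 z4 z5 z6 z7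
    rw [errorConst, mul_assoc]
    exact this

end FactorModel

namespace FactorModel

theorem errorConst_pos {Λ b R : ℝ} (hΛ : 1 ≤ Λ) (hb : 0 ≤ b) (hR : 1 ≤ R) :
    0 < errorConst Λ b R := by
  unfold errorConst
  positivity

section Sequence

variable {M K : ℕ} {κ : ℝ} {Ω : ℕ → Type u} [∀ n, MeasurableSpace (Ω n)]
  {P : ∀ n, Measure (Ω n)} {D : ∀ n, FactorModel M K (Ω n)} {q C Λ : ℝ}

theorem _root_.AsymptoticRegime.eventually_T_pos (h : AsymptoticRegime D) :
    ∀ᶠ n in atTop, 0 < (D n).T := by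
  rcases h.2.1 with h1 | ⟨T₀, h1, h2⟩
  · exact h1.eventually_gt_atTop 0
  · filter_upwards [h2] with n hn
    omega

theorem exists_eventually_tame (hReg : ∀ᶠ n in atTop, (D n).Regular (P n))
    (hBasis : AssumptionBasis P D) (hDGP : AssumptionDGP P D) (hRates : AssumptionRates P D)
    (hAsym : AssumptionAsym P D) (hRegime : AsymptoticRegime D) :
    ∃ q C x y : ℝ, q ≤ x ∧
      (WithProbToOne P fun n ω => ∀ t, spectrum ℝ ((D n).Qhat t ω) ⊆ Set.Ioo x y) ∧
      0 < q ∧ ∀ᶠ n in atTop, (D n).Tame (P n) q C := by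
  obtain ⟨⟨x, y, hx, _, hspec⟩, Ca, hCa⟩ := hBasis
  obtain ⟨hind, hmean, C₁, _, hC₁⟩ := hDGP
  obtain ⟨⟨Cb, hCb⟩, ⟨c, Cc, hc, hcross⟩, hz, _⟩ := hRates
  obtain ⟨_, hε, C₃, _, hC₃⟩ := hAsym
  set C := 1 + |Ca| + |C₁| + |Cb| + |C₃| with hC
  have l0 := abs_nonneg Ca
  have l1 := abs_nonneg C₁
  have l2 := abs_nonneg Cb
  have l3 := abs_nonneg C₃
  have g0 : Ca ≤ C := by linarith [le_abs_self Ca]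
  have g1 : C₁ ≤ C := by linarith [le_abs_self C₁]
  have g2 : Cb ≤ C := by linarith [le_abs_self Cb]
  have g3 : C₃ ≤ C := by linarith [le_abs_self C₃]
  refine ⟨min x c, C, x, y, min_le_left _ _, hspec, lt_min hx hc, ?_⟩
  filter_upwards [hReg, hCa, hind, hmean, hC₁, hCb, hcross, hz, hε, hC₃,
    hRegime.1.eventually_gt_atTop 0, hRegime.eventually_T_pos] with n k1 k2 k3 k4 k5 k6 k7 k8 k9
      k10 k11 k12
  have hN : (0 : ℝ) < (D n).N := by exact_mod_cast k11
  have hT : (0 : ℝ) < (D n).T := by exact_mod_cast k12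
  refine ⟨k1, lt_min hx hc, by linarith, k11, k12, k3, k4, fun i t => (k5.1 i t).le.trans g1, ?_,
    fun m j i t => (k2 m j i t).trans g0, fun m j i t => (k6 m j i t).trans g2,
    fun i t s hs => (min_le_right _ _).trans (k7 i t hs).1, k8, k9, fun i => ?_⟩
  · have h1 := k5.2.le
    rw [one_div, ← div_eq_inv_mul, div_le_iff₀ (mul_pos hN hT)] at h1
    exact h1.trans (mul_le_mul_of_nonneg_right g1 (mul_pos hN hT).le)
  · have h1 := (k10 i).le
    rw [one_div, ← div_eq_inv_mul, div_le_iff₀ (pow_pos hT 2)] at h1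
    exact h1.trans (mul_le_mul_of_nonneg_right g3 (pow_pos hT 2).le)

theorem exists_eventually_bounded (hLF : AssumptionLoadingsFactors D κ)
    (hInt : AssumptionIntercept D) (hAsym : AssumptionAsym P D) (hRegime : AsymptoticRegime D)
    {Υ : ℕ → Matrix (Fin K) (Fin K) ℝ} {v : ℕ → Fin K → ℝ}
    (hΥ : ∀ᶠ n in atTop, IsSpectralDecomposition (D n).spectralMatrix (Υ n) (v n)) :
    ∃ Λ : ℝ, 1 ≤ Λ ∧ ∀ᶠ n in atTop, (D n).Bounded (Υ n) (v n) Λ := by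
  obtain ⟨⟨dmin, dmax, hd, hd', hLF⟩, _⟩ := hLF
  obtain ⟨C₀, _, hInt⟩ := hInt
  obtain ⟨⟨c, hc, hgap⟩, _⟩ := hAsym
  obtain ⟨Λ, hΛ, h⟩ := exists_bounded.{u} M K (C₀ := C₀) hd hd' hc
  refine ⟨Λ, hΛ, ?_⟩
  filter_upwards [hLF, hInt, hgap, hΥ, hRegime.eventually_T_pos] with n k1 k2 k3 k4 k5
  exact h (D n) (Υ n) (v n) k5.ne' k1.1 k1.2.1 k1.2.2 k2.1 k2.2 k3.1 k3.2 k4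

theorem eventually_growth [∀ n, IsProbabilityMeasure (P n)] (hM : 0 < M) (hq : 0 < q)
    (ht : ∀ᶠ n in atTop, (D n).Tame (P n) q C) (hRegime : AsymptoticRegime D) :
    ∀ᶠ n in atTop, (D n).Growth := by
  obtain ⟨_, _, hJ, ho⟩ := hRegime
  have hJ' : Tendsto (fun n => ((D n).J : ℝ)) atTop atTop :=
    tendsto_natCast_atTop_atTop.comp hJ
  filter_upwards [ht, hJ.eventually_gt_atTop 0,
    (Real.tendsto_log_atTop.comp hJ').eventually_ge_atTop 1,
    hJ'.eventually_ge_atTop q⁻¹, ho.bound zero_lt_one] with n k1 k2 k3 k4 k5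
  have hlog : 1 ≤ Real.log (D n).J := k3
  have hξ := k1.mul_J_le_ξ_sq hM
  have h1 : 1 ≤ q * (D n).J := by
    calc 1 = q * q⁻¹ := (mul_inv_cancel₀ hq.ne').symm
      _ ≤ q * (D n).J := mul_le_mul_of_nonneg_left k4 hq.le
  have hJ2 : 0 ≤ ((D n).J : ℝ) ^ 2 := sq_nonneg _
  have h2 : ((D n).J : ℝ) ^ 2 * (D n).ξ ^ 2 ≤ (D n).N := by
    rw [Real.norm_natCast, one_mul] at k5
    refine le_trans ?_ ((le_abs_self _).trans k5)
    exact le_mul_of_one_le_right (by positivity) hlog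
  exact ⟨k1.N_pos, k1.T_pos, k2,
    (le_mul_of_one_le_right hJ2 (h1.trans hξ)).trans h2, h2, hlog⟩

theorem eventually_small (hκ : 0 < κ) (hJ : Tendsto (fun n => (D n).J) atTop atTop)
    (hg : ∀ᶠ n in atTop, (D n).Growth) (L b : ℝ) {R : ℝ} (hR : 0 ≤ R) (hL : 0 ≤ L) :
    ∀ᶠ n in atTop, L * (b * ((D n).J : ℝ) ^ (-κ)
      + R * (Real.sqrt (D n).J / Real.sqrt (D n).N)) ≤ 1 := by
  have hJ' : Tendsto (fun n => ((D n).J : ℝ)) atTop atTop :=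
    tendsto_natCast_atTop_atTop.comp hJ
  have h1 : Tendsto (fun n => L * (b * ((D n).J : ℝ) ^ (-κ) + R * ((D n).J : ℝ) ^ (-(1 / 2 : ℝ))))
      atTop (𝓝 (L * (b * 0 + R * 0))) :=
    ((((tendsto_rpow_neg_atTop hκ).comp hJ').const_mul b).add
      (((tendsto_rpow_neg_atTop one_half_pos).comp hJ').const_mul R)).const_mul L
  have h2 : L * (b * 0 + R * 0) < 1 := by simp
  filter_upwards [h1.eventually_lt_const h2, hg] with n k1 k2
  refine le_trans ?_ k1.le
  have hJ0 : (0 : ℝ) < (D n).J := by exact_mod_cast k2.J_pos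
  have h3 : Real.sqrt (D n).J / Real.sqrt (D n).N ≤ ((D n).J : ℝ) ^ (-(1 / 2 : ℝ)) := by
    rw [Real.rpow_neg hJ0.le, ← Real.sqrt_eq_rpow, div_le_iff₀ (hJ0.trans_le k2.J_le_sqrt),
      inv_mul_eq_div, le_div_iff₀ (Real.sqrt_pos.2 hJ0), Real.mul_self_sqrt hJ0.le]
    exact k2.J_le_sqrt
  gcongr

end Sequence

end FactorModel

theorem IsBigOInProb.of_eq_zero {Ω : ℕ → Type*} [∀ n, MeasurableSpace (Ω n)]
    {P : ∀ n, Measure (Ω n)} {X : ∀ n, Ω n → ℝ} {r : ℕ → ℝ} (hX : ∀ n ω, X n ω = 0)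
    (hr : ∀ n, 0 ≤ r n) : IsBigOInProb P X r := by
  refine fun η _ => ⟨1, one_pos, Eventually.of_forall fun n => ?_⟩
  have : {ω | 1 * r n < |X n ω|} = ∅ := by
    ext ω
    simp [hX, hr]
  rw [this]
  simp

theorem IsBigOInProb.of_small_events {Ω : ℕ → Type*} [∀ n, MeasurableSpace (Ω n)]
    {P : ∀ n, Measure (Ω n)} {X : ∀ n, Ω n → ℝ} {r : ℕ → ℝ} (hX : ∀ n ω, 0 ≤ X n ω)
    (h : ∀ η : ℝ, 0 < η → ∃ C : ℝ, 0 < C ∧ ∀ᶠ n in atTop, ∃ S : Set (Ω n),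
      P n S ≤ ENNReal.ofReal η ∧ ∀ ω ∉ S, X n ω ≤ C * r n) : IsBigOInProb P X r := by
  intro η hη
  obtain ⟨C, hC, hS⟩ := h η hη
  refine ⟨C, hC, hS.mono fun n ⟨S, hS, hXS⟩ => le_trans (measure_mono fun ω hω => ?_) hS⟩
  by_contra hn
  rw [Set.mem_ofPred_eq, abs_of_nonneg (hX n ω)] at hω
  exact absurd (hXS ω hn) (not_le.2 hω)

theorem WithProbToOne.eventually_le {Ω : ℕ → Type*} [∀ n, MeasurableSpace (Ω n)]
    {P : ∀ n, Measure (Ω n)} {p : ∀ n, Ω n → Prop} (h : WithProbToOne P p) {η : ℝ} (hη : 0 < η) :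
    ∀ᶠ n in atTop, P n {ω | ¬ p n ω} ≤ ENNReal.ofReal η :=
  (h.eventually_lt_const (ENNReal.ofReal_pos.2 hη)).mono fun _ h => h.le

theorem mainTheorem2 {M K : ℕ} {κ : ℝ} {Ω : ℕ → Type u} [∀ n, MeasurableSpace (Ω n)]
    (P : ∀ n, Measure (Ω n)) [∀ n, IsProbabilityMeasure (P n)]
    (D : ∀ n, FactorModel M K (Ω n))
    (hReg : ∀ᶠ n in atTop, (D n).Regular (P n))
    (hBasis : AssumptionBasis P D)
    (hLF : AssumptionLoadingsFactors D κ)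
    (hDGP : AssumptionDGP P D)
    (hInt : AssumptionIntercept D)
    (hRates : AssumptionRates P D)
    (hAsym : AssumptionAsym P D)
    (hRegime : AsymptoticRegime D)
    -- the estimator `B̂`
    (Bhat : ∀ n, Ω n → Matrix (Fin M × Fin (D n).J) (Fin K) ℝ)
    (hBhat : ∀ᶠ n in atTop, ∀ ω, IsLeadingEigenvectors ((D n).pcaMatrix ω) (Bhat n ω))
    -- the nonrandom spectral decomposition that defines `𝓗` and `𝓜`
    (Υ : ℕ → Matrix (Fin K) (Fin K) ℝ) (v : ℕ → Fin K → ℝ)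
    (hΥ : ∀ᶠ n in atTop, IsSpectralDecomposition (D n).spectralMatrix (Υ n) (v n))
    -- the signs of the columns of `B̂` and of `B𝓗` agree
    (hSign : WithProbToOne P fun n ω =>
      ∀ k, 0 ≤ (((D n).B * (D n).limH (Υ n) (v n))ᵀ * Bhat n ω) k k) :
    -- a sequence of extensions of the probability spaces and a random matrix on them
    ∃ (Ω' : ℕ → Type u) (_ : ∀ n, MeasurableSpace (Ω' n)) (P' : ∀ n, Measure (Ω' n))
      (π : ∀ n, Ω' n → Ω n)
      (NN : ∀ n, Ω' n → Matrix (Fin M × Fin (D n).J) (Fin (K + 1)) ℝ),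
      (∀ n, MeasurePreserving (π n) (P' n) (P n)) ∧
      (∀ᶠ n in atTop, ((D n).Omega (P n)).PosSemidef ∧
        HasLaw (fun ω => WithLp.toLp 2 (Matrix.vec (NN n ω)))
          (multivariateGaussian 0 ((D n).Omega (P n))) (P' n)) ∧
      IsBigOInProb P'
        (fun n ω => euclNorm
          (Real.sqrt ((D n).N * (D n).T) • ((D n).ahat (Bhat n (π n ω)) (π n ω) - (D n).a)
            - (D n).Ga (Υ n) (v n) (NN n ω)))
        (fun n => (D n).rate κ) ∧
      IsBigOInProb P'
        (fun n ω => frobNorm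
          (Real.sqrt ((D n).N * (D n).T) •
              (Bhat n (π n ω) - (D n).B * (D n).H (Bhat n (π n ω)) (π n ω))
            - (D n).GB (Υ n) (v n) (NN n ω)))
        (fun n => (D n).rate κ) := by
  obtain ⟨q, C, x, y, hqx, hspec, hq, hT⟩ :=
    FactorModel.exists_eventually_tame hReg hBasis hDGP hRates hAsym hRegime
  obtain ⟨Λ, hΛ, hB⟩ := FactorModel.exists_eventually_bounded hLF hInt hAsym hRegime hΥ
  obtain ⟨_, hκ, b₀, hb₀⟩ := hLF
  have hcoup : ∀ n, ∃ P' : Measure (Ω n × EuclideanSpace ℝ (Fin (K + 1) × (Fin M × Fin (D n).J))),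
      P'.map Prod.fst = P n ∧ ((D n).Tame (P n) q C → (D n).Bounded (Υ n) (v n) Λ →
        ((D n).Omega (P n)).PosSemidef ∧
        P'.map Prod.snd = multivariateGaussian 0 ((D n).Omega (P n)) ∧
        (0 < M → 0 < (D n).J →
          Integrable (fun z => ‖∑ i, (D n).scoreTerm (P n) i z.1 - z.2‖) P' ∧
          ∫ z, ‖∑ i, (D n).scoreTerm (P n) i z.1 - z.2‖ ∂P' ≤
            FactorModel.couplingConst M K q C Λ
              * (((D n).J : ℝ) ^ (5 / 6 : ℝ) / ((D n).N : ℝ) ^ (1 / 6 : ℝ)))) := by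
    intro n
    by_cases h : (D n).Tame (P n) q C ∧ (D n).Bounded (Υ n) (v n) Λ
    · obtain ⟨h1, P', h2, h3, h4⟩ := h.1.exists_coupling h.2.sum_fdag_sq_le
      exact ⟨P', h2, fun _ _ => ⟨h1, h3, h4⟩⟩
    · exact ⟨(P n).prod (Measure.dirac 0), by simp, fun h1 h2 => absurd ⟨h1, h2⟩ h⟩
  choose P' hfst hP' using hcoup
  have hnorm : (∀ n (z : Ω n × EuclideanSpace ℝ (Fin (K + 1) × (Fin M × Fin (D n).J))),
      0 ≤ euclNorm (Real.sqrt ((D n).N * (D n).T) • ((D n).ahat (Bhat n z.1) z.1 - (D n).a)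
        - (D n).Ga (Υ n) (v n) ((D n).gaussMatrix z.2))) ∧
      ∀ n (z : Ω n × EuclideanSpace ℝ (Fin (K + 1) × (Fin M × Fin (D n).J))),
      0 ≤ frobNorm (Real.sqrt ((D n).N * (D n).T) •
        (Bhat n z.1 - (D n).B * (D n).H (Bhat n z.1) z.1)
        - (D n).GB (Υ n) (v n) ((D n).gaussMatrix z.2)) :=
    ⟨fun _ _ => euclNorm_nonneg _, fun _ _ => frobNorm_nonneg _⟩
  refine ⟨fun n => Ω n × EuclideanSpace ℝ (Fin (K + 1) × (Fin M × Fin (D n).J)),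
    fun n => inferInstance, P', fun n => Prod.fst, fun n z => (D n).gaussMatrix z.2,
    fun n => ⟨measurable_fst, hfst n⟩, ?_, ?_⟩
  · filter_upwards [hT, hB] with n h1 h2
    obtain ⟨h3, h4, _⟩ := hP' n h1 h2
    exact ⟨h3, measurable_snd.aemeasurable, h4⟩
  rcases Nat.eq_zero_or_pos M with rfl | hM
  · exact ⟨IsBigOInProb.of_eq_zero (fun n z => by
      rw [euclNorm, norm_eq_zero]; ext p; exact p.1.elim0) fun n => (D n).rate_nonneg κ,
      IsBigOInProb.of_eq_zero (fun n z => by simp [frobNorm]) fun n => (D n).rate_nonneg κ⟩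
  have hG := FactorModel.eventually_growth hM hq hT hRegime
  set b := |b₀|
  set b' := M * (1 + K * Λ) * b / Real.sqrt q with hb'
  have hb'0 : 0 ≤ b' := by positivity
  have main : ∀ η : ℝ, 0 < η → ∃ Ktot : ℝ, 0 < Ktot ∧ ∀ᶠ n in atTop,
      ∃ S : Set (Ω n × EuclideanSpace ℝ (Fin (K + 1) × (Fin M × Fin (D n).J))),
      P' n S ≤ ENNReal.ofReal η ∧ ∀ z ∉ S,
      frobNorm (Real.sqrt ((D n).N * (D n).T) •
        (Bhat n z.1 - (D n).B * (D n).H (Bhat n z.1) z.1)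
        - (D n).GB (Υ n) (v n) ((D n).gaussMatrix z.2)) ≤ Ktot * (D n).rate κ ∧
      euclNorm (Real.sqrt ((D n).N * (D n).T) • ((D n).ahat (Bhat n z.1) z.1 - (D n).a)
        - (D n).Ga (Υ n) (v n) ((D n).gaussMatrix z.2)) ≤ Ktot * (D n).rate κ := by
    intro η hη
    have hη7 : 0 < η / 7 := by positivity
    set R := 1 + |FactorModel.momentConst M K q C Λ| / (η / 7) with hR
    have hR1 : 1 ≤ R := by
      have : 0 ≤ |FactorModel.momentConst M K q C Λ| / (η / 7) := by positivity
      linarith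
    have hRη : FactorModel.momentConst M K q C Λ ≤ η / 7 * R := by
      rw [hR, mul_add, mul_div_cancel₀ _ hη7.ne']
      linarith [le_abs_self (FactorModel.momentConst M K q C Λ)]
    refine ⟨FactorModel.errorConst Λ b' R, FactorModel.errorConst_pos hΛ hb'0 hR1, ?_⟩
    filter_upwards [hT, hB, hG, hb₀, hBhat, hspec.eventually_le hη7, hSign.eventually_le hη7,
      FactorModel.eventually_small (κ := κ) (by linarith) hRegime.2.2.1 hG (208 * Λ ^ 19) b'
        (zero_le_one.trans hR1) (by positivity)] with n k1 k2 k3 k4 k5 k6 k7 k8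
    obtain ⟨_, _, h3⟩ := hP' n k1 k2
    obtain ⟨h4, h5⟩ := h3 hM k3.J_pos
    have hJκ : 0 ≤ ((D n).J : ℝ) ^ (-κ) := by positivity
    have hle : b₀ * ((D n).J : ℝ) ^ (-κ) ≤ b * ((D n).J : ℝ) ^ (-κ) :=
      mul_le_mul_of_nonneg_right (le_abs_self _) hJκ
    have := k1.exists_small_event k2 k3 hM hη7 hR1 hRη (abs_nonneg b₀)
      (fun m x hx => ⟨fun k => ((k4 m x hx).1 k).trans hle, (k4 m x hx).2.trans hle⟩)
      hb' k8 k5 hqx k6 k7 (hfst n) h4 h5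
    rwa [mul_div_cancel₀ η (by norm_num : (7 : ℝ) ≠ 0)] at this
  refine ⟨IsBigOInProb.of_small_events hnorm.1 fun η hη => ?_,
    IsBigOInProb.of_small_events hnorm.2 fun η hη => ?_⟩
  · obtain ⟨Ktot, h1, h2⟩ := main η hη
    exact ⟨Ktot, h1, h2.mono fun n ⟨S, h3, h4⟩ => ⟨S, h3, fun z hz => (h4 z hz).2⟩⟩
  · obtain ⟨Ktot, h1, h2⟩ := main η hη
    exact ⟨Ktot, h1, h2.mono fun n ⟨S, h3, h4⟩ => ⟨S, h3, fun z hz => (h4 z hz).1⟩⟩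

end
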